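/- Let $\phi_1,\dots,\phi_N\in\mathcal S(\mathbb R^3)$ be (occupied) orbitals and let $\tau_{ik}(\mathbf x_1,\mathbf x_2)$, $1\le i,k\le N$, be pair-amplitudes of generic asymptotic type without logarithmic terms. In the coordinates $\mathbf x=\mathbf x_1$, $\mathbf z=\mathbf x_1-\mathbf x_2$ this means that $\tau_{ik}$ is $C^\infty$ for $\mathbf z\ne0$; that for $|\mathbf z|\ge1$ it is, with all its derivatives, rapidly decreasing in $(\mathbf x,\mathbf z)$; and that there are $v_{j,lm}\in\mathcal S(\mathbb R^3)$ (depending on $i,k$) such that for every $J\in\mathbb N_0$ the remainder $$R_J(\mathbf x,\mathbf z)=\tau_{ik}-\sum_{j<J}|\mathbf z|^j\sum_{l\le j}\sum_{m=-l}^{l}v_{j,lm}(\mathbf x)\,Y_{lm}(\mathbf z/|\mathbf z|)$$ satisfies $|\mathbf x|^k\,|\partial_{\mathbf x}^\alpha\partial_{\mathbf z}^\beta R_J|\le C_{J,\alpha,\beta,k}\,|\mathbf z|^{J-|\beta|}$ for $0<|\mathbf z|\le1$ and all $\alpha,\beta,k$. Here $Y_{lm}$ are the spherical harmonics. Define the symbols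 $$\sigma_{ik}(\mathbf x,\boldsymbol\eta)=\int e^{-i\mathbf z\cdot\boldsymbol\eta}\,\tau_{ik}(\mathbf x,\mathbf x-\mathbf z)\,d\mathbf z,\qquad \rho_{kj}(\mathbf x,\boldsymbol\eta)=\int e^{-i\mathbf z\cdot\boldsymbol\eta}\,\frac{\phi_k(\mathbf x)\,\phi_j(\mathbf x-\mathbf z)}{|\mathbf z|}\,d\mathbf z,\qquad \rho_{[k,l]}=\rho_{kl}-\rho_{lk},$$ and for symbols $s,r$ the composite symbol $$(s\circ r)(\mathbf x,\boldsymbol\eta)=(2\pi)^{-3}\iint e^{i(\mathbf x-\mathbf y)\cdot(\boldsymbol\xi-\boldsymbol\eta)}\,s(\mathbf x,\boldsymbol\xi)\,r(\mathbf y,\boldsymbol\eta)\,d\boldsymbol\xi\,d\mathbf y .$$ Put $$\sigma^{RPA}_{ij,-6}=\sum_k\sigma_{ik}\circ\rho_{kj},\qquad \sigma^{RPA}_{ij,-10}=\sum_{k,l}(\sigma_{ik}\circ\rho_{[k,l]})\circ\sigma_{lj}.$$ For $p\in\mathbb Z$, $S^p$ is the set of $s\in C^\infty(\mathbb R^3\times\mathbb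 R^3)$ with $|\partial_{\mathbf x}^\alpha\partial_{\boldsymbol\eta}^\beta s|\le C_{\alpha\beta}(1+|\boldsymbol\eta|)^{p-|\beta|}$ on $\mathbb R^3\times\mathbb R^3$. Write $s\sim\sum_{n\ge0}s_{p-n}$ if $s_{p-n}\in S^{p-n}$ and $s-\sum_{n<M}s_{p-n}\in S^{p-M}$ for every $M\in\mathbb N_0$. $S^p_{cl}$ is the set of $s$ that have such an expansion with $s_{p-n}(\mathbf x,\lambda\boldsymbol\eta)=\lambda^{p-n}s_{p-n}(\mathbf x,\boldsymbol\eta)$ for all $\lambda\ge1$ and $|\boldsymbol\eta|$ greater than some constant. Then all integrals above that enter $\sigma^{RPA}_{ij,-6}$ and $\sigma^{RPA}_{ij,-10}$ converge absolutely, and for all $i,j$: $\sigma^{RPA}_{ij,-6}\in S^{-6}_{cl}$ and $\sigma^{RPA}_{ij,-10}\in S^{-10}_{cl}$. For $p=-6,-10$ there is an asymptotic expansion $\sigma^{RPA}_{ij,p}\sim\sum_{n\ge0}\sigma^{RPA}_{ij,p-n}$ with $$\sigma^{RPA}_{ij,p-n}(\mathbf x,\lambda\boldsymbol\eta)=\lambda^{p-n}\sigma^{RPA}_{ij,p-n}(\mathbf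 x,\boldsymbol\eta)$$ for all $\lambda\ge1$ and $|\boldsymbol\eta|$ greater than some constant, whose terms satisfy, in spherical coordinates $(\eta,\Theta,\Phi)$ of $\boldsymbol\eta$ and for all $\mathbf x\in\mathbb R^3$, $\eta>0$, the orthogonality constraints $$\int_0^{2\pi}\!\!\int_0^{\pi}\sigma^{RPA}_{ij,p-n}(\mathbf x,\eta,\Theta,\Phi)\,Y_{lm}(\Theta,\Phi)\,\sin\Theta\,d\Theta\,d\Phi=0\qquad\text{if } n-l \text{ is odd or } l>n \quad(|m|\le l).$$ -/

import Mathlib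

open MeasureTheory
open scoped ContDiff

noncomputable section

namespace RPA

/-- Three-dimensional Euclidean space. -/
abbrev E3 : Type := EuclideanSpace ℝ (Fin 3)

/-! ### Symbol classes -/

/-- `mixedDeriv f a b x η` is the tensor of all mixed partial derivatives of `f` at `(x, η)`, of
order `a` in the first and of order `b` in the second variable. -/
def mixedDeriv (f : E3 → E3 → ℂ) (a b : ℕ) (x η : E3) :=
  iteratedFDeriv ℝ a (fun x' : E3 => iteratedFDeriv ℝ b (f x') η) x

/-- The Hörmander class `S^p(ℝ³ × ℝ³)`. -/
def IsSymbol (p : ℤ) (s : E3 → E3 → ℂ) : Prop :=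
  ContDiff ℝ ∞ (fun q : E3 × E3 => s q.1 q.2) ∧
    ∀ a b : ℕ, ∃ C : ℝ, ∀ x η : E3,
      ‖mixedDeriv s a b x η‖ ≤ C * (1 + ‖η‖) ^ (p - (b : ℤ))

/-- `s ∼ ∑ₙ t n`, where `t n ∈ S^{p-n}` is positively homogeneous of degree `p - n` in `η`
for `‖η‖` greater than some constant. -/
def IsHomogeneousExpansion (p : ℤ) (s : E3 → E3 → ℂ) (t : ℕ → E3 → E3 → ℂ) : Prop :=
  (∀ n : ℕ, IsSymbol (p - (n : ℤ)) (t n)) ∧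
  (∃ R : ℝ, ∀ (n : ℕ) (x η : E3) (r : ℝ), R ≤ ‖η‖ → 1 ≤ r →
    t n x (r • η) = ((r ^ (p - (n : ℤ)) : ℝ) : ℂ) * t n x η) ∧
  (∀ N : ℕ, IsSymbol (p - (N : ℤ)) (fun x η => s x η - ∑ n ∈ Finset.range N, t n x η))

/-- The class `S^p_cl(ℝ³ × ℝ³)` of classical symbols. -/
def IsClassicalSymbol (p : ℤ) (s : E3 → E3 → ℂ) : Prop :=
  ∃ t : ℕ → E3 → E3 → ℂ, IsHomogeneousExpansion p s t

/-! ### Spherical harmonics -/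

/-- The point of the unit sphere with polar angle `θ` and azimuthal angle `ϕ`. -/
def spherePoint (θ ϕ : ℝ) : E3 :=
  !₂[Real.sin θ * Real.cos ϕ, Real.sin θ * Real.sin ϕ, Real.cos θ]

/-- `Y_{lm}` for `0 ≤ m ≤ l`, as a function of a unit vector `u` with angles `(θ, ϕ)`: here
`(u₀ + i u₁)^m = sin^m θ e^{imϕ}`, `u₂ = cos θ`, and the derivative of order `l + m` of
`(X² - 1)^l / (2^l l!)` is Rodrigues' formula (with Condon-Shortley phase). -/
def sphericalHarmonicNat (l m : ℕ) (u : E3) : ℂ :=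
  ((Real.sqrt ((2 * (l : ℝ) + 1) / (4 * Real.pi) *
      ((Nat.factorial (l - m) : ℝ) / (Nat.factorial (l + m) : ℝ))) : ℝ) : ℂ) *
    (-1) ^ m * ((u 0 : ℂ) + Complex.I * (u 1 : ℂ)) ^ m *
    (((Polynomial.derivative^[l + m] ((Polynomial.X ^ 2 - 1) ^ l : Polynomial ℝ)).eval (u 2) /
      (2 ^ l * (Nat.factorial l : ℝ)) : ℝ) : ℂ)

/-- The spherical harmonic `Y_{lm}`, `-l ≤ m ≤ l`, as a function of a unit vector, with
`Y_{l,-m} = (-1)^m conj Y_{lm}`. -/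
def sphericalHarmonic (l : ℕ) (m : ℤ) (u : E3) : ℂ :=
  if 0 ≤ m then sphericalHarmonicNat l m.natAbs u
  else (-1) ^ m.natAbs * (starRingEnd ℂ) (sphericalHarmonicNat l m.natAbs u)

/-- The surface integral of `t(x, r ·) Y_{lm}` over the unit sphere, in spherical coordinates. -/
def sphericalComponent (t : E3 → E3 → ℂ) (x : E3) (r : ℝ) (l : ℕ) (m : ℤ) : ℂ :=
  ∫ ϕ in (0 : ℝ)..(2 * Real.pi), ∫ θ in (0 : ℝ)..Real.pi,
    t x (r • spherePoint θ ϕ) * sphericalHarmonic l m (spherePoint θ ϕ) * (Real.sin θ : ℂ)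

/-- The orthogonality constraints: the `Y_{lm}` component of the `n`-th term vanishes if
`n - l` is odd or `l > n`. -/
def OrthogonalityConstraints (t : ℕ → E3 → E3 → ℂ) : Prop :=
  ∀ (n l : ℕ) (m : ℤ), |m| ≤ (l : ℤ) → (Odd ((n : ℤ) - (l : ℤ)) ∨ n < l) →
    ∀ (x : E3) (r : ℝ), 0 < r → sphericalComponent (t n) x r l m = 0

/-! ### Pair-amplitudes and effective interaction potentials -/

/-- The `j`-th term `|z|^j ∑_{l ≤ j} ∑_m v_{lm}(x) Y_{lm}(z / |z|)` of the expansion of a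
pair-amplitude near the coalescence points `z = 0`. -/
def coalescenceTerm (j : ℕ) (v : ℕ → ℤ → SchwartzMap E3 ℂ) (x z : E3) : ℂ :=
  ∑ l ∈ Finset.range (j + 1), ∑ m ∈ Finset.Icc (-(l : ℤ)) (l : ℤ),
    v l m x * ((‖z‖ ^ j : ℝ) : ℂ) * sphericalHarmonic l m (‖z‖⁻¹ • z)

/-- A two-particle function `K(x₁, x₂)` in the coordinates `x = x₁`, `z = x₁ - x₂`. -/
def inXZ (K : E3 → E3 → ℂ) (x z : E3) : ℂ := K x (x - z)

/-- Pair-amplitudes `τ(x₁, x₂)` of generic asymptotic type without logarithmic terms: smooth off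
the diagonal, rapidly decreasing with all derivatives away from it, and with an asymptotic
expansion in powers `|z|^j` near it. The coefficient of `|z|^j` has angular components `Y_{lm}`
with `l ≤ j` only, and is of Schwartz class in `x`. The remainders are flat in `z`, of Schwartz
type in `x`. -/
structure IsPairAmplitude (τ : E3 → E3 → ℂ) : Prop where
  smooth : ContDiffOn ℝ ∞ (fun q : E3 × E3 => inXZ τ q.1 q.2) {q | q.2 ≠ 0}
  expansion : ∃ v : ℕ → ℕ → ℤ → SchwartzMap E3 ℂ, ∀ J a b k : ℕ, ∃ C : ℝ, ∀ x z : E3,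
    z ≠ 0 → ‖z‖ ≤ 1 →
      ‖x‖ ^ k * ‖mixedDeriv
        (fun x z => inXZ τ x z - ∑ j ∈ Finset.range J, coalescenceTerm j (v j) x z) a b x z‖
        ≤ C * ‖z‖ ^ ((J : ℤ) - (b : ℤ))
  decay : ∀ a b k : ℕ, ∃ C : ℝ, ∀ x z : E3, 1 ≤ ‖z‖ →
    (‖x‖ + ‖z‖) ^ k * ‖mixedDeriv (inXZ τ) a b x z‖ ≤ C

/-- The effective interaction potential `V_{kj}(x₁, x₂) = φ_k(x₁) |x₁ - x₂|⁻¹ φ_j(x₂)`. -/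
def effectivePotential (φk φj : SchwartzMap E3 ℂ) (x₁ x₂ : E3) : ℂ :=
  φk x₁ * ((‖x₁ - x₂‖⁻¹ : ℝ) : ℂ) * φj x₂

/-! ### Symbols of kernels and their composition -/

/-- The integrand `e^{-i z·η} K(x, z)` of the symbol of a kernel. -/
def symbolIntegrand (K : E3 → E3 → ℂ) (x η z : E3) : ℂ :=
  Complex.exp (-(Complex.I * ((inner ℝ z η : ℝ) : ℂ))) * inXZ K x z

/-- The symbol `∫ e^{-i z·η} K(x, z) dz` of a kernel `K`. -/
def kernelSymbol (K : E3 → E3 → ℂ) (x η : E3) : ℂ :=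
  ∫ z : E3, symbolIntegrand K x η z

/-- The integrand `e^{i(x - y)·(ξ - η)} s(x, ξ) r(y, η)`, `q = (ξ, y)`, of the composite symbol. -/
def compIntegrand (s r : E3 → E3 → ℂ) (x η : E3) (q : E3 × E3) : ℂ :=
  Complex.exp (Complex.I * ((inner ℝ (x - q.2) (q.1 - η) : ℝ) : ℂ)) * s x q.1 * r q.2 η

/-- The composite symbol
`(s ∘ r)(x, η) = (2π)⁻³ ∬ e^{i(x - y)·(ξ - η)} s(x, ξ) r(y, η) dξ dy`. -/
def symbolComp (s r : E3 → E3 → ℂ) (x η : E3) : ℂ :=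
  (((2 * Real.pi) ^ 3 : ℝ) : ℂ)⁻¹ * ∫ q : E3 × E3, compIntegrand s r x η q

/-- The integral that defines the symbol of the kernel `K` converges absolutely. -/
def SymbolConverges (K : E3 → E3 → ℂ) : Prop :=
  ∀ x η : E3, Integrable (symbolIntegrand K x η)

/-- The integral that defines the composite symbol `s ∘ r` converges absolutely. -/
def CompConverges (s r : E3 → E3 → ℂ) : Prop :=
  ∀ x η : E3, Integrable (compIntegrand s r x η)

section Composite

variable {N : ℕ} (φ : Fin N → SchwartzMap E3 ℂ) (τ : Fin N → Fin N → E3 → E3 → ℂ)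

/-- `σ_{ik}`, the symbol of the pair-amplitude `τ_{ik}`. -/
def sigma (i k : Fin N) : E3 → E3 → ℂ := kernelSymbol (τ i k)

/-- `ρ_{kj}`, the symbol of the effective interaction potential `V_{kj}`. -/
def rho (k j : Fin N) : E3 → E3 → ℂ := kernelSymbol (effectivePotential (φ k) (φ j))

/-- `ρ_{[k,l]} = ρ_{kl} - ρ_{lk}`. -/
def rhoAnti (k l : Fin N) : E3 → E3 → ℂ := fun x η => rho φ k l x η - rho φ l k x η

/-- `∑_k σ_{ik} ∘ ρ_{kj}`. -/
def sigmaRPA6 (i j : Fin N) : E3 → E3 → ℂ := fun x η =>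
  ∑ k, symbolComp (sigma τ i k) (rho φ k j) x η

/-- `∑_{k,l} σ_{ik} ∘ ρ_{[k,l]} ∘ σ_{lj}`. -/
def sigmaRPA10 (i j : Fin N) : E3 → E3 → ℂ := fun x η =>
  ∑ k, ∑ l, symbolComp (symbolComp (sigma τ i k) (rhoAnti φ k l)) (sigma τ l j) x η

end Composite

end RPA

end

/-!
The symbols are studied through their Fourier transform in the position variable. If `g` and `h`
are the Fourier transforms of `s` and `r`, that of `s ∘ r` is the twisted convolution
`twist g h θ η = ∫ g (θ - ζ) (η + 2πζ) * h ζ η dζ` (`symbolComp_symOf`). This integral converges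
absolutely, because the Fourier transforms decrease rapidly in their first variable, and by Peetre's
inequality it adds the orders of the symbols (`IsRS.twist`).

The orthogonality constraints say that the `n`-th term of an expansion is, on each sphere, a
polynomial of degree at most `n` and of the parity of `n`. The space `homSym p n` consists of the
functions with this property that are homogeneous of degree `p - n` for large `η`
(`orthogonality_of_mem_homSym`). It is mapped to `homSym p (n + 1)` by derivatives (`homSym_dirD`),
and multiplication maps `homSym p n` and `homSym q m` to `homSym (p + q) (n + m)` (`homSym_mul`).
Expanding `g (θ - ζ) (η + 2πζ)` in a Taylor series at `η` shows that expansions with terms of this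
kind (`HasExpansion`) are stable under composition (`HasExpansion.twist`). It remains to find such
expansions for the symbols of the two kinds of kernels, of order `-4` for the pair-amplitudes and of
order `-2` for the effective potentials.

The Coulomb potential is the sum of `u(z) = (2/√π) ∫_{s > 1} e^{-s²|z|²} ds`, which decreases
rapidly, and of a smooth function. The Fourier transform of `u` is `4π (1 - e^{-|η|²/4}) / |η|²`
(`ft_coulombShort`), that is `4π/|η|²` up to a symbol of order `-∞`. The part of an effective
potential with the kernel `φ(x) u(x - y) ψ(y)` is a composition of two multiplication operators and
a Fourier multiplier, so that its symbol is again a twisted convolution; the other part has a smooth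
kernel (`exists_isRep_effectivePotential`).

The terms `|z|^j Y_{lm}(z/|z|)`, `l ≤ j`, of the expansion of a pair-amplitude are sums of functions
`|z|^e P(z)` with `e` a natural number and `P` a monomial, `e + deg P = j`. They are smooth if `e` is
even. If `e` is odd, `|z|` may be replaced by `|z|² u(z)` up to a smooth function, and the Fourier
transform of the result is obtained from that of `u` by the Laplacian and derivatives: it is in
`homSym (-4) (j - 1)` up to a symbol of order `-∞` (`hasHomFT_sphMono_mul_oddKernel`). When
these singular parts are removed from a pair-amplitude, a function of class `C^M` in `z` is left,
for any `M`, and its Fourier transform decays like `|η|^{-M}` (`IsCuspKernel.hasExpansion`).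
-/

noncomputable section

namespace RPA

open Set Filter Topology
open scoped FourierTransform

/-! ### Smooth families of functions and their integrals -/

section Param

variable {E V : Type} [NormedAddCommGroup E] [NormedSpace ℝ E]
  [NormedAddCommGroup V] [NormedSpace ℝ V]

/-- Uncurrying the first argument, as an equivalence of topological vector spaces. -/
def curryLeftIso (E V : Type) [NormedAddCommGroup E] [NormedSpace ℝ E]
    [NormedAddCommGroup V] [NormedSpace ℝ V] (n : ℕ) :
    (E →L[ℝ] (E [×n]→L[ℝ] V)) ≃L[ℝ] (E [×(n + 1)]→L[ℝ] V) :=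
  (continuousMultilinearCurryLeftEquiv ℝ (fun _ : Fin (n + 1) => E)
    V).symm.toContinuousLinearEquiv

theorem norm_curryLeftIso (n : ℕ) (f : E →L[ℝ] (E [×n]→L[ℝ] V)) :
    ‖curryLeftIso E V n f‖ = ‖f‖ :=
  (continuousMultilinearCurryLeftEquiv ℝ (fun _ : Fin (n + 1) => E) V).symm.norm_map f

theorem iteratedFDeriv_succ_eq_curryLeftIso (f : E → V) (n : ℕ) (x : E) :
    iteratedFDeriv ℝ (n + 1) f x = curryLeftIso E V n (fderiv ℝ (iteratedFDeriv ℝ n f) x) := by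
  rw [iteratedFDeriv_succ_eq_comp_left]; rfl

/-- Differentiation under the integral sign, to all orders, on an open set. The derivatives of
each order are dominated by an integrable function, locally uniformly in the parameter. -/
theorem contDiffOn_integral_and_iteratedFDeriv {α : Type} [MeasurableSpace α] {μ : Measure α}
    [CompleteSpace V]
    {Ω : Set E} (hΩ : IsOpen Ω) (F : α → E → V) (hs : ∀ a, ContDiffOn ℝ ∞ (F a) Ω)
    (hm : ∀ n : ℕ, ∀ x ∈ Ω, AEStronglyMeasurable (fun a => iteratedFDeriv ℝ n (F a) x) μ)
    (hd : ∀ n : ℕ, ∀ x₀ ∈ Ω, ∃ ε > 0, ∃ bd : α → ℝ, Integrable bd μ ∧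
      ∀ᵐ a ∂μ, ∀ x ∈ Metric.ball x₀ ε, x ∈ Ω → ‖iteratedFDeriv ℝ n (F a) x‖ ≤ bd a) :
    ContDiffOn ℝ ∞ (fun x => ∫ a, F a x ∂μ) Ω ∧
    ∀ n : ℕ, ∀ x ∈ Ω, iteratedFDeriv ℝ n (fun x => ∫ a, F a x ∂μ) x
      = ∫ a, iteratedFDeriv ℝ n (F a) x ∂μ := by
  have hint : ∀ n : ℕ, ∀ x ∈ Ω, Integrable (fun a => iteratedFDeriv ℝ n (F a) x) μ := by
    intro n x hx
    obtain ⟨ε, hε, bd, hbd, h⟩ := hd n x hx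
    refine hbd.mono' (hm n x hx) ?_
    filter_upwards [h] with a ha using ha x (Metric.mem_ball_self hε) hx
  have hdiff : ∀ (n : ℕ) (a : α), ∀ x ∈ Ω, DifferentiableAt ℝ (iteratedFDeriv ℝ n (F a)) x := by
    intro n a x hx
    have h1 : ContDiffAt ℝ ∞ (F a) x := (hs a).contDiffAt (hΩ.mem_nhds hx)
    exact h1.differentiableAt_iteratedFDeriv (by exact_mod_cast ENat.natCast_lt_top n)
  have key : ∀ n : ℕ, ∀ x ∈ Ω, HasFDerivAt (fun x => ∫ a, iteratedFDeriv ℝ n (F a) x ∂μ)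
      (∫ a, fderiv ℝ (iteratedFDeriv ℝ n (F a)) x ∂μ) x := by
    intro n x hx
    obtain ⟨ε, hε, bd, hbd, h⟩ := hd (n + 1) x hx
    have hnb : Metric.ball x ε ∩ Ω ∈ 𝓝 x :=
      Filter.inter_mem (Metric.ball_mem_nhds x hε) (hΩ.mem_nhds hx)
    refine hasFDerivAt_integral_of_dominated_of_fderiv_le (bound := bd)
      (F' := fun x a => fderiv ℝ (iteratedFDeriv ℝ n (F a)) x) hnb ?_ (hint n x hx) ?_ ?_ hbd ?_
    · filter_upwards [hΩ.mem_nhds hx] with y hy using hm n y hy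
    · have h2 := hm (n + 1) x hx
      have : (fun a => fderiv ℝ (iteratedFDeriv ℝ n (F a)) x) = fun a =>
          (curryLeftIso E V n).symm (iteratedFDeriv ℝ (n + 1) (F a) x) := by
        funext a
        rw [iteratedFDeriv_succ_eq_curryLeftIso]; simp
      rw [this]
      exact (ContinuousLinearEquiv.continuous _).comp_aestronglyMeasurable h2
    · filter_upwards [h] with a ha y hy
      rw [norm_fderiv_iteratedFDeriv]
      exact ha y hy.1 hy.2
    · filter_upwards with a y hy using (hdiff n a y hy.2).hasFDerivAt
  have hid : ∀ n : ℕ, ∀ x ∈ Ω, iteratedFDeriv ℝ n (fun x => ∫ a, F a x ∂μ) x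
      = ∫ a, iteratedFDeriv ℝ n (F a) x ∂μ := by
    intro n
    induction n with
    | zero =>
      intro x hx
      simp only [iteratedFDeriv_zero_eq_comp, Function.comp_def]
      exact ((continuousMultilinearCurryFin0 ℝ E V).symm.toContinuousLinearEquiv.integral_comp_comm
        _).symm
    | succ n ih =>
      intro x hx
      rw [iteratedFDeriv_succ_eq_curryLeftIso]
      rw [(Filter.eventuallyEq_of_mem (hΩ.mem_nhds hx) ih).fderiv_eq, (key n x hx).fderiv]
      simp only [iteratedFDeriv_succ_eq_curryLeftIso]
      exact (ContinuousLinearEquiv.integral_comp_comm (𝕜 := ℝ) (μ := μ)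
        (E := E →L[ℝ] (E [×n]→L[ℝ] V)) (F := E [×(n + 1)]→L[ℝ] V) (curryLeftIso E V n) _).symm
  refine ⟨?_, hid⟩
  apply contDiffOn_of_differentiableOn
  intro m _ x hx
  have h1 : DifferentiableAt ℝ (iteratedFDeriv ℝ m (fun x => ∫ a, F a x ∂μ)) x :=
    ((key m x hx).congr_of_eventuallyEq
      (Filter.eventuallyEq_of_mem (hΩ.mem_nhds hx) (hid m))).differentiableAt
  refine h1.differentiableWithinAt.congr (fun y hy => ?_) ?_
  · exact iteratedFDerivWithin_of_isOpen m hΩ hy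
  · exact iteratedFDerivWithin_of_isOpen m hΩ hx

/-- A family of smooth functions that is jointly continuous and whose derivatives of each order
are locally bounded has jointly continuous derivatives. -/
theorem continuousOn_iteratedFDeriv_family [FiniteDimensional ℝ E] {A : Type} [TopologicalSpace A]
    {Ω : Set E} (hΩ : IsOpen Ω) (F : A → E → V) (hs : ∀ a, ContDiffOn ℝ ∞ (F a) Ω)
    (hc : ContinuousOn (fun q : A × E => F q.1 q.2) (univ ×ˢ Ω))
    (hb : ∀ n : ℕ, ∀ a₀ : A, ∀ x₀ ∈ Ω, ∃ C : ℝ, ∀ᶠ q : A × E in 𝓝 (a₀, x₀),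
      ‖iteratedFDeriv ℝ n (F q.1) q.2‖ ≤ C) (n : ℕ) :
    ContinuousOn (fun q : A × E => iteratedFDeriv ℝ n (F q.1) q.2) (univ ×ˢ Ω) := by
  have hO : IsOpen ((univ : Set A) ×ˢ Ω) := isOpen_univ.prod hΩ
  have hdiff : ∀ (n : ℕ) (a : A), ∀ x ∈ Ω, DifferentiableAt ℝ (iteratedFDeriv ℝ n (F a)) x := by
    intro n a x hx
    have h1 : ContDiffAt ℝ ∞ (F a) x := (hs a).contDiffAt (hΩ.mem_nhds hx)
    exact h1.differentiableAt_iteratedFDeriv (by exact_mod_cast ENat.natCast_lt_top n)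
  induction n with
  | zero =>
    simp only [iteratedFDeriv_zero_eq_comp, Function.comp_def]
    exact (LinearIsometryEquiv.continuous _).comp_continuousOn hc
  | succ n ih =>
    simp only [iteratedFDeriv_succ_eq_curryLeftIso]
    refine (ContinuousLinearEquiv.continuous _).comp_continuousOn ?_
    rw [continuousOn_clm_apply]
    intro v
    refine fun q₀ hq₀ => ContinuousAt.continuousWithinAt ?_
    obtain ⟨a₀, x₀⟩ := q₀
    have hx₀ : x₀ ∈ Ω := hq₀.2
    obtain ⟨C, hC⟩ := hb (n + 2) a₀ x₀ hx₀
    rw [nhds_prod_eq, Filter.eventually_prod_iff] at hC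
    obtain ⟨pa, hpa, px, hpx, hC⟩ := hC
    obtain ⟨δ, hδ, hball⟩ := Metric.mem_nhds_iff.1 (Filter.inter_mem hpx (hΩ.mem_nhds hx₀))
    have hC' : ∀ a, pa a → ∀ x ∈ Metric.ball x₀ δ, ∀ y ∈ Metric.ball x₀ δ,
        ‖iteratedFDeriv ℝ n (F a) y - iteratedFDeriv ℝ n (F a) x
          - fderiv ℝ (iteratedFDeriv ℝ n (F a)) x (y - x)‖ ≤ (|C| * ‖y - x‖) * ‖y - x‖ := by
      intro a ha x hx y hy
      have hcv : Convex ℝ (Metric.ball x₀ δ) := convex_ball x₀ δ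
      have hlip : ∀ z ∈ Metric.ball x₀ δ, ‖fderiv ℝ (iteratedFDeriv ℝ n (F a)) z
          - fderiv ℝ (iteratedFDeriv ℝ n (F a)) x‖ ≤ |C| * ‖z - x‖ := by
        intro z hz
        have h3 := hcv.norm_image_sub_le_of_norm_fderiv_le (𝕜 := ℝ)
          (f := iteratedFDeriv ℝ (n + 1) (F a)) (C := |C|)
          (fun w hw => hdiff (n + 1) a w (hball hw).2)
          (fun w hw => by
            rw [norm_fderiv_iteratedFDeriv]
            exact (hC ha (hball hw).1).trans (le_abs_self C)) hx hz
        refine le_trans (le_of_eq ?_) h3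
        simp only [iteratedFDeriv_succ_eq_curryLeftIso]
        rw [← map_sub, norm_curryLeftIso]
      have hseg : segment ℝ x y ⊆ Metric.ball x₀ δ := hcv.segment_subset hx hy
      refine (convex_segment x y).norm_image_sub_le_of_norm_fderiv_le' (𝕜 := ℝ)
        (fun w hw => hdiff n a w (hball (hseg hw)).2) (fun w hw => ?_)
        (left_mem_segment ℝ x y) (right_mem_segment ℝ x y)
      refine (hlip w (hseg hw)).trans ?_
      gcongr
      exact norm_sub_le_of_mem_segment hw
    refine continuousAt_of_locally_uniform_approx_of_continuousAt (fun u hu => ?_)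
    obtain ⟨ε, hε, hεu⟩ := Metric.mem_uniformity_dist.1 hu
    obtain ⟨h, hh, hh1, hh2⟩ : ∃ h : ℝ, 0 < h ∧ h * ‖v‖ < δ / 2 ∧ |C| * ‖v‖ * ‖v‖ * h < ε := by
      have t1 : Tendsto (fun h : ℝ => h * ‖v‖) (𝓝[>] 0) (𝓝 (0 * ‖v‖)) :=
        (tendsto_nhdsWithin_of_tendsto_nhds tendsto_id).mul_const _
      have t2 : Tendsto (fun h : ℝ => |C| * ‖v‖ * ‖v‖ * h) (𝓝[>] 0) (𝓝 (|C| * ‖v‖ * ‖v‖ * 0)) :=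
        (tendsto_nhdsWithin_of_tendsto_nhds tendsto_id).const_mul _
      rw [zero_mul] at t1
      rw [mul_zero] at t2
      have := ((t1.eventually (gt_mem_nhds (half_pos hδ))).and
        (t2.eventually (gt_mem_nhds hε))).and self_mem_nhdsWithin
      obtain ⟨h, ⟨h1, h2⟩, h3⟩ := this.exists
      exact ⟨h, h3, h1, h2⟩
    have hsh : ∀ x ∈ Metric.ball x₀ (δ / 2), x + h • v ∈ Metric.ball x₀ δ := by
      intro x hx
      rw [Metric.mem_ball, dist_eq_norm] at hx ⊢
      calc ‖x + h • v - x₀‖ = ‖(x - x₀) + h • v‖ := by congr 1; abel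
        _ ≤ ‖x - x₀‖ + h * ‖v‖ := by
          refine (norm_add_le _ _).trans ?_
          rw [norm_smul, Real.norm_of_nonneg hh.le]
        _ < δ := by linarith
    refine ⟨{a | pa a} ×ˢ Metric.ball x₀ (δ / 2), prod_mem_nhds hpa
      (Metric.ball_mem_nhds _ (half_pos hδ)), fun q => h⁻¹ •
        (iteratedFDeriv ℝ n (F q.1) (q.2 + h • v) - iteratedFDeriv ℝ n (F q.1) q.2), ?_, ?_⟩
    · refine ContinuousAt.fun_const_smul (ContinuousAt.fun_sub ?_ ?_) _
      · have hmem : (a₀, x₀ + h • v) ∈ (univ : Set A) ×ˢ Ω :=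
          ⟨trivial, (hball (hsh x₀ (Metric.mem_ball_self (half_pos hδ)))).2⟩
        have h5 := ih.continuousAt (hO.mem_nhds hmem)
        exact ContinuousAt.comp (f := fun q : A × E => (q.1, q.2 + h • v)) (x := (a₀, x₀)) h5
          (by fun_prop)
      · exact ih.continuousAt (hO.mem_nhds hq₀)
    · rintro ⟨a, x⟩ ⟨ha, hx⟩
      apply hεu
      have hxb : x ∈ Metric.ball x₀ δ := Metric.ball_subset_ball (by linarith) hx
      have h6 := hC' a ha x hxb _ (hsh x hx)
      simp only [add_sub_cancel_left, map_smul, norm_smul, Real.norm_of_nonneg hh.le] at h6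
      rw [dist_comm, dist_eq_norm]
      have h7 : h⁻¹ • (iteratedFDeriv ℝ n (F a) (x + h • v) - iteratedFDeriv ℝ n (F a) x)
          - fderiv ℝ (iteratedFDeriv ℝ n (F a)) x v = h⁻¹ •
          (iteratedFDeriv ℝ n (F a) (x + h • v) - iteratedFDeriv ℝ n (F a) x
          - h • fderiv ℝ (iteratedFDeriv ℝ n (F a)) x v) := by
        rw [smul_sub h⁻¹ _ (h • _), smul_smul, inv_mul_cancel₀ hh.ne', one_smul]
      rw [h7, norm_smul, norm_inv, Real.norm_of_nonneg hh.le]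
      calc h⁻¹ * _ ≤ h⁻¹ * (|C| * (h * ‖v‖) * (h * ‖v‖)) := by gcongr
        _ = |C| * ‖v‖ * ‖v‖ * h := by field_simp
        _ < ε := hh2

end Param

/-! ### Weights -/

theorem one_le_weight (η : E3) : 1 ≤ 1 + ‖η‖ := by linarith [norm_nonneg η]

theorem weight_pos (η : E3) : 0 < 1 + ‖η‖ := by linarith [norm_nonneg η]

theorem weight_add_le (η v : E3) : 1 + ‖η + v‖ ≤ (1 + ‖η‖) * (1 + ‖v‖) := by
  nlinarith [norm_add_le η v, mul_nonneg (norm_nonneg η) (norm_nonneg v)]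

/-- The reverse triangle inequality for the weights. -/
theorem weight_le_add (η v : E3) : 1 + ‖η‖ ≤ (1 + ‖η + v‖) * (1 + ‖v‖) := by
  have := weight_add_le (η + v) (-v)
  simpa using this

/-- Peetre's inequality. -/
theorem peetre (m : ℤ) (η v : E3) :
    (1 + ‖η + v‖) ^ m ≤ (1 + ‖η‖) ^ m * (1 + ‖v‖) ^ m.natAbs := by
  obtain ⟨k, rfl | rfl⟩ := m.eq_nat_or_neg
  · simp only [zpow_natCast, Int.natAbs_natCast]
    rw [← mul_pow]
    exact pow_le_pow_left₀ (weight_pos _).le (weight_add_le η v) k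
  · simp only [zpow_neg, zpow_natCast, Int.natAbs_neg, Int.natAbs_natCast]
    rw [inv_mul_eq_div, le_div_iff₀ (pow_pos (weight_pos _) _),
      inv_mul_le_iff₀ (pow_pos (weight_pos _) _), ← mul_pow]
    exact pow_le_pow_left₀ (weight_pos _).le (weight_le_add η v) k

theorem weight_zpow_mono {m n : ℤ} (h : m ≤ n) (η : E3) : (1 + ‖η‖) ^ m ≤ (1 + ‖η‖) ^ n :=
  zpow_le_zpow_right₀ (one_le_weight η) h

theorem weight_zpow_pos (m : ℤ) (η : E3) : 0 < (1 + ‖η‖) ^ m := zpow_pos (weight_pos η) m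

theorem weight_zpow_add (m n : ℤ) (η : E3) :
    (1 + ‖η‖) ^ (m + n) = (1 + ‖η‖) ^ m * (1 + ‖η‖) ^ n :=
  zpow_add₀ (weight_pos η).ne' m n

theorem integrable_weight_inv : Integrable (fun z : E3 => ((1 + ‖z‖) ^ 4)⁻¹) := by
  have h := integrable_one_add_norm (E := E3) (μ := volume) (r := 4) (by simp; norm_num)
  refine h.congr (Filter.Eventually.of_forall fun z => ?_)
  have : (1 + ‖z‖) ^ (-(4:ℝ)) = ((1 + ‖z‖) ^ (4:ℕ))⁻¹ := by
    rw [Real.rpow_neg (weight_pos z).le]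
    norm_cast
  exact this

theorem one_add_pow_le {r : ℝ} (hr : 0 ≤ r) (k : ℕ) : (1 + r) ^ k ≤ 2 ^ k * (r ^ 0 + r ^ k) := by
  rcases le_total r 1 with h | h
  · calc (1 + r) ^ k ≤ 2 ^ k := by gcongr; linarith
      _ ≤ _ := by
        refine le_mul_of_one_le_right (by positivity) ?_
        rw [pow_zero]
        linarith [pow_nonneg hr k]
  · calc (1 + r) ^ k ≤ (2 * r) ^ k := by gcongr; linarith
      _ = 2 ^ k * r ^ k := mul_pow _ _ _
      _ ≤ _ := by
        gcongr
        rw [pow_zero]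
        linarith

/-! ### Scalar derivatives -/

section Directional

/-- The directional derivative of `f` in the direction `v`. -/
def dirD (v : E3) (f : E3 → ℂ) (η : E3) : ℂ := fderiv ℝ f η v

/-- The standard basis of Euclidean space. -/
def stdE (i : Fin 3) : E3 := EuclideanSpace.single i 1

theorem contDiff_dirD {f : E3 → ℂ} (hf : ContDiff ℝ ∞ f) (v : E3) : ContDiff ℝ ∞ (dirD v f) :=
  (hf.fderiv_right (m := ∞) (by simp)).clm_apply contDiff_const

theorem norm_iteratedFDeriv_dirD_le {f : E3 → ℂ} (hf : ContDiff ℝ ∞ f) (v : E3) (b : ℕ) (η : E3) :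
    ‖iteratedFDeriv ℝ b (dirD v f) η‖ ≤ ‖v‖ * ‖iteratedFDeriv ℝ (b + 1) f η‖ := by
  have h := norm_iteratedFDeriv_clm_apply_const (f := fderiv ℝ f) (c := v) (x := η) (N := ∞)
    (n := b) (hf.fderiv_right (m := ∞) (by simp)).contDiffAt (by exact_mod_cast le_top)
  rwa [norm_iteratedFDeriv_fderiv] at h

theorem norm_iteratedFDeriv_succ_le_sum {f : E3 → ℂ} (hf : ContDiff ℝ ∞ f) (b : ℕ) (η : E3) :
    ‖iteratedFDeriv ℝ (b + 1) f η‖ ≤ ∑ i, ‖iteratedFDeriv ℝ b (dirD (stdE i) f) η‖ := by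
  let P : Fin 3 → (E3 →L[ℝ] ℝ) := fun i => EuclideanSpace.proj i
  let L : Fin 3 → (ℂ →L[ℝ] (E3 →L[ℝ] ℂ)) := fun i =>
    ContinuousLinearMap.smulRightL ℝ E3 ℂ (P i)
  have hP : ∀ i, ‖P i‖ ≤ 1 := fun i => by
    refine ContinuousLinearMap.opNorm_le_bound _ zero_le_one (fun x => ?_)
    rw [one_mul]
    exact PiLp.norm_apply_le x i
  have hL : ∀ i, ‖L i‖ ≤ 1 := by
    intro i
    refine ContinuousLinearMap.opNorm_le_bound _ zero_le_one (fun c => ?_)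
    have : ‖L i c‖ = ‖P i‖ * ‖c‖ := ContinuousLinearMap.norm_smulRight_apply _ _
    rw [this]
    exact mul_le_mul_of_nonneg_right (hP i) (norm_nonneg _)
  have hsum : fderiv ℝ f = fun x => ∑ i, L i (dirD (stdE i) f x) := by
    funext x
    ext v
    have hv : v = ∑ i, v i • stdE i := by
      ext j
      simp [stdE, Finset.sum_apply, Pi.single_apply]
    conv_lhs => rw [hv]
    rw [map_sum, sum_apply]
    refine Finset.sum_congr rfl (fun i _ => ?_)
    rw [map_smul]
    rfl
  rw [← norm_iteratedFDeriv_fderiv, hsum]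
  have hc : ∀ i ∈ Finset.univ, ContDiff ℝ (b : ℕ∞) (fun x => L i (dirD (stdE i) f x)) := by
    intro i _
    exact (L i).contDiff.comp ((contDiff_dirD hf _).of_le (by exact_mod_cast le_top))
  rw [iteratedFDeriv_fun_sum_apply fun i hi => (hc i hi).contDiffAt]
  refine (norm_sum_le _ _).trans (Finset.sum_le_sum fun i _ => ?_)
  refine ((L i).norm_iteratedFDeriv_comp_left (N := ∞)
    (contDiff_dirD hf (stdE i)).contDiffAt (by exact_mod_cast le_top)).trans ?_
  calc _ ≤ 1 * ‖iteratedFDeriv ℝ b (dirD (stdE i) f) η‖ := by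
        gcongr
        exact hL i
    _ = _ := one_mul _

end Directional

theorem natCast_le_infty (b : ℕ) : (b : WithTop ℕ∞) ≤ (∞ : WithTop ℕ∞) := by exact_mod_cast le_top

/-! ### Symbol classes on the Fourier side -/

/-- Scalar symbols of order `p` in the dual variable alone. -/
structure IsSym (p : ℤ) (f : E3 → ℂ) : Prop where
  smooth : ContDiff ℝ ∞ f
  bound : ∀ b : ℕ, ∃ C : ℝ, ∀ η : E3, ‖iteratedFDeriv ℝ b f η‖ ≤ C * (1 + ‖η‖) ^ (p - (b : ℤ))

/-- Symbols of order `p` depending on a parameter, with bounds of polynomial growth in the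
parameter. -/
structure IsPS (p : ℤ) (A : E3 → E3 → ℂ) : Prop where
  smooth : ∀ ζ, ContDiff ℝ ∞ (A ζ)
  cont : Continuous (fun q : E3 × E3 => A q.1 q.2)
  bound : ∀ b : ℕ, ∃ (K : ℕ) (C : ℝ), ∀ ζ η : E3,
    ‖iteratedFDeriv ℝ b (A ζ) η‖ ≤ C * (1 + ‖ζ‖) ^ K * (1 + ‖η‖) ^ (p - (b : ℤ))

/-- Symbols of order `p` depending on a parameter, with bounds that decrease rapidly in the
parameter. The parameter is the Fourier variable dual to the position. -/
structure IsRS (p : ℤ) (g : E3 → E3 → ℂ) : Prop where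
  smooth : ∀ ζ, ContDiff ℝ ∞ (g ζ)
  cont : Continuous (fun q : E3 × E3 => g q.1 q.2)
  bound : ∀ b k : ℕ, ∃ C : ℝ, ∀ ζ η : E3,
    (1 + ‖ζ‖) ^ k * ‖iteratedFDeriv ℝ b (g ζ) η‖ ≤ C * (1 + ‖η‖) ^ (p - (b : ℤ))

/-- Continuous functions that decrease rapidly. -/
structure IsRapid (c : E3 → ℂ) : Prop where
  cont : Continuous c
  bound : ∀ k : ℕ, ∃ C : ℝ, ∀ ζ : E3, (1 + ‖ζ‖) ^ k * ‖c ζ‖ ≤ C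

theorem le_abs_mul_of_le {a C w : ℝ} (hw : 0 ≤ w) (h : a ≤ C * w) : a ≤ |C| * w :=
  h.trans (mul_le_mul_of_nonneg_right (le_abs_self C) hw)

/-- The constants in the bounds can be chosen to be nonnegative. -/
theorem IsSym.bound' {p : ℤ} {f : E3 → ℂ} (hf : IsSym p f) (b : ℕ) : ∃ C : ℝ, 0 ≤ C ∧ ∀ η : E3,
    ‖iteratedFDeriv ℝ b f η‖ ≤ C * (1 + ‖η‖) ^ (p - (b : ℤ)) := by
  obtain ⟨C, hC⟩ := hf.bound b
  exact ⟨|C|, abs_nonneg C, fun η => le_abs_mul_of_le (weight_zpow_pos _ _).le (hC η)⟩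

theorem IsPS.bound' {p : ℤ} {A : E3 → E3 → ℂ} (hA : IsPS p A) (b : ℕ) :
    ∃ (K : ℕ) (C : ℝ), 0 ≤ C ∧ ∀ ζ η : E3,
    ‖iteratedFDeriv ℝ b (A ζ) η‖ ≤ C * (1 + ‖ζ‖) ^ K * (1 + ‖η‖) ^ (p - (b : ℤ)) := by
  obtain ⟨K, C, hC⟩ := hA.bound b
  refine ⟨K, |C|, abs_nonneg C, fun ζ η => ?_⟩
  rw [mul_assoc]
  refine le_abs_mul_of_le ?_ (by rw [← mul_assoc]; exact hC ζ η)
  have := weight_zpow_pos (p - b) η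
  have := weight_pos ζ
  positivity

theorem IsRS.bound' {p : ℤ} {g : E3 → E3 → ℂ} (hg : IsRS p g) (b k : ℕ) :
    ∃ C : ℝ, 0 ≤ C ∧ ∀ ζ η : E3,
    (1 + ‖ζ‖) ^ k * ‖iteratedFDeriv ℝ b (g ζ) η‖ ≤ C * (1 + ‖η‖) ^ (p - (b : ℤ)) := by
  obtain ⟨C, hC⟩ := hg.bound b k
  exact ⟨|C|, abs_nonneg C, fun ζ η => le_abs_mul_of_le (weight_zpow_pos _ _).le (hC ζ η)⟩

theorem IsRapid.bound' {c : E3 → ℂ} (hc : IsRapid c) (k : ℕ) :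
    ∃ C : ℝ, 0 ≤ C ∧ ∀ ζ : E3, (1 + ‖ζ‖) ^ k * ‖c ζ‖ ≤ C := by
  obtain ⟨C, hC⟩ := hc.bound k
  exact ⟨|C|, abs_nonneg C, fun ζ => (hC ζ).trans (le_abs_self C)⟩

theorem le_mul_inv_pow {a C : ℝ} {k : ℕ} {ζ : E3} (h : (1 + ‖ζ‖) ^ k * a ≤ C) :
    a ≤ C * ((1 + ‖ζ‖) ^ k)⁻¹ := by
  rw [← div_eq_mul_inv, le_div_iff₀ (pow_pos (weight_pos ζ) k), mul_comm]
  exact h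

namespace IsSym

variable {p q : ℤ} {f g : E3 → ℂ}

theorem add (hf : IsSym p f) (hg : IsSym p g) : IsSym p (fun η => f η + g η) := by
  refine ⟨hf.smooth.add hg.smooth, fun b => ?_⟩
  obtain ⟨C, hC⟩ := hf.bound b
  obtain ⟨D, hD⟩ := hg.bound b
  refine ⟨C + D, fun η => ?_⟩
  have : iteratedFDeriv ℝ b (fun η => f η + g η) η
      = iteratedFDeriv ℝ b f η + iteratedFDeriv ℝ b g η :=
    iteratedFDeriv_add_apply (hf.smooth.of_le (natCast_le_infty b)).contDiffAt
      (hg.smooth.of_le (natCast_le_infty b)).contDiffAt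
  rw [this, add_mul]
  exact (norm_add_le _ _).trans (add_le_add (hC η) (hD η))

theorem const_mul (hf : IsSym p f) (c : ℂ) : IsSym p (fun η => c * f η) := by
  refine ⟨contDiff_const.mul hf.smooth, fun b => ?_⟩
  obtain ⟨C, hC⟩ := hf.bound b
  refine ⟨‖c‖ * C, fun η => ?_⟩
  have : iteratedFDeriv ℝ b (fun η => c * f η) η = c • iteratedFDeriv ℝ b f η :=
    iteratedFDeriv_const_smul_apply (a := c) (hf.smooth.of_le (natCast_le_infty b)).contDiffAt
  rw [this, norm_smul, mul_assoc]
  exact mul_le_mul_of_nonneg_left (hC η) (norm_nonneg c)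

theorem mul (hf : IsSym p f) (hg : IsSym q g) : IsSym (p + q) (fun η => f η * g η) := by
  refine ⟨hf.smooth.mul hg.smooth, fun b => ?_⟩
  choose C hC0 hC using hf.bound'
  choose D hD0 hD using hg.bound'
  refine ⟨∑ i ∈ Finset.range (b + 1), (b.choose i : ℝ) * C i * D (b - i), fun η => ?_⟩
  refine (norm_iteratedFDeriv_mul_le hf.smooth hg.smooth η (natCast_le_infty b)).trans ?_
  rw [Finset.sum_mul]
  refine Finset.sum_le_sum fun i hi => ?_
  have hi' : i ≤ b := Nat.lt_succ_iff.1 (Finset.mem_range.1 hi)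
  have hw : (1 + ‖η‖) ^ (p + q - (b : ℤ)) = (1 + ‖η‖) ^ (p - (i : ℤ)) *
      (1 + ‖η‖) ^ (q - ((b - i : ℕ) : ℤ)) := by
    rw [← weight_zpow_add]
    congr 1
    push_cast [hi']
    ring
  rw [hw]
  calc _ ≤ (b.choose i : ℝ) * (C i * (1 + ‖η‖) ^ (p - (i : ℤ))) *
        (D (b - i) * (1 + ‖η‖) ^ (q - ((b - i : ℕ) : ℤ))) := by
        have h1 := hC i η
        have h2 := hD (b - i) η
        have := mul_nonneg (hC0 i) (weight_zpow_pos (p - (i : ℤ)) η).le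
        gcongr
    _ = _ := by ring

theorem dirD (hf : IsSym p f) (v : E3) : IsSym (p - 1) (dirD v f) := by
  refine ⟨contDiff_dirD hf.smooth v, fun b => ?_⟩
  obtain ⟨C, hC⟩ := hf.bound (b + 1)
  refine ⟨‖v‖ * C, fun η => (norm_iteratedFDeriv_dirD_le hf.smooth v b η).trans ?_⟩
  rw [mul_assoc]
  refine mul_le_mul_of_nonneg_left ((hC η).trans (le_of_eq ?_)) (norm_nonneg v)
  congr 2
  push_cast
  ring

theorem sum {ι : Type} (s : Finset ι) {f : ι → E3 → ℂ} (h : ∀ i ∈ s, IsSym p (f i)) :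
    IsSym p (fun η => ∑ i ∈ s, f i η) := by
  classical
  induction s using Finset.induction_on with
  | empty =>
    simp only [Finset.sum_empty]
    refine ⟨contDiff_const, fun b => ⟨0, fun η => ?_⟩⟩
    rw [iteratedFDeriv_fun_zero]
    simp
  | insert a s ha ih =>
    simp only [Finset.sum_insert ha]
    exact (h a (Finset.mem_insert_self a s)).add
      (ih fun i hi => h i (Finset.mem_insert_of_mem hi))

end IsSym

namespace IsRS

variable {p q : ℤ} {g h : E3 → E3 → ℂ}

theorem mono (hg : IsRS p g) (hpq : p ≤ q) : IsRS q g := by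
  refine ⟨hg.smooth, hg.cont, fun b k => ?_⟩
  obtain ⟨C, hC0, hC⟩ := hg.bound' b k
  exact ⟨C, fun ζ η => (hC ζ η).trans
    (mul_le_mul_of_nonneg_left (weight_zpow_mono (by omega) η) hC0)⟩

theorem add (hg : IsRS p g) (hh : IsRS p h) : IsRS p (fun ζ η => g ζ η + h ζ η) := by
  refine ⟨fun ζ => (hg.smooth ζ).add (hh.smooth ζ), hg.cont.add hh.cont, fun b k => ?_⟩
  obtain ⟨C, hC⟩ := hg.bound b k
  obtain ⟨D, hD⟩ := hh.bound b k
  refine ⟨C + D, fun ζ η => ?_⟩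
  have : iteratedFDeriv ℝ b (fun η => g ζ η + h ζ η) η
      = iteratedFDeriv ℝ b (g ζ) η + iteratedFDeriv ℝ b (h ζ) η :=
    iteratedFDeriv_add_apply ((hg.smooth ζ).of_le (natCast_le_infty b)).contDiffAt
      ((hh.smooth ζ).of_le (natCast_le_infty b)).contDiffAt
  rw [this, add_mul]
  refine le_trans ?_ (add_le_add (hC ζ η) (hD ζ η))
  rw [← mul_add]
  exact mul_le_mul_of_nonneg_left (norm_add_le _ _) (pow_nonneg (weight_pos ζ).le k)

theorem const_mul (hg : IsRS p g) (c : ℂ) : IsRS p (fun ζ η => c * g ζ η) := by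
  refine ⟨fun ζ => contDiff_const.mul (hg.smooth ζ), continuous_const.mul hg.cont, fun b k => ?_⟩
  obtain ⟨C, hC⟩ := hg.bound b k
  refine ⟨‖c‖ * C, fun ζ η => ?_⟩
  have : iteratedFDeriv ℝ b (fun η => c * g ζ η) η = c • iteratedFDeriv ℝ b (g ζ) η :=
    iteratedFDeriv_const_smul_apply (a := c) ((hg.smooth ζ).of_le (natCast_le_infty b)).contDiffAt
  rw [this, norm_smul, mul_assoc, mul_left_comm]
  exact mul_le_mul_of_nonneg_left (hC ζ η) (norm_nonneg c)

theorem zero : IsRS p (fun _ _ => 0) := by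
  refine ⟨fun _ => contDiff_const, continuous_const, fun b k => ⟨0, fun ζ η => ?_⟩⟩
  rw [iteratedFDeriv_fun_zero]
  simp

theorem sum {ι : Type} (s : Finset ι) {g : ι → E3 → E3 → ℂ} (h : ∀ i ∈ s, IsRS p (g i)) :
    IsRS p (fun ζ η => ∑ i ∈ s, g i ζ η) := by
  classical
  induction s using Finset.induction_on with
  | empty => simpa using zero
  | insert a s ha ih =>
    simp only [Finset.sum_insert ha]
    exact (h a (Finset.mem_insert_self a s)).add
      (ih fun i hi => h i (Finset.mem_insert_of_mem hi))

/-- The product of a symbol of polynomial growth in the parameter with a rapidly decreasing one. -/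
theorem ps_mul {A : E3 → E3 → ℂ} (hA : IsPS p A) (hh : IsRS q h) :
    IsRS (p + q) (fun ζ η => A ζ η * h ζ η) := by
  refine ⟨fun ζ => (hA.smooth ζ).mul (hh.smooth ζ), hA.cont.mul hh.cont, fun b k => ?_⟩
  choose K C hC0 hC using hA.bound'
  choose D hD0 hD using hh.bound'
  refine ⟨∑ i ∈ Finset.range (b + 1), (b.choose i : ℝ) * C i * D (b - i) (K i + k), fun ζ η => ?_⟩
  refine (mul_le_mul_of_nonneg_left (norm_iteratedFDeriv_mul_le (hA.smooth ζ) (hh.smooth ζ) η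
    (natCast_le_infty b)) (pow_nonneg (weight_pos ζ).le k)).trans ?_
  rw [Finset.sum_mul, Finset.mul_sum]
  refine Finset.sum_le_sum fun i hi => ?_
  have hi' : i ≤ b := Nat.lt_succ_iff.1 (Finset.mem_range.1 hi)
  have hw : (1 + ‖η‖) ^ (p + q - (b : ℤ)) = (1 + ‖η‖) ^ (p - (i : ℤ)) *
      (1 + ‖η‖) ^ (q - ((b - i : ℕ) : ℤ)) := by
    rw [← weight_zpow_add]
    congr 1
    push_cast [hi']
    ring
  rw [hw]
  have h1 := hC i ζ η
  have h2 := hD (b - i) (K i + k) ζ η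
  have hw1 := weight_zpow_pos (p - (i : ℤ)) η
  have hz := weight_pos ζ
  calc _ ≤ (1 + ‖ζ‖) ^ k * ((b.choose i : ℝ) * (C i * (1 + ‖ζ‖) ^ K i *
          (1 + ‖η‖) ^ (p - (i : ℤ))) * ‖iteratedFDeriv ℝ (b - i) (h ζ) η‖) := by gcongr
    _ = (b.choose i : ℝ) * (C i * (1 + ‖η‖) ^ (p - (i : ℤ))) *
        ((1 + ‖ζ‖) ^ (K i + k) * ‖iteratedFDeriv ℝ (b - i) (h ζ) η‖) := by rw [pow_add]; ring
    _ ≤ (b.choose i : ℝ) * (C i * (1 + ‖η‖) ^ (p - (i : ℤ))) *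
        (D (b - i) (K i + k) * (1 + ‖η‖) ^ (q - ((b - i : ℕ) : ℤ))) := by
        have := mul_nonneg (hC0 i) hw1.le
        gcongr
    _ = _ := by ring

end IsRS

theorem IsSym.isPS {p : ℤ} {f : E3 → ℂ} (hf : IsSym p f) : IsPS p (fun _ η => f η) := by
  refine ⟨fun _ => hf.smooth, hf.smooth.continuous.comp continuous_snd, fun b => ?_⟩
  obtain ⟨C, hC⟩ := hf.bound b
  exact ⟨0, C, fun ζ η => by simpa using hC η⟩

theorem IsRapid.isRS {c : E3 → ℂ} (hc : IsRapid c) : IsRS 0 (fun ζ _ => c ζ) := by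
  refine ⟨fun _ => contDiff_const, hc.cont.comp continuous_fst, fun b k => ?_⟩
  obtain ⟨C, hC0, hC⟩ := hc.bound' k
  refine ⟨C, fun ζ η => ?_⟩
  rcases b with _ | b
  · simpa using hC ζ
  · rw [iteratedFDeriv_succ_const]
    simp only [Pi.zero_apply, norm_zero, mul_zero]
    exact mul_nonneg hC0 (weight_zpow_pos _ _).le

theorem IsRapid.mul_isSym {p : ℤ} {c f : E3 → ℂ} (hc : IsRapid c) (hf : IsSym p f) :
    IsRS p (fun ζ η => c ζ * f η) := by
  have := IsRS.ps_mul hf.isPS hc.isRS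
  simpa [mul_comm] using this

theorem IsRS.continuous_iteratedFDeriv {p : ℤ} {g : E3 → E3 → ℂ} (hg : IsRS p g) (b : ℕ) :
    Continuous (fun q : E3 × E3 => iteratedFDeriv ℝ b (g q.1) q.2) := by
  have := continuousOn_iteratedFDeriv_family (A := E3) isOpen_univ g
    (fun a => (hg.smooth a).contDiffOn) hg.cont.continuousOn ?_ b
  · simpa [continuousOn_univ] using this
  · intro n a₀ x₀ _
    obtain ⟨C, hC⟩ := hg.bound n 0
    refine ⟨C * (1 + ‖x₀‖) ^ (p - (n : ℤ)) + 1, ?_⟩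
    have hcw : Continuous (fun q : E3 × E3 => C * (1 + ‖q.2‖) ^ (p - (n : ℤ))) := by
      refine continuous_const.mul (Continuous.zpow₀ (by fun_prop) _ fun q => ?_)
      exact Or.inl (weight_pos _).ne'
    filter_upwards [hcw.continuousAt.eventually_lt (continuousAt_const (y := C * (1 + ‖x₀‖) ^
      (p - (n : ℤ)) + 1)) (lt_add_one _)] with q hq
    exact le_trans (by simpa using hC q.1 q.2) hq.le

/-- Integrals over a further parameter of symbols with rapidly decreasing bounds. -/
theorem IsRS.integral {p : ℤ} (G : E3 → E3 → E3 → ℂ) (hs : ∀ θ ζ, ContDiff ℝ ∞ (G θ ζ))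
    (hc : Continuous fun q : (E3 × E3) × E3 => G q.1.1 q.1.2 q.2)
    (hb : ∀ b k : ℕ, ∃ C : ℝ, ∀ θ ζ η : E3, (1 + ‖θ‖) ^ k * (1 + ‖ζ‖) ^ 4 *
      ‖iteratedFDeriv ℝ b (G θ ζ) η‖ ≤ C * (1 + ‖η‖) ^ (p - (b : ℤ))) :
    IsRS p (fun θ η => ∫ ζ, G θ ζ η) := by
  have hcw : ∀ (C : ℝ) (b : ℕ), Continuous (fun η : E3 => C * (1 + ‖η‖) ^ (p - (b : ℤ))) := by
    intro C b
    refine continuous_const.mul (Continuous.zpow₀ (by fun_prop) _ fun q => ?_)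
    exact Or.inl (weight_pos _).ne'
  have hle : ∀ b : ℕ, ∃ C : ℝ, ∀ θ ζ η : E3, ‖iteratedFDeriv ℝ b (G θ ζ) η‖ ≤
      C * (1 + ‖η‖) ^ (p - (b : ℤ)) * ((1 + ‖ζ‖) ^ 4)⁻¹ := by
    intro b
    obtain ⟨C, hC⟩ := hb b 0
    exact ⟨C, fun θ ζ η => le_mul_inv_pow (by simpa using hC θ ζ η)⟩
  have hinv : ∀ ζ : E3, ((1 + ‖ζ‖) ^ 4)⁻¹ ≤ 1 := fun ζ =>
    inv_le_one_of_one_le₀ (one_le_pow₀ (one_le_weight ζ))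
  have hcd : ∀ b : ℕ, Continuous (fun q : (E3 × E3) × E3 =>
      iteratedFDeriv ℝ b (G q.1.1 q.1.2) q.2) := by
    intro b
    have := continuousOn_iteratedFDeriv_family (A := E3 × E3) isOpen_univ (fun a => G a.1 a.2)
      (fun a => (hs a.1 a.2).contDiffOn) hc.continuousOn ?_ b
    · simpa [continuousOn_univ] using this
    · intro n a₀ x₀ _
      obtain ⟨C, hC⟩ := hle n
      refine ⟨|C * (1 + ‖x₀‖) ^ (p - (n : ℤ))| + 1, ?_⟩
      filter_upwards [((hcw C n).abs.comp continuous_snd).continuousAt.eventually_lt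
        (continuousAt_const (y := |C * (1 + ‖x₀‖) ^ (p - (n : ℤ))| + 1)) (lt_add_one _)] with q hq
      refine (hC _ _ _).trans (le_trans ?_ hq.le)
      refine (mul_le_mul_of_nonneg_right (le_abs_self _) (by positivity)).trans ?_
      exact mul_le_of_le_one_right (abs_nonneg _) (hinv _)
  have hA : ∀ θ, _ := fun θ => contDiffOn_integral_and_iteratedFDeriv (μ := volume) isOpen_univ
    (G θ) (fun ζ => (hs θ ζ).contDiffOn)
    (fun n η _ => ((hcd n).comp (f := fun ζ : E3 => ((θ, ζ), η))
      (by fun_prop)).aestronglyMeasurable) (by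
      intro n η₀ _
      obtain ⟨C, hC⟩ := hle n
      obtain ⟨ε, hε, h⟩ := Metric.eventually_nhds_iff_ball.1
        ((hcw C n).continuousAt.eventually_lt (continuousAt_const (y := C * (1 + ‖η₀‖) ^
          (p - (n : ℤ)) + 1)) (lt_add_one _))
      refine ⟨ε, hε, fun ζ => (C * (1 + ‖η₀‖) ^ (p - (n : ℤ)) + 1) * ((1 + ‖ζ‖) ^ 4)⁻¹,
        integrable_weight_inv.const_mul _, Filter.Eventually.of_forall fun ζ η hη _ => ?_⟩
      exact (hC θ ζ η).trans (mul_le_mul_of_nonneg_right (h η hη).le (by positivity)))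
  refine ⟨fun θ => contDiffOn_univ.1 (hA θ).1, ?_, fun b k => ?_⟩
  · refine continuous_iff_continuousAt.2 fun q₀ => ?_
    obtain ⟨C, hC⟩ := hle 0
    refine continuousAt_of_dominated (bound := fun ζ =>
      (C * (1 + ‖q₀.2‖) ^ (p - ((0 : ℕ) : ℤ)) + 1) * ((1 + ‖ζ‖) ^ 4)⁻¹) ?_ ?_
      (integrable_weight_inv.const_mul _) ?_
    · refine Filter.Eventually.of_forall fun q => ?_
      exact (hc.comp (f := fun ζ : E3 => ((q.1, ζ), q.2)) (by fun_prop)).aestronglyMeasurable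
    · filter_upwards [((hcw C 0).comp continuous_snd).continuousAt.eventually_lt
        (continuousAt_const (y := C * (1 + ‖q₀.2‖) ^ (p - ((0 : ℕ) : ℤ)) + 1)) (lt_add_one _)]
        with q hq
      refine Filter.Eventually.of_forall fun ζ => ?_
      have := hC q.1 ζ q.2
      rw [norm_iteratedFDeriv_zero] at this
      exact this.trans (mul_le_mul_of_nonneg_right hq.le (by positivity))
    · exact Filter.Eventually.of_forall fun ζ =>
        (hc.comp (f := fun q : E3 × E3 => ((q.1, ζ), q.2)) (by fun_prop)).continuousAt
  · obtain ⟨C, hC⟩ := hb b k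
    refine ⟨C * ∫ ζ : E3, ((1 + ‖ζ‖) ^ 4)⁻¹, fun θ η => ?_⟩
    rw [(hA θ).2 b η trivial]
    have h1 : ‖∫ ζ, iteratedFDeriv ℝ b (G θ ζ) η‖ ≤
        ∫ ζ : E3, (C * (1 + ‖η‖) ^ (p - (b : ℤ)) * ((1 + ‖θ‖) ^ k)⁻¹) * ((1 + ‖ζ‖) ^ 4)⁻¹ := by
      refine norm_integral_le_of_norm_le (integrable_weight_inv.const_mul _)
        (Filter.Eventually.of_forall fun ζ => ?_)
      refine le_mul_inv_pow ?_
      refine le_mul_inv_pow ?_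
      rw [← mul_assoc]
      exact hC θ ζ η
    rw [integral_const_mul] at h1
    have hk := pow_pos (weight_pos θ) k
    calc (1 + ‖θ‖) ^ k * _ ≤ (1 + ‖θ‖) ^ k * _ := mul_le_mul_of_nonneg_left h1 hk.le
      _ = _ := by field_simp

/-! ### Twisted convolution -/

/-- The composition of symbols on the Fourier side: if `g` and `h` are the Fourier transforms in
the position variable of the symbols `s` and `r`, then `twist g h` is that of `s ∘ r`. The factor
`2π` comes from the normalization `e^{-2πi⟨x, ζ⟩}` of the Fourier transform in Mathlib. -/
def twist (g h : E3 → E3 → ℂ) (θ η : E3) : ℂ :=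
  ∫ ζ, g (θ - ζ) (η + (2 * Real.pi) • ζ) * h ζ η

theorem weight_two_pi_smul_le (ζ : E3) : 1 + ‖(2 * Real.pi) • ζ‖ ≤ 2 * Real.pi * (1 + ‖ζ‖) := by
  have := Real.pi_gt_three
  rw [norm_smul, Real.norm_of_nonneg (by positivity)]
  nlinarith [norm_nonneg ζ]

theorem peetre_two_pi (m : ℤ) (η ζ : E3) : (1 + ‖η + (2 * Real.pi) • ζ‖) ^ m ≤
    (2 * Real.pi) ^ m.natAbs * (1 + ‖ζ‖) ^ m.natAbs * (1 + ‖η‖) ^ m := by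
  refine (peetre m η _).trans ?_
  rw [mul_comm, ← mul_pow]
  exact mul_le_mul_of_nonneg_right (pow_le_pow_left₀ (weight_pos _).le (weight_two_pi_smul_le ζ) _)
    (weight_zpow_pos _ _).le

theorem weight_pow_le_sub (k : ℕ) (θ ζ : E3) :
    (1 + ‖θ‖) ^ k ≤ (1 + ‖θ - ζ‖) ^ k * (1 + ‖ζ‖) ^ k := by
  rw [← mul_pow]
  refine pow_le_pow_left₀ (weight_pos _).le ?_ k
  simpa using weight_add_le (θ - ζ) ζ

/-- By Peetre's inequality, the shift of the dual variable by `2πζ` costs only a power of `1 + |ζ|`,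
which the decay of `h` in `ζ` absorbs. -/
theorem twist_integrand_bound {p q : ℤ} {g h : E3 → E3 → ℂ} (hg : IsRS p g) (hh : IsRS q h)
    (b k l : ℕ) : ∃ C : ℝ, ∀ θ ζ η : E3, (1 + ‖θ‖) ^ k * (1 + ‖ζ‖) ^ l *
      ‖iteratedFDeriv ℝ b (fun η => g (θ - ζ) (η + (2 * Real.pi) • ζ) * h ζ η) η‖
        ≤ C * (1 + ‖η‖) ^ (p + q - (b : ℤ)) := by
  choose C hC0 hC using fun b => hg.bound' b k
  choose D hD0 hD using hh.bound'
  let e : ℕ → ℕ := fun i => (p - (i : ℤ)).natAbs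
  refine ⟨∑ i ∈ Finset.range (b + 1), (b.choose i : ℝ) * C i * (2 * Real.pi) ^ e i *
    D (b - i) (k + l + e i), fun θ ζ η => ?_⟩
  have hsm : ContDiff ℝ ∞ (fun η => g (θ - ζ) (η + (2 * Real.pi) • ζ)) :=
    (hg.smooth (θ - ζ)).comp (contDiff_id.add contDiff_const)
  refine (mul_le_mul_of_nonneg_left (norm_iteratedFDeriv_mul_le hsm (hh.smooth ζ) η
    (natCast_le_infty b)) (by positivity)).trans ?_
  rw [Finset.sum_mul, Finset.mul_sum]
  refine Finset.sum_le_sum fun i hi => ?_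
  have hi' : i ≤ b := Nat.lt_succ_iff.1 (Finset.mem_range.1 hi)
  have hw : (1 + ‖η‖) ^ (p + q - (b : ℤ)) = (1 + ‖η‖) ^ (p - (i : ℤ)) *
      (1 + ‖η‖) ^ (q - ((b - i : ℕ) : ℤ)) := by
    rw [← weight_zpow_add]
    congr 1
    push_cast [hi']
    ring
  rw [hw]
  have hsh : iteratedFDeriv ℝ i (fun η => g (θ - ζ) (η + (2 * Real.pi) • ζ)) η
      = iteratedFDeriv ℝ i (g (θ - ζ)) (η + (2 * Real.pi) • ζ) :=
    iteratedFDeriv_comp_add_right i _ _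
  rw [hsh]
  have h1 := hC i (θ - ζ) (η + (2 * Real.pi) • ζ)
  have h1' := h1.trans (mul_le_mul_of_nonneg_left (peetre_two_pi (p - (i : ℤ)) η ζ) (hC0 i))
  have h2 := hD (b - i) (k + l + e i) ζ η
  have hw1 := weight_zpow_pos (p - (i : ℤ)) η
  have hz := weight_pos ζ
  have hpi := Real.pi_pos
  have hCi := hC0 i
  set X := ‖iteratedFDeriv ℝ i (g (θ - ζ)) (η + (2 * Real.pi) • ζ)‖
  set Y := ‖iteratedFDeriv ℝ (b - i) (h ζ) η‖
  calc (1 + ‖θ‖) ^ k * (1 + ‖ζ‖) ^ l * ((b.choose i : ℝ) * X * Y)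
      ≤ ((1 + ‖θ - ζ‖) ^ k * (1 + ‖ζ‖) ^ k) * (1 + ‖ζ‖) ^ l * ((b.choose i : ℝ) * X * Y) := by
        gcongr
        exact weight_pow_le_sub k θ ζ
    _ = (b.choose i : ℝ) * ((1 + ‖θ - ζ‖) ^ k * X) * ((1 + ‖ζ‖) ^ (k + l) * Y) := by
        rw [pow_add]; ring
    _ ≤ (b.choose i : ℝ) * (C i * ((2 * Real.pi) ^ e i * (1 + ‖ζ‖) ^ e i *
          (1 + ‖η‖) ^ (p - (i : ℤ)))) * ((1 + ‖ζ‖) ^ (k + l) * Y) := by gcongr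
    _ = (b.choose i : ℝ) * C i * (2 * Real.pi) ^ e i * (1 + ‖η‖) ^ (p - (i : ℤ)) *
          ((1 + ‖ζ‖) ^ (k + l + e i) * Y) := by rw [pow_add _ (k + l)]; ring
    _ ≤ (b.choose i : ℝ) * C i * (2 * Real.pi) ^ e i * (1 + ‖η‖) ^ (p - (i : ℤ)) *
          (D (b - i) (k + l + e i) * (1 + ‖η‖) ^ (q - ((b - i : ℕ) : ℤ))) := by gcongr
    _ = _ := by ring

theorem IsRS.continuous_twist_integrand {p q : ℤ} {g h : E3 → E3 → ℂ} (hg : IsRS p g)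
    (hh : IsRS q h) : Continuous fun r : (E3 × E3) × E3 =>
      g (r.1.1 - r.1.2) (r.2 + (2 * Real.pi) • r.1.2) * h r.1.2 r.2 :=
  (hg.cont.comp (f := fun r : (E3 × E3) × E3 =>
      (r.1.1 - r.1.2, r.2 + (2 * Real.pi) • r.1.2)) (by fun_prop)).mul
    (hh.cont.comp (f := fun r : (E3 × E3) × E3 => (r.1.2, r.2)) (by fun_prop))

theorem IsRS.twist {p q : ℤ} {g h : E3 → E3 → ℂ} (hg : IsRS p g) (hh : IsRS q h) :
    IsRS (p + q) (twist g h) := by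
  refine IsRS.integral (fun θ ζ η => g (θ - ζ) (η + (2 * Real.pi) • ζ) * h ζ η)
    (fun θ ζ => ((hg.smooth (θ - ζ)).comp (contDiff_id.add contDiff_const)).mul (hh.smooth ζ))
    (hg.continuous_twist_integrand hh) fun b k => twist_integrand_bound hg hh b k 4

theorem IsRS.integrable_twist {p q : ℤ} {g h : E3 → E3 → ℂ} (hg : IsRS p g) (hh : IsRS q h)
    (θ η : E3) : Integrable fun ζ => g (θ - ζ) (η + (2 * Real.pi) • ζ) * h ζ η := by
  obtain ⟨C, hC⟩ := twist_integrand_bound hg hh 0 0 4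
  refine (integrable_weight_inv.const_mul (C * (1 + ‖η‖) ^ (p + q - ((0 : ℕ) : ℤ)))).mono'
    ((hg.continuous_twist_integrand hh).comp (f := fun ζ : E3 => ((θ, ζ), η))
      (by fun_prop)).aestronglyMeasurable (Filter.Eventually.of_forall fun ζ => ?_)
  have := hC θ ζ η
  rw [norm_iteratedFDeriv_zero] at this
  exact le_mul_inv_pow (by simpa using this)

theorem twist_add_left {p q : ℤ} {g g' h : E3 → E3 → ℂ} (hg : IsRS p g) (hg' : IsRS p g')
    (hh : IsRS q h) : twist (fun ζ η => g ζ η + g' ζ η) h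
      = fun θ η => twist g h θ η + twist g' h θ η := by
  funext θ η
  simp only [twist, add_mul]
  exact integral_add (hg.integrable_twist hh θ η) (hg'.integrable_twist hh θ η)

theorem twist_add_right {p q : ℤ} {g h h' : E3 → E3 → ℂ} (hg : IsRS p g) (hh : IsRS q h)
    (hh' : IsRS q h') : twist g (fun ζ η => h ζ η + h' ζ η)
      = fun θ η => twist g h θ η + twist g h' θ η := by
  funext θ η
  simp only [twist, mul_add]
  exact integral_add (hg.integrable_twist hh θ η) (hg.integrable_twist hh' θ η)

theorem twist_const_mul_left (c : ℂ) (g h : E3 → E3 → ℂ) :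
    twist (fun ζ η => c * g ζ η) h = fun θ η => c * twist g h θ η := by
  funext θ η
  simp only [twist, mul_assoc]
  exact integral_const_mul c _

theorem twist_const_mul_right (c : ℂ) (g h : E3 → E3 → ℂ) :
    twist g (fun ζ η => c * h ζ η) = fun θ η => c * twist g h θ η := by
  funext θ η
  simp only [twist, mul_left_comm _ c]
  exact integral_const_mul c _

theorem twist_sum_left {p q : ℤ} {ι : Type} (s : Finset ι) {g : ι → E3 → E3 → ℂ}
    {h : E3 → E3 → ℂ} (hg : ∀ i ∈ s, IsRS p (g i)) (hh : IsRS q h) :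
    twist (fun ζ η => ∑ i ∈ s, g i ζ η) h = fun θ η => ∑ i ∈ s, twist (g i) h θ η := by
  funext θ η
  simp only [twist, Finset.sum_mul]
  exact integral_finsetSum _ fun i hi => (hg i hi).integrable_twist hh θ η

theorem twist_sum_right {p q : ℤ} {ι : Type} (s : Finset ι) {h : ι → E3 → E3 → ℂ}
    {g : E3 → E3 → ℂ} (hg : IsRS p g) (hh : ∀ i ∈ s, IsRS q (h i)) :
    twist g (fun ζ η => ∑ i ∈ s, h i ζ η) = fun θ η => ∑ i ∈ s, twist g (h i) θ η := by
  funext θ η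
  simp only [twist, Finset.mul_sum]
  exact integral_finsetSum _ fun i hi => hg.integrable_twist (hh i hi) θ η

/-! ### Taylor expansion of symbols -/

theorem contDiff_iterate_dirD {f : E3 → ℂ} (hf : ContDiff ℝ ∞ f) (w : E3) (k : ℕ) :
    ContDiff ℝ ∞ ((dirD w)^[k] f) := by
  induction k generalizing f with
  | zero => exact hf
  | succ k ih => exact ih (contDiff_dirD hf w)

theorem norm_iteratedFDeriv_iterate_dirD_le {f : E3 → ℂ} (hf : ContDiff ℝ ∞ f) (w : E3) (k b : ℕ)
    (η : E3) :
    ‖iteratedFDeriv ℝ b ((dirD w)^[k] f) η‖ ≤ ‖w‖ ^ k * ‖iteratedFDeriv ℝ (b + k) f η‖ := by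
  induction k generalizing b with
  | zero => simp
  | succ k ih =>
    rw [Function.iterate_succ_apply']
    refine (norm_iteratedFDeriv_dirD_le (contDiff_iterate_dirD hf w k) w b η).trans ?_
    refine (mul_le_mul_of_nonneg_left (ih (b + 1)) (norm_nonneg w)).trans (le_of_eq ?_)
    rw [show b + 1 + k = b + (k + 1) by ring]
    ring

theorem dirD_comm {f : E3 → ℂ} (hf : ContDiff ℝ ∞ f) (v w : E3) :
    dirD v (dirD w f) = dirD w (dirD v f) := by
  funext η
  have hd : DifferentiableAt ℝ (fderiv ℝ f) η :=
    ((hf.fderiv_right (m := ∞) (by simp)).differentiable (by simp)).differentiableAt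
  have h : ∀ v w : E3, dirD v (dirD w f) η = fderiv ℝ (fderiv ℝ f) η v w := by
    intro v w
    have : HasFDerivAt (fun x => fderiv ℝ f x w) ((fderiv ℝ (fderiv ℝ f) η).flip w) η := by
      simpa using hd.hasFDerivAt.clm_apply (hasFDerivAt_const w η)
    change fderiv ℝ (fun x => fderiv ℝ f x w) η v = _
    rw [this.fderiv]
    rfl
  rw [h, h]
  exact (hf.contDiffAt.isSymmSndFDerivAt (by simpa using natCast_le_infty 2)) v w

theorem dirD_iterate_comm {f : E3 → ℂ} (hf : ContDiff ℝ ∞ f) (v w : E3) (k : ℕ) :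
    dirD v ((dirD w)^[k] f) = (dirD w)^[k] (dirD v f) := by
  induction k generalizing f with
  | zero => rfl
  | succ k ih =>
    rw [Function.iterate_succ_apply, Function.iterate_succ_apply, ih (contDiff_dirD hf w),
      dirD_comm hf]

theorem dirD_add {f g : E3 → ℂ} (hf : ContDiff ℝ ∞ f) (hg : ContDiff ℝ ∞ g) (v : E3) :
    dirD v (fun η => f η + g η) = fun η => dirD v f η + dirD v g η := by
  funext η
  have := fderiv_fun_add (𝕜 := ℝ) (hf.differentiable (by simp) η) (hg.differentiable (by simp) η)
  simp [dirD, this]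

theorem dirD_const_mul {f : E3 → ℂ} (hf : ContDiff ℝ ∞ f) (c : ℂ) (v : E3) :
    dirD v (fun η => c * f η) = fun η => c * dirD v f η := by
  funext η
  have := fderiv_const_mul (𝕜 := ℝ) (hf.differentiable (by simp) η) c
  simp [dirD, this]

theorem dirD_sum {ι : Type} (s : Finset ι) {f : ι → E3 → ℂ} (hf : ∀ i, ContDiff ℝ ∞ (f i))
    (v : E3) : dirD v (fun η => ∑ i ∈ s, f i η) = fun η => ∑ i ∈ s, dirD v (f i) η := by
  funext η
  have := fderiv_fun_sum (𝕜 := ℝ) (u := s) (x := η)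
    fun i _ => (hf i).differentiable (by simp) η
  simp [dirD, this]

theorem dirD_eq_sum (f : E3 → ℂ) (v : E3) :
    dirD v f = fun η => ∑ i, (v i : ℂ) * dirD (stdE i) f η := by
  funext η
  have hv : v = ∑ i, v i • stdE i := by
    ext j
    simp [stdE, Finset.sum_apply, Pi.single_apply]
  conv_lhs => rw [dirD, hv]
  simp [dirD, map_sum]

/-- The remainder of order `M` of the Taylor expansion of `f (η + w)` in `w`. -/
def taylorRem (M : ℕ) (f : E3 → ℂ) (w η : E3) : ℂ :=
  f (η + w) - ∑ k ∈ Finset.range M, ((k.factorial : ℂ))⁻¹ * (dirD w)^[k] f η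

/-- Taylor's formula on the segment from `η` to `η + w`. The derivative in `t` of the remainder of
order `M + 1` of `f` is the remainder of order `M` of `dirD w f`. -/
theorem norm_taylor_le {M : ℕ} {f : E3 → ℂ} (hf : ContDiff ℝ ∞ f) (w η : E3) (B : ℝ)
    (hB : ∀ t ∈ Icc (0 : ℝ) 1, ‖(dirD w)^[M] f (η + t • w)‖ ≤ B) :
    ∀ t ∈ Icc (0 : ℝ) 1, ‖f (η + t • w) - ∑ k ∈ Finset.range M,
      (((t ^ k / k.factorial : ℝ)) : ℂ) * (dirD w)^[k] f η‖ ≤ B := by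
  induction M generalizing f with
  | zero => simpa using hB
  | succ M ih =>
    intro t ht
    have hB0 : 0 ≤ B := (norm_nonneg _).trans (hB 0 (by simp))
    have ih' := ih (contDiff_dirD hf w) (by simpa using hB)
    have hder : ∀ s ∈ Icc (0 : ℝ) 1, HasDerivWithinAt (fun t : ℝ => f (η + t • w)
        - ∑ k ∈ Finset.range (M + 1), (((t ^ k / k.factorial : ℝ)) : ℂ) * (dirD w)^[k] f η)
        (dirD w f (η + s • w) - ∑ k ∈ Finset.range M,
          (((s ^ k / k.factorial : ℝ)) : ℂ) * (dirD w)^[k] (dirD w f) η) (Icc 0 1) s := by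
      intro s _
      refine HasDerivAt.hasDerivWithinAt (HasDerivAt.fun_sub ?_ ?_)
      · have h1 : HasDerivAt (fun t : ℝ => η + t • w) w s := by
          simpa using ((hasDerivAt_id s).smul_const w).const_add η
        exact ((hf.differentiable (by simp) (η + s • w)).hasFDerivAt).comp_hasDerivAt s h1
      · simp only [Finset.sum_range_succ' _ M, pow_zero, Nat.factorial_zero]
        refine HasDerivAt.add_const _ ?_
        refine HasDerivAt.fun_sum fun k _ => ?_
        have h2 : HasDerivAt (fun t : ℝ => t ^ (k + 1) / ((k + 1).factorial : ℝ))
            (s ^ k / (k.factorial : ℝ)) s := by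
          have := (hasDerivAt_pow (k + 1) s).div_const ((k + 1).factorial : ℝ)
          refine this.congr_deriv ?_
          rw [Nat.factorial_succ]
          push_cast
          have : (k.factorial : ℝ) ≠ 0 := by positivity
          have : (k : ℝ) + 1 ≠ 0 := by positivity
          field_simp
        exact (h2.ofReal_comp).mul_const _
    have h3 := norm_image_sub_le_of_norm_deriv_le_segment' hder
      (fun s hs => ih' s (Ico_subset_Icc_self hs)) t ht
    have h4 : f (η + (0 : ℝ) • w) - ∑ k ∈ Finset.range (M + 1),
        ((((0 : ℝ) ^ k / k.factorial : ℝ)) : ℂ) * (dirD w)^[k] f η = 0 := by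
      rw [Finset.sum_range_succ' _ M]
      simp
    rw [h4, sub_zero, sub_zero] at h3
    exact h3.trans (mul_le_of_le_one_right hB0 ht.2)

theorem contDiff_taylorRem {f : E3 → ℂ} (hf : ContDiff ℝ ∞ f) (M : ℕ) (w : E3) :
    ContDiff ℝ ∞ (taylorRem M f w) :=
  (hf.comp (contDiff_id.add contDiff_const)).sub
    (ContDiff.sum fun k _ => contDiff_const.mul (contDiff_iterate_dirD hf w k))

theorem dirD_taylorRem {f : E3 → ℂ} (hf : ContDiff ℝ ∞ f) (M : ℕ) (v w : E3) :
    dirD v (taylorRem M f w) = taylorRem M (dirD v f) w := by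
  funext η
  have h1 : DifferentiableAt ℝ (fun η => f (η + w)) η :=
    (hf.comp (contDiff_id.add contDiff_const)).differentiable (by simp) η
  have hk : ∀ k, ContDiff ℝ ∞ fun η => ((k.factorial : ℂ))⁻¹ * (dirD w)^[k] f η :=
    fun k => contDiff_const.mul (contDiff_iterate_dirD hf w k)
  have h2 : DifferentiableAt ℝ (fun η => ∑ k ∈ Finset.range M,
      ((k.factorial : ℂ))⁻¹ * (dirD w)^[k] f η) η :=
    (ContDiff.sum fun k _ => hk k).differentiable (by simp) η
  have h3 : dirD v (taylorRem M f w) η = fderiv ℝ (fun η => f (η + w)) η v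
      - dirD v (fun η => ∑ k ∈ Finset.range M, ((k.factorial : ℂ))⁻¹ * (dirD w)^[k] f η) η := by
    have := fderiv_fun_sub (𝕜 := ℝ) h1 h2
    change fderiv ℝ (fun η => f (η + w) - _) η v = _
    rw [this]
    rfl
  rw [h3, dirD_sum _ hk, fderiv_comp_add_right]
  simp only [dirD_const_mul (contDiff_iterate_dirD hf w _), dirD_iterate_comm hf]
  rfl

/-- The Taylor remainder of order `M` of a symbol of order `p` is a symbol of order `p - M`, with
bounds of polynomial growth in the increment. -/
theorem IsSym.norm_iteratedFDeriv_taylorRem_le {p : ℤ} {f : E3 → ℂ} (hf : IsSym p f) (M b : ℕ) :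
    ∃ (K : ℕ) (C : ℝ), 0 ≤ C ∧ ∀ w η : E3, ‖iteratedFDeriv ℝ b (taylorRem M f w) η‖ ≤
      C * (1 + ‖w‖) ^ K * (1 + ‖η‖) ^ (p - (M : ℤ) - (b : ℤ)) := by
  induction b generalizing f p with
  | zero =>
    obtain ⟨C, hC0, hC⟩ := hf.bound' M
    refine ⟨M + (p - (M : ℤ)).natAbs, C, hC0, fun w η => ?_⟩
    rw [norm_iteratedFDeriv_zero]
    have h := norm_taylor_le (M := M) hf.smooth w η
      (C * (1 + ‖w‖) ^ (M + (p - (M : ℤ)).natAbs) * (1 + ‖η‖) ^ (p - (M : ℤ))) ?_ 1 (by simp)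
    · simpa [taylorRem] using h
    · intro t ht
      have h1 := norm_iteratedFDeriv_iterate_dirD_le hf.smooth w M 0 (η + t • w)
      rw [norm_iteratedFDeriv_zero, zero_add] at h1
      refine h1.trans ?_
      have h2 := (hC (η + t • w)).trans (mul_le_mul_of_nonneg_left (peetre _ _ _) hC0)
      have h3 : ‖t • w‖ ≤ ‖w‖ := by
        rw [norm_smul, Real.norm_of_nonneg ht.1]
        exact mul_le_of_le_one_left (norm_nonneg w) ht.2
      have h4 := weight_zpow_pos (p - (M : ℤ)) η
      calc _ ≤ (1 + ‖w‖) ^ M * (C * ((1 + ‖η‖) ^ (p - (M : ℤ)) *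
            (1 + ‖w‖) ^ (p - (M : ℤ)).natAbs)) := by
            gcongr
            · linarith
            · refine h2.trans ?_
              gcongr
        _ = _ := by rw [pow_add]; ring
  | succ b ih =>
    choose K C hC0 hC using fun i => ih (hf.dirD (stdE i))
    refine ⟨∑ i, K i, ∑ i, C i, Finset.sum_nonneg fun i _ => hC0 i, fun w η => ?_⟩
    refine (norm_iteratedFDeriv_succ_le_sum (contDiff_taylorRem hf.smooth M w) b η).trans ?_
    rw [Finset.sum_mul, Finset.sum_mul]
    refine Finset.sum_le_sum fun i hi => ?_
    rw [dirD_taylorRem hf.smooth]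
    refine (hC i w η).trans ?_
    rw [show p - 1 - (M : ℤ) - (b : ℤ) = p - (M : ℤ) - ((b + 1 : ℕ) : ℤ) by push_cast; ring]
    have h4 := weight_zpow_pos (p - (M : ℤ) - ((b + 1 : ℕ) : ℤ)) η
    have h5 := hC0 i
    gcongr
    · exact one_le_weight w
    · exact Finset.single_le_sum (f := K) (fun _ _ => Nat.zero_le _) hi

theorem continuous_iterate_dirD {f : E3 → ℂ} (hf : ContDiff ℝ ∞ f) (k : ℕ) :
    Continuous fun q : E3 × E3 => (dirD q.1)^[k] f q.2 := by
  induction k generalizing f with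
  | zero => exact hf.continuous.comp continuous_snd
  | succ k ih =>
    have : (fun q : E3 × E3 => (dirD q.1)^[k + 1] f q.2) = fun q : E3 × E3 =>
        ∑ i, (q.1 i : ℂ) * (dirD q.1)^[k] (dirD (stdE i) f) q.2 := by
      funext q
      rw [Function.iterate_succ_apply', dirD_eq_sum]
      simp only [dirD_iterate_comm hf]
    rw [this]
    refine continuous_finsetSum _ fun i _ => ?_
    exact (Complex.continuous_ofReal.comp (by fun_prop)).mul (ih (contDiff_dirD hf _))

theorem IsSym.isPS_taylorRem {p : ℤ} {f : E3 → ℂ} (hf : IsSym p f) (M : ℕ) :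
    IsPS (p - M) (fun ζ η => taylorRem M f ((2 * Real.pi) • ζ) η) := by
  refine ⟨fun ζ => contDiff_taylorRem hf.smooth M _, ?_, fun b => ?_⟩
  · refine Continuous.sub (hf.smooth.continuous.comp (by fun_prop)) ?_
    refine continuous_finsetSum _ fun k _ => continuous_const.mul ?_
    exact (continuous_iterate_dirD hf.smooth k).comp
      (f := fun q : E3 × E3 => ((2 * Real.pi) • q.1, q.2)) (by fun_prop)
  · obtain ⟨K, C, hC0, hC⟩ := hf.norm_iteratedFDeriv_taylorRem_le M b
    refine ⟨K, C * (2 * Real.pi) ^ K, fun ζ η => (hC _ η).trans ?_⟩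
    rw [mul_assoc C (_ ^ K) (_ ^ K), ← mul_pow]
    have h4 := weight_zpow_pos (p - (M : ℤ) - (b : ℤ)) η
    gcongr
    exact weight_two_pi_smul_le ζ

/-! ### Homogeneous symbols with few spherical harmonics -/

/-- The monomial `(η₀ + iη₁)^a (η₀ - iη₁)^b η₂^c`. -/
def sphMono (a b c : ℕ) (η : E3) : ℂ :=
  ((η 0 : ℂ) + Complex.I * (η 1 : ℂ)) ^ a * ((η 0 : ℂ) - Complex.I * (η 1 : ℂ)) ^ b * (η 2 : ℂ) ^ c

theorem sphMono_mul (a b c a' b' c' : ℕ) (η : E3) :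
    sphMono a b c η * sphMono a' b' c' η = sphMono (a + a') (b + b') (c + c') η := by
  simp only [sphMono, pow_add]
  ring

/-- The continuous linear functional `η ↦ η_i`, with values in the complex numbers. -/
def coordC (i : Fin 3) : E3 →L[ℝ] ℂ := Complex.ofRealCLM.comp (EuclideanSpace.proj i)

@[simp] theorem coordC_apply (i : Fin 3) (η : E3) : coordC i η = (η i : ℂ) := rfl

theorem contDiff_sphMono (a b c : ℕ) : ContDiff ℝ ∞ (sphMono a b c) := by
  have h : ∀ i, ContDiff ℝ ∞ fun η : E3 => (η i : ℂ) := fun i => (coordC i).contDiff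
  exact ((((h 0).add (contDiff_const.mul (h 1))).pow a).mul
    (((h 0).sub (contDiff_const.mul (h 1))).pow b)).mul ((h 2).pow c)

theorem dirD_sphMono (a b c : ℕ) (v η : E3) : dirD v (sphMono a b c) η =
    (a : ℂ) * sphMono 1 0 0 v * sphMono (a - 1) b c η
      + (b : ℂ) * sphMono 0 1 0 v * sphMono a (b - 1) c η
      + (c : ℂ) * sphMono 0 0 1 v * sphMono a b (c - 1) η := by
  have h0 : HasFDerivAt (fun η : E3 => (η 0 : ℂ)) (coordC 0) η := (coordC 0).hasFDerivAt
  have h1 : HasFDerivAt (fun η : E3 => (η 1 : ℂ)) (coordC 1) η := (coordC 1).hasFDerivAt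
  have h2 : HasFDerivAt (fun η : E3 => (η 2 : ℂ)) (coordC 2) η := (coordC 2).hasFDerivAt
  have hp := (h0.add (h1.const_mul Complex.I)).pow a
  have hm := (h0.sub (h1.const_mul Complex.I)).pow b
  have h := (hp.mul hm).mul (h2.pow c)
  have h' : HasFDerivAt (sphMono a b c) _ η := h
  rw [dirD, h'.fderiv]
  simp [sphMono]
  ring

theorem contDiff_radial {f : ℝ → ℂ} (hf : ContDiff ℝ ∞ f) :
    ContDiff ℝ ∞ fun η : E3 => f (‖η‖ ^ 2) :=
  hf.comp (contDiff_norm_sq ℝ)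

theorem dirD_radial {f : ℝ → ℂ} (hf : ContDiff ℝ ∞ f) (v η : E3) :
    dirD v (fun η : E3 => f (‖η‖ ^ 2)) η = deriv f (‖η‖ ^ 2) *
      (sphMono 0 1 0 v * sphMono 1 0 0 η + sphMono 1 0 0 v * sphMono 0 1 0 η
        + 2 * sphMono 0 0 1 v * sphMono 0 0 1 η) := by
  have h1 : HasFDerivAt (fun η : E3 => ‖η‖ ^ 2) (2 • innerSL ℝ η) η :=
    (hasStrictFDerivAt_norm_sq η).hasFDerivAt
  have h2 : HasDerivAt f (deriv f (‖η‖ ^ 2)) (‖η‖ ^ 2) :=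
    (hf.differentiable (by simp) _).hasDerivAt
  have h3 := h2.hasFDerivAt.comp η h1
  have h4 : HasFDerivAt (fun η : E3 => f (‖η‖ ^ 2)) _ η := h3
  rw [dirD, h4.fderiv]
  have h5 : inner ℝ η v = η 0 * v 0 + η 1 * v 1 + η 2 * v 2 := by
    simp [PiLp.inner_apply, Fin.sum_univ_three]
    ring
  simp [sphMono, h5]
  linear_combination (2 * deriv f (‖η‖ ^ 2) * (v 1 : ℂ) * (η 1 : ℂ)) * Complex.I_sq

/-- Products `f(|η|²) (η₀ + iη₁)^a (η₀ - iη₁)^b η₂^c` of degree `a + b + c ≤ n`, of the parity of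
`n`, with `f` smooth and such that the product is homogeneous of degree `p - n` for large `η`. The
power law of `f` is required for `|η|² > 1/2`, hence on a neighbourhood of `|η| ≥ 1`. -/
def homGen (p : ℤ) (n : ℕ) : Set (E3 → ℂ) :=
  {F | ∃ (f : ℝ → ℂ) (a b c : ℕ) (e : ℤ) (C : ℂ), ContDiff ℝ ∞ f ∧ a + b + c ≤ n ∧
    Even (n + (a + b + c)) ∧ 2 * e + ((a + b + c : ℕ) : ℤ) = p - n ∧
    (∀ t : ℝ, 1 / 2 < t → f t = C * (t : ℂ) ^ e) ∧
    F = fun η => f (‖η‖ ^ 2) * sphMono a b c η}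

/-- Smooth functions that are homogeneous of degree `p - n` for large `η` and whose restrictions to
spheres are polynomials of degree at most `n` and of the parity of `n`. -/
def homSym (p : ℤ) (n : ℕ) : Submodule ℂ (E3 → ℂ) := Submodule.span ℂ (homGen p n)

theorem contDiff_of_mem_homSym {p : ℤ} {n : ℕ} {F : E3 → ℂ} (hF : F ∈ homSym p n) :
    ContDiff ℝ ∞ F := by
  induction hF using Submodule.span_induction with
  | mem F h =>
    obtain ⟨f, a, b, c, e, C, hf, -, -, -, -, rfl⟩ := h
    exact (contDiff_radial hf).mul (contDiff_sphMono a b c)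
  | zero => exact contDiff_const
  | add F G _ _ hF hG => exact hF.add hG
  | smul r F _ hF => exact contDiff_const.smul hF

theorem sphMono_smul (a b c : ℕ) (r : ℝ) (η : E3) :
    sphMono a b c (r • η) = (r : ℂ) ^ (a + b + c) * sphMono a b c η := by
  simp only [sphMono, PiLp.smul_apply, smul_eq_mul, Complex.ofReal_mul, pow_add]
  rw [show (r : ℂ) * (η 0 : ℂ) + Complex.I * ((r : ℂ) * (η 1 : ℂ))
      = (r : ℂ) * ((η 0 : ℂ) + Complex.I * (η 1 : ℂ)) by ring,
    show (r : ℂ) * (η 0 : ℂ) - Complex.I * ((r : ℂ) * (η 1 : ℂ))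
      = (r : ℂ) * ((η 0 : ℂ) - Complex.I * (η 1 : ℂ)) by ring]
  simp only [mul_pow]
  ring

theorem homogeneous_of_mem_homSym {p : ℤ} {n : ℕ} {F : E3 → ℂ} (hF : F ∈ homSym p n) (r : ℝ)
    (η : E3) (hη : 1 ≤ ‖η‖) (hr : 1 ≤ r) : F (r • η) = (r : ℂ) ^ (p - (n : ℤ)) * F η := by
  induction hF using Submodule.span_induction with
  | mem F h =>
    obtain ⟨f, a, b, c, e, C, hf, -, -, he, hfe, rfl⟩ := h
    have h1 : 1 ≤ ‖η‖ ^ 2 := one_le_pow₀ hη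
    have h2 : 1 ≤ ‖r • η‖ ^ 2 := by
      rw [norm_smul, mul_pow, Real.norm_of_nonneg (by linarith)]
      nlinarith [one_le_pow₀ (n := 2) hr]
    have hr0 : (r : ℂ) ≠ 0 := by
      norm_cast
      linarith
    simp only
    rw [hfe _ (by linarith), hfe _ (by linarith), sphMono_smul, ← he, zpow_add₀ hr0, zpow_natCast,
      norm_smul, mul_pow, Real.norm_of_nonneg (by linarith)]
    push_cast
    rw [mul_zpow, zpow_mul, zpow_ofNat]
    ring
  | zero => simp
  | add F G _ _ hF hG => simp [hF, hG, mul_add]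
  | smul c F _ hF =>
    simp only [Pi.smul_apply, smul_eq_mul, hF]
    ring

/-- Bounds on the compact ball of radius `2` extend to all larger `η` by homogeneity. -/
theorem isSym_of_homogeneous {m : ℤ} {F : E3 → ℂ} (hF : ContDiff ℝ ∞ F)
    (hh : ∀ (r : ℝ) (η : E3), 1 ≤ ‖η‖ → 1 ≤ r → F (r • η) = (r : ℂ) ^ m * F η) : IsSym m F := by
  refine ⟨hF, fun b => ?_⟩
  have hcont : Continuous (iteratedFDeriv ℝ b F) :=
    hF.continuous_iteratedFDeriv (natCast_le_infty b)
  obtain ⟨S, hS⟩ := (isCompact_closedBall (0 : E3) 2).exists_bound_of_continuousOn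
    hcont.continuousOn
  have hS0 : 0 ≤ S := (norm_nonneg _).trans (hS 0 (by simp))
  set z : ℤ := m - (b : ℤ) with hz
  -- on the ball of radius 2 the weight is bounded below; outside, the norm is comparable to it
  have hw : ∀ (ρ W : ℝ), 0 < ρ → ρ ≤ W → W ≤ 3 * ρ → ρ ^ z ≤ 3 ^ z.natAbs * W ^ z := by
    intro ρ W hρ h1 h2
    have hW : 0 < W := hρ.trans_le h1
    obtain ⟨k, hk | hk⟩ := z.eq_nat_or_neg
    · rw [hk]
      simp only [zpow_natCast, Int.natAbs_natCast]
      calc ρ ^ k ≤ W ^ k := pow_le_pow_left₀ hρ.le h1 k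
        _ ≤ 3 ^ k * W ^ k := le_mul_of_one_le_left (by positivity) (one_le_pow₀ (by norm_num))
    · rw [hk]
      simp only [zpow_neg, zpow_natCast, Int.natAbs_neg, Int.natAbs_natCast]
      rw [inv_le_iff_one_le_mul₀ (by positivity), mul_assoc, ← div_eq_inv_mul, ← div_pow, ← mul_pow]
      refine one_le_pow₀ ?_
      rw [mul_div_assoc', le_div_iff₀ hW]
      linarith
  refine ⟨S * 3 ^ z.natAbs, fun η => ?_⟩
  have hpos := weight_zpow_pos z η
  rcases le_or_gt ‖η‖ 2 with hη | hη
  · have h1 := hS η (by simpa using hη)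
    have h2 := hw 1 (1 + ‖η‖) one_pos (one_le_weight η) (by linarith)
    rw [one_zpow] at h2
    rw [mul_assoc]
    exact h1.trans (le_mul_of_one_le_right hS0 h2)
  · set r : ℝ := ‖η‖ / 2 with hr
    have hr1 : 1 ≤ r := by rw [hr]; linarith
    have hr0 : 0 < r := by linarith
    set η' : E3 := r⁻¹ • η with hη'
    have hη'n : ‖η'‖ = 2 := by
      rw [hη', norm_smul, norm_inv, Real.norm_of_nonneg hr0.le, hr]
      field_simp
    have hrη : r • η' = η := by rw [hη', smul_smul, mul_inv_cancel₀ hr0.ne', one_smul]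
    have h1 : iteratedFDeriv ℝ b (fun y => F (r • y)) η'
        = (r : ℂ) ^ m • iteratedFDeriv ℝ b F η' := by
      have hloc : (fun y => F (r • y)) =ᶠ[𝓝 η'] fun y => (r : ℂ) ^ m • F y := by
        have : ∀ᶠ y : E3 in 𝓝 η', 1 < ‖y‖ :=
          continuous_norm.continuousAt.eventually_const_lt (by simp only [hη'n]; norm_num)
        filter_upwards [this] with y hy using hh r y hy.le hr1
      rw [(hloc.iteratedFDeriv ℝ b).eq_of_nhds]
      exact iteratedFDeriv_const_smul_apply (a := (r : ℂ) ^ m) (f := F)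
        (hF.of_le (natCast_le_infty b)).contDiffAt
    rw [iteratedFDeriv_comp_const_smul r (hF.of_le (natCast_le_infty b))] at h1
    simp only [hrη] at h1
    have h2 := congrArg norm h1
    rw [norm_smul, norm_smul, norm_pow, norm_zpow, Complex.norm_real,
      Real.norm_of_nonneg hr0.le] at h2
    have h3 : ‖iteratedFDeriv ℝ b F η‖ = r ^ z * ‖iteratedFDeriv ℝ b F η'‖ := by
      rw [hz, zpow_sub₀ hr0.ne', zpow_natCast, div_mul_eq_mul_div, ← h2]
      field_simp
    have h4 := hS η' (by simp [hη'n])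
    have h5 := hw r (1 + ‖η‖) hr0 (by rw [hr]; linarith) (by rw [hr]; linarith)
    rw [h3]
    calc r ^ z * _ ≤ (3 ^ z.natAbs * (1 + ‖η‖) ^ z) * S := by gcongr
      _ = _ := by ring

theorem isSym_of_mem_homSym {p : ℤ} {n : ℕ} {F : E3 → ℂ} (hF : F ∈ homSym p n) :
    IsSym (p - n) F :=
  isSym_of_homogeneous (contDiff_of_mem_homSym hF)
    fun r η hη hr => homogeneous_of_mem_homSym hF r η hη hr

theorem homSym_mul {p q : ℤ} {n m : ℕ} {F G : E3 → ℂ} (hF : F ∈ homSym p n)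
    (hG : G ∈ homSym q m) : (fun η => F η * G η) ∈ homSym (p + q) (n + m) := by
  have h : F * G ∈ homSym p n * homSym q m := Submodule.mul_mem_mul hF hG
  rw [homSym, homSym, Submodule.span_mul_span] at h
  refine Submodule.span_mono ?_ h
  rintro _ ⟨_, ⟨f, a, b, c, e, C, hf, hk, hpar, he, hfe, rfl⟩, _,
    ⟨f', a', b', c', e', C', hf', hk', hpar', he', hfe', rfl⟩, rfl⟩
  refine ⟨fun t => f t * f' t, a + a', b + b', c + c', e + e', C * C', hf.mul hf', by omega, ?_, ?_,
    fun t ht => ?_, ?_⟩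
  · rw [show n + m + (a + a' + (b + b') + (c + c'))
      = n + (a + b + c) + (m + (a' + b' + c')) by omega]
    exact hpar.add hpar'
  · push_cast at he he' ⊢
    linarith
  · have ht0 : (t : ℂ) ≠ 0 := by
      norm_cast
      linarith
    simp only
    rw [hfe t ht, hfe' t ht, zpow_add₀ ht0]
    ring
  · funext η
    simp only [Pi.mul_apply, ← sphMono_mul]
    ring

theorem deriv_of_eq_zpow {f : ℝ → ℂ} {C : ℂ} {e : ℤ} (hfe : ∀ t : ℝ, 1 / 2 < t →
    f t = C * (t : ℂ) ^ e) (t : ℝ) (ht : 1 / 2 < t) :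
    deriv f t = C * e * (t : ℂ) ^ (e - 1) := by
  have ht0 : (t : ℂ) ≠ 0 := by
    norm_cast
    linarith
  have h1 : f =ᶠ[𝓝 t] fun t : ℝ => C * (t : ℂ) ^ e := by
    filter_upwards [lt_mem_nhds ht] with s hs using hfe s hs
  rw [h1.deriv_eq]
  have h2 : HasDerivAt (fun t : ℝ => C * (t : ℂ) ^ e) (C * (e * (t : ℂ) ^ (e - 1))) t :=
    ((hasDerivAt_zpow e (t : ℂ) (Or.inl ht0)).comp_ofReal).const_mul C
  rw [h2.deriv]
  ring

/-- A derivative of the monomial lowers its degree by one; a derivative of the radial factor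
produces a coordinate. Both lower the order of homogeneity by one and change the parity. -/
theorem homSym_dirD {p : ℤ} {n : ℕ} {F : E3 → ℂ} (hF : F ∈ homSym p n) (v : E3) :
    dirD v F ∈ homSym p (n + 1) := by
  induction hF using Submodule.span_induction with
  | mem F h =>
    obtain ⟨f, a, b, c, e, C, hf, hk, hpar, he, hfe, rfl⟩ := h
    have hprod : dirD v (fun η => f (‖η‖ ^ 2) * sphMono a b c η) = fun η =>
        f (‖η‖ ^ 2) * dirD v (sphMono a b c) η
          + sphMono a b c η * dirD v (fun η : E3 => f (‖η‖ ^ 2)) η := by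
      funext η
      have := fderiv_fun_mul (𝕜 := ℝ) ((contDiff_radial hf).differentiable (by simp) η)
        ((contDiff_sphMono a b c).differentiable (by simp) η)
      simp [dirD, this]
    have hd : ContDiff ℝ ∞ (deriv f) := by
      exact (contDiff_infty_iff_deriv.1 hf).2
    -- the terms in which the radial factor is differentiated
    have hrad : ∀ a' b' c' : ℕ, a' + b' + c' = 1 →
        (fun η : E3 => deriv f (‖η‖ ^ 2) * sphMono (a + a') (b + b') (c + c') η)
          ∈ homSym p (n + 1) := by
      intro a' b' c' h1
      refine Submodule.subset_span ⟨deriv f, a + a', b + b', c + c', e - 1, C * e, hd, by omega, ?_,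
        ?_, deriv_of_eq_zpow hfe, rfl⟩
      · rw [show n + 1 + (a + a' + (b + b') + (c + c')) = n + (a + b + c) + 2 by omega]
        exact hpar.add even_two
      · push_cast at he ⊢
        have : (a' : ℤ) + b' + c' = 1 := by exact_mod_cast h1
        linarith
    -- the terms in which the monomial is differentiated
    have hmon : ∀ a' b' c' : ℕ, a' + b' + c' + 1 = a + b + c →
        (fun η : E3 => f (‖η‖ ^ 2) * sphMono a' b' c' η) ∈ homSym p (n + 1) := by
      intro a' b' c' h1
      refine Submodule.subset_span ⟨f, a', b', c', e, C, hf, by omega, ?_, ?_, hfe, rfl⟩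
      · rw [← h1] at hpar
        convert hpar using 1
        ring
      · have : (a' : ℤ) + b' + c' + 1 = a + b + c := by exact_mod_cast h1
        push_cast at he ⊢
        linarith
    have hmon' : ∀ (m a' b' c' : ℕ) (r : ℂ), (m ≠ 0 → a' + b' + c' + 1 = a + b + c) →
        (fun η : E3 => (m * r) * (f (‖η‖ ^ 2) * sphMono a' b' c' η)) ∈ homSym p (n + 1) := by
      intro m a' b' c' r h1
      rcases eq_or_ne m 0 with rfl | hm
      · simp only [Nat.cast_zero, zero_mul]
        exact Submodule.zero_mem _
      · exact Submodule.smul_mem _ _ (hmon a' b' c' (h1 hm))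
    have h1 := hmon' a (a - 1) b c (sphMono 1 0 0 v) (by omega)
    have h2 := hmon' b a (b - 1) c (sphMono 0 1 0 v) (by omega)
    have h3 := hmon' c a b (c - 1) (sphMono 0 0 1 v) (by omega)
    have h4 := Submodule.smul_mem _ (sphMono 0 1 0 v) (hrad 1 0 0 rfl)
    have h5 := Submodule.smul_mem _ (sphMono 1 0 0 v) (hrad 0 1 0 rfl)
    have h6 := Submodule.smul_mem _ (2 * sphMono 0 0 1 v) (hrad 0 0 1 rfl)
    have hsum := Submodule.add_mem _ (Submodule.add_mem _ (Submodule.add_mem _ h1 h2) h3)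
      (Submodule.add_mem _ (Submodule.add_mem _ h4 h5) h6)
    rw [hprod]
    convert hsum using 1
    funext η
    simp only [dirD_sphMono, dirD_radial hf, Pi.add_apply, Pi.smul_apply, smul_eq_mul,
      ← sphMono_mul]
    ring
  | zero =>
    have : dirD v (0 : E3 → ℂ) = 0 := by
      funext η
      simp [dirD]
    rw [this]
    exact Submodule.zero_mem _
  | add F G hF' hG' hF hG =>
    have := dirD_add (contDiff_of_mem_homSym hF') (contDiff_of_mem_homSym hG') v
    change dirD v (fun η => F η + G η) ∈ _
    rw [this]
    exact Submodule.add_mem _ hF hG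
  | smul r F hF' hF =>
    change dirD v (fun η => r * F η) ∈ _
    rw [dirD_const_mul (contDiff_of_mem_homSym hF')]
    exact Submodule.smul_mem _ r hF

theorem one_mem_homSym : (fun _ : E3 => (1 : ℂ)) ∈ homSym 0 0 :=
  Submodule.subset_span ⟨fun _ => 1, 0, 0, 0, 0, 1, contDiff_const, le_rfl, by simp, by simp,
    by simp, by simp [sphMono]⟩

/-! ### Expansions of symbols and their composition -/

/-- Finite sums of products of a rapidly decreasing function of the parameter and a function in
`homSym p n`: the possible `n`-th terms of an expansion. -/
def homRap (p : ℤ) (n : ℕ) : Submodule ℂ (E3 → E3 → ℂ) := Submodule.span ℂ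
  {A | ∃ c f : E3 → ℂ, IsRapid c ∧ f ∈ homSym p n ∧ A = fun ζ η => c ζ * f η}

theorem isRS_of_mem_homRap {p : ℤ} {n : ℕ} {A : E3 → E3 → ℂ} (hA : A ∈ homRap p n) :
    IsRS (p - n) A := by
  induction hA using Submodule.span_induction with
  | mem A h =>
    obtain ⟨c, f, hc, hf, rfl⟩ := h
    exact hc.mul_isSym (isSym_of_mem_homSym hf)
  | zero => exact IsRS.zero
  | add A B _ _ hA hB => exact hA.add hB
  | smul r A _ hA => exact hA.const_mul r

/-- Continuous functions of polynomial growth. -/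
structure IsPoly (q : E3 → ℂ) : Prop where
  cont : Continuous q
  bound : ∃ (K : ℕ) (C : ℝ), ∀ w, ‖q w‖ ≤ C * (1 + ‖w‖) ^ K

theorem IsPoly.one : IsPoly fun _ => 1 := ⟨continuous_const, 0, 1, fun w => by simp⟩

theorem IsPoly.coord_mul {q : E3 → ℂ} (hq : IsPoly q) (i : Fin 3) :
    IsPoly fun w => (w i : ℂ) * q w := by
  obtain ⟨K, C, hC⟩ := hq.bound
  refine ⟨(coordC i).continuous.mul hq.cont, K + 1, C, fun w => ?_⟩
  have h1 : ‖(w i : ℂ)‖ ≤ 1 + ‖w‖ := by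
    rw [Complex.norm_real]
    linarith [PiLp.norm_apply_le w i]
  rw [norm_mul]
  calc _ ≤ (1 + ‖w‖) * (C * (1 + ‖w‖) ^ K) := by
        have := weight_pos w
        gcongr
        exact hC w
    _ = _ := by ring

theorem IsRapid.poly_mul {q c : E3 → ℂ} (hq : IsPoly q) (hc : IsRapid c) :
    IsRapid fun ζ => q ((2 * Real.pi) • ζ) * c ζ := by
  obtain ⟨K, C, hC⟩ := hq.bound
  have hC0 : 0 ≤ C := by simpa using (norm_nonneg _).trans (hC 0)
  refine ⟨(hq.cont.comp (by fun_prop)).mul hc.cont, fun k => ?_⟩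
  obtain ⟨D, hD⟩ := hc.bound (K + k)
  refine ⟨C * (2 * Real.pi) ^ K * D, fun ζ => ?_⟩
  have hw := weight_pos ζ
  have hpi := Real.pi_pos
  rw [norm_mul]
  calc (1 + ‖ζ‖) ^ k * (‖q ((2 * Real.pi) • ζ)‖ * ‖c ζ‖)
      ≤ (1 + ‖ζ‖) ^ k * ((C * (2 * Real.pi * (1 + ‖ζ‖)) ^ K) * ‖c ζ‖) := by
        gcongr
        refine (hC _).trans ?_
        gcongr
        exact weight_two_pi_smul_le ζ
    _ = C * (2 * Real.pi) ^ K * ((1 + ‖ζ‖) ^ (K + k) * ‖c ζ‖) := by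
        rw [mul_pow, pow_add]
        ring
    _ ≤ _ := by
        gcongr
        exact hD ζ

/-- Finite sums of products of a function of polynomial growth of the parameter and a function in
`homSym p n`. -/
def homPoly (p : ℤ) (n : ℕ) : Submodule ℂ (E3 → E3 → ℂ) := Submodule.span ℂ
  {A | ∃ q f : E3 → ℂ, IsPoly q ∧ f ∈ homSym p n ∧ A = fun w η => q w * f η}

theorem coord_mul_mem_homPoly {p : ℤ} {n : ℕ} {A : E3 → E3 → ℂ} (hA : A ∈ homPoly p n)
    (i : Fin 3) : (fun w η => (w i : ℂ) * A w η) ∈ homPoly p n := by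
  induction hA using Submodule.span_induction with
  | mem A h =>
    obtain ⟨q, f, hq, hf, rfl⟩ := h
    exact Submodule.subset_span ⟨_, f, hq.coord_mul i, hf, by simp only [mul_assoc]⟩
  | zero => simp only [Pi.zero_apply, mul_zero]; exact Submodule.zero_mem _
  | add A B _ _ hA hB =>
    simp only [Pi.add_apply, mul_add]
    exact Submodule.add_mem _ hA hB
  | smul r A _ hA =>
    simp only [Pi.smul_apply, smul_eq_mul, mul_left_comm _ r]
    exact Submodule.smul_mem _ r hA

/-- The `k`-th term of the Taylor expansion of a function in `homSym p n` has coefficients in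
`homSym p (n + k)`. -/
theorem iterate_dirD_mem_homPoly {p : ℤ} {n : ℕ} {f : E3 → ℂ} (hf : f ∈ homSym p n) (k : ℕ) :
    (fun w η => (dirD w)^[k] f η) ∈ homPoly p (n + k) := by
  induction k generalizing f n with
  | zero => exact Submodule.subset_span ⟨fun _ => 1, f, IsPoly.one, hf, by simp⟩
  | succ k ih =>
    have hs := contDiff_of_mem_homSym hf
    have : (fun w η => (dirD w)^[k + 1] f η) = ∑ i, fun (w : E3) (η : E3) =>
        (w i : ℂ) * (dirD w)^[k] (dirD (stdE i) f) η := by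
      funext w η
      rw [Function.iterate_succ_apply', dirD_eq_sum]
      simp only [dirD_iterate_comm hs, Finset.sum_apply]
    rw [this]
    refine Submodule.sum_mem _ fun i _ => coord_mul_mem_homPoly ?_ i
    rw [show n + (k + 1) = n + 1 + k by ring]
    exact ih (homSym_dirD hf (stdE i))

/-- The factor `2π` is the one of the shift in `twist`. -/
theorem homPoly_mul_mem_homRap {p q : ℤ} {n m : ℕ} {A : E3 → E3 → ℂ} (hA : A ∈ homPoly p n)
    {c f : E3 → ℂ} (hc : IsRapid c) (hf : f ∈ homSym q m) :
    (fun ζ η => A ((2 * Real.pi) • ζ) η * (c ζ * f η)) ∈ homRap (p + q) (n + m) := by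
  induction hA using Submodule.span_induction with
  | mem A h =>
    obtain ⟨r, g, hr, hg, rfl⟩ := h
    refine Submodule.subset_span ⟨_, _, IsRapid.poly_mul hr hc, homSym_mul hg hf, ?_⟩
    funext ζ η
    ring
  | zero => simp only [Pi.zero_apply, zero_mul]; exact Submodule.zero_mem _
  | add A B _ _ hA hB =>
    simp only [Pi.add_apply, add_mul]
    exact Submodule.add_mem _ hA hB
  | smul r A _ hA =>
    simp only [Pi.smul_apply, smul_eq_mul, mul_assoc r]
    exact Submodule.smul_mem _ r hA

theorem IsRapid.conv {c c' : E3 → ℂ} (hc : IsRapid c) (hc' : IsRapid c') :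
    IsRapid fun θ => ∫ ζ, c (θ - ζ) * c' ζ := by
  have h := hc.isRS.twist hc'.isRS
  refine ⟨h.cont.comp (f := fun θ : E3 => (θ, (0 : E3))) (by fun_prop), fun k => ?_⟩
  obtain ⟨C, hC⟩ := h.bound 0 k
  refine ⟨C, fun θ => ?_⟩
  have := hC θ 0
  rw [norm_iteratedFDeriv_zero] at this
  simpa [twist] using this

theorem twist_mem_homRap {p : ℤ} {n : ℕ} {c : E3 → ℂ} (hc : IsRapid c) {B : E3 → E3 → ℂ}
    (hB : B ∈ homRap p n) : twist (fun θ _ => c θ) B ∈ homRap p n := by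
  induction hB using Submodule.span_induction with
  | mem A h =>
    obtain ⟨c', f, hc', hf, rfl⟩ := h
    refine Submodule.subset_span ⟨_, f, hc.conv hc', hf, ?_⟩
    funext θ η
    simp only [twist, ← mul_assoc]
    exact integral_mul_const _ _
  | zero =>
    have : twist (fun θ _ => c θ) 0 = 0 := by
      funext θ η
      simp [twist]
    rw [this]
    exact Submodule.zero_mem _
  | add A B hA' hB' hA hB =>
    have := twist_add_right hc.isRS (isRS_of_mem_homRap hA') (isRS_of_mem_homRap hB')
    change twist _ (fun ζ η => A ζ η + B ζ η) ∈ _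
    rw [this]
    exact Submodule.add_mem _ hA hB
  | smul r A _ hA =>
    change twist _ (fun ζ η => r * A ζ η) ∈ _
    rw [twist_const_mul_right]
    exact Submodule.smul_mem _ r hA

/-- `g` has an asymptotic expansion of order `p` with terms in `homRap p n`, starting with the
term of index `n₀`. -/
def HasExpansion (p : ℤ) (n₀ : ℕ) (g : E3 → E3 → ℂ) : Prop :=
  ∃ t : ℕ → E3 → E3 → ℂ, (∀ n, t n ∈ homRap p n) ∧ (∀ n < n₀, t n = 0) ∧
    ∀ N : ℕ, IsRS (p - N) (fun ζ η => g ζ η - ∑ n ∈ Finset.range N, t n ζ η)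

namespace HasExpansion

variable {p q : ℤ} {n₀ : ℕ} {g h : E3 → E3 → ℂ}

theorem isRS (hg : HasExpansion p n₀ g) : IsRS p g := by
  obtain ⟨t, -, -, h⟩ := hg
  simpa using h 0

theorem add (hg : HasExpansion p n₀ g) (hh : HasExpansion p n₀ h) :
    HasExpansion p n₀ (fun ζ η => g ζ η + h ζ η) := by
  obtain ⟨t, h1, h2, h3⟩ := hg
  obtain ⟨t', h1', h2', h3'⟩ := hh
  refine ⟨fun n => t n + t' n, fun n => Submodule.add_mem _ (h1 n) (h1' n),
    fun n hn => by simp [h2 n hn, h2' n hn], fun N => ?_⟩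
  have := (h3 N).add (h3' N)
  convert this using 3
  simp only [Pi.add_apply, Finset.sum_add_distrib]
  ring

theorem const_mul (hg : HasExpansion p n₀ g) (r : ℂ) :
    HasExpansion p n₀ (fun ζ η => r * g ζ η) := by
  obtain ⟨t, h1, h2, h3⟩ := hg
  refine ⟨fun n => r • t n, fun n => Submodule.smul_mem _ _ (h1 n),
    fun n hn => by simp [h2 n hn], fun N => ?_⟩
  have := (h3 N).const_mul r
  convert this using 3
  simp only [Pi.smul_apply, smul_eq_mul, ← Finset.mul_sum]
  ring

theorem zero : HasExpansion p n₀ (fun _ _ => 0) :=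
  ⟨fun _ => 0, fun _ => Submodule.zero_mem _, fun _ _ => rfl, fun N => by simpa using IsRS.zero⟩

theorem sub (hg : HasExpansion p n₀ g) (hh : HasExpansion p n₀ h) :
    HasExpansion p n₀ (fun ζ η => g ζ η - h ζ η) := by
  simpa [sub_eq_add_neg] using hg.add (hh.const_mul (-1))

theorem sum {ι : Type} (s : Finset ι) {g : ι → E3 → E3 → ℂ}
    (h : ∀ i ∈ s, HasExpansion p n₀ (g i)) :
    HasExpansion p n₀ (fun ζ η => ∑ i ∈ s, g i ζ η) := by
  classical
  induction s using Finset.induction_on with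
  | empty => simpa using zero
  | insert a s ha ih =>
    simp only [Finset.sum_insert ha]
    exact (h a (Finset.mem_insert_self a s)).add
      (ih fun i hi => h i (Finset.mem_insert_of_mem hi))

/-- Changing `g` by a symbol of order `-∞`. -/
theorem add_smoothing (hg : HasExpansion p n₀ g) (hh : ∀ m, IsRS m h) :
    HasExpansion p n₀ (fun ζ η => g ζ η + h ζ η) := by
  obtain ⟨t, h1, h2, h3⟩ := hg
  refine ⟨t, h1, h2, fun N => ?_⟩
  have := (h3 N).add (hh _)
  convert this using 3
  ring

end HasExpansion

theorem hasExpansion_of_mem_homRap {p : ℤ} {n : ℕ} {A : E3 → E3 → ℂ} (hA : A ∈ homRap p n) :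
    HasExpansion p n A := by
  classical
  refine ⟨fun j => if j = n then A else 0, fun j => ?_, fun j hj => if_neg (by omega),
    fun N => ?_⟩
  · by_cases h : j = n
    · subst h
      simpa using hA
    · simp only [h, if_false]
      exact Submodule.zero_mem _
  · by_cases h : n < N
    · have : ∀ ζ η, A ζ η - ∑ j ∈ Finset.range N, (if j = n then A else 0) ζ η = 0 := by
        intro ζ η
        rw [Finset.sum_eq_single n (by intro b _ hb; simp [hb]) (by simp [h])]
        simp
      simp only [this]
      exact IsRS.zero
    · have : ∀ ζ η, A ζ η - ∑ j ∈ Finset.range N, (if j = n then A else 0) ζ η = A ζ η := by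
        intro ζ η
        rw [Finset.sum_eq_zero, sub_zero]
        intro j hj
        have := Finset.mem_range.1 hj
        simp [show j ≠ n by omega]
      simp only [this]
      exact (isRS_of_mem_homRap hA).mono (by omega)

/-- The composition of two products, by Taylor expansion of the left factor. -/
theorem hasExpansion_twist_mul {p q : ℤ} {n m : ℕ} {c f c' f' : E3 → ℂ} (hc : IsRapid c)
    (hf : f ∈ homSym p n) (hc' : IsRapid c') (hf' : f' ∈ homSym q m) :
    HasExpansion (p + q) (n + m) (twist (fun ζ η => c ζ * f η) (fun ζ η => c' ζ * f' η)) := by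
  have hfs := isSym_of_mem_homSym hf
  have hh : IsRS (q - m) (fun ζ η => c' ζ * f' η) := hc'.mul_isSym (isSym_of_mem_homSym hf')
  set B : ℕ → E3 → E3 → ℂ := fun k ζ η =>
    (dirD ((2 * Real.pi) • ζ))^[k] f η * (c' ζ * f' η) with hBdef
  have hB : ∀ k, B k ∈ homRap (p + q) (n + k + m) := fun k =>
    homPoly_mul_mem_homRap (iterate_dirD_mem_homPoly hf k) hc' hf'
  set T : ℕ → E3 → E3 → ℂ := fun k => ((k.factorial : ℂ))⁻¹ • twist (fun θ _ => c θ) (B k)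
    with hT
  have hT' : ∀ k, T k ∈ homRap (p + q) (n + k + m) := fun k =>
    Submodule.smul_mem _ _ (twist_mem_homRap hc (hB k))
  refine ⟨fun j => if j < n + m then 0 else T (j - (n + m)), fun j => ?_, fun j hj => if_pos hj,
    fun N => ?_⟩
  · by_cases h : j < n + m
    · simp only [h, if_true]
      exact Submodule.zero_mem _
    · simp only [h, if_false]
      have := hT' (j - (n + m))
      rwa [show n + (j - (n + m)) + m = j by omega] at this
  · rcases le_or_gt N (n + m) with hN | hN
    · have h0 : ∀ θ η : E3, ∑ j ∈ Finset.range N,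
          (if j < n + m then (0 : E3 → E3 → ℂ) else T (j - (n + m))) θ η = 0 := by
        intro θ η
        refine Finset.sum_eq_zero fun j hj => ?_
        rw [if_pos (by have := Finset.mem_range.1 hj; omega)]
        rfl
      simp only [h0, sub_zero]
      exact (IsRS.twist (hc.mul_isSym hfs) hh).mono (by omega)
    · obtain ⟨M, rfl⟩ : ∃ M, N = (n + m) + M := ⟨N - (n + m), by omega⟩
      have h0 : ∀ θ η : E3, ∑ j ∈ Finset.range ((n + m) + M),
          (if j < n + m then (0 : E3 → E3 → ℂ) else T (j - (n + m))) θ η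
            = ∑ k ∈ Finset.range M, T k θ η := by
        intro θ η
        rw [Finset.sum_range_add, Finset.sum_eq_zero, zero_add]
        · refine Finset.sum_congr rfl fun k _ => ?_
          rw [if_neg (by omega), Nat.add_sub_cancel_left]
        · intro j hj
          rw [if_pos (Finset.mem_range.1 hj)]
          rfl
      have hrem : IsRS (p - n - M + (q - m)) (fun ζ η =>
          taylorRem M f ((2 * Real.pi) • ζ) η * (c' ζ * f' η)) :=
        IsRS.ps_mul (hfs.isPS_taylorRem M) hh
      have hBk : ∀ k ∈ Finset.range M, IsRS (p + q) (fun ζ η => ((k.factorial : ℂ))⁻¹ * B k ζ η) :=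
        fun k _ => ((isRS_of_mem_homRap (hB k)).mono (by omega)).const_mul _
      have hsplit : twist (fun ζ η => c ζ * f η) (fun ζ η => c' ζ * f' η)
          = twist (fun θ _ => c θ) (fun ζ η =>
              taylorRem M f ((2 * Real.pi) • ζ) η * (c' ζ * f' η)
              + ∑ k ∈ Finset.range M, ((k.factorial : ℂ))⁻¹ * B k ζ η) := by
        funext θ η
        simp only [twist]
        congr 1
        funext ζ
        have : ∑ k ∈ Finset.range M, ((k.factorial : ℂ))⁻¹ * B k ζ η = (∑ k ∈ Finset.range M,
            ((k.factorial : ℂ))⁻¹ * (dirD ((2 * Real.pi) • ζ))^[k] f η) * (c' ζ * f' η) := by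
          rw [Finset.sum_mul]
          simp only [hBdef, mul_assoc]
        rw [this, taylorRem]
        ring
      rw [hsplit, twist_add_right hc.isRS (hrem.mono (q := p + q) (by omega)) (IsRS.sum _ hBk),
        twist_sum_right _ hc.isRS hBk]
      simp only [twist_const_mul_right, h0]
      have := (hc.isRS.twist hrem).mono (q := p + q - ((n + m + M : ℕ) : ℤ))
        (by push_cast; linarith)
      convert this using 3
      simp [hT]

theorem hasExpansion_twist_homRap {p q : ℤ} {n m : ℕ} {A B : E3 → E3 → ℂ} (hA : A ∈ homRap p n)
    (hB : B ∈ homRap q m) : HasExpansion (p + q) (n + m) (twist A B) := by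
  induction hA using Submodule.span_induction with
  | mem A h =>
    obtain ⟨c, f, hc, hf, rfl⟩ := h
    have hcf : IsRS (p - n) (fun ζ η => c ζ * f η) := hc.mul_isSym (isSym_of_mem_homSym hf)
    induction hB using Submodule.span_induction with
    | mem B h =>
      obtain ⟨c', f', hc', hf', rfl⟩ := h
      exact hasExpansion_twist_mul hc hf hc' hf'
    | zero =>
      have : twist (fun ζ η => c ζ * f η) 0 = fun _ _ => 0 := by
        funext θ η
        simp [twist]
      rw [this]
      exact HasExpansion.zero
    | add B B' hB' hB'' hB hB1 =>
      have := twist_add_right hcf (isRS_of_mem_homRap hB') (isRS_of_mem_homRap hB'')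
      change HasExpansion _ _ (twist _ (fun ζ η => B ζ η + B' ζ η))
      rw [this]
      exact hB.add hB1
    | smul r B _ hB =>
      change HasExpansion _ _ (twist _ (fun ζ η => r * B ζ η))
      rw [twist_const_mul_right]
      exact hB.const_mul r
  | zero =>
    have : twist 0 B = fun _ _ => 0 := by
      funext θ η
      simp [twist]
    rw [this]
    exact HasExpansion.zero
  | add A A' hA' hA'' hA hA1 =>
    have := twist_add_left (isRS_of_mem_homRap hA') (isRS_of_mem_homRap hA'')
      (isRS_of_mem_homRap hB)
    change HasExpansion _ _ (twist (fun ζ η => A ζ η + A' ζ η) B)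
    rw [this]
    exact hA.add hA1
  | smul r A _ hA =>
    change HasExpansion _ _ (twist (fun ζ η => r * A ζ η) B)
    rw [twist_const_mul_left]
    exact hA.const_mul r

/-- Composition of symbols with expansions. -/
theorem HasExpansion.twist {p q : ℤ} {g h : E3 → E3 → ℂ} (hg : HasExpansion p 0 g)
    (hh : HasExpansion q 0 h) : HasExpansion (p + q) 0 (twist g h) := by
  have hgR := hg.isRS
  have hhR := hh.isRS
  obtain ⟨a, ha, -, haN⟩ := hg
  obtain ⟨b, hb, -, hbN⟩ := hh
  choose t ht1 ht2 ht3 using fun i j => hasExpansion_twist_homRap (ha i) (hb j)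
  refine ⟨fun n => ∑ i ∈ Finset.range (n + 1), ∑ j ∈ Finset.range (n + 1), t i j n,
    fun n => Submodule.sum_mem _ fun i _ => Submodule.sum_mem _ fun j _ => ht1 i j n,
    fun n hn => absurd hn (Nat.not_lt_zero n), fun N => ?_⟩
  have haR : ∀ i ∈ Finset.range N, IsRS p (a i) := fun i _ =>
    (isRS_of_mem_homRap (ha i)).mono (by omega)
  have hbR : ∀ i ∈ Finset.range N, IsRS q (b i) := fun i _ =>
    (isRS_of_mem_homRap (hb i)).mono (by omega)
  have hsum : ∀ θ η : E3, ∑ n ∈ Finset.range N, (∑ i ∈ Finset.range (n + 1),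
      ∑ j ∈ Finset.range (n + 1), t i j n) θ η
      = ∑ i ∈ Finset.range N, ∑ j ∈ Finset.range N, ∑ n ∈ Finset.range N, t i j n θ η := by
    intro θ η
    -- the terms with `n < i + j` vanish, so that all sums can be extended to `range N`
    have h1 : ∀ n ∈ Finset.range N, (∑ i ∈ Finset.range (n + 1),
        ∑ j ∈ Finset.range (n + 1), t i j n) θ η
        = ∑ i ∈ Finset.range N, ∑ j ∈ Finset.range N, t i j n θ η := by
      intro n hn
      have hn' := Finset.mem_range.1 hn
      simp only [Finset.sum_apply]
      have hsub : Finset.range (n + 1) ⊆ Finset.range N := Finset.range_subset_range.2 hn'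
      have h2 : ∀ i, ∑ j ∈ Finset.range (n + 1), t i j n θ η
          = ∑ j ∈ Finset.range N, t i j n θ η := by
        intro i
        refine Finset.sum_subset hsub fun j _ hj => ?_
        rw [Finset.mem_range] at hj
        rw [ht2 i j n (by omega)]
        rfl
      simp only [h2]
      refine Finset.sum_subset hsub fun i _ hi => Finset.sum_eq_zero fun j _ => ?_
      rw [Finset.mem_range] at hi
      rw [ht2 i j n (by omega)]
      rfl
    rw [Finset.sum_congr rfl h1, Finset.sum_comm]
    exact Finset.sum_congr rfl fun i _ => Finset.sum_comm
  have e1 : RPA.twist g h = fun θ η => RPA.twist (fun ζ η => g ζ η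
      - ∑ n ∈ Finset.range N, a n ζ η) h θ η
      + RPA.twist (fun ζ η => ∑ n ∈ Finset.range N, a n ζ η) h θ η := by
    rw [← twist_add_left ((haN N).mono (q := p) (by omega)) (IsRS.sum _ haR) hhR]
    simp
  have e2 : RPA.twist (fun ζ η => ∑ n ∈ Finset.range N, a n ζ η) h = fun θ η =>
      RPA.twist (fun ζ η => ∑ n ∈ Finset.range N, a n ζ η) (fun ζ η => h ζ η
      - ∑ n ∈ Finset.range N, b n ζ η) θ η
      + RPA.twist (fun ζ η => ∑ n ∈ Finset.range N, a n ζ η)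
        (fun ζ η => ∑ n ∈ Finset.range N, b n ζ η) θ η := by
    rw [← twist_add_right (IsRS.sum _ haR) ((hbN N).mono (q := q) (by omega))
      (IsRS.sum _ hbR)]
    simp
  have e3 : RPA.twist (fun ζ η => ∑ n ∈ Finset.range N, a n ζ η)
        (fun ζ η => ∑ n ∈ Finset.range N, b n ζ η) = fun θ η =>
      ∑ i ∈ Finset.range N, ∑ j ∈ Finset.range N, RPA.twist (a i) (b j) θ η := by
    rw [twist_sum_left _ haR (IsRS.sum _ hbR)]
    funext θ η
    refine Finset.sum_congr rfl fun i hi => ?_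
    rw [twist_sum_right _ (haR i hi) hbR]
  have r1 := ((haN N).twist hhR).mono (q := p + q - N) (by omega)
  have r2 := ((IsRS.sum _ haR).twist (hbN N)).mono (q := p + q - N) (by omega)
  have r3 := IsRS.sum (Finset.range N) fun i _ => IsRS.sum (Finset.range N) fun j _ => ht3 i j N
  have := (r1.add r2).add r3
  convert this using 3 with θ η
  rw [hsum, e1, e2, e3]
  simp only [Finset.sum_sub_distrib]
  ring

/-! ### Orthogonality to spherical harmonics -/

section Legendre

open Polynomial

/-- Repeated integration by parts without boundary terms. -/
theorem integral_mul_iterate_derivative (A W : ℝ[X]) (j : ℕ)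
    (h1 : ∀ i < j, (derivative^[i] A).eval 1 * (derivative^[j - 1 - i] W).eval 1 = 0)
    (h2 : ∀ i < j, (derivative^[i] A).eval (-1) * (derivative^[j - 1 - i] W).eval (-1) = 0) :
    ∫ x in (-1 : ℝ)..1, A.eval x * (derivative^[j] W).eval x
      = (-1) ^ j * ∫ x in (-1 : ℝ)..1, (derivative^[j] A).eval x * W.eval x := by
  induction j generalizing A with
  | zero => simp
  | succ j ih =>
    have hparts := intervalIntegral.integral_mul_deriv_eq_deriv_mul (a := -1) (b := 1)
      (u := fun x => A.eval x) (v := fun x => (derivative^[j] W).eval x)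
      (u' := fun x => (derivative A).eval x) (v' := fun x => (derivative^[j + 1] W).eval x)
      (fun x _ => A.hasDerivAt x)
      (fun x _ => by
        rw [Function.iterate_succ_apply']
        exact (derivative^[j] W).hasDerivAt x)
      ((derivative A).continuous.intervalIntegrable _ _)
      ((derivative^[j + 1] W).continuous.intervalIntegrable _ _)
    rw [hparts, ih (derivative A) (fun i hi => ?_) (fun i hi => ?_)]
    · have e1 := h1 0 (by omega)
      have e2 := h2 0 (by omega)
      simp only [Function.iterate_zero, id, Nat.add_sub_cancel, Nat.sub_zero] at e1 e2
      rw [e1, e2, ← Function.iterate_succ_apply]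
      ring
    · have := h1 (i + 1) (by omega)
      rw [Function.iterate_succ_apply] at this
      rwa [show j + 1 - 1 - (i + 1) = j - 1 - i by omega] at this
    · have := h2 (i + 1) (by omega)
      rw [Function.iterate_succ_apply] at this
      rwa [show j + 1 - 1 - (i + 1) = j - 1 - i by omega] at this

theorem eval_iterate_derivative_eq_zero {p : ℝ[X]} {a : ℝ} {n i : ℕ} (h : (X - C a) ^ n ∣ p)
    (hi : i < n) : (derivative^[i] p).eval a = 0 := by
  have h1 := pow_sub_dvd_iterate_derivative_of_pow_dvd i h
  have h2 : (X - C a) ∣ derivative^[i] p :=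
    (dvd_pow_self _ (by omega)).trans h1
  exact dvd_iff_isRoot.1 h2

/-- Every derivative changes the parity of a polynomial. -/
theorem derivative_comp_neg_X_of_parity {p : ℝ[X]} {j : ℕ} (h : p.comp (-X) = (-1) ^ j * p)
    (i : ℕ) : (derivative^[i] p).comp (-X) = (-1) ^ (j + i) * derivative^[i] p := by
  induction i with
  | zero => simpa using h
  | succ i ih =>
    have h1 := congrArg derivative ih
    rw [derivative_comp, show ((-1 : ℝ[X]) ^ (j + i)) = C ((-1) ^ (j + i)) by simp,
      derivative_C_mul] at h1
    simp only [derivative_neg, derivative_X] at h1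
    rw [Function.iterate_succ_apply', show j + (i + 1) = j + i + 1 by ring, pow_succ,
      show ((-1 : ℝ[X]) ^ (j + i)) = C ((-1) ^ (j + i)) by simp]
    linear_combination (-1 : ℝ[X]) * h1

/-- Orthogonality of `(1 - x²)^s x^c` to the derivative of order `l + M` of `(x² - 1)^l`, which is,
up to a factor, an associated Legendre function without its power of `1 - x²`. -/
theorem integral_legendre_eq_zero (l M s c n : ℕ) (hs : M ≤ s)
    (hk : 2 * s + c ≤ n + M) (hpar : Even (n + M + c)) (h : Odd (n + l) ∨ n < l) :
    ∫ x in (-1 : ℝ)..1, ((1 - X ^ 2) ^ s * X ^ c : ℝ[X]).eval x *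
      (derivative^[l + M] ((X ^ 2 - 1) ^ l : ℝ[X])).eval x = 0 := by
  rcases h with h | h
  · -- the integrand is odd
    have hW : ((X ^ 2 - 1) ^ l : ℝ[X]).comp (-X) = (-1) ^ 0 * (X ^ 2 - 1) ^ l := by simp
    have hW' := derivative_comp_neg_X_of_parity hW (l + M)
    have hodd : ∀ x : ℝ, ((1 - X ^ 2) ^ s * X ^ c : ℝ[X]).eval (-x) *
        (derivative^[l + M] ((X ^ 2 - 1) ^ l : ℝ[X])).eval (-x)
        = -(((1 - X ^ 2) ^ s * X ^ c : ℝ[X]).eval x *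
        (derivative^[l + M] ((X ^ 2 - 1) ^ l : ℝ[X])).eval x) := by
      intro x
      have h1 := congrArg (Polynomial.eval x) hW'
      simp only [eval_comp, eval_neg, eval_X, eval_mul, eval_pow, eval_one, zero_add] at h1
      rw [h1]
      simp only [eval_mul, eval_pow, eval_sub, eval_one, eval_X]
      have h2 : (-x) ^ c = (-1) ^ c * x ^ c := by rw [← mul_pow]; simp
      have h3 : ((-1 : ℝ)) ^ c * (-1) ^ (l + M) = -1 := by
        rw [← pow_add]
        refine Odd.neg_one_pow ?_
        by_contra h0
        rw [Nat.not_odd_iff_even] at h0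
        have h5 := (h0.add hpar)
        rw [show c + (l + M) + (n + M + c) = (n + l) + 2 * (c + M) by ring] at h5
        have := (Nat.even_add.1 h5).2 (even_two_mul _)
        exact (Nat.not_odd_iff_even.2 this) h
      rw [h2]
      linear_combination ((1 - x ^ 2) ^ s * x ^ c *
        (derivative^[l + M] ((X ^ 2 - 1) ^ l : ℝ[X])).eval x) * h3
    have h1 := intervalIntegral.integral_comp_neg (a := -1) (b := 1) (f := fun x : ℝ =>
      ((1 - X ^ 2) ^ s * X ^ c : ℝ[X]).eval x *
        (derivative^[l + M] ((X ^ 2 - 1) ^ l : ℝ[X])).eval x)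
    simp only [hodd, neg_neg, intervalIntegral.integral_neg] at h1
    linarith
  · -- the degree of the left factor is too low
    have hd1 : ((X : ℝ[X]) - C 1) ^ s ∣ (1 - X ^ 2) ^ s * X ^ c :=
      Dvd.dvd.mul_right (pow_dvd_pow_of_dvd ⟨-(X + 1), by simp; ring⟩ s) _
    have hd2 : ((X : ℝ[X]) - C (-1)) ^ s ∣ (1 - X ^ 2) ^ s * X ^ c :=
      Dvd.dvd.mul_right (pow_dvd_pow_of_dvd ⟨1 - X, by simp; ring⟩ s) _
    have hw1 : ((X : ℝ[X]) - C 1) ^ l ∣ (X ^ 2 - 1) ^ l :=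
      pow_dvd_pow_of_dvd ⟨X + 1, by simp; ring⟩ l
    have hw2 : ((X : ℝ[X]) - C (-1)) ^ l ∣ (X ^ 2 - 1) ^ l :=
      pow_dvd_pow_of_dvd ⟨X - 1, by simp; ring⟩ l
    rw [integral_mul_iterate_derivative]
    · have : derivative^[l + M] ((1 - X ^ 2) ^ s * X ^ c : ℝ[X]) = 0 := by
        refine iterate_derivative_eq_zero (lt_of_le_of_lt ?_ (show n + M < l + M by omega))
        refine le_trans ?_ hk
        compute_degree
        omega
      simp [this]
    · intro i hi
      rcases lt_or_ge i s with hi' | hi'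
      · rw [eval_iterate_derivative_eq_zero hd1 hi', zero_mul]
      · rw [eval_iterate_derivative_eq_zero hw1 (show l + M - 1 - i < l by omega), mul_zero]
    · intro i hi
      rcases lt_or_ge i s with hi' | hi'
      · rw [eval_iterate_derivative_eq_zero hd2 hi', zero_mul]
      · rw [eval_iterate_derivative_eq_zero hw2 (show l + M - 1 - i < l by omega), mul_zero]

theorem integral_sin_legendre_eq_zero (l M s c n : ℕ) (hs : M ≤ s)
    (hk : 2 * s + c ≤ n + M) (hpar : Even (n + M + c)) (h : Odd (n + l) ∨ n < l) :
    ∫ θ in (0 : ℝ)..Real.pi, Real.sin θ ^ (2 * s) * Real.cos θ ^ c *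
      (derivative^[l + M] ((X ^ 2 - 1) ^ l : ℝ[X])).eval (Real.cos θ) * Real.sin θ = 0 := by
  have h1 := intervalIntegral.integral_comp_mul_deriv (a := 0) (b := Real.pi) (f := Real.cos)
    (f' := fun θ => -Real.sin θ) (g := fun x : ℝ => ((1 - X ^ 2) ^ s * X ^ c : ℝ[X]).eval x *
      (derivative^[l + M] ((X ^ 2 - 1) ^ l : ℝ[X])).eval x)
    (fun x _ => Real.hasDerivAt_cos x) (Real.continuous_sin.neg.continuousOn)
    ((Polynomial.continuous _).mul (Polynomial.continuous _))
  rw [Real.cos_zero, Real.cos_pi, intervalIntegral.integral_symm (-1 : ℝ) 1,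
    integral_legendre_eq_zero l M s c n hs hk hpar h, neg_zero] at h1
  rw [← neg_eq_zero, ← intervalIntegral.integral_neg, ← h1]
  congr 1
  funext θ
  simp only [Function.comp, eval_mul, eval_pow, eval_sub, eval_one, eval_X]
  rw [pow_mul, Real.sin_sq]
  ring

end Legendre

theorem norm_spherePoint (θ ϕ : ℝ) : ‖spherePoint θ ϕ‖ = 1 := by
  rw [EuclideanSpace.norm_eq, Real.sqrt_eq_one]
  simp only [spherePoint, Fin.sum_univ_three, Real.norm_eq_abs, sq_abs]
  simp
  nlinarith [Real.sin_sq_add_cos_sq θ, Real.sin_sq_add_cos_sq ϕ]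

theorem continuous_spherePoint : Continuous fun q : ℝ × ℝ => spherePoint q.2 q.1 := by
  unfold spherePoint
  refine (PiLp.continuous_toLp 2 _).comp (continuous_pi fun i => ?_)
  fin_cases i <;> simp <;> fun_prop

theorem spherePoint_plus (θ ϕ : ℝ) : (spherePoint θ ϕ 0 : ℂ) + Complex.I * (spherePoint θ ϕ 1 : ℂ)
    = (Real.sin θ : ℂ) * Complex.exp (Complex.I * ϕ) := by
  rw [mul_comm Complex.I (ϕ : ℂ), Complex.exp_mul_I]
  simp [spherePoint]
  ring

theorem spherePoint_minus (θ ϕ : ℝ) : (spherePoint θ ϕ 0 : ℂ) - Complex.I * (spherePoint θ ϕ 1 : ℂ)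
    = (Real.sin θ : ℂ) * Complex.exp (-(Complex.I * ϕ)) := by
  rw [show -(Complex.I * (ϕ : ℂ)) = ((-ϕ : ℝ) : ℂ) * Complex.I by push_cast; ring,
    Complex.exp_mul_I]
  simp [spherePoint]
  ring

theorem spherePoint_two (θ ϕ : ℝ) : spherePoint θ ϕ 2 = Real.cos θ := by simp [spherePoint]

theorem sphMono_spherePoint (a b c : ℕ) (θ ϕ : ℝ) : sphMono a b c (spherePoint θ ϕ)
    = ((Real.sin θ ^ (a + b) * Real.cos θ ^ c : ℝ) : ℂ) *
      Complex.exp (((a : ℤ) - (b : ℤ) : ℤ) * (Complex.I * ϕ)) := by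
  rw [sphMono, spherePoint_plus, spherePoint_minus, spherePoint_two]
  have : Complex.exp (((a : ℤ) - (b : ℤ) : ℤ) * (Complex.I * ϕ)) =
      Complex.exp (Complex.I * ϕ) ^ a * Complex.exp (-(Complex.I * ϕ)) ^ b := by
    rw [← Complex.exp_nat_mul, ← Complex.exp_nat_mul, ← Complex.exp_add]
    push_cast
    ring_nf
  rw [this, pow_add]
  push_cast
  ring

/-- The associated Legendre factor of `Y_{lm}` in terms of the polar angle. -/
theorem sphericalHarmonic_spherePoint (l : ℕ) (m : ℤ) : ∃ K : ℂ, ∀ θ ϕ : ℝ,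
    sphericalHarmonic l m (spherePoint θ ϕ) = K * ((Real.sin θ ^ m.natAbs *
      (Polynomial.derivative^[l + m.natAbs] ((Polynomial.X ^ 2 - 1) ^ l : Polynomial ℝ)).eval
        (Real.cos θ) : ℝ) : ℂ) * Complex.exp (m * (Complex.I * ϕ)) := by
  have hnat : ∀ M : ℕ, ∃ K : ℝ, ∀ θ ϕ : ℝ, sphericalHarmonicNat l M (spherePoint θ ϕ)
      = (K : ℂ) * ((Real.sin θ ^ M *
      (Polynomial.derivative^[l + M] ((Polynomial.X ^ 2 - 1) ^ l : Polynomial ℝ)).eval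
        (Real.cos θ) : ℝ) : ℂ) * Complex.exp (M * (Complex.I * ϕ)) := by
    intro M
    refine ⟨Real.sqrt ((2 * (l : ℝ) + 1) / (4 * Real.pi) *
      ((Nat.factorial (l - M) : ℝ) / (Nat.factorial (l + M) : ℝ))) * (-1) ^ M /
      (2 ^ l * (Nat.factorial l : ℝ)), fun θ ϕ => ?_⟩
    rw [sphericalHarmonicNat, spherePoint_plus, spherePoint_two, Complex.exp_nat_mul]
    push_cast
    ring
  obtain ⟨K, hK⟩ := hnat m.natAbs
  by_cases hm : 0 ≤ m
  · refine ⟨K, fun θ ϕ => ?_⟩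
    rw [sphericalHarmonic, if_pos hm, hK]
    have : (m : ℂ) = (m.natAbs : ℂ) := by
      rw [← Int.cast_natCast, Int.natAbs_of_nonneg hm]
    rw [this]
  · refine ⟨(-1) ^ m.natAbs * K, fun θ ϕ => ?_⟩
    rw [sphericalHarmonic, if_neg hm, hK]
    have : (m : ℂ) = -(m.natAbs : ℂ) := by
      rw [← Int.cast_natCast, Int.ofNat_natAbs_of_nonpos (by omega)]
      simp
    rw [this, map_mul, map_mul, Complex.conj_ofReal, Complex.conj_ofReal, ← Complex.exp_conj]
    simp only [map_mul, Complex.conj_I, Complex.conj_ofReal, map_natCast]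
    ring_nf

theorem integral_exp_int_eq_zero {k : ℤ} (hk : k ≠ 0) :
    ∫ ϕ in (0 : ℝ)..(2 * Real.pi), Complex.exp (k * (Complex.I * ϕ)) = 0 := by
  have h : (k : ℂ) * Complex.I ≠ 0 := mul_ne_zero (by exact_mod_cast hk) Complex.I_ne_zero
  have h1 := integral_exp_mul_complex (a := 0) (b := 2 * Real.pi) h
  simp only [mul_assoc] at h1
  rw [h1]
  have h2 : Complex.exp ((k : ℂ) * (Complex.I * ((2 * Real.pi : ℝ) : ℂ))) = 1 := by
    rw [show (k : ℂ) * (Complex.I * ((2 * Real.pi : ℝ) : ℂ)) = k * (2 * Real.pi * Complex.I) by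
      push_cast; ring]
    exact Complex.exp_int_mul_two_pi_mul_I k
  rw [h2]
  simp

/-- The restriction to the sphere of a monomial of degree at most `n` and of the parity of `n` is
orthogonal to the spherical harmonics of degree `l` if `l > n` or `n - l` is odd. -/
theorem integral_sphMono_sphericalHarmonic (a b c n l : ℕ) (m : ℤ)
    (hk : a + b + c ≤ n) (hpar : Even (n + (a + b + c)))
    (h : Odd (n + l) ∨ n < l) :
    ∫ ϕ in (0 : ℝ)..(2 * Real.pi), ∫ θ in (0 : ℝ)..Real.pi, sphMono a b c (spherePoint θ ϕ) *
      sphericalHarmonic l m (spherePoint θ ϕ) * (Real.sin θ : ℂ) = 0 := by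
  obtain ⟨K, hK⟩ := sphericalHarmonic_spherePoint l m
  set M := m.natAbs with hM
  set Q : ℝ → ℝ := fun θ => Real.sin θ ^ (a + b + M) * Real.cos θ ^ c *
      (Polynomial.derivative^[l + M] ((Polynomial.X ^ 2 - 1) ^ l : Polynomial ℝ)).eval
        (Real.cos θ) * Real.sin θ with hQ
  have h1 : ∀ ϕ θ : ℝ, sphMono a b c (spherePoint θ ϕ) *
      sphericalHarmonic l m (spherePoint θ ϕ) * (Real.sin θ : ℂ)
      = (K * Complex.exp (((a : ℤ) - b + m : ℤ) * (Complex.I * ϕ))) * (Q θ : ℂ) := by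
    intro ϕ θ
    rw [hK, sphMono_spherePoint]
    have : Complex.exp (((a : ℤ) - b + m : ℤ) * (Complex.I * ϕ)) =
        Complex.exp (((a : ℤ) - b : ℤ) * (Complex.I * ϕ)) * Complex.exp (m * (Complex.I * ϕ)) := by
      rw [← Complex.exp_add]
      push_cast
      ring_nf
    rw [this, hQ]
    push_cast
    ring
  simp only [h1, intervalIntegral.integral_const_mul, intervalIntegral.integral_mul_const]
  by_cases hz : (a : ℤ) - b + m = 0
  · have hzero : ∫ θ in (0 : ℝ)..Real.pi, Q θ = 0 := by
      -- the power of the sine is `2 s` with `s` the larger of `a` and `b`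
      obtain ⟨s, hs2, hsM⟩ : ∃ s, a + b + M = 2 * s ∧ M ≤ s := by
        rcases le_or_gt 0 m with hm | hm
        · exact ⟨b, by omega, by omega⟩
        · exact ⟨a, by omega, by omega⟩
      simp only [hQ, hs2]
      refine integral_sin_legendre_eq_zero l M s c n hsM (by omega) ?_ h
      obtain ⟨k, hk⟩ := hpar
      exact ⟨k + M - s, by omega⟩
    rw [intervalIntegral.integral_ofReal, hzero]
    simp
  · rw [integral_exp_int_eq_zero hz]
    simp

theorem continuous_sphericalHarmonic (l : ℕ) (m : ℤ) :
    Continuous fun q : ℝ × ℝ => sphericalHarmonic l m (spherePoint q.2 q.1) := by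
  obtain ⟨K, hK⟩ := sphericalHarmonic_spherePoint l m
  simp only [hK]
  refine Continuous.mul (continuous_const.mul (Complex.continuous_ofReal.comp ?_)) (by fun_prop)
  exact (by fun_prop : Continuous fun q : ℝ × ℝ => Real.sin q.2 ^ m.natAbs).mul
    ((Polynomial.continuous _).comp (by fun_prop))

/-- The radial factor is constant on spheres, so only the monomial enters the integral. -/
theorem orthogonality_of_mem_homSym {p : ℤ} {n l : ℕ} {m : ℤ} {F : E3 → ℂ} (hF : F ∈ homSym p n)
    (h : Odd (n + l) ∨ n < l) (r : ℝ) :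
    ∫ ϕ in (0 : ℝ)..(2 * Real.pi), ∫ θ in (0 : ℝ)..Real.pi,
      F (r • spherePoint θ ϕ) * sphericalHarmonic l m (spherePoint θ ϕ) * (Real.sin θ : ℂ) = 0 := by
  have hcont : ∀ F : E3 → ℂ, Continuous F → Continuous fun q : ℝ × ℝ =>
      F (r • spherePoint q.2 q.1) * sphericalHarmonic l m (spherePoint q.2 q.1) *
        (Real.sin q.2 : ℂ) := fun F hF =>
    ((hF.comp (continuous_spherePoint.const_smul r)).mul (continuous_sphericalHarmonic l m)).mul
      (by fun_prop)
  induction hF using Submodule.span_induction with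
  | mem F hF =>
    obtain ⟨f, a, b, c, e, C, hf, hk, hpar, he, hfe, rfl⟩ := hF
    have h1 : ∀ ϕ θ : ℝ, f (‖r • spherePoint θ ϕ‖ ^ 2) * sphMono a b c (r • spherePoint θ ϕ) *
        sphericalHarmonic l m (spherePoint θ ϕ) * (Real.sin θ : ℂ)
        = (f (r ^ 2) * (r : ℂ) ^ (a + b + c)) * (sphMono a b c (spherePoint θ ϕ) *
        sphericalHarmonic l m (spherePoint θ ϕ) * (Real.sin θ : ℂ)) := by
      intro ϕ θ
      rw [norm_smul, norm_spherePoint, mul_one, Real.norm_eq_abs, sq_abs, sphMono_smul]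
      ring
    simp only [h1, intervalIntegral.integral_const_mul]
    rw [integral_sphMono_sphericalHarmonic a b c n l m hk hpar h, mul_zero]
  | zero => simp
  | add F G hF' hG' hF hG =>
    have hFc := hcont F (contDiff_of_mem_homSym hF').continuous
    have hGc := hcont G (contDiff_of_mem_homSym hG').continuous
    simp only [Pi.add_apply, add_mul]
    have hin : ∀ ϕ : ℝ, ∀ H : ℝ × ℝ → ℂ, Continuous H →
        IntervalIntegrable (fun θ => H (ϕ, θ)) volume 0 Real.pi := fun ϕ H hH =>
      (hH.comp (f := fun θ : ℝ => (ϕ, θ)) (by fun_prop)).intervalIntegrable _ _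
    have hout : ∀ H : ℝ × ℝ → ℂ, Continuous H → IntervalIntegrable
        (fun ϕ => ∫ θ in (0 : ℝ)..Real.pi, H (ϕ, θ)) volume 0 (2 * Real.pi) := fun H hH =>
      (intervalIntegral.continuous_parametric_intervalIntegral_of_continuous'
        (f := fun ϕ θ => H (ϕ, θ)) hH 0 Real.pi).intervalIntegrable _ _
    have e1 : ∀ ϕ : ℝ, (∫ θ in (0 : ℝ)..Real.pi,
        (F (r • spherePoint θ ϕ) * sphericalHarmonic l m (spherePoint θ ϕ) * (Real.sin θ : ℂ)
        + G (r • spherePoint θ ϕ) * sphericalHarmonic l m (spherePoint θ ϕ) * (Real.sin θ : ℂ)))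
        = _ := fun ϕ => intervalIntegral.integral_add (hin ϕ _ hFc) (hin ϕ _ hGc)
    simp only [e1]
    rw [intervalIntegral.integral_add (hout _ hFc) (hout _ hGc), hF, hG, add_zero]
  | smul c F _ hF =>
    simp only [Pi.smul_apply, smul_eq_mul, mul_assoc c, intervalIntegral.integral_const_mul]
    simp only [hF, mul_zero]

/-! ### From the Fourier side to symbols -/

/-- The symbol whose Fourier transform in the position variable is `g`. -/
def symOf (g : E3 → E3 → ℂ) (x η : E3) : ℂ := 𝓕⁻ (fun ζ => g ζ η) x

/-- The character `e^{2πi⟨ζ, x⟩}`. -/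
def waveE (ζ x : E3) : ℂ := Complex.exp (((2 * Real.pi * inner ℝ ζ x : ℝ) : ℂ) * Complex.I)

theorem norm_waveE (ζ x : E3) : ‖waveE ζ x‖ = 1 := Complex.norm_exp_ofReal_mul_I _

theorem continuous_waveE : Continuous fun q : E3 × E3 => waveE q.1 q.2 := by
  unfold waveE
  fun_prop

theorem fourierInv_eq_waveE {V : Type} [NormedAddCommGroup V] [NormedSpace ℂ V] (f : E3 → V)
    (x : E3) : 𝓕⁻ f x = ∫ ζ, waveE ζ x • f ζ := Real.fourierInv_eq' f x

theorem waveE_add_left (ζ θ x : E3) : waveE (ζ + θ) x = waveE ζ x * waveE θ x := by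
  simp only [waveE, inner_add_left, ← Complex.exp_add]
  push_cast
  ring_nf

theorem fourier_eq_waveE {V : Type} [NormedAddCommGroup V] [NormedSpace ℂ V] (f : E3 → V)
    (x : E3) : 𝓕 f x = ∫ ζ, waveE ζ (-x) • f ζ := by
  rw [Real.fourier_eq']
  congr 1
  funext ζ
  simp [waveE]

theorem symOf_eq (g : E3 → E3 → ℂ) (x η : E3) : symOf g x η = ∫ ζ, waveE ζ x * g ζ η :=
  fourierInv_eq_waveE _ x

/-- The constant `∫ (1 + |z|)^{-4} dz`. -/
def weightConst : ℝ := ∫ ζ : E3, ((1 + ‖ζ‖) ^ 4)⁻¹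

theorem weightConst_nonneg : 0 ≤ weightConst :=
  integral_nonneg fun ζ => inv_nonneg.2 (pow_nonneg (weight_pos ζ).le 4)

theorem integrable_of_weight_le {V : Type} [NormedAddCommGroup V] {f : E3 → V}
    (hf : AEStronglyMeasurable f) {A : ℝ} (h : ∀ᵐ ζ : E3, (1 + ‖ζ‖) ^ 4 * ‖f ζ‖ ≤ A) :
    Integrable f ∧ ∫ ζ, ‖f ζ‖ ≤ A * weightConst := by
  have h1 : ∀ᵐ ζ : E3, ‖f ζ‖ ≤ A * ((1 + ‖ζ‖) ^ 4)⁻¹ := by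
    filter_upwards [h] with ζ hζ using le_mul_inv_pow hζ
  have hi : Integrable f := (integrable_weight_inv.const_mul A).mono' hf h1
  refine ⟨hi, ?_⟩
  rw [weightConst, ← integral_const_mul]
  exact integral_mono_ae hi.norm (integrable_weight_inv.const_mul A) h1

theorem integrable_pow_mul_norm {V : Type} [NormedAddCommGroup V] {f : E3 → V} (hf : Continuous f)
    {a : ℕ} {A : ℝ} (h : ∀ ζ : E3, (1 + ‖ζ‖) ^ (a + 4) * ‖f ζ‖ ≤ A) {k : ℕ} (hk : k ≤ a) :
    Integrable (fun v : E3 => ‖v‖ ^ k * ‖f v‖) ∧ ∫ v : E3, ‖v‖ ^ k * ‖f v‖ ≤ A * weightConst := by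
  have hm : Continuous (fun v : E3 => ‖v‖ ^ k * ‖f v‖) := by fun_prop
  have := integrable_of_weight_le hm.aestronglyMeasurable (A := A)
    (Filter.Eventually.of_forall fun ζ => ?_)
  · refine ⟨this.1, le_trans (le_of_eq ?_) this.2⟩
    congr 1
    funext v
    rw [norm_mul, norm_pow, norm_norm, norm_norm]
  · refine le_trans ?_ (h ζ)
    rw [norm_mul, norm_pow, norm_norm, norm_norm, add_comm a 4, pow_add, mul_assoc]
    have h1 := one_le_weight ζ
    have h2 : ‖ζ‖ ^ k ≤ (1 + ‖ζ‖) ^ a :=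
      (pow_le_pow_left₀ (norm_nonneg ζ) (by linarith) k).trans (pow_le_pow_right₀ h1 hk)
    gcongr

/-- Derivatives of an inverse Fourier transform are bounded by moments of the function. -/
theorem norm_iteratedFDeriv_fourierInv_le {V : Type} [NormedAddCommGroup V] [NormedSpace ℂ V]
    {f : E3 → V} (hf : Continuous f) (a : ℕ) {A : ℝ}
    (h : ∀ ζ : E3, (1 + ‖ζ‖) ^ (a + 4) * ‖f ζ‖ ≤ A) (x : E3) :
    ‖iteratedFDeriv ℝ a (𝓕⁻ f) x‖ ≤ (2 * Real.pi) ^ a * ((a + 1) * weightConst) * A := by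
  have hk : ∀ k ≤ a, Integrable (fun v : E3 => ‖v‖ ^ k * ‖f v‖) ∧
      ∫ v : E3, ‖v‖ ^ k * ‖f v‖ ≤ A * weightConst := fun k hk => integrable_pow_mul_norm hf h hk
  have hiso : 𝓕⁻ f = 𝓕 f ∘ (LinearIsometryEquiv.neg ℝ : E3 ≃ₗᵢ[ℝ] E3) := by
    funext w
    rw [Real.fourierInv_eq_fourier_neg]
    rfl
  rw [hiso, LinearIsometryEquiv.norm_iteratedFDeriv_comp_right]
  have h1 := Real.pow_mul_norm_iteratedFDeriv_fourier_le (f := f) (K := a) (N := 0)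
    (by exact_mod_cast contDiff_zero.2 hf)
    (fun k n hka hn => by
      obtain rfl : n = 0 := by simpa using hn
      simp only [norm_iteratedFDeriv_zero]
      exact (hk k (by exact_mod_cast hka)).1) (k := a) (n := 0) le_rfl le_rfl
    ((LinearIsometryEquiv.neg ℝ : E3 ≃ₗᵢ[ℝ] E3) x)
  rw [pow_zero, one_mul, pow_zero, mul_one] at h1
  refine h1.trans ?_
  rw [mul_assoc]
  refine mul_le_mul_of_nonneg_left ?_ (by positivity)
  rw [zero_add, Finset.range_one, Finset.sum_product]
  simp only [Finset.sum_singleton, norm_iteratedFDeriv_zero]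
  refine (Finset.sum_le_sum fun k hk' =>
    (hk k (Nat.lt_succ_iff.1 (Finset.mem_range.1 hk'))).2).trans (le_of_eq ?_)
  simp
  ring

theorem iteratedDeriv_exp_mul_I (n : ℕ) : iteratedDeriv n (fun t : ℝ => Complex.exp (t * Complex.I))
    = fun t : ℝ => Complex.I ^ n * Complex.exp (t * Complex.I) := by
  induction n with
  | zero => simp
  | succ n ih =>
    rw [iteratedDeriv_succ, ih]
    funext t
    have h : HasDerivAt (fun t : ℝ => Complex.exp (t * Complex.I))
        (Complex.exp (t * Complex.I) * Complex.I) t := by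
      have h1 : HasDerivAt (fun t : ℝ => (t : ℂ) * Complex.I) (1 * Complex.I) t :=
        (hasDerivAt_id t).ofReal_comp.mul_const _
      simpa using h1.cexp
    rw [(h.const_mul _).deriv, pow_succ]
    ring

/-- The real-linear functional `q ↦ 2π⟨ζ, q.1⟩` on pairs. -/
def phaseL (ζ : E3) : E3 × E3 →L[ℝ] ℝ :=
  ((2 * Real.pi) • innerSL ℝ ζ).comp (ContinuousLinearMap.fst ℝ E3 E3)

theorem norm_phaseL_le (ζ : E3) : ‖phaseL ζ‖ ≤ 2 * Real.pi * (1 + ‖ζ‖) := by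
  refine (ContinuousLinearMap.opNorm_comp_le _ _).trans ?_
  have h1 : ‖ContinuousLinearMap.fst ℝ E3 E3‖ ≤ 1 := ContinuousLinearMap.norm_fst_le ..
  have h2 : ‖(2 * Real.pi) • innerSL ℝ ζ‖ = 2 * Real.pi * ‖ζ‖ := by
    rw [norm_smul, innerSL_apply_norm, Real.norm_of_nonneg (by positivity)]
  rw [h2]
  have := Real.pi_pos
  have h3 := norm_nonneg ζ
  calc 2 * Real.pi * ‖ζ‖ * _ ≤ 2 * Real.pi * ‖ζ‖ * 1 := by gcongr
    _ ≤ _ := by rw [mul_one]; gcongr; linarith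

theorem norm_iteratedFDeriv_comp_clm_le {X Y V : Type} [NormedAddCommGroup X] [NormedSpace ℝ X]
    [NormedAddCommGroup Y] [NormedSpace ℝ Y] [NormedAddCommGroup V] [NormedSpace ℝ V]
    {f : Y → V} (hf : ContDiff ℝ ∞ f) (L : X →L[ℝ] Y) (n : ℕ) (x : X) :
    ‖iteratedFDeriv ℝ n (fun x => f (L x)) x‖ ≤ ‖iteratedFDeriv ℝ n f (L x)‖ * ‖L‖ ^ n := by
  have h := L.iteratedFDeriv_comp_right (hf.of_le (natCast_le_infty n)) x (i := n) le_rfl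
  rw [show (fun x => f (L x)) = f ∘ L from rfl, h]
  refine (ContinuousMultilinearMap.norm_compContinuousLinearMap_le _ _).trans (le_of_eq ?_)
  simp

theorem contDiff_exp_mul_I : ContDiff ℝ ∞ fun t : ℝ => Complex.exp (t * Complex.I) :=
  (Complex.ofRealCLM.contDiff.mul contDiff_const).cexp

theorem norm_iteratedFDeriv_waveE_le (ζ : E3) (n : ℕ) (q : E3 × E3) :
    ‖iteratedFDeriv ℝ n (fun q : E3 × E3 => waveE ζ q.1) q‖ ≤ (2 * Real.pi * (1 + ‖ζ‖)) ^ n := by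
  have h1 := norm_iteratedFDeriv_comp_clm_le contDiff_exp_mul_I (phaseL ζ) n q
  have h2 : ‖iteratedFDeriv ℝ n (fun t : ℝ => Complex.exp (t * Complex.I)) (phaseL ζ q)‖ = 1 := by
    rw [norm_iteratedFDeriv_eq_norm_iteratedDeriv, iteratedDeriv_exp_mul_I, norm_mul, norm_pow,
      Complex.norm_I, Complex.norm_exp_ofReal_mul_I]
    simp
  rw [h2, one_mul] at h1
  exact h1.trans (pow_le_pow_left₀ (norm_nonneg _) (norm_phaseL_le ζ) n)

theorem contDiff_waveE (ζ : E3) : ContDiff ℝ ∞ fun q : E3 × E3 => waveE ζ q.1 :=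
  contDiff_exp_mul_I.comp (phaseL ζ).contDiff

namespace IsRS

variable {p q : ℤ} {g h : E3 → E3 → ℂ}

theorem integrable (hg : IsRS p g) (η : E3) : Integrable fun ζ => g ζ η := by
  obtain ⟨C, hC⟩ := hg.bound 0 4
  refine (integrable_of_weight_le (hg.cont.comp
    (f := fun ζ : E3 => (ζ, η)) (by fun_prop)).aestronglyMeasurable
    (Filter.Eventually.of_forall fun ζ => ?_) (A := C * (1 + ‖η‖) ^ (p - ((0 : ℕ) : ℤ)))).1
  have := hC ζ η
  rwa [norm_iteratedFDeriv_zero] at this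

theorem integrable_waveE (hg : IsRS p g) (x η : E3) : Integrable fun ζ => waveE ζ x * g ζ η := by
  refine (hg.integrable η).mono ?_ (Filter.Eventually.of_forall fun ζ => ?_)
  · exact (continuous_waveE.comp (f := fun ζ : E3 => (ζ, x)) (by fun_prop)).aestronglyMeasurable.mul
      (hg.integrable η).1
  · rw [norm_mul, norm_waveE, one_mul]

theorem symOf_add (hg : IsRS p g) (hh : IsRS q h) :
    symOf (fun ζ η => g ζ η + h ζ η) = fun x η => symOf g x η + symOf h x η := by
  funext x η
  simp only [symOf_eq, mul_add]
  exact integral_add (hg.integrable_waveE x η) (hh.integrable_waveE x η)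

theorem symOf_sub (hg : IsRS p g) (hh : IsRS q h) :
    symOf (fun ζ η => g ζ η - h ζ η) = fun x η => symOf g x η - symOf h x η := by
  funext x η
  simp only [symOf_eq, mul_sub]
  exact integral_sub (hg.integrable_waveE x η) (hh.integrable_waveE x η)

theorem symOf_sum {ι : Type} (s : Finset ι) {g : ι → E3 → E3 → ℂ} (h : ∀ i ∈ s, IsRS p (g i)) :
    symOf (fun ζ η => ∑ i ∈ s, g i ζ η) = fun x η => ∑ i ∈ s, symOf (g i) x η := by
  funext x η
  simp only [symOf_eq, Finset.mul_sum]
  exact integral_finsetSum _ fun i hi => (h i hi).integrable_waveE x η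

theorem iteratedFDeriv_symOf (hg : IsRS p g) (b : ℕ) (x η : E3) :
    iteratedFDeriv ℝ b (symOf g x) η = 𝓕⁻ (fun ζ => iteratedFDeriv ℝ b (g ζ) η) x := by
  have hfd : ∀ (n : ℕ) (ζ η : E3), iteratedFDeriv ℝ n (fun η => waveE ζ x * g ζ η) η
      = waveE ζ x • iteratedFDeriv ℝ n (g ζ) η := fun n ζ η =>
    iteratedFDeriv_const_smul_apply (a := waveE ζ x) (f := g ζ)
      ((hg.smooth ζ).of_le (natCast_le_infty n)).contDiffAt
  have h := (contDiffOn_integral_and_iteratedFDeriv (μ := volume) isOpen_univ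
    (fun ζ η => waveE ζ x * g ζ η) (fun ζ => (contDiff_const.mul (hg.smooth ζ)).contDiffOn)
    (fun n η _ => ?_) (fun n η₀ _ => ?_)).2 b η trivial
  · rw [show symOf g x = fun η => ∫ ζ, waveE ζ x * g ζ η from funext fun η => symOf_eq g x η, h,
      fourierInv_eq_waveE]
    simp only [hfd]
  · simp only [hfd]
    exact ((continuous_waveE.comp (f := fun ζ : E3 => (ζ, x)) (by fun_prop)).smul
      ((hg.continuous_iteratedFDeriv n).comp (f := fun ζ : E3 => (ζ, η))
        (by fun_prop))).aestronglyMeasurable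
  · obtain ⟨C, hC⟩ := hg.bound n 4
    have hcw : Continuous (fun η : E3 => C * (1 + ‖η‖) ^ (p - (n : ℤ))) := by
      refine continuous_const.mul (Continuous.zpow₀ (by fun_prop) _ fun q => ?_)
      exact Or.inl (weight_pos _).ne'
    obtain ⟨ε, hε, h⟩ := Metric.eventually_nhds_iff_ball.1
      (hcw.continuousAt.eventually_lt (continuousAt_const (y := C * (1 + ‖η₀‖) ^
        (p - (n : ℤ)) + 1)) (lt_add_one _))
    refine ⟨ε, hε, fun ζ => (C * (1 + ‖η₀‖) ^ (p - (n : ℤ)) + 1) * ((1 + ‖ζ‖) ^ 4)⁻¹,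
      integrable_weight_inv.const_mul _, Filter.Eventually.of_forall fun ζ η hη _ => ?_⟩
    rw [hfd, norm_smul, norm_waveE, one_mul]
    exact le_mul_inv_pow ((hC ζ η).trans (h η hη).le)

theorem contDiff_symOf (hg : IsRS p g) :
    ContDiff ℝ ∞ (fun q : E3 × E3 => symOf g q.1 q.2) := by
  set F : E3 → E3 × E3 → ℂ := fun ζ q => waveE ζ q.1 * g ζ q.2 with hF
  have hsnd : ∀ ζ, ContDiff ℝ ∞ fun q : E3 × E3 => g ζ q.2 :=
    fun ζ => (hg.smooth ζ).comp contDiff_snd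
  have hsm : ∀ ζ, ContDiff ℝ ∞ (F ζ) := fun ζ => (contDiff_waveE ζ).mul (hsnd ζ)
  have hFc : Continuous fun r : E3 × (E3 × E3) => F r.1 r.2 :=
    (continuous_waveE.comp (f := fun r : E3 × (E3 × E3) => (r.1, r.2.1)) (by fun_prop)).mul
      (hg.cont.comp (f := fun r : E3 × (E3 × E3) => (r.1, r.2.2)) (by fun_prop))
  -- the bound for the derivatives of the integrand
  have hbd : ∀ n : ℕ, ∃ C : ℝ, 0 ≤ C ∧ ∀ (ζ : E3) (q : E3 × E3), ‖iteratedFDeriv ℝ n (F ζ) q‖ ≤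
      C * (1 + ‖q.2‖) ^ p.natAbs * ((1 + ‖ζ‖) ^ 4)⁻¹ := by
    intro n
    choose C hC0 hC using fun b => hg.bound' b (n + 4)
    have hpi := Real.pi_pos
    refine ⟨∑ i ∈ Finset.range (n + 1), (n.choose i : ℝ) * (2 * Real.pi) ^ i * C (n - i),
      Finset.sum_nonneg fun i _ => by have := hC0 (n - i); positivity, fun ζ q => ?_⟩
    refine le_mul_inv_pow ?_
    refine (mul_le_mul_of_nonneg_left (norm_iteratedFDeriv_mul_le (contDiff_waveE ζ) (hsnd ζ) q
      (natCast_le_infty n)) (pow_nonneg (weight_pos ζ).le 4)).trans ?_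
    rw [Finset.sum_mul, Finset.mul_sum]
    refine Finset.sum_le_sum fun i hi => ?_
    have hi' : i ≤ n := Nat.lt_succ_iff.1 (Finset.mem_range.1 hi)
    have h1 := norm_iteratedFDeriv_waveE_le ζ i q
    have h2 : ‖iteratedFDeriv ℝ (n - i) (fun q : E3 × E3 => g ζ q.2) q‖
        ≤ ‖iteratedFDeriv ℝ (n - i) (g ζ) q.2‖ := by
      refine (norm_iteratedFDeriv_comp_clm_le (hg.smooth ζ)
        (ContinuousLinearMap.snd ℝ E3 E3) (n - i) q).trans ?_
      refine mul_le_of_le_one_right (norm_nonneg _) (pow_le_one₀ (norm_nonneg _) ?_)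
      exact ContinuousLinearMap.norm_snd_le ..
    have h3 := hC (n - i) ζ q.2
    have h4 : (1 + ‖q.2‖) ^ (p - ((n - i : ℕ) : ℤ)) ≤ (1 + ‖q.2‖) ^ p.natAbs := by
      rw [← zpow_natCast]
      exact weight_zpow_mono (by omega) _
    have hz := weight_pos ζ
    have hq := weight_pos q.2
    have hCi := hC0 (n - i)
    set X := ‖iteratedFDeriv ℝ (n - i) (g ζ) q.2‖
    calc (1 + ‖ζ‖) ^ 4 * ((n.choose i : ℝ) * ‖iteratedFDeriv ℝ i (fun q : E3 × E3 =>
            waveE ζ q.1) q‖ * ‖iteratedFDeriv ℝ (n - i) (fun q : E3 × E3 => g ζ q.2) q‖)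
        ≤ (1 + ‖ζ‖) ^ 4 * ((n.choose i : ℝ) * (2 * Real.pi * (1 + ‖ζ‖)) ^ i * X) := by gcongr
      _ = (n.choose i : ℝ) * (2 * Real.pi) ^ i * ((1 + ‖ζ‖) ^ (i + 4) * X) := by
        rw [mul_pow, pow_add]
        ring
      _ ≤ (n.choose i : ℝ) * (2 * Real.pi) ^ i * ((1 + ‖ζ‖) ^ (n + 4) * X) := by
        gcongr
        exact one_le_weight ζ
      _ ≤ (n.choose i : ℝ) * (2 * Real.pi) ^ i * (C (n - i) * (1 + ‖q.2‖) ^ p.natAbs) := by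
        refine mul_le_mul_of_nonneg_left (h3.trans (mul_le_mul_of_nonneg_left h4 hCi)) ?_
        positivity
      _ = _ := by ring
  have hcw : ∀ (C : ℝ), Continuous (fun q : E3 × E3 => C * (1 + ‖q.2‖) ^ p.natAbs) := by
    intro C
    fun_prop
  have hcd : ∀ n, Continuous fun r : E3 × (E3 × E3) => iteratedFDeriv ℝ n (F r.1) r.2 := by
    intro n
    have := continuousOn_iteratedFDeriv_family (A := E3) isOpen_univ F
      (fun ζ => (hsm ζ).contDiffOn) hFc.continuousOn ?_ n
    · simpa [continuousOn_univ] using this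
    · intro n ζ₀ q₀ _
      obtain ⟨C, hC0, hC⟩ := hbd n
      refine ⟨C * (1 + ‖q₀.2‖) ^ p.natAbs + 1, ?_⟩
      filter_upwards [((hcw C).comp continuous_snd).continuousAt.eventually_lt
        (continuousAt_const (y := C * (1 + ‖q₀.2‖) ^ p.natAbs + 1)) (lt_add_one _)] with r hr
      refine (hC r.1 r.2).trans (le_trans (mul_le_of_le_one_right ?_ ?_) hr.le)
      · have := weight_pos r.2.2
        positivity
      · exact inv_le_one_of_one_le₀ (one_le_pow₀ (one_le_weight _))
  have h := (contDiffOn_integral_and_iteratedFDeriv (μ := volume) isOpen_univ F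
    (fun ζ => (hsm ζ).contDiffOn) (fun n q _ => ((hcd n).comp
      (f := fun ζ : E3 => (ζ, q)) (by fun_prop)).aestronglyMeasurable) (fun n q₀ _ => ?_)).1
  · have h' := contDiffOn_univ.1 h
    convert h' using 2 with q
    exact symOf_eq g _ _
  · obtain ⟨C, hC0, hC⟩ := hbd n
    obtain ⟨ε, hε, h⟩ := Metric.eventually_nhds_iff_ball.1
      ((hcw C).continuousAt.eventually_lt (continuousAt_const
        (y := C * (1 + ‖q₀.2‖) ^ p.natAbs + 1)) (lt_add_one _))
    refine ⟨ε, hε, fun ζ => (C * (1 + ‖q₀.2‖) ^ p.natAbs + 1) * ((1 + ‖ζ‖) ^ 4)⁻¹,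
      integrable_weight_inv.const_mul _, Filter.Eventually.of_forall fun ζ q hq _ => ?_⟩
    exact (hC ζ q).trans (mul_le_mul_of_nonneg_right (h q hq).le
      (inv_nonneg.2 (pow_nonneg (weight_pos ζ).le 4)))

theorem isSymbol_symOf (hg : IsRS p g) : IsSymbol p (symOf g) := by
  refine ⟨hg.contDiff_symOf, fun a b => ?_⟩
  obtain ⟨C, hC⟩ := hg.bound b (a + 4)
  refine ⟨(2 * Real.pi) ^ a * ((a + 1) * weightConst) * C, fun x η => ?_⟩
  have h1 : mixedDeriv (symOf g) a b x η
      = iteratedFDeriv ℝ a (𝓕⁻ (fun ζ => iteratedFDeriv ℝ b (g ζ) η)) x := by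
    unfold mixedDeriv
    congr 1
    funext x'
    exact hg.iteratedFDeriv_symOf b x' η
  rw [h1, mul_assoc]
  exact norm_iteratedFDeriv_fourierInv_le ((hg.continuous_iteratedFDeriv b).comp
    (f := fun ζ : E3 => (ζ, η)) (by fun_prop)) a (fun ζ => hC ζ η) x

end IsRS

/-- The terms of an expansion on the Fourier side give, at each position, functions in `homSym p n`.
-/
theorem symOf_mem_homSym {p : ℤ} {n : ℕ} {A : E3 → E3 → ℂ} (hA : A ∈ homRap p n) (x : E3) :
    symOf A x ∈ homSym p n := by
  induction hA using Submodule.span_induction with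
  | mem A h =>
    obtain ⟨c, f, hc, hf, rfl⟩ := h
    have : symOf (fun ζ η => c ζ * f η) x = (∫ ζ, waveE ζ x * c ζ) • f := by
      funext η
      rw [symOf_eq]
      simp only [← mul_assoc]
      exact integral_mul_const _ _
    rw [this]
    exact Submodule.smul_mem _ _ hf
  | zero =>
    have : symOf 0 x = 0 := by
      funext η
      simp [symOf_eq]
    rw [this]
    exact Submodule.zero_mem _
  | add A B hA' hB' hA hB =>
    change symOf (fun ζ η => A ζ η + B ζ η) x ∈ _
    rw [(isRS_of_mem_homRap hA').symOf_add (isRS_of_mem_homRap hB')]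
    exact Submodule.add_mem _ hA hB
  | smul r A _ hA =>
    have : symOf (r • A) x = r • symOf A x := by
      funext η
      simp only [symOf_eq, Pi.smul_apply, smul_eq_mul, mul_left_comm _ r]
      exact integral_const_mul r _
    rw [this]
    exact Submodule.smul_mem _ r hA

/-- An expansion on the Fourier side gives one of the symbol, by functions that satisfy the
orthogonality constraints. -/
theorem HasExpansion.exists_isHomogeneousExpansion {p : ℤ} {g : E3 → E3 → ℂ}
    (hg : HasExpansion p 0 g) :
    ∃ t : ℕ → E3 → E3 → ℂ, IsHomogeneousExpansion p (symOf g) t ∧ OrthogonalityConstraints t := by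
  have hgR := hg.isRS
  obtain ⟨t, ht, -, htN⟩ := hg
  have htR : ∀ n : ℕ, IsRS (p - n) (t n) := fun n => isRS_of_mem_homRap (ht n)
  refine ⟨fun n => symOf (t n), ⟨fun n => (htR n).isSymbol_symOf, ⟨1, fun n x η r hη hr => ?_⟩,
    fun N => ?_⟩, fun n l m _ h x r _ => ?_⟩
  · change symOf (t n) x (r • η) = _ * symOf (t n) x η
    rw [homogeneous_of_mem_homSym (symOf_mem_homSym (ht n) x) r η hη hr]
    push_cast
    rfl
  · have hs : IsRS p (fun ζ η => ∑ n ∈ Finset.range N, t n ζ η) :=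
      IsRS.sum _ fun n _ => (htR n).mono (by omega)
    have h1 := (htN N).isSymbol_symOf
    rw [hgR.symOf_sub hs, IsRS.symOf_sum (p := p) _ fun n _ => (htR n).mono (by omega)] at h1
    exact h1
  · refine orthogonality_of_mem_homSym (symOf_mem_homSym (ht n) x) ?_ r
    refine h.imp_left fun h => ?_
    have : Odd (((n : ℤ) - l) + 2 * l) := h.add_even (even_two_mul _)
    rw [show ((n : ℤ) - l) + 2 * l = ((n + l : ℕ) : ℤ) by push_cast; ring] at this
    exact_mod_cast this

/-! ### The composition formula -/

/-- The integral over `θ` in `symOf (twist g h)` is an inverse Fourier transform of `g`, at a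
shifted dual variable. -/
theorem symOf_twist {p q : ℤ} {g h : E3 → E3 → ℂ} (hg : IsRS p g) (hh : IsRS q h) (x η : E3) :
    symOf (twist g h) x η
      = ∫ ζ, waveE ζ x * symOf g x (η + (2 * Real.pi) • ζ) * h ζ η := by
  have hint : Integrable (Function.uncurry fun θ ζ : E3 =>
      waveE θ x * (g (θ - ζ) (η + (2 * Real.pi) • ζ) * h ζ η)) (volume.prod volume) := by
    obtain ⟨C, hC⟩ := twist_integrand_bound hg hh 0 4 4
    have hi := (integrable_weight_inv.mul_prod integrable_weight_inv).const_mul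
      (C * (1 + ‖η‖) ^ (p + q - ((0 : ℕ) : ℤ)))
    refine hi.mono' (Continuous.aestronglyMeasurable ?_) (Filter.Eventually.of_forall fun r => ?_)
    · exact (continuous_waveE.comp (f := fun r : E3 × E3 => (r.1, x)) (by fun_prop)).mul
        ((hg.continuous_twist_integrand hh).comp (f := fun r : E3 × E3 => (r, η)) (by fun_prop))
    · have h1 := hC r.1 r.2 η
      rw [norm_iteratedFDeriv_zero, mul_assoc] at h1
      have h2 := le_mul_inv_pow (le_mul_inv_pow h1)
      simp only [Function.uncurry]
      rw [norm_mul, norm_waveE, one_mul]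
      refine (le_mul_inv_pow (le_mul_inv_pow (C := C * (1 + ‖η‖) ^ (p + q - ((0 : ℕ) : ℤ)))
        (ζ := r.1) (k := 4) (by exact h1))).trans (le_of_eq (by ring))
  have e1 : symOf (twist g h) x η = ∫ θ, ∫ ζ,
      waveE θ x * (g (θ - ζ) (η + (2 * Real.pi) • ζ) * h ζ η) := by
    rw [symOf_eq]
    congr 1
    funext θ
    exact (integral_const_mul _ _).symm
  rw [e1, integral_integral_swap hint]
  congr 1
  funext ζ
  have e2 : (fun θ => waveE θ x * (g (θ - ζ) (η + (2 * Real.pi) • ζ) * h ζ η))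
      = fun θ => (fun θ' => waveE ζ x * (waveE θ' x * g θ' (η + (2 * Real.pi) • ζ)) * h ζ η)
        (θ - ζ) := by
    funext θ
    have : waveE θ x = waveE ζ x * waveE (θ - ζ) x := by
      rw [← waveE_add_left]
      simp
    simp only [this]
    ring
  rw [e2, integral_sub_right_eq_self (fun θ' => waveE ζ x *
    (waveE θ' x * g θ' (η + (2 * Real.pi) • ζ)) * h ζ η), integral_mul_const, integral_const_mul,
    symOf_eq]

/-- The threshold is `-4` because `(1 + |ξ|)^{-4}` is integrable in dimension three. -/
theorem IsSymbol.integrable {p : ℤ} {s : E3 → E3 → ℂ} (hs : IsSymbol p s) (hp : p ≤ -4) (x : E3) :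
    Integrable (s x) := by
  obtain ⟨C, hC⟩ := hs.2 0 0
  have hcont : Continuous (s x) :=
    hs.1.continuous.comp (f := fun ξ : E3 => (x, ξ)) (by fun_prop)
  have hbd : ∀ ξ, ‖s x ξ‖ ≤ |C| * ((1 + ‖ξ‖) ^ 4)⁻¹ := by
    intro ξ
    have h1 := hC x ξ
    simp only [mixedDeriv] at h1
    rw [norm_iteratedFDeriv_zero, norm_iteratedFDeriv_zero] at h1
    refine (le_abs_mul_of_le (weight_zpow_pos _ _).le h1).trans ?_
    refine mul_le_mul_of_nonneg_left ?_ (abs_nonneg C)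
    refine (weight_zpow_mono (n := -4) (by omega) ξ).trans (le_of_eq ?_)
    rw [zpow_neg]
    rfl
  exact (integrable_weight_inv.const_mul |C|).mono' hcont.aestronglyMeasurable
    (Filter.Eventually.of_forall hbd)

/-- The composite symbol converges absolutely and is given, on the Fourier side, by the twisted
convolution. -/
theorem symbolComp_symOf {p q : ℤ} {g h r : E3 → E3 → ℂ} (hg : IsRS p g) (hp : p ≤ -4)
    (hh : IsRS q h) (hr : ∀ η, Integrable fun y => r y η)
    (hrh : ∀ ζ η, 𝓕 (fun y => r y η) ζ = h ζ η) :
    CompConverges (symOf g) r ∧ symbolComp (symOf g) r = symOf (twist g h) := by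
  have hconv : CompConverges (symOf g) r := by
    intro x η
    have h1 := (hg.isSymbol_symOf.integrable hp x).mul_prod (hr η)
    have hph : Continuous fun q : E3 × E3 =>
        Complex.exp (Complex.I * ((inner ℝ (x - q.2) (q.1 - η) : ℝ) : ℂ)) := by fun_prop
    refine Integrable.mono (g := fun q : E3 × E3 => symOf g x q.1 * r q.2 η) h1 ?_
      (Filter.Eventually.of_forall fun q => ?_)
    · have := hph.aestronglyMeasurable.mul h1.1
      refine this.congr (Filter.Eventually.of_forall fun q => ?_)
      simp only [compIntegrand, Pi.mul_apply]
      ring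
    · rw [compIntegrand, mul_assoc, norm_mul, mul_comm Complex.I, Complex.norm_exp_ofReal_mul_I,
        one_mul]
  refine ⟨hconv, ?_⟩
  funext x η
  have hpi : (2 * Real.pi) ≠ 0 := by positivity
  rw [symbolComp, symOf_twist hg hh, Measure.volume_eq_prod, integral_prod _ (hconv x η)]
  -- the integral over `y` is a Fourier transform
  have e1 : ∀ ξ, ∫ y, compIntegrand (symOf g) r x η (ξ, y) =
      (fun ζ => waveE ζ x * symOf g x (η + (2 * Real.pi) • ζ) * h ζ η)
        ((2 * Real.pi)⁻¹ • (ξ - η)) := by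
    intro ξ
    simp only
    rw [smul_smul, mul_inv_cancel₀ hpi, one_smul, add_sub_cancel, ← hrh, fourier_eq_waveE,
      ← integral_const_mul]
    congr 1
    funext y
    have h1 : Complex.exp (Complex.I * ((inner ℝ (x - y) (ξ - η) : ℝ) : ℂ))
        = waveE ((2 * Real.pi)⁻¹ • (ξ - η)) x * waveE y (-((2 * Real.pi)⁻¹ • (ξ - η))) := by
      simp only [waveE, ← Complex.exp_add]
      congr 1
      rw [← add_mul, ← Complex.ofReal_add, mul_comm]
      congr 2
      rw [inner_smul_left, inner_neg_right, inner_smul_right, inner_sub_left,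
        real_inner_comm x]
      simp
      field_simp
      ring
    simp only [compIntegrand, smul_eq_mul]
    rw [h1]
    ring
  simp only [e1]
  set Φ : E3 → ℂ := fun ζ => waveE ζ x * symOf g x (η + (2 * Real.pi) • ζ) * h ζ η
  rw [integral_sub_right_eq_self (fun ξ => Φ ((2 * Real.pi)⁻¹ • ξ)),
    Measure.integral_comp_smul]
  simp only [finrank_euclideanSpace, Fintype.card_fin, Complex.real_smul]
  rw [← mul_assoc]
  have h2 : (((2 * Real.pi) ^ 3 : ℝ) : ℂ)⁻¹ * ((|(((2 * Real.pi)⁻¹) ^ 3)⁻¹| : ℝ) : ℂ) = 1 := by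
    rw [abs_of_nonneg (by positivity), inv_pow, inv_inv]
    exact inv_mul_cancel₀ (by exact_mod_cast pow_ne_zero 3 hpi)
  rw [h2, one_mul]

/-! ### The regularized Coulomb potential -/

/-- A set of smooth rapidly decreasing functions that is closed under differentiation consists of
functions all of whose derivatives decrease rapidly. -/
theorem decay_of_forall_dirD {S : Set (E3 → ℂ)} (hs : ∀ f ∈ S, ContDiff ℝ ∞ f)
    (hd : ∀ f ∈ S, ∀ v, dirD v f ∈ S)
    (hb : ∀ f ∈ S, ∀ k : ℕ, ∃ C : ℝ, ∀ w, (1 + ‖w‖) ^ k * ‖f w‖ ≤ C) (n : ℕ) :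
    ∀ f ∈ S, ∀ k : ℕ, ∃ C : ℝ, ∀ w, (1 + ‖w‖) ^ k * ‖iteratedFDeriv ℝ n f w‖ ≤ C := by
  induction n with
  | zero => simpa only [norm_iteratedFDeriv_zero] using hb
  | succ n ih =>
    intro f hf k
    choose C hC using fun i => ih _ (hd f hf (stdE i)) k
    refine ⟨∑ i, C i, fun w => ?_⟩
    refine (mul_le_mul_of_nonneg_left (norm_iteratedFDeriv_succ_le_sum (hs f hf) n w)
      (pow_nonneg (weight_pos w).le k)).trans ?_
    rw [Finset.mul_sum]
    exact Finset.sum_le_sum fun i _ => hC i w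

theorem isSym_of_decay {f : E3 → ℂ} (hf : ContDiff ℝ ∞ f)
    (h : ∀ n k : ℕ, ∃ C : ℝ, ∀ w, (1 + ‖w‖) ^ k * ‖iteratedFDeriv ℝ n f w‖ ≤ C) (m : ℤ) :
    IsSym m f := by
  refine ⟨hf, fun b => ?_⟩
  obtain ⟨C, hC⟩ := h b (m - b).natAbs
  refine ⟨|C|, fun η => ?_⟩
  refine (le_mul_inv_pow ((hC η).trans (le_abs_self C))).trans ?_
  refine mul_le_mul_of_nonneg_left ?_ (abs_nonneg C)
  rw [← zpow_natCast, ← zpow_neg]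
  exact weight_zpow_mono (by omega) η

/-- The function `t ↦ e^{-t}`, the profile of the Gaussian as a function of `|w|²`. -/
def expNeg (t : ℝ) : ℂ := ((Real.exp (-t) : ℝ) : ℂ)

theorem contDiff_expNeg : ContDiff ℝ ∞ expNeg :=
  Complex.ofRealCLM.contDiff.comp (Real.contDiff_exp.comp contDiff_neg)

theorem deriv_expNeg (t : ℝ) : deriv expNeg t = -expNeg t := by
  have h : HasDerivAt (fun t : ℝ => Real.exp (-t)) (Real.exp (-t) * -1) t :=
    (hasDerivAt_neg t).exp
  have h' := h.ofReal_comp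
  refine h'.deriv.trans ?_
  simp [expNeg]

/-- The Gaussian `e^{-|w|²}`. -/
def gauss (w : E3) : ℂ := expNeg (‖w‖ ^ 2)

theorem norm_gauss (w : E3) : ‖gauss w‖ = Real.exp (-‖w‖ ^ 2) := by
  rw [gauss, expNeg, Complex.norm_real, Real.norm_of_nonneg (Real.exp_pos _).le]

theorem contDiff_gauss : ContDiff ℝ ∞ gauss := contDiff_radial contDiff_expNeg

/-- Products of polynomials with the Gaussian. -/
def gaussSpan : Submodule ℂ (E3 → ℂ) :=
  Submodule.span ℂ (range fun a : ℕ × ℕ × ℕ => fun w => gauss w * sphMono a.1 a.2.1 a.2.2 w)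

theorem norm_sphMono_le (a b c : ℕ) (w : E3) :
    ‖sphMono a b c w‖ ≤ (2 * (1 + ‖w‖)) ^ (a + b + c) := by
  have hc : ∀ i, ‖((w i : ℝ) : ℂ)‖ ≤ 1 + ‖w‖ := fun i => by
    rw [Complex.norm_real]
    linarith [PiLp.norm_apply_le w i]
  have h0 : ‖(w 0 : ℂ) + Complex.I * (w 1 : ℂ)‖ ≤ 2 * (1 + ‖w‖) := by
    refine (norm_add_le _ _).trans ?_
    rw [norm_mul, Complex.norm_I]
    linarith [hc 0, hc 1]
  have h1 : ‖(w 0 : ℂ) - Complex.I * (w 1 : ℂ)‖ ≤ 2 * (1 + ‖w‖) := by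
    refine (norm_sub_le _ _).trans ?_
    rw [norm_mul, Complex.norm_I]
    linarith [hc 0, hc 1]
  have h2 : ‖(w 2 : ℂ)‖ ≤ 2 * (1 + ‖w‖) := by linarith [hc 2, weight_pos w]
  rw [sphMono, norm_mul, norm_mul, norm_pow, norm_pow, norm_pow, pow_add, pow_add]
  gcongr

theorem exists_weight_pow_mul_exp_le (k : ℕ) :
    ∃ C : ℝ, ∀ w : E3, (1 + ‖w‖) ^ k * Real.exp (-‖w‖ ^ 2) ≤ C := by
  refine ⟨(k.factorial : ℝ) * Real.exp (1 + 1), fun w => ?_⟩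
  have h1 : (1 + ‖w‖) ^ k ≤ k.factorial * Real.exp (1 + ‖w‖) := by
    have := Real.pow_div_factorial_le_exp (1 + ‖w‖) (weight_pos w).le k
    rwa [div_le_iff₀' (by positivity)] at this
  calc (1 + ‖w‖) ^ k * Real.exp (-‖w‖ ^ 2)
      ≤ k.factorial * Real.exp (1 + ‖w‖) * Real.exp (-‖w‖ ^ 2) := by gcongr
    _ = k.factorial * Real.exp (1 + ‖w‖ - ‖w‖ ^ 2) := by
      rw [mul_assoc, ← Real.exp_add]
      ring_nf
    _ ≤ _ := by
      gcongr
      nlinarith [sq_nonneg (‖w‖ - 1 / 2)]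

theorem contDiff_of_mem_gaussSpan {f : E3 → ℂ} (hf : f ∈ gaussSpan) : ContDiff ℝ ∞ f := by
  induction hf using Submodule.span_induction with
  | mem f h =>
    obtain ⟨a, rfl⟩ := h
    exact contDiff_gauss.mul (contDiff_sphMono _ _ _)
  | zero => exact contDiff_const
  | add f g _ _ hf hg => exact hf.add hg
  | smul r f _ hf => exact contDiff_const.smul hf

theorem dirD_mem_gaussSpan {f : E3 → ℂ} (hf : f ∈ gaussSpan) (v : E3) : dirD v f ∈ gaussSpan := by
  have hgen : ∀ a b c : ℕ, (fun w => gauss w * sphMono a b c w) ∈ gaussSpan := fun a b c =>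
    Submodule.subset_span ⟨(a, b, c), rfl⟩
  induction hf using Submodule.span_induction with
  | mem f h =>
    obtain ⟨⟨a, b, c⟩, rfl⟩ := h
    have : dirD v (fun w => gauss w * sphMono a b c w)
        = (a * sphMono 1 0 0 v) • (fun w => gauss w * sphMono (a - 1) b c w)
        + (b * sphMono 0 1 0 v) • (fun w => gauss w * sphMono a (b - 1) c w)
        + (c * sphMono 0 0 1 v) • (fun w => gauss w * sphMono a b (c - 1) w)
        + (-sphMono 0 1 0 v) • (fun w => gauss w * sphMono (a + 1) b c w)
        + (-sphMono 1 0 0 v) • (fun w => gauss w * sphMono a (b + 1) c w)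
        + (-2 * sphMono 0 0 1 v) • (fun w => gauss w * sphMono a b (c + 1) w) := by
      funext w
      have h1 : dirD v (fun w => gauss w * sphMono a b c w) w
          = gauss w * dirD v (sphMono a b c) w + dirD v gauss w * sphMono a b c w := by
        have := fderiv_fun_mul (𝕜 := ℝ) (contDiff_gauss.differentiable (by simp) w)
          ((contDiff_sphMono a b c).differentiable (by simp) w)
        simp [dirD, this]
        ring
      have h2 : dirD v gauss w = -gauss w * (sphMono 0 1 0 v * sphMono 1 0 0 w
          + sphMono 1 0 0 v * sphMono 0 1 0 w + 2 * sphMono 0 0 1 v * sphMono 0 0 1 w) := by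
        have := dirD_radial contDiff_expNeg v w
        rw [deriv_expNeg] at this
        exact this
      rw [h1, h2, dirD_sphMono]
      simp only [Pi.add_apply, Pi.smul_apply, smul_eq_mul]
      simp only [sphMono, pow_succ, pow_zero]
      ring
    change dirD v (fun w => gauss w * sphMono a b c w) ∈ _
    rw [this]
    exact Submodule.add_mem _ (Submodule.add_mem _ (Submodule.add_mem _ (Submodule.add_mem _
      (Submodule.add_mem _ (Submodule.smul_mem _ _ (hgen _ _ _))
      (Submodule.smul_mem _ _ (hgen _ _ _))) (Submodule.smul_mem _ _ (hgen _ _ _)))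
      (Submodule.smul_mem _ _ (hgen _ _ _))) (Submodule.smul_mem _ _ (hgen _ _ _)))
      (Submodule.smul_mem _ _ (hgen _ _ _))
  | zero =>
    have : dirD v (0 : E3 → ℂ) = 0 := by
      funext w
      simp [dirD]
    rw [this]
    exact Submodule.zero_mem _
  | add f g hf' hg' hf hg =>
    have : dirD v (f + g) = dirD v f + dirD v g := by
      funext w
      have := fderiv_add (𝕜 := ℝ) ((contDiff_of_mem_gaussSpan hf').differentiable (by simp) w)
        ((contDiff_of_mem_gaussSpan hg').differentiable (by simp) w)
      simp [dirD, this]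
    rw [this]
    exact Submodule.add_mem _ hf hg
  | smul r f hf' hf =>
    have : dirD v (r • f) = r • dirD v f := by
      funext w
      have := fderiv_const_smul (𝕜 := ℝ)
        ((contDiff_of_mem_gaussSpan hf').differentiable (by simp) w) r
      simp [dirD, this]
    rw [this]
    exact Submodule.smul_mem _ r hf

theorem decay_of_mem_gaussSpan {f : E3 → ℂ} (hf : f ∈ gaussSpan) (k : ℕ) :
    ∃ C : ℝ, ∀ w, (1 + ‖w‖) ^ k * ‖f w‖ ≤ C := by
  induction hf using Submodule.span_induction with
  | mem f h =>
    obtain ⟨⟨a, b, c⟩, rfl⟩ := h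
    obtain ⟨C, hC⟩ := exists_weight_pow_mul_exp_le (k + (a + b + c))
    refine ⟨2 ^ (a + b + c) * C, fun w => ?_⟩
    simp only [norm_mul, norm_gauss]
    calc (1 + ‖w‖) ^ k * (Real.exp (-‖w‖ ^ 2) * ‖sphMono a b c w‖)
        ≤ (1 + ‖w‖) ^ k * (Real.exp (-‖w‖ ^ 2) * (2 * (1 + ‖w‖)) ^ (a + b + c)) := by
          have := weight_pos w
          gcongr
          exact norm_sphMono_le a b c w
      _ = 2 ^ (a + b + c) * ((1 + ‖w‖) ^ (k + (a + b + c)) * Real.exp (-‖w‖ ^ 2)) := by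
        rw [mul_pow, pow_add]
        ring
      _ ≤ _ := mul_le_mul_of_nonneg_left (hC w) (by positivity)
  | zero => exact ⟨0, fun w => by simp⟩
  | add f g _ _ hf hg =>
    obtain ⟨C, hC⟩ := hf
    obtain ⟨D, hD⟩ := hg
    refine ⟨C + D, fun w => ?_⟩
    refine (mul_le_mul_of_nonneg_left (norm_add_le _ _) (pow_nonneg (weight_pos w).le k)).trans ?_
    rw [mul_add]
    exact add_le_add (hC w) (hD w)
  | smul r f _ hf =>
    obtain ⟨C, hC⟩ := hf
    refine ⟨‖r‖ * C, fun w => ?_⟩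
    rw [Pi.smul_apply, norm_smul, mul_left_comm]
    exact mul_le_mul_of_nonneg_left (hC w) (norm_nonneg r)

theorem decay_gauss (n k : ℕ) :
    ∃ C : ℝ, ∀ w, (1 + ‖w‖) ^ k * ‖iteratedFDeriv ℝ n gauss w‖ ≤ C := by
  refine decay_of_forall_dirD (S := gaussSpan) (fun f hf => contDiff_of_mem_gaussSpan hf)
    (fun f hf v => dirD_mem_gaussSpan hf v) (fun f hf k => decay_of_mem_gaussSpan hf k) n gauss
    ?_ k
  refine Submodule.subset_span ⟨(0, 0, 0), ?_⟩
  funext w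
  simp [sphMono]

/-- The part `(2/√π) ∫_I e^{-s²|z|²} ds` of `1/|z| = (2/√π) ∫₀^∞ e^{-s²|z|²} ds`. -/
def coulombPart (I : Set ℝ) (z : E3) : ℂ :=
  ((2 / Real.sqrt Real.pi : ℝ) : ℂ) * ∫ s in I, gauss (s • z)

/-- The part of the Coulomb potential that is singular at the origin; it decreases rapidly. -/
def coulombShort : E3 → ℂ := coulombPart (Ioi 1)

/-- The smooth part of the Coulomb potential. -/
def coulombLong : E3 → ℂ := coulombPart (Ioc 0 1)

theorem gauss_smul (s : ℝ) (z : E3) : gauss (s • z) = ((Real.exp (-‖z‖ ^ 2 * s ^ 2) : ℝ) : ℂ) := by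
  rw [gauss, expNeg, norm_smul, mul_pow, Real.norm_eq_abs, sq_abs]
  ring_nf

theorem integrableOn_gauss_smul {z : E3} (hz : z ≠ 0) :
    IntegrableOn (fun s : ℝ => gauss (s • z)) (Ioi 0) := by
  simp only [gauss_smul]
  have h := integrable_exp_neg_mul_sq (b := ‖z‖ ^ 2) (pow_pos (norm_pos_iff.2 hz) 2)
  exact h.integrableOn.ofReal

theorem coulombShort_add_coulombLong {z : E3} (hz : z ≠ 0) :
    coulombShort z + coulombLong z = ((‖z‖⁻¹ : ℝ) : ℂ) := by
  have hi := integrableOn_gauss_smul hz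
  have h1 : ∫ s in Ioi (0 : ℝ), gauss (s • z)
      = (∫ s in Ioc (0 : ℝ) 1, gauss (s • z)) + ∫ s in Ioi (1 : ℝ), gauss (s • z) := by
    rw [← setIntegral_union (Ioc_disjoint_Ioi le_rfl) measurableSet_Ioi
      (hi.mono_set Ioc_subset_Ioi_self) (hi.mono_set (Ioi_subset_Ioi zero_le_one)),
      Ioc_union_Ioi_eq_Ioi zero_le_one]
  have h2 : ∫ s in Ioi (0 : ℝ), gauss (s • z) = ((Real.sqrt (Real.pi / ‖z‖ ^ 2) / 2 : ℝ) : ℂ) := by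
    rw [← integral_gaussian_Ioi]
    simp only [gauss_smul]
    exact integral_ofReal
  have hpi : Real.sqrt Real.pi ≠ 0 := (Real.sqrt_pos.2 Real.pi_pos).ne'
  rw [coulombShort, coulombLong, coulombPart, coulombPart, ← mul_add,
    add_comm (∫ s in Ioi (1 : ℝ), gauss (s • z)), ← h1, h2, ← Complex.ofReal_mul,
    Real.sqrt_div Real.pi_pos.le, Real.sqrt_sq (norm_nonneg z)]
  congr 1
  field_simp

theorem iteratedFDeriv_gauss_smul (n : ℕ) (s : ℝ) (z : E3) :
    iteratedFDeriv ℝ n (fun z => gauss (s • z)) z = s ^ n • iteratedFDeriv ℝ n gauss (s • z) :=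
  congrFun (iteratedFDeriv_comp_const_smul s (contDiff_gauss.of_le (natCast_le_infty n))) z

theorem continuous_iteratedFDeriv_gauss_smul (n : ℕ) (z : E3) :
    Continuous fun s : ℝ => iteratedFDeriv ℝ n (fun z => gauss (s • z)) z := by
  simp only [iteratedFDeriv_gauss_smul]
  exact (continuous_pow n).smul
    ((contDiff_gauss.continuous_iteratedFDeriv (natCast_le_infty n)).comp
    (f := fun s : ℝ => s • z) (by fun_prop))

theorem contDiff_gauss_smul (s : ℝ) : ContDiff ℝ ∞ fun z => gauss (s • z) :=
  contDiff_gauss.comp (contDiff_const_smul s)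

/-- The dilations `s ≤ 1` of the Gaussian have uniformly bounded derivatives. -/
theorem coulombLong_spec : ContDiff ℝ ∞ coulombLong ∧
    ∀ n : ℕ, ∃ C : ℝ, ∀ z, ‖iteratedFDeriv ℝ n coulombLong z‖ ≤ C := by
  have hb : ∀ n : ℕ, ∃ C : ℝ, ∀ s ∈ Ioc (0 : ℝ) 1, ∀ z : E3,
      ‖iteratedFDeriv ℝ n (fun z => gauss (s • z)) z‖ ≤ C := by
    intro n
    obtain ⟨C, hC⟩ := decay_gauss n 0
    refine ⟨C, fun s hs z => ?_⟩
    rw [iteratedFDeriv_gauss_smul, norm_smul, norm_pow, Real.norm_of_nonneg hs.1.le]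
    have h1 := hC (s • z)
    rw [pow_zero, one_mul] at h1
    exact (mul_le_of_le_one_left (norm_nonneg _) (pow_le_one₀ hs.1.le hs.2)).trans h1
  obtain ⟨h1, h2⟩ := contDiffOn_integral_and_iteratedFDeriv (μ := volume.restrict (Ioc (0 : ℝ) 1))
    isOpen_univ (fun s z => gauss (s • z)) (fun s => (contDiff_gauss_smul s).contDiffOn)
    (fun n z _ => (continuous_iteratedFDeriv_gauss_smul n z).aestronglyMeasurable)
    (fun n z _ => by
      obtain ⟨C, hC⟩ := hb n
      exact ⟨1, one_pos, fun _ => C, integrable_const C,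
        (ae_restrict_mem measurableSet_Ioc).mono fun s hs x _ _ => hC s hs x⟩)
  have h1' := contDiffOn_univ.1 h1
  refine ⟨contDiff_const.mul h1', fun n => ?_⟩
  obtain ⟨C, hC⟩ := hb n
  refine ⟨2 / Real.sqrt Real.pi * C, fun z => ?_⟩
  have h3 : iteratedFDeriv ℝ n coulombLong z = ((2 / Real.sqrt Real.pi : ℝ) : ℂ) •
      iteratedFDeriv ℝ n (fun z => ∫ s in Ioc (0 : ℝ) 1, gauss (s • z)) z :=
    iteratedFDeriv_const_smul_apply (a := ((2 / Real.sqrt Real.pi : ℝ) : ℂ))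
      (h1'.of_le (natCast_le_infty n)).contDiffAt
  rw [h3, norm_smul, h2 n z trivial, Complex.norm_real, Real.norm_of_nonneg (by positivity)]
  refine mul_le_mul_of_nonneg_left ?_ (by positivity)
  have := norm_setIntegral_le_of_norm_le_const (μ := volume) (s := Ioc (0 : ℝ) 1)
    (f := fun s => iteratedFDeriv ℝ n (fun z => gauss (s • z)) z) (by simp)
    (fun s hs => hC s hs z)
  simpa using this

theorem integrableOn_inv_sq : IntegrableOn (fun s : ℝ => (s ^ 2)⁻¹) (Ioi 1) := by
  have h := integrableOn_Ioi_rpow_of_lt (a := -2) (c := 1) (by norm_num) one_pos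
  refine h.congr_fun (fun s hs => ?_) measurableSet_Ioi
  have : (0 : ℝ) < s := one_pos.trans hs
  simp only
  rw [Real.rpow_neg this.le]
  norm_cast

/-- The derivatives of `e^{-s²|z|²}` of order `n` are bounded by `s^n (s|z|)^{-n-2-k}`, which is
integrable over `s > 1`. -/
theorem coulombShort_spec : ContDiffOn ℝ ∞ coulombShort {z | z ≠ 0} ∧
    ∀ n k : ℕ, ∃ C : ℝ, ∀ z, 1 ≤ ‖z‖ → (1 + ‖z‖) ^ k * ‖iteratedFDeriv ℝ n coulombShort z‖ ≤ C := by
  have hΩ : IsOpen {z : E3 | z ≠ 0} := isOpen_ne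
  have hb : ∀ n k : ℕ, ∃ C : ℝ, 0 ≤ C ∧ ∀ s ∈ Ioi (1 : ℝ), ∀ z : E3, z ≠ 0 →
      ‖iteratedFDeriv ℝ n (fun z => gauss (s • z)) z‖
        ≤ C * (‖z‖ ^ (n + 2 + k))⁻¹ * (s ^ 2)⁻¹ := by
    intro n k
    obtain ⟨C, hC⟩ := decay_gauss n (n + 2 + k)
    refine ⟨|C|, abs_nonneg C, fun s hs z hz => ?_⟩
    have hs1 : (1 : ℝ) < s := hs
    have hs0 : (0 : ℝ) < s := one_pos.trans hs1
    have hz0 : 0 < ‖z‖ := norm_pos_iff.2 hz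
    rw [iteratedFDeriv_gauss_smul, norm_smul, norm_pow, Real.norm_of_nonneg hs0.le]
    have h1 := le_mul_inv_pow ((hC (s • z)).trans (le_abs_self C))
    have h2 : ((1 + ‖s • z‖) ^ (n + 2 + k))⁻¹ ≤ ((s * ‖z‖) ^ (n + 2 + k))⁻¹ := by
      rw [norm_smul, Real.norm_of_nonneg hs0.le]
      gcongr
      linarith
    calc s ^ n * ‖iteratedFDeriv ℝ n gauss (s • z)‖
        ≤ s ^ n * (|C| * ((s * ‖z‖) ^ (n + 2 + k))⁻¹) := by
          gcongr
          exact h1.trans (mul_le_mul_of_nonneg_left h2 (abs_nonneg C))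
      _ = |C| * (‖z‖ ^ (n + 2 + k))⁻¹ * (s ^ 2)⁻¹ * (s ^ k)⁻¹ := by
        rw [mul_pow, pow_add s, pow_add s]
        field_simp
      _ ≤ _ := mul_le_of_le_one_right (by positivity)
        (inv_le_one_of_one_le₀ (one_le_pow₀ hs1.le))
  obtain ⟨h1, h2⟩ := contDiffOn_integral_and_iteratedFDeriv (μ := volume.restrict (Ioi (1 : ℝ)))
    hΩ (fun s z => gauss (s • z)) (fun s => (contDiff_gauss_smul s).contDiffOn)
    (fun n z _ => (continuous_iteratedFDeriv_gauss_smul n z).aestronglyMeasurable)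
    (fun n z₀ hz₀ => by
      obtain ⟨C, hC0, hC⟩ := hb n 0
      have hz0 : 0 < ‖z₀‖ := norm_pos_iff.2 hz₀
      refine ⟨‖z₀‖ / 2, by positivity, fun s => C * ((‖z₀‖ / 2) ^ (n + 2 + 0))⁻¹ * (s ^ 2)⁻¹,
        integrableOn_inv_sq.const_mul _,
        (ae_restrict_mem measurableSet_Ioi).mono fun s hs x hx hx0 => ?_⟩
      have hs0 : (0 : ℝ) < s := one_pos.trans hs
      refine (hC s hs x hx0).trans ?_
      have : ‖z₀‖ / 2 ≤ ‖x‖ := by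
        rw [Metric.mem_ball, dist_eq_norm] at hx
        have := norm_sub_norm_le z₀ x
        rw [norm_sub_rev] at hx
        linarith
      beta_reduce
      gcongr)
  refine ⟨contDiffOn_const.mul h1, fun n k => ?_⟩
  obtain ⟨C, hC0, hC⟩ := hb n k
  set S := ∫ s in Ioi (1 : ℝ), (s ^ 2)⁻¹ with hS
  refine ⟨2 ^ k * (2 / Real.sqrt Real.pi * (C * S)), fun z hz => ?_⟩
  have hz0 : z ≠ 0 := by
    rintro rfl
    norm_num at hz
  have h3 : iteratedFDeriv ℝ n coulombShort z = ((2 / Real.sqrt Real.pi : ℝ) : ℂ) •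
      iteratedFDeriv ℝ n (fun z => ∫ s in Ioi (1 : ℝ), gauss (s • z)) z :=
    iteratedFDeriv_const_smul_apply (a := ((2 / Real.sqrt Real.pi : ℝ) : ℂ))
      ((h1.contDiffAt (hΩ.mem_nhds hz0)).of_le (natCast_le_infty n))
  have h4 : ‖∫ s in Ioi (1 : ℝ), iteratedFDeriv ℝ n (fun z => gauss (s • z)) z‖
      ≤ C * (‖z‖ ^ (n + 2 + k))⁻¹ * S := by
    rw [hS, ← integral_const_mul]
    exact norm_integral_le_of_norm_le (integrableOn_inv_sq.const_mul _)
      ((ae_restrict_mem measurableSet_Ioi).mono fun s hs => hC s hs z hz0)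
  have hSn : 0 ≤ S := integral_nonneg fun s => by positivity
  rw [h3, norm_smul, h2 n z hz0, Complex.norm_real, Real.norm_of_nonneg (by positivity)]
  have hzp : 0 < ‖z‖ := norm_pos_iff.2 hz0
  calc (1 + ‖z‖) ^ k * (2 / Real.sqrt Real.pi * _)
      ≤ (2 * ‖z‖) ^ k * (2 / Real.sqrt Real.pi * (C * (‖z‖ ^ k)⁻¹ * S)) := by
        gcongr
        · linarith
        · refine h4.trans ?_
          gcongr
          · omega
    _ = _ := by
      rw [mul_pow]
      field_simp

/-! ### Fourier transforms of functions with finite moments -/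

/-- The Fourier transform `∫ e^{-i z·η} f(z) dz`. -/
def ft (f : E3 → ℂ) (η : E3) : ℂ :=
  ∫ z : E3, Complex.exp (-(Complex.I * ((inner ℝ z η : ℝ) : ℂ))) * f z

theorem ft_eq_fourier (f : E3 → ℂ) (η : E3) : ft f η = 𝓕 f ((2 * Real.pi)⁻¹ • η) := by
  rw [ft, Real.fourier_eq']
  congr 1
  funext z
  have hpi := Real.pi_ne_zero
  rw [smul_eq_mul, real_inner_smul_right]
  congr 2
  have : -2 * Real.pi * ((2 * Real.pi)⁻¹ * inner ℝ z η) = -inner ℝ z η := by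
    field_simp
  rw [this]
  push_cast
  ring

/-- Measurable functions all of whose moments are finite. -/
structure IsMoment (f : E3 → ℂ) : Prop where
  meas : AEStronglyMeasurable f
  integrable_moment : ∀ k : ℕ, Integrable fun z => (1 + ‖z‖) ^ k * ‖f z‖

namespace IsMoment

variable {f g : E3 → ℂ}

theorem integrable (hf : IsMoment f) : Integrable f := by
  have := hf.integrable_moment 0
  simp only [pow_zero, one_mul] at this
  exact (integrable_norm_iff hf.meas).1 this

theorem integrable_pow (hf : IsMoment f) (k : ℕ) : Integrable fun z => ‖z‖ ^ k * ‖f z‖ := by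
  refine (hf.integrable_moment k).mono' ?_ (Filter.Eventually.of_forall fun z => ?_)
  · exact (continuous_norm.pow k).aestronglyMeasurable.mul hf.meas.norm
  · rw [Real.norm_of_nonneg (by positivity)]
    gcongr
    linarith

theorem integrable_exp (hf : IsMoment f) (η : E3) :
    Integrable fun z => Complex.exp (-(Complex.I * ((inner ℝ z η : ℝ) : ℂ))) * f z := by
  refine hf.integrable.mono ?_ (Filter.Eventually.of_forall fun z => ?_)
  · exact (Continuous.aestronglyMeasurable (by fun_prop)).mul hf.meas
  · rw [norm_mul, mul_comm Complex.I, ← neg_mul, ← Complex.ofReal_neg,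
      Complex.norm_exp_ofReal_mul_I, one_mul]

theorem add (hf : IsMoment f) (hg : IsMoment g) : IsMoment (fun z => f z + g z) := by
  refine ⟨hf.meas.add hg.meas, fun k => ?_⟩
  refine ((hf.integrable_moment k).add (hg.integrable_moment k)).mono' ?_
    (Filter.Eventually.of_forall fun z => ?_)
  · exact (Continuous.aestronglyMeasurable (by fun_prop)).mul (hf.meas.add hg.meas).norm
  · rw [Real.norm_of_nonneg (by positivity), Pi.add_apply, ← mul_add]
    gcongr
    exact norm_add_le _ _

theorem const_mul (hf : IsMoment f) (c : ℂ) : IsMoment (fun z => c * f z) := by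
  refine ⟨hf.meas.const_mul c, fun k => ?_⟩
  have := (hf.integrable_moment k).const_mul ‖c‖
  refine this.congr (Filter.Eventually.of_forall fun z => ?_)
  simp only [norm_mul]
  ring

theorem inner_mul (hf : IsMoment f) (v : E3) :
    IsMoment (fun z => ((inner ℝ z v : ℝ) : ℂ) * f z) := by
  have hm : AEStronglyMeasurable (fun z : E3 => ((inner ℝ z v : ℝ) : ℂ) * f z) :=
    (Continuous.aestronglyMeasurable (by fun_prop)).mul hf.meas
  refine ⟨hm, fun k => ?_⟩
  refine ((hf.integrable_moment (k + 1)).const_mul ‖v‖).mono'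
    ((Continuous.aestronglyMeasurable (by fun_prop)).mul hm.norm)
    (Filter.Eventually.of_forall fun z => ?_)
  rw [Real.norm_of_nonneg (by positivity), norm_mul, Complex.norm_real]
  have h1 : ‖inner ℝ z v‖ ≤ (1 + ‖z‖) * ‖v‖ :=
    (norm_inner_le_norm z v).trans (by gcongr; linarith)
  calc (1 + ‖z‖) ^ k * (‖inner ℝ z v‖ * ‖f z‖)
      ≤ (1 + ‖z‖) ^ k * ((1 + ‖z‖) * ‖v‖ * ‖f z‖) := by gcongr
    _ = _ := by ring

theorem contDiff_ft (hf : IsMoment f) : ContDiff ℝ ∞ (ft f) := by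
  have h : ContDiff ℝ ∞ (𝓕 f) := by
    have := Real.contDiff_fourier (N := ⊤) (fun n _ => hf.integrable_pow n)
    exact this
  have := h.comp (contDiff_const_smul (2 * Real.pi)⁻¹)
  convert this using 1
  funext η
  exact ft_eq_fourier f η

theorem ft_add (hf : IsMoment f) (hg : IsMoment g) :
    ft (fun z => f z + g z) = fun η => ft f η + ft g η := by
  funext η
  simp only [ft, mul_add]
  exact integral_add (hf.integrable_exp η) (hg.integrable_exp η)

theorem ft_inner_mul (hf : IsMoment f) (v : E3) :
    ft (fun z => ((inner ℝ z v : ℝ) : ℂ) * f z) = fun η => Complex.I * dirD v (ft f) η := by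
  funext η
  have h1 := Real.hasFDerivAt_fourier hf.integrable (by simpa using hf.integrable_pow 1)
    ((2 * Real.pi)⁻¹ • η)
  have h2 : HasFDerivAt (fun η : E3 => (2 * Real.pi)⁻¹ • η)
      ((2 * Real.pi)⁻¹ • ContinuousLinearMap.id ℝ E3) η :=
    ((2 * Real.pi)⁻¹ • ContinuousLinearMap.id ℝ E3).hasFDerivAt
  have h3 := h1.comp η h2
  have h4 : ft f = 𝓕 f ∘ fun η : E3 => (2 * Real.pi)⁻¹ • η := funext fun η => ft_eq_fourier f η
  have hint : Integrable (VectorFourier.fourierSMulRight (innerSL ℝ) f) := by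
    refine ((hf.integrable_pow 1).const_mul (2 * Real.pi * 1)).mono'
      hf.meas.fourierSMulRight (Filter.Eventually.of_forall fun z => ?_)
    refine (VectorFourier.norm_fourierSMulRight_le (innerSL ℝ) f z).trans ?_
    rw [pow_one, mul_assoc]
    have : ‖innerSL ℝ (E := E3)‖ ≤ 1 := norm_innerSL_le ℝ
    gcongr
  have h5 : dirD v (ft f) η = 𝓕 (VectorFourier.fourierSMulRight (innerSL ℝ) f)
      ((2 * Real.pi)⁻¹ • η) ((2 * Real.pi)⁻¹ • v) := by
    rw [dirD, h4, h3.fderiv]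
    rfl
  rw [h5, Real.fourier_eq', ContinuousLinearMap.integral_apply]
  · rw [ft, ← integral_const_mul]
    congr 1
    funext z
    have hpi : (Real.pi : ℂ) ≠ 0 := by exact_mod_cast Real.pi_ne_zero
    have e1 : (VectorFourier.fourierSMulRight (innerSL ℝ) f z) ((2 * Real.pi)⁻¹ • v)
        = -Complex.I * (((inner ℝ z v : ℝ) : ℂ) * f z) := by
      rw [VectorFourier.fourierSMulRight_apply, innerSL_apply_apply, real_inner_smul_right]
      rw [smul_eq_mul, Complex.real_smul]
      push_cast
      field_simp
    have e2 : Complex.exp (((-2 * Real.pi * inner ℝ z ((2 * Real.pi)⁻¹ • η) : ℝ) : ℂ) * Complex.I)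
        = Complex.exp (-(Complex.I * ((inner ℝ z η : ℝ) : ℂ))) := by
      rw [real_inner_smul_right]
      congr 1
      push_cast
      field_simp
    rw [_root_.smul_apply, e1, e2, smul_eq_mul]
    linear_combination (Complex.exp (-(Complex.I * ((inner ℝ z η : ℝ) : ℂ))) *
      (((inner ℝ z v : ℝ) : ℂ) * f z)) * Complex.I_sq
  · refine hint.mono ?_ (Filter.Eventually.of_forall fun z => ?_)
    · have hc : Continuous fun z : E3 => Complex.exp
          (((-2 * Real.pi * inner ℝ z ((2 * Real.pi)⁻¹ • η) : ℝ) : ℂ) * Complex.I) := by fun_prop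
      exact hc.aestronglyMeasurable.smul hint.1
    · rw [norm_smul, Complex.norm_exp_ofReal_mul_I, one_mul]

end IsMoment

theorem ft_const_mul (f : E3 → ℂ) (c : ℂ) : ft (fun z => c * f z) = fun η => c * ft f η := by
  funext η
  simp only [ft, mul_left_comm _ c]
  exact integral_const_mul _ _

/-! ### The Fourier transform of the short-range Coulomb potential -/

theorem integrable_gauss_prod : Integrable (fun q : E3 × ℝ => gauss (q.2 • q.1))
    (volume.prod (volume.restrict (Ioi (1 : ℝ)))) := by
  have hcont : Continuous fun q : E3 × ℝ => gauss (q.2 • q.1) :=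
    contDiff_gauss.continuous.comp (f := fun q : E3 × ℝ => q.2 • q.1) (by fun_prop)
  have hg : Integrable gauss := by
    obtain ⟨C, hC⟩ := decay_gauss 0 4
    simp only [norm_iteratedFDeriv_zero] at hC
    exact (integrable_of_weight_le contDiff_gauss.continuous.aestronglyMeasurable
      (Filter.Eventually.of_forall hC)).1
  rw [integrable_prod_iff' hcont.aestronglyMeasurable]
  constructor
  · filter_upwards [ae_restrict_mem measurableSet_Ioi] with s hs
    exact hg.comp_smul (one_pos.trans hs).ne'
  · have h1 : ∀ s : ℝ, ∫ z : E3, ‖gauss (s • z)‖ = |(s ^ 3)⁻¹| * ∫ z : E3, ‖gauss z‖ := by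
      intro s
      have := Measure.integral_comp_smul (volume : Measure E3) (fun z => ‖gauss z‖) s
      simpa using this
    simp only [h1]
    refine Integrable.mul_const ?_ _
    refine integrableOn_inv_sq.mono' (Measurable.aestronglyMeasurable (by fun_prop)) ?_
    filter_upwards [ae_restrict_mem measurableSet_Ioi] with s hs
    have hs1 : (1 : ℝ) < s := hs
    have hs0 : (0 : ℝ) < s := one_pos.trans hs1
    rw [norm_abs_eq_norm, Real.norm_of_nonneg (by positivity)]
    exact inv_anti₀ (by positivity) (pow_le_pow_right₀ hs1.le (by norm_num))

theorem isMoment_coulombShort : IsMoment coulombShort := by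
  have hi : Integrable coulombShort := by
    have := integrable_gauss_prod.integral_prod_left
    exact this.const_mul _
  refine ⟨hi.1, fun k => ?_⟩
  obtain ⟨C, hC⟩ := coulombShort_spec.2 0 (k + 4)
  simp only [norm_iteratedFDeriv_zero] at hC
  have hb := (hi.norm.const_mul (2 ^ k)).add (integrable_weight_inv.const_mul |C|)
  refine hb.mono' ((Continuous.aestronglyMeasurable (by fun_prop)).mul hi.1.norm)
    (Filter.Eventually.of_forall fun z => ?_)
  rw [Real.norm_of_nonneg (by positivity), Pi.add_apply]
  rcases le_total 1 ‖z‖ with hz | hz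
  · have h1 := hC z hz
    rw [pow_add, mul_assoc, mul_left_comm] at h1
    refine (le_mul_inv_pow (h1.trans (le_abs_self C))).trans ?_
    exact le_add_of_nonneg_left (by positivity)
  · refine le_trans ?_ (le_add_of_nonneg_right (by positivity))
    have := weight_pos z
    gcongr
    linarith

/-- The integrand is the derivative of `e^{-a/s²} / (2a)`. -/
theorem integral_exp_neg_div_sq {a : ℝ} (ha : 0 < a) :
    ∫ s in Ioi (1 : ℝ), (s ^ 3)⁻¹ * Real.exp (-(a / s ^ 2)) = (1 - Real.exp (-a)) / (2 * a) := by
  have hd : ∀ s ∈ Ici (1 : ℝ), HasDerivAt (fun s : ℝ => Real.exp (-(a / s ^ 2)) / (2 * a))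
      ((s ^ 3)⁻¹ * Real.exp (-(a / s ^ 2))) s := by
    intro s hs
    have hs0 : s ≠ 0 := (one_pos.trans_le hs).ne'
    have h1 : HasDerivAt (fun s : ℝ => -(a / s ^ 2)) (2 * a * (s ^ 3)⁻¹) s := by
      have := ((hasDerivAt_const s a).fun_div (hasDerivAt_pow 2 s) (pow_ne_zero 2 hs0)).fun_neg
      refine this.congr_deriv ?_
      field_simp
      ring
    refine (h1.exp.div_const (2 * a)).congr_deriv ?_
    field_simp
  have hlim : Tendsto (fun s : ℝ => Real.exp (-(a / s ^ 2)) / (2 * a)) atTop (𝓝 (1 / (2 * a))) := by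
    have h1 : Tendsto (fun s : ℝ => -(a / s ^ 2)) atTop (𝓝 (-0)) :=
      (tendsto_const_nhds.div_atTop (tendsto_pow_atTop two_ne_zero)).neg
    have h2 := (Real.continuous_exp.tendsto (-0)).comp h1
    rw [neg_zero, Real.exp_zero] at h2
    exact h2.div_const _
  have hpos : ∀ s ∈ Ioi (1 : ℝ), 0 ≤ (s ^ 3)⁻¹ * Real.exp (-(a / s ^ 2)) := fun s hs => by
    have : (0 : ℝ) < s := one_pos.trans hs
    positivity
  have hi := integrableOn_Ioi_deriv_of_nonneg' hd hpos hlim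
  rw [integral_Ioi_of_hasDerivAt_of_tendsto' hd hi hlim]
  simp only [one_pow, div_one]
  ring

/-- The Fourier transform of the dilated Gaussian `e^{-s²|z|²}`. -/
theorem ft_gauss_smul {s : ℝ} (hs : 0 < s) (η : E3) :
    ∫ z : E3, Complex.exp (-(Complex.I * ((inner ℝ z η : ℝ) : ℂ))) * gauss (s • z)
      = ((Real.sqrt Real.pi ^ 3 * ((s ^ 3)⁻¹ * Real.exp (-(‖η‖ ^ 2 / 4 / s ^ 2))) : ℝ) : ℂ) := by
  have h := GaussianFourier.integral_cexp_neg_mul_sq_norm_add (V := E3) (b := ((s ^ 2 : ℝ) : ℂ))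
    (by rw [Complex.ofReal_re]; positivity) (-Complex.I) η
  have e1 : (fun z : E3 => Complex.exp (-(Complex.I * ((inner ℝ z η : ℝ) : ℂ))) * gauss (s • z))
      = fun z : E3 => Complex.exp (-((s ^ 2 : ℝ) : ℂ) * (‖z‖ : ℂ) ^ 2
        + -Complex.I * ((inner ℝ η z : ℝ) : ℂ)) := by
    funext z
    rw [gauss_smul, Complex.ofReal_exp, ← Complex.exp_add, real_inner_comm]
    congr 1
    push_cast
    ring
  have e2 : ((Real.pi : ℂ) / ((s ^ 2 : ℝ) : ℂ)) ^ ((Module.finrank ℝ E3 : ℂ) / 2)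
      = ((Real.sqrt Real.pi ^ 3 * (s ^ 3)⁻¹ : ℝ) : ℂ) := by
    have hb : (0 : ℝ) ≤ Real.pi / s ^ 2 := by positivity
    have : ((Module.finrank ℝ E3 : ℂ) / 2) = ((1 / 2 * (3 : ℕ) : ℝ) : ℂ) := by
      simp
      norm_num
    rw [this, ← Complex.ofReal_div, ← Complex.ofReal_cpow hb, Real.rpow_mul hb,
      ← Real.sqrt_eq_rpow, Real.rpow_natCast, Real.sqrt_div Real.pi_pos.le,
      Real.sqrt_sq hs.le, div_pow, div_eq_mul_inv]
  rw [e1, h, e2, ← mul_assoc, Complex.ofReal_mul (_ * _), Complex.ofReal_exp]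
  congr 2
  push_cast
  rw [neg_sq, Complex.I_sq]
  ring

/-- `∫ e^{-i z·η} u(z) dz = 4π (1 - e^{-|η|²/4}) / |η|²` for the short-range part `u` of `1/|z|`. -/
theorem ft_coulombShort {η : E3} (hη : η ≠ 0) : ft coulombShort η
    = ((4 * Real.pi * (1 - Real.exp (-(‖η‖ ^ 2 / 4))) / ‖η‖ ^ 2 : ℝ) : ℂ) := by
  set κ : ℂ := ((2 / Real.sqrt Real.pi : ℝ) : ℂ) with hκ
  have hint : Integrable (Function.uncurry fun (z : E3) (s : ℝ) =>
      Complex.exp (-(Complex.I * ((inner ℝ z η : ℝ) : ℂ))) * gauss (s • z))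
      (volume.prod (volume.restrict (Ioi (1 : ℝ)))) := by
    refine integrable_gauss_prod.mono (Continuous.aestronglyMeasurable ?_)
      (Filter.Eventually.of_forall fun q => ?_)
    · refine Continuous.mul (by fun_prop) ?_
      exact contDiff_gauss.continuous.comp (f := fun q : E3 × ℝ => q.2 • q.1) (by fun_prop)
    · simp only [Function.uncurry]
      rw [norm_mul, mul_comm Complex.I, ← neg_mul, ← Complex.ofReal_neg,
        Complex.norm_exp_ofReal_mul_I, one_mul]
  have e1 : ft coulombShort η = κ * ∫ z : E3, ∫ s in Ioi (1 : ℝ),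
      Complex.exp (-(Complex.I * ((inner ℝ z η : ℝ) : ℂ))) * gauss (s • z) := by
    rw [ft, ← integral_const_mul]
    congr 1
    funext z
    rw [coulombShort, coulombPart, integral_const_mul]
    ring
  have e2 : ∫ s in Ioi (1 : ℝ), (∫ z : E3,
      Complex.exp (-(Complex.I * ((inner ℝ z η : ℝ) : ℂ))) * gauss (s • z))
      = ∫ s in Ioi (1 : ℝ), ((Real.sqrt Real.pi ^ 3 *
        ((s ^ 3)⁻¹ * Real.exp (-(‖η‖ ^ 2 / 4 / s ^ 2))) : ℝ) : ℂ) :=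
    setIntegral_congr_fun measurableSet_Ioi fun s hs => ft_gauss_smul (one_pos.trans hs) η
  have hη0 : 0 < ‖η‖ := norm_pos_iff.2 hη
  have e3 : ∫ s in Ioi (1 : ℝ), ((Real.sqrt Real.pi ^ 3 *
      ((s ^ 3)⁻¹ * Real.exp (-(‖η‖ ^ 2 / 4 / s ^ 2))) : ℝ) : ℂ)
      = ((Real.sqrt Real.pi ^ 3 *
        ((1 - Real.exp (-(‖η‖ ^ 2 / 4))) / (2 * (‖η‖ ^ 2 / 4))) : ℝ) : ℂ) := by
    rw [← integral_exp_neg_div_sq (by positivity), ← integral_const_mul]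
    exact integral_ofReal
  rw [e1, integral_integral_swap hint, e2, e3, hκ, ← Complex.ofReal_mul]
  congr 1
  have hs : 0 < Real.sqrt Real.pi := Real.sqrt_pos.2 Real.pi_pos
  have hs2 : Real.sqrt Real.pi ^ 2 = Real.pi := Real.sq_sqrt Real.pi_pos.le
  field_simp
  rw [hs2]
  ring

/-- The profile `4π/t`, cut off near `t = 0`. -/
def coulombProfile (t : ℝ) : ℂ := ((4 * Real.pi * Real.smoothTransition (4 * t - 1) / t : ℝ) : ℂ)

theorem contDiff_coulombProfile : ContDiff ℝ ∞ coulombProfile := by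
  refine Complex.ofRealCLM.contDiff.comp (f := fun t : ℝ =>
    4 * Real.pi * Real.smoothTransition (4 * t - 1) / t) ?_
  rw [contDiff_iff_contDiffAt]
  intro t
  have h1 : ContDiff ℝ ∞ fun t : ℝ => 4 * Real.pi * Real.smoothTransition (4 * t - 1) :=
    contDiff_const.mul (Real.smoothTransition.contDiff (n := ⊤) |>.comp (by fun_prop))
  rcases eq_or_ne t 0 with rfl | ht
  · refine (contDiffAt_const (c := (0 : ℝ))).congr_of_eventuallyEq ?_
    filter_upwards [gt_mem_nhds (show (0 : ℝ) < 1 / 4 by norm_num)] with s hs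
    rw [Real.smoothTransition.zero_of_nonpos (by linarith), mul_zero, zero_div]
  · exact h1.contDiffAt.fun_div contDiffAt_id ht

theorem coulombProfile_of_lt (t : ℝ) (ht : 1 / 2 < t) :
    coulombProfile t = (4 * Real.pi : ℝ) * (t : ℂ) ^ (-1 : ℤ) := by
  rw [coulombProfile, Real.smoothTransition.one_of_one_le (by linarith)]
  push_cast
  rw [zpow_neg_one, mul_one, div_eq_mul_inv]

/-- The homogeneous part of the symbol of the short-range Coulomb potential. -/
def coulombHat (η : E3) : ℂ := coulombProfile (‖η‖ ^ 2)

theorem coulombHat_mem_homSym : coulombHat ∈ homSym (-2) 0 := by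
  refine Submodule.subset_span ⟨coulombProfile, 0, 0, 0, -1, (4 * Real.pi : ℝ),
    contDiff_coulombProfile, le_rfl, by simp, by simp, coulombProfile_of_lt, ?_⟩
  funext η
  simp [coulombHat, sphMono]

/-- For `|η| ≥ 1` the difference is `-4π e^{-|η|²/4} / |η|²`, and it is smooth everywhere. -/
theorem isSym_ft_coulombShort_sub (m : ℤ) :
    IsSym m (fun η => ft coulombShort η - coulombHat η) := by
  have hg : ContDiff ℝ ∞ fun η : E3 => gauss ((1 / 2 : ℝ) • η) := contDiff_gauss_smul _
  have hgs : IsSym (m + 2) fun η : E3 => gauss ((1 / 2 : ℝ) • η) := by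
    refine isSym_of_decay hg (fun n k => ?_) _
    obtain ⟨C, hC⟩ := decay_gauss n k
    refine ⟨2 ^ k * C, fun w => ?_⟩
    rw [iteratedFDeriv_gauss_smul, norm_smul, norm_pow]
    have h1 := hC ((1 / 2 : ℝ) • w)
    have h2 : 1 + ‖w‖ ≤ 2 * (1 + ‖(1 / 2 : ℝ) • w‖) := by
      rw [norm_smul, Real.norm_of_nonneg (by norm_num)]
      linarith
    have h3 : ‖(1 / 2 : ℝ)‖ ^ n ≤ 1 := pow_le_one₀ (norm_nonneg _) (by norm_num)
    calc (1 + ‖w‖) ^ k * (‖(1 / 2 : ℝ)‖ ^ n * ‖iteratedFDeriv ℝ n gauss ((1 / 2 : ℝ) • w)‖)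
        ≤ (2 * (1 + ‖(1 / 2 : ℝ) • w‖)) ^ k *
          (1 * ‖iteratedFDeriv ℝ n gauss ((1 / 2 : ℝ) • w)‖) := by gcongr
      _ = 2 ^ k * ((1 + ‖(1 / 2 : ℝ) • w‖) ^ k *
          ‖iteratedFDeriv ℝ n gauss ((1 / 2 : ℝ) • w)‖) := by
        rw [mul_pow]
        ring
      _ ≤ _ := by gcongr
  have hΘ : IsSym (-2) coulombHat := by
    have := isSym_of_mem_homSym coulombHat_mem_homSym
    simpa using this
  have hprod : IsSym m fun η : E3 => gauss ((1 / 2 : ℝ) • η) * coulombHat η := by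
    have := hgs.mul hΘ
    rwa [show m + 2 + -2 = m by ring] at this
  set H : E3 → ℂ := fun η =>
    ft coulombShort η - coulombHat η + gauss ((1 / 2 : ℝ) • η) * coulombHat η with hH
  have hH0 : ∀ η : E3, 1 ≤ ‖η‖ → H η = 0 := by
    intro η hη
    have hη0 : η ≠ 0 := by
      rintro rfl
      norm_num at hη
    have h2 : 1 / 2 < ‖η‖ ^ 2 := by nlinarith
    have hc : ((‖η‖ : ℝ) : ℂ) ≠ 0 := by exact_mod_cast (norm_pos_iff.2 hη0).ne'
    rw [hH]
    simp only [coulombHat]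
    rw [ft_coulombShort hη0, coulombProfile_of_lt _ h2, gauss_smul,
      show -‖η‖ ^ 2 * (1 / 2 : ℝ) ^ 2 = -(‖η‖ ^ 2 / 4) by ring]
    push_cast
    rw [zpow_neg_one]
    field_simp
    ring
  have hHs : ContDiff ℝ ∞ H :=
    (isMoment_coulombShort.contDiff_ft.sub hΘ.smooth).add hprod.smooth
  have hHm : IsSym m H := by
    refine isSym_of_homogeneous hHs fun r η hη hr => ?_
    rw [hH0 η hη, hH0, mul_zero]
    rw [norm_smul, Real.norm_of_nonneg (zero_le_one.trans hr)]
    nlinarith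
  have h := hHm.add (hprod.const_mul (-1))
  have e : (fun η => H η + -1 * (gauss ((1 / 2 : ℝ) • η) * coulombHat η))
      = fun η => ft coulombShort η - coulombHat η := by
    funext η
    simp only [hH]
    ring
  rwa [e] at h

/-! ### Fourier transforms of homogeneous singularities of odd order -/

/-- Functions with finite moments whose Fourier transform is, up to rapidly decreasing terms, in
`homSym (-4) n`. -/
def HasHomFT (n : ℕ) (f : E3 → ℂ) : Prop :=
  IsMoment f ∧ ∃ t ∈ homSym (-4) n, ∀ m : ℤ, IsSym m (fun η => ft f η - t η)

theorem HasHomFT.add {n : ℕ} {f g : E3 → ℂ} (hf : HasHomFT n f) (hg : HasHomFT n g) :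
    HasHomFT n (fun z => f z + g z) := by
  obtain ⟨hf, t, ht, h⟩ := hf
  obtain ⟨hg, s, hs, h'⟩ := hg
  refine ⟨hf.add hg, t + s, Submodule.add_mem _ ht hs, fun m => ?_⟩
  convert (h m).add (h' m) using 2 with η
  rw [hf.ft_add hg, Pi.add_apply]
  ring

theorem HasHomFT.const_mul {n : ℕ} {f : E3 → ℂ} (hf : HasHomFT n f) (c : ℂ) :
    HasHomFT n (fun z => c * f z) := by
  obtain ⟨hf, t, ht, h⟩ := hf
  refine ⟨hf.const_mul c, c • t, Submodule.smul_mem _ c ht, fun m => ?_⟩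
  convert (h m).const_mul c using 2 with η
  rw [ft_const_mul, Pi.smul_apply, smul_eq_mul]
  ring

/-- Multiplication by a coordinate is a derivative on the Fourier side. -/
theorem HasHomFT.inner_mul {n : ℕ} {f : E3 → ℂ} (hf : HasHomFT n f) (v : E3) :
    HasHomFT (n + 1) (fun z => ((inner ℝ z v : ℝ) : ℂ) * f z) := by
  obtain ⟨hf, t, ht, h⟩ := hf
  refine ⟨hf.inner_mul v, Complex.I • dirD v t, Submodule.smul_mem _ _ (homSym_dirD ht v),
    fun m => ?_⟩
  have h1 := ((h (m + 1)).dirD v).const_mul Complex.I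
  rw [show m + 1 - 1 = m by ring] at h1
  convert h1 using 2 with η
  have := fderiv_fun_sub (𝕜 := ℝ) (hf.contDiff_ft.differentiable (by simp) η)
    ((contDiff_of_mem_homSym ht).differentiable (by simp) η)
  rw [hf.ft_inner_mul, Pi.smul_apply, smul_eq_mul]
  simp only [dirD, this, _root_.sub_apply]
  ring

theorem inner_stdE (z : E3) (i : Fin 3) : inner ℝ z (stdE i) = z i := by
  simp [stdE, EuclideanSpace.inner_single_right]

theorem dirD_stdE_radial {f : ℝ → ℂ} (hf : ContDiff ℝ ∞ f) (i : Fin 3) :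
    dirD (stdE i) (fun η : E3 => f (‖η‖ ^ 2))
      = fun η => deriv f (‖η‖ ^ 2) * (2 * ((η i : ℝ) : ℂ)) := by
  funext η
  rw [dirD_radial hf]
  congr 1
  fin_cases i
  · simp [sphMono, stdE]
    ring
  · simp [sphMono, stdE]
    ring_nf
    simp [Complex.I_sq]
  · simp [sphMono, stdE]

theorem dirD_stdE_stdE_radial {f : ℝ → ℂ} (hf : ContDiff ℝ ∞ f) (i : Fin 3) (η : E3) :
    dirD (stdE i) (dirD (stdE i) (fun η : E3 => f (‖η‖ ^ 2))) η
      = deriv (deriv f) (‖η‖ ^ 2) * (4 * ((η i : ℝ) : ℂ) ^ 2) + 2 * deriv f (‖η‖ ^ 2) := by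
  have hd : ContDiff ℝ ∞ (deriv f) := (contDiff_infty_iff_deriv.1 hf).2
  rw [dirD_stdE_radial hf]
  have h1 : HasFDerivAt (fun η : E3 => (2 : ℂ) * ((η i : ℝ) : ℂ)) ((2 : ℂ) • coordC i) η :=
    (coordC i).hasFDerivAt.const_mul 2
  have h2 := ((contDiff_radial hd).differentiable (by simp) η).hasFDerivAt.fun_mul h1
  have h3 : fderiv ℝ (fun η : E3 => deriv f (‖η‖ ^ 2)) η (stdE i)
      = deriv (deriv f) (‖η‖ ^ 2) * (2 * ((η i : ℝ) : ℂ)) := congrFun (dirD_stdE_radial hd i) η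
  have h4 : coordC i (stdE i) = 1 := by
    simp [coordC, stdE]
  rw [dirD, h2.fderiv]
  simp only [_root_.add_apply, _root_.smul_apply, smul_eq_mul, h3, h4]
  ring

/-- The second derivatives of the homogeneous part `4π/|η|²` add up to a function of `|η|²`. -/
theorem sum_dirD_coulombHat_mem_homSym :
    (fun η => ∑ i, dirD (stdE i) (dirD (stdE i) coulombHat) η) ∈ homSym (-4) 0 := by
  have hf := contDiff_coulombProfile
  have hd : ContDiff ℝ ∞ (deriv coulombProfile) := (contDiff_infty_iff_deriv.1 hf).2
  have hdd : ContDiff ℝ ∞ (deriv (deriv coulombProfile)) := (contDiff_infty_iff_deriv.1 hd).2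
  refine Submodule.subset_span ⟨fun t => 4 * (t : ℂ) * deriv (deriv coulombProfile) t
    + 6 * deriv coulombProfile t, 0, 0, 0, -2, (8 * Real.pi : ℝ), ?_, le_rfl, by simp, by simp,
    fun t ht => ?_, ?_⟩
  · exact ((contDiff_const.mul Complex.ofRealCLM.contDiff).mul hdd).add (contDiff_const.mul hd)
  · have h1 := deriv_of_eq_zpow coulombProfile_of_lt
    have h2 := deriv_of_eq_zpow h1 t ht
    have ht0 : (t : ℂ) ≠ 0 := by
      norm_cast
      linarith
    simp only [h2, h1 t ht]
    norm_num
    field_simp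
    ring
  · funext η
    have hn : ((‖η‖ ^ 2 : ℝ) : ℂ) = ((η 0 : ℝ) : ℂ) ^ 2 + ((η 1 : ℝ) : ℂ) ^ 2
        + ((η 2 : ℝ) : ℂ) ^ 2 := by
      rw [EuclideanSpace.real_norm_sq_eq, Fin.sum_univ_three]
      push_cast
      rfl
    have h := dirD_stdE_stdE_radial hf (η := η)
    change ∑ i, dirD (stdE i) (dirD (stdE i) (fun η => coulombProfile (‖η‖ ^ 2))) η = _
    simp only [Fin.sum_univ_three, h, hn, sphMono]
    ring

theorem normSq_eq_sum (z : E3) : ((‖z‖ ^ 2 : ℝ) : ℂ) = ∑ i, ((z i : ℝ) : ℂ) * ((z i : ℝ) : ℂ) := by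
  rw [EuclideanSpace.real_norm_sq_eq]
  push_cast
  simp only [sq]

/-- Multiplication by `|z|²` is the negative Laplacian on the Fourier side. -/
theorem ft_sum_coord_coord_mul {f : E3 → ℂ} (hf : IsMoment f) :
    IsMoment (fun z => ((‖z‖ ^ 2 : ℝ) : ℂ) * f z) ∧
    ft (fun z => ((‖z‖ ^ 2 : ℝ) : ℂ) * f z)
      = fun η => -∑ i, dirD (stdE i) (dirD (stdE i) (ft f)) η := by
  have h1 : ∀ i, IsMoment (fun z => ((inner ℝ z (stdE i) : ℝ) : ℂ) *
      (((inner ℝ z (stdE i) : ℝ) : ℂ) * f z)) := fun i => (hf.inner_mul _).inner_mul _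
  have h2 : ∀ i, ft (fun z => ((inner ℝ z (stdE i) : ℝ) : ℂ) *
      (((inner ℝ z (stdE i) : ℝ) : ℂ) * f z))
      = fun η => -dirD (stdE i) (dirD (stdE i) (ft f)) η := by
    intro i
    rw [(hf.inner_mul _).ft_inner_mul, hf.ft_inner_mul]
    funext η
    rw [dirD_const_mul (contDiff_dirD hf.contDiff_ft _)]
    linear_combination (dirD (stdE i) (dirD (stdE i) (ft f)) η) * Complex.I_sq
  have e : (fun z => ((‖z‖ ^ 2 : ℝ) : ℂ) * f z) = fun z =>
      (((inner ℝ z (stdE 0) : ℝ) : ℂ) * (((inner ℝ z (stdE 0) : ℝ) : ℂ) * f z)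
      + ((inner ℝ z (stdE 1) : ℝ) : ℂ) * (((inner ℝ z (stdE 1) : ℝ) : ℂ) * f z))
      + ((inner ℝ z (stdE 2) : ℝ) : ℂ) * (((inner ℝ z (stdE 2) : ℝ) : ℂ) * f z) := by
    funext z
    rw [normSq_eq_sum, Fin.sum_univ_three]
    simp only [inner_stdE]
    ring
  rw [e]
  refine ⟨((h1 0).add (h1 1)).add (h1 2), ?_⟩
  rw [((h1 0).add (h1 1)).ft_add (h1 2), (h1 0).ft_add (h1 1), h2, h2, h2]
  funext η
  rw [Fin.sum_univ_three]
  ring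

/-- The singularity `|z|² u(z)`, which near the origin is `|z|` up to a smooth function. -/
def oddKernel (z : E3) : ℂ := ((‖z‖ ^ 2 : ℝ) : ℂ) * coulombShort z

/-- The Laplacian of `4π/|η|²` is homogeneous of degree `-4`. -/
theorem hasHomFT_oddKernel : HasHomFT 0 oddKernel := by
  obtain ⟨h1, h2⟩ := ft_sum_coord_coord_mul isMoment_coulombShort
  refine ⟨h1, (-1 : ℂ) • fun η => ∑ i, dirD (stdE i) (dirD (stdE i) coulombHat) η,
    Submodule.smul_mem _ _ sum_dirD_coulombHat_mem_homSym, fun m => ?_⟩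
  have h3 := fun i : Fin 3 =>
    ((isSym_ft_coulombShort_sub (m + 2)).dirD (stdE i)).dirD (stdE i)
  have h4 := (IsSym.sum Finset.univ fun i _ => h3 i).const_mul (-1)
  rw [show m + 2 - 1 - 1 = m by ring] at h4
  have hΘ : ContDiff ℝ ∞ coulombHat := contDiff_radial contDiff_coulombProfile
  have hU := isMoment_coulombShort.contDiff_ft
  have h5 : ∀ i : Fin 3, dirD (stdE i) (dirD (stdE i) fun η => ft coulombShort η - coulombHat η)
      = fun η => dirD (stdE i) (dirD (stdE i) (ft coulombShort)) η
        - dirD (stdE i) (dirD (stdE i) coulombHat) η := by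
    intro i
    have hsub : ∀ {f g : E3 → ℂ}, ContDiff ℝ ∞ f → ContDiff ℝ ∞ g →
        dirD (stdE i) (fun η => f η - g η) = fun η => dirD (stdE i) f η - dirD (stdE i) g η := by
      intro f g hf hg
      funext η
      simp only [dirD, fderiv_fun_sub (𝕜 := ℝ) (hf.differentiable (by simp) η)
        (hg.differentiable (by simp) η), _root_.sub_apply]
    rw [hsub hU hΘ, hsub (contDiff_dirD hU _) (contDiff_dirD hΘ _)]
  simp only [h5] at h4
  convert h4 using 2 with η
  have h6 : ft oddKernel η = -∑ i, dirD (stdE i) (dirD (stdE i) (ft coulombShort)) η :=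
    congrFun h2 η
  rw [h6, Finset.sum_sub_distrib]
  simp only [Pi.smul_apply, smul_eq_mul]
  ring

theorem hasHomFT_sphMono_mul_oddKernel (a b c : ℕ) :
    HasHomFT (a + b + c) (fun z => sphMono a b c z * oddKernel z) := by
  have hstep : ∀ {n : ℕ} {f : E3 → ℂ} (i : Fin 3), HasHomFT n f →
      HasHomFT (n + 1) (fun z => ((z i : ℝ) : ℂ) * f z) := by
    intro n f i hf
    have := hf.inner_mul (stdE i)
    simpa only [inner_stdE] using this
  induction a with
  | succ a ih =>
    have h1 := (hstep 0 ih).add ((hstep 1 ih).const_mul Complex.I)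
    rw [show a + 1 + b + c = a + b + c + 1 by ring]
    convert h1 using 2 with z
    simp only [sphMono]
    ring
  | zero =>
    induction b with
    | succ b ih =>
      have h1 := (hstep 0 ih).add ((hstep 1 ih).const_mul (-Complex.I))
      rw [show 0 + (b + 1) + c = 0 + b + c + 1 by ring]
      convert h1 using 2 with z
      simp only [sphMono]
      ring
    | zero =>
      induction c with
      | succ c ih =>
        have h1 := hstep 2 ih
        rw [show 0 + 0 + (c + 1) = 0 + 0 + c + 1 by ring]
        convert h1 using 2 with z
        simp only [sphMono]
        ring
      | zero =>
        have := hasHomFT_oddKernel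
        simpa [sphMono] using this

/-! ### Decay of Fourier transforms and flat functions -/

/-- The Fourier transform of a `C^N` function decays like the power `-N`, with a bound that is
linear in the size of the derivatives. -/
theorem exists_fourier_decay_const (V : Type) [NormedAddCommGroup V] [NormedSpace ℂ V]
    (b N : ℕ) : ∃ c : ℝ, 0 ≤ c ∧ ∀ (W : E3 → V), ContDiff ℝ N W → ∀ A : ℝ,
      (∀ n ≤ N, ∀ z, (1 + ‖z‖) ^ (b + 4) * ‖iteratedFDeriv ℝ n W z‖ ≤ A) →
      ∀ w : E3, (1 + ‖w‖) ^ N * ‖iteratedFDeriv ℝ b (𝓕 W) w‖ ≤ c * A := by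
  set c : ℕ → ℝ := fun n => (2 * Real.pi) ^ b * (2 * b + 2) ^ n *
    ((b + 1) * (n + 1) * weightConst) with hc
  have hc0 : ∀ n, 0 ≤ c n := fun n => by
    have := weightConst_nonneg
    positivity
  refine ⟨2 ^ N * (c 0 + c N), mul_nonneg (by positivity) (add_nonneg (hc0 _) (hc0 _)),
    fun W hW A hA w => ?_⟩
  have hk : ∀ k ≤ b, ∀ n ≤ N, Integrable (fun v : E3 => ‖v‖ ^ k * ‖iteratedFDeriv ℝ n W v‖) ∧
      ∫ v : E3, ‖v‖ ^ k * ‖iteratedFDeriv ℝ n W v‖ ≤ A * weightConst := fun k hk n hn =>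
    integrable_pow_mul_norm (hW.continuous_iteratedFDeriv (m := n) (by exact_mod_cast hn))
      (hA n hn) hk
  have hkey : ∀ n ≤ N, ‖w‖ ^ n * ‖iteratedFDeriv ℝ b (𝓕 W) w‖ ≤ c n * A := by
    intro n hn
    have h1 := Real.pow_mul_norm_iteratedFDeriv_fourier_le (f := W) (K := b) (N := N)
      hW (fun k n hka hn => (hk k (by exact_mod_cast hka) n (by exact_mod_cast hn)).1)
      (k := b) (n := n) le_rfl (by exact_mod_cast hn) w
    refine h1.trans ?_
    rw [hc, mul_assoc _ _ A]
    refine mul_le_mul_of_nonneg_left ?_ (by positivity)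
    refine (Finset.sum_le_sum fun p hp => (hk p.1 ?_ p.2 ?_).2).trans (le_of_eq ?_)
    · have := (Finset.mem_product.1 hp).1
      exact Nat.lt_succ_iff.1 (Finset.mem_range.1 this)
    · have := (Finset.mem_product.1 hp).2
      exact (Nat.lt_succ_iff.1 (Finset.mem_range.1 this)).trans hn
    · simp
      ring
  have h2 := one_add_pow_le (norm_nonneg w) N
  calc (1 + ‖w‖) ^ N * ‖iteratedFDeriv ℝ b (𝓕 W) w‖
      ≤ 2 ^ N * (‖w‖ ^ 0 + ‖w‖ ^ N) * ‖iteratedFDeriv ℝ b (𝓕 W) w‖ := by gcongr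
    _ = 2 ^ N * (‖w‖ ^ 0 * ‖iteratedFDeriv ℝ b (𝓕 W) w‖
        + ‖w‖ ^ N * ‖iteratedFDeriv ℝ b (𝓕 W) w‖) := by ring
    _ ≤ 2 ^ N * (c 0 * A + c N * A) := by
      exact mul_le_mul_of_nonneg_left (add_le_add (hkey 0 (Nat.zero_le _)) (hkey N le_rfl))
        (by positivity)
    _ = _ := by ring

/-- The same with the normalization `ft` of the Fourier transform. -/
theorem exists_ft_decay_const (b N : ℕ) : ∃ c : ℝ, 0 ≤ c ∧ ∀ (W : E3 → ℂ), ContDiff ℝ N W →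
    ∀ A : ℝ, (∀ n ≤ N, ∀ z, (1 + ‖z‖) ^ (b + 4) * ‖iteratedFDeriv ℝ n W z‖ ≤ A) →
      ContDiff ℝ b (ft W) ∧
      ∀ η : E3, (1 + ‖η‖) ^ N * ‖iteratedFDeriv ℝ b (ft W) η‖ ≤ c * A := by
  obtain ⟨c, hc0, hc⟩ := exists_fourier_decay_const ℂ b N
  refine ⟨(2 * Real.pi) ^ N * c, by positivity, fun W hW A hA => ?_⟩
  have hF : ContDiff ℝ b (𝓕 W) := by
    have := Real.contDiff_fourier (f := W) (N := b) (fun n hn => ?_)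
    · exact_mod_cast this
    · exact (integrable_pow_mul_norm hW.continuous (A := A) (fun ζ => by
        simpa only [norm_iteratedFDeriv_zero] using hA 0 (Nat.zero_le _) ζ)
        (show n ≤ b by exact_mod_cast hn)).1
  have hft : ft W = fun η => 𝓕 W ((2 * Real.pi)⁻¹ • η) := funext fun η => ft_eq_fourier W η
  rw [hft]
  refine ⟨hF.comp (contDiff_const_smul _), fun η => ?_⟩
  have h1 := congrFun (iteratedFDeriv_comp_const_smul (2 * Real.pi)⁻¹ hF) η
  rw [h1, norm_smul]
  have h3 : (1 : ℝ) ≤ 2 * Real.pi := by linarith [Real.pi_gt_three]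
  have h2 : ‖(2 * Real.pi)⁻¹ ^ b‖ ≤ 1 := by
    rw [norm_pow, norm_inv, Real.norm_of_nonneg (by positivity)]
    exact pow_le_one₀ (by positivity) (inv_le_one_of_one_le₀ h3)
  have h4 : 1 + ‖η‖ ≤ 2 * Real.pi * (1 + ‖(2 * Real.pi)⁻¹ • η‖) := by
    rw [norm_smul, norm_inv, Real.norm_of_nonneg (by positivity), mul_add,
      mul_inv_cancel_left₀ (by positivity)]
    linarith
  set w := (2 * Real.pi)⁻¹ • η
  calc (1 + ‖η‖) ^ N * (‖(2 * Real.pi)⁻¹ ^ b‖ * ‖iteratedFDeriv ℝ b (𝓕 W) w‖)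
      ≤ (2 * Real.pi * (1 + ‖w‖)) ^ N * (1 * ‖iteratedFDeriv ℝ b (𝓕 W) w‖) := by gcongr
    _ = (2 * Real.pi) ^ N * ((1 + ‖w‖) ^ N * ‖iteratedFDeriv ℝ b (𝓕 W) w‖) := by
      rw [mul_pow]
      ring
    _ ≤ (2 * Real.pi) ^ N * (c * A) := by
      exact mul_le_mul_of_nonneg_left (hc W hW A hA w) (by positivity)
    _ = _ := by ring

/-- A function that is smooth off the origin and vanishes to order `M + 1` there, with the
corresponding bounds on its derivatives, is of class `C^M`. -/
theorem contDiff_of_flat (M : ℕ) : ∀ {V : Type} [NormedAddCommGroup V] [NormedSpace ℝ V]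
    {F : E3 → V} (_ : F 0 = 0) (_ : ContDiffOn ℝ ∞ F {z | z ≠ 0}) {A : ℕ → ℝ}
    (_ : ∀ b ≤ M, ∀ z : E3, z ≠ 0 → ‖z‖ < 1 →
      ‖iteratedFDeriv ℝ b F z‖ ≤ A b * ‖z‖ ^ (M + 1 - b)),
    ContDiff ℝ M F ∧ ∀ b ≤ M, iteratedFDeriv ℝ b F 0 = 0 := by
  have hΩ : IsOpen {z : E3 | z ≠ 0} := isOpen_ne
  induction M with
  | zero =>
    intro V _ _ F h0 hs A hb
    refine ⟨?_, fun b hb => ?_⟩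
    · refine contDiff_zero.2 (continuous_iff_continuousAt.2 fun z => ?_)
      rcases eq_or_ne z 0 with rfl | hz
      · rw [ContinuousAt, h0, tendsto_zero_iff_norm_tendsto_zero]
        have hlim : Tendsto (fun z : E3 => |A 0| * ‖z‖) (𝓝 0) (𝓝 0) := by
          have : Continuous fun z : E3 => |A 0| * ‖z‖ := by fun_prop
          simpa using this.tendsto 0
        refine squeeze_zero' (Filter.Eventually.of_forall fun z => norm_nonneg _) ?_ hlim
        filter_upwards [Metric.ball_mem_nhds (0 : E3) one_pos] with z hz
        rcases eq_or_ne z 0 with rfl | hz0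
        · simp [h0]
        · have h1 := hb 0 le_rfl z hz0 (by simpa using hz)
          rw [norm_iteratedFDeriv_zero, zero_add, Nat.sub_zero, pow_one] at h1
          exact h1.trans (mul_le_mul_of_nonneg_right (le_abs_self _) (norm_nonneg _))
      · exact (hs.contDiffAt (hΩ.mem_nhds hz)).continuousAt
    · obtain rfl : b = 0 := by omega
      rw [← norm_eq_zero, norm_iteratedFDeriv_zero, h0, norm_zero]
  | succ M ih =>
    intro V _ _ F h0 hs A hb
    have hd0 : HasFDerivAt F (0 : E3 →L[ℝ] V) 0 := by
      rw [hasFDerivAt_iff_isLittleO_nhds_zero]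
      refine Asymptotics.IsBigO.trans_isLittleO (g := fun z : E3 => ‖z‖ ^ 2) ?_ ?_
      · refine Asymptotics.IsBigO.of_bound |A 0| ?_
        filter_upwards [Metric.ball_mem_nhds (0 : E3) one_pos] with z hz
        rcases eq_or_ne z 0 with rfl | hz0
        · simp [h0]
        · have hz1 : ‖z‖ < 1 := by simpa using hz
          have h1 := hb 0 (Nat.zero_le _) z hz0 hz1
          rw [norm_iteratedFDeriv_zero] at h1
          rw [zero_add, h0, sub_zero, _root_.zero_apply, sub_zero,
            Real.norm_of_nonneg (by positivity)]
          refine h1.trans (mul_le_mul (le_abs_self _) ?_ (by positivity) (abs_nonneg _))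
          exact pow_le_pow_of_le_one (norm_nonneg _) hz1.le (by omega)
      · refine Asymptotics.isLittleO_norm_right.1 ?_
        exact (Asymptotics.isLittleO_pow_id (by norm_num : 1 < 2)).comp_tendsto
          (by simpa using (continuous_norm (E := E3)).tendsto 0)
    have hdiff : Differentiable ℝ F := fun z => by
      rcases eq_or_ne z 0 with rfl | hz
      · exact hd0.differentiableAt
      · exact (hs.contDiffAt (hΩ.mem_nhds hz)).differentiableAt (by simp)
    have hsd : ContDiffOn ℝ ∞ (fderiv ℝ F) {z | z ≠ 0} :=
      hs.fderiv_of_isOpen hΩ (by simp)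
    obtain ⟨h1, h2⟩ := ih (F := fderiv ℝ F) hd0.fderiv hsd (A := fun b => A (b + 1))
      (fun b hbM z hz hz1 => by
        have := hb (b + 1) (by omega) z hz hz1
        rw [← norm_iteratedFDeriv_fderiv, show M + 1 + 1 - (b + 1) = M + 1 - b by omega] at this
        exact this)
    refine ⟨?_, fun b hbM => ?_⟩
    · push_cast
      exact contDiff_succ_iff_fderiv.2 ⟨hdiff, fun h => by simp at h, h1⟩
    · rcases b with _ | b
      · rw [← norm_eq_zero, norm_iteratedFDeriv_zero, h0, norm_zero]
      · rw [← norm_eq_zero, ← norm_iteratedFDeriv_fderiv, h2 b (by omega), norm_zero]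

/-! ### Partial Fourier transforms of kernels -/

/-- The derivatives in the second variable of a jointly smooth function are jointly smooth. -/
theorem contDiffOn_iteratedFDeriv_snd {Ω : Set E3} (hΩ : IsOpen Ω) {T : E3 → E3 → ℂ}
    (hT : ContDiffOn ℝ ∞ (fun q : E3 × E3 => T q.1 q.2) {q | q.2 ∈ Ω}) (b : ℕ) :
    ContDiffOn ℝ ∞ (fun q : E3 × E3 => iteratedFDeriv ℝ b (T q.1) q.2) {q | q.2 ∈ Ω} := by
  have hΩ' : IsOpen {q : E3 × E3 | q.2 ∈ Ω} := hΩ.preimage continuous_snd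
  induction b with
  | zero =>
    have : (fun q : E3 × E3 => iteratedFDeriv ℝ 0 (T q.1) q.2) = fun q =>
        (continuousMultilinearCurryFin0 ℝ E3 ℂ).symm (T q.1 q.2) := by
      funext q
      rw [iteratedFDeriv_zero_eq_comp]
      rfl
    rw [this]
    exact (continuousMultilinearCurryFin0 ℝ E3 ℂ).symm.contDiff.comp_contDiffOn hT
  | succ b ih =>
    have : (fun q : E3 × E3 => iteratedFDeriv ℝ (b + 1) (T q.1) q.2) = fun q =>
        curryLeftIso E3 ℂ b (fderiv ℝ (iteratedFDeriv ℝ b (T q.1)) q.2) := by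
      funext q
      exact iteratedFDeriv_succ_eq_curryLeftIso _ _ _
    rw [this]
    have hiso : ContDiff ℝ ∞ fun f : E3 →L[ℝ] (E3 [×b]→L[ℝ] ℂ) => curryLeftIso E3 ℂ b f :=
      ContinuousLinearEquiv.contDiff (𝕜 := ℝ) (E := E3 →L[ℝ] (E3 [×b]→L[ℝ] ℂ))
        (F := E3 [×(b + 1)]→L[ℝ] ℂ) (curryLeftIso E3 ℂ b)
    refine hiso.comp_contDiffOn fun q hq => ?_
    refine (ContDiffAt.fderiv (f := fun (q : E3 × E3) (z : E3) => iteratedFDeriv ℝ b (T q.1) z)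
      (g := fun q => q.2) (n := ∞) ?_ contDiffAt_snd (by simp)).contDiffWithinAt
    have h1 : ContDiffAt ℝ ∞ (fun q : E3 × E3 => iteratedFDeriv ℝ b (T q.1) q.2) q :=
      ih.contDiffAt (hΩ'.mem_nhds hq)
    exact ContDiffAt.comp (q, q.2) (g := fun q : E3 × E3 => iteratedFDeriv ℝ b (T q.1) q.2)
      (f := fun r : (E3 × E3) × E3 => (r.1.1, r.2)) h1
      ((contDiffAt_fst.comp _ contDiffAt_fst).prodMk contDiffAt_snd)

/-- The Fourier transform of a kernel in its first variable. -/
def xft (T : E3 → E3 → ℂ) (ζ z : E3) : ℂ := 𝓕 (fun x => T x z) ζ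

section PartialFourier

variable {Ω : Set E3} {T : E3 → E3 → ℂ} {w : ℕ → E3 → ℝ}

theorem xft_eq (T : E3 → E3 → ℂ) (ζ z : E3) : xft T ζ z = ∫ x, waveE x (-ζ) * T x z :=
  fourier_eq_waveE _ ζ

theorem contDiff_iteratedFDeriv_fst (hΩ : IsOpen Ω)
    (hT : ContDiffOn ℝ ∞ (fun q : E3 × E3 => T q.1 q.2) {q | q.2 ∈ Ω}) (b : ℕ) {z : E3}
    (hz : z ∈ Ω) : ContDiff ℝ ∞ fun x => iteratedFDeriv ℝ b (T x) z := by
  have h := contDiffOn_iteratedFDeriv_snd hΩ hT b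
  rw [← contDiffOn_univ]
  exact h.comp (f := fun x : E3 => (x, z)) (by fun_prop) fun x _ => hz

theorem contDiffOn_snd (hT : ContDiffOn ℝ ∞ (fun q : E3 × E3 => T q.1 q.2) {q | q.2 ∈ Ω})
    (x : E3) : ContDiffOn ℝ ∞ (T x) Ω :=
  hT.comp (f := fun z : E3 => (x, z)) (by fun_prop) fun z hz => hz

/-- The Fourier transform in the first variable of a kernel that is smooth and of Schwartz type in
this variable is smooth in the second one and can be differentiated under the integral sign. -/
theorem xft_spec (hΩ : IsOpen Ω)
    (hT : ContDiffOn ℝ ∞ (fun q : E3 × E3 => T q.1 q.2) {q | q.2 ∈ Ω})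
    (hw : ∀ b, ContinuousOn (w b) Ω)
    (hb : ∀ b : ℕ, ∃ C : ℝ, ∀ x, ∀ z ∈ Ω, (1 + ‖x‖) ^ 4 * ‖iteratedFDeriv ℝ b (T x) z‖ ≤ C * w b z)
    (ζ : E3) : ContDiffOn ℝ ∞ (xft T ζ) Ω ∧ ∀ b : ℕ, ∀ z ∈ Ω,
      iteratedFDeriv ℝ b (xft T ζ) z = 𝓕 (fun x => iteratedFDeriv ℝ b (T x) z) ζ := by
  have hfd : ∀ (n : ℕ) (x : E3), ∀ z ∈ Ω, iteratedFDeriv ℝ n (fun z => waveE x (-ζ) * T x z) z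
      = waveE x (-ζ) • iteratedFDeriv ℝ n (T x) z := fun n x z hz =>
    iteratedFDeriv_const_smul_apply (a := waveE x (-ζ)) (f := T x)
      (((contDiffOn_snd hT x).contDiffAt (hΩ.mem_nhds hz)).of_le (natCast_le_infty n))
  have h := contDiffOn_integral_and_iteratedFDeriv (μ := volume) hΩ
    (fun x z => waveE x (-ζ) * T x z)
    (fun x => contDiffOn_const.mul (contDiffOn_snd hT x))
    (fun n z hz => ?_) (fun n z₀ hz₀ => ?_)
  · have e : xft T ζ = fun z => ∫ x, waveE x (-ζ) * T x z := funext fun z => xft_eq T ζ z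
    rw [e]
    refine ⟨h.1, fun b z hz => ?_⟩
    rw [h.2 b z hz, fourier_eq_waveE]
    congr 1
    funext x
    exact hfd b x z hz
  · simp only [hfd n _ z hz]
    exact ((continuous_waveE.comp (f := fun x : E3 => (x, -ζ)) (by fun_prop)).smul
      (contDiff_iteratedFDeriv_fst hΩ hT n hz).continuous).aestronglyMeasurable
  · obtain ⟨C, hC⟩ := hb n
    have h1 : ContinuousOn (fun z => C * w n z) Ω := continuousOn_const.mul (hw n)
    have h2 := (h1.continuousAt (hΩ.mem_nhds hz₀)).eventually_lt
      (continuousAt_const (y := C * w n z₀ + 1)) (lt_add_one _)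
    obtain ⟨ε, hε, h3⟩ := Metric.eventually_nhds_iff_ball.1 h2
    refine ⟨ε, hε, fun x => (C * w n z₀ + 1) * ((1 + ‖x‖) ^ 4)⁻¹,
      integrable_weight_inv.const_mul _, Filter.Eventually.of_forall fun x z hz hzΩ => ?_⟩
    rw [hfd n x z hzΩ, norm_smul, norm_waveE, one_mul]
    exact le_mul_inv_pow ((hC x z hzΩ).trans (h3 z hz).le)

/-- The partial Fourier transform decreases rapidly in `ζ` if all derivatives in `x` are bounded by
`(1 + |x|)^{-4}`, uniformly up to the weight `w`. -/
theorem xft_bound (hΩ : IsOpen Ω)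
    (hT : ContDiffOn ℝ ∞ (fun q : E3 × E3 => T q.1 q.2) {q | q.2 ∈ Ω})
    (hw : ∀ b, ContinuousOn (w b) Ω) (hw0 : ∀ b, ∀ z ∈ Ω, 0 ≤ w b z)
    (hb : ∀ a b : ℕ, ∃ C : ℝ, ∀ x, ∀ z ∈ Ω, (1 + ‖x‖) ^ 4 * ‖mixedDeriv T a b x z‖ ≤ C * w b z)
    (b k : ℕ) : ∃ C : ℝ, 0 ≤ C ∧ ∀ ζ, ∀ z ∈ Ω,
      (1 + ‖ζ‖) ^ k * ‖iteratedFDeriv ℝ b (xft T ζ) z‖ ≤ C * w b z := by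
  obtain ⟨c, hc0, hc⟩ := exists_fourier_decay_const (E3 [×b]→L[ℝ] ℂ) 0 k
  choose C hC using fun a => hb a b
  refine ⟨c * ∑ a ∈ Finset.range (k + 1), |C a|, by positivity, fun ζ z hz => ?_⟩
  have h0 : ∀ b : ℕ, ∃ C : ℝ, ∀ x, ∀ z ∈ Ω,
      (1 + ‖x‖) ^ 4 * ‖iteratedFDeriv ℝ b (T x) z‖ ≤ C * w b z := by
    intro b
    obtain ⟨C, hC⟩ := hb 0 b
    refine ⟨C, fun x z hz => ?_⟩
    have := hC x z hz
    rwa [mixedDeriv, norm_iteratedFDeriv_zero] at this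
  rw [(xft_spec hΩ hT hw h0 ζ).2 b z hz]
  have h1 := hc (fun x => iteratedFDeriv ℝ b (T x) z)
    ((contDiff_iteratedFDeriv_fst hΩ hT b hz).of_le (natCast_le_infty k))
    ((∑ a ∈ Finset.range (k + 1), |C a|) * w b z) (fun n hn x => ?_) ζ
  · rw [norm_iteratedFDeriv_zero] at h1
    rw [mul_assoc]
    exact h1
  · rw [zero_add]
    refine (hC n x z hz).trans (mul_le_mul_of_nonneg_right ?_ (hw0 b z hz))
    refine (le_abs_self _).trans (Finset.single_le_sum (f := fun a => |C a|)
      (fun a _ => abs_nonneg _) ?_)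
    exact Finset.mem_range.2 (by omega)

end PartialFourier

/-! ### Symbols of kernels -/

theorem ae_ne_zero : ∀ᵐ z : E3, z ≠ 0 := by
  simp [ae_iff]

theorem ae_prod_ne_zero : ∀ᵐ q : E3 × E3, q.2 ≠ 0 := by
  have h : (volume : Measure (E3 × E3)) (univ ×ˢ {0}) = 0 := by
    rw [Measure.volume_eq_prod, Measure.prod_prod]
    simp
  rw [ae_iff]
  convert h using 2
  ext q
  simp

theorem aestronglyMeasurable_of_continuousOn_ne {f : E3 → ℂ} (hf : ContinuousOn f {z | z ≠ 0}) :
    AEStronglyMeasurable f := by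
  have h := hf.aestronglyMeasurable (μ := volume) isOpen_ne.measurableSet
  rwa [Measure.restrict_eq_self_of_ae_mem (s := {z : E3 | z ≠ 0}) ae_ne_zero] at h

section Kernel

variable {T : E3 → E3 → ℂ} {m : E3 → ℝ}

theorem aestronglyMeasurable_kernel
    (hc : ContinuousOn (fun q : E3 × E3 => T q.1 q.2) {q | q.2 ≠ 0}) :
    AEStronglyMeasurable (fun q : E3 × E3 => T q.1 q.2) := by
  have hΩ : IsOpen {q : E3 × E3 | q.2 ≠ 0} := isOpen_ne.preimage continuous_snd
  have h := hc.aestronglyMeasurable (μ := volume) hΩ.measurableSet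
  rwa [Measure.restrict_eq_self_of_ae_mem (s := {q : E3 × E3 | q.2 ≠ 0}) ae_prod_ne_zero] at h

theorem norm_exp_phase (z η : E3) :
    ‖Complex.exp (-(Complex.I * ((inner ℝ z η : ℝ) : ℂ)))‖ = 1 := by
  rw [mul_comm Complex.I, ← neg_mul, ← Complex.ofReal_neg, Complex.norm_exp_ofReal_mul_I]

theorem continuousOn_kernel_snd
    (hc : ContinuousOn (fun q : E3 × E3 => T q.1 q.2) {q | q.2 ≠ 0}) (x : E3) :
    ContinuousOn (T x) {z | z ≠ 0} :=
  hc.comp (f := fun z : E3 => (x, z)) (by fun_prop) fun z hz => hz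

theorem continuous_kernel_fst
    (hc : ContinuousOn (fun q : E3 × E3 => T q.1 q.2) {q | q.2 ≠ 0}) {z : E3} (hz : z ≠ 0) :
    Continuous fun x => T x z := by
  rw [← continuousOn_univ]
  exact hc.comp (f := fun x : E3 => (x, z)) (by fun_prop) fun x _ => hz

theorem kernel_le (hb : ∀ x z, z ≠ 0 → (1 + ‖x‖) ^ 4 * ‖T x z‖ ≤ m z) {x z : E3} (hz : z ≠ 0) :
    ‖T x z‖ ≤ m z :=
  (le_mul_of_one_le_left (norm_nonneg _) (one_le_pow₀ (one_le_weight x))).trans (hb x z hz)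

theorem integrable_symbolIntegrand
    (hc : ContinuousOn (fun q : E3 × E3 => T q.1 q.2) {q | q.2 ≠ 0}) (hm : Integrable m)
    (hb : ∀ x z, z ≠ 0 → (1 + ‖x‖) ^ 4 * ‖T x z‖ ≤ m z) (x η : E3) :
    Integrable fun z => Complex.exp (-(Complex.I * ((inner ℝ z η : ℝ) : ℂ))) * T x z := by
  refine hm.mono' ((Continuous.aestronglyMeasurable (by fun_prop)).mul
    (aestronglyMeasurable_of_continuousOn_ne (continuousOn_kernel_snd hc x))) ?_
  filter_upwards [ae_ne_zero] with z hz
  rw [norm_mul, norm_exp_phase, one_mul]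
  exact kernel_le hb hz

theorem continuous_symbol
    (hc : ContinuousOn (fun q : E3 × E3 => T q.1 q.2) {q | q.2 ≠ 0}) (hm : Integrable m)
    (hb : ∀ x z, z ≠ 0 → (1 + ‖x‖) ^ 4 * ‖T x z‖ ≤ m z) (η : E3) :
    Continuous fun x => ft (T x) η := by
  refine continuous_of_dominated (bound := m)
    (fun x => (integrable_symbolIntegrand hc hm hb x η).1) (fun x => ?_) hm ?_
  · filter_upwards [ae_ne_zero] with z hz
    rw [norm_mul, norm_exp_phase, one_mul]
    exact kernel_le hb hz
  · filter_upwards [ae_ne_zero] with z hz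
    exact continuous_const.mul (continuous_kernel_fst hc hz)

theorem integrable_symbol
    (hc : ContinuousOn (fun q : E3 × E3 => T q.1 q.2) {q | q.2 ≠ 0}) (hm : Integrable m)
    (hb : ∀ x z, z ≠ 0 → (1 + ‖x‖) ^ 4 * ‖T x z‖ ≤ m z) (η : E3) :
    Integrable fun x => ft (T x) η := by
  refine (integrable_of_weight_le (continuous_symbol hc hm hb η).aestronglyMeasurable
    (A := ∫ z, m z) (Filter.Eventually.of_forall fun x => ?_)).1
  rw [ft, ← Complex.norm_of_nonneg (pow_nonneg (weight_pos x).le 4), ← norm_mul,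
    ← integral_const_mul]
  refine norm_integral_le_of_norm_le hm ?_
  filter_upwards [ae_ne_zero] with z hz
  rw [norm_mul, norm_mul, norm_exp_phase, one_mul,
    Complex.norm_of_nonneg (pow_nonneg (weight_pos x).le 4)]
  exact hb x z hz

theorem xft_norm_le (hb : ∀ x z, z ≠ 0 → (1 + ‖x‖) ^ 4 * ‖T x z‖ ≤ m z)
    (ζ : E3) {z : E3} (hz : z ≠ 0) : ‖xft T ζ z‖ ≤ m z * weightConst := by
  rw [xft_eq, weightConst, ← integral_const_mul]
  refine norm_integral_le_of_norm_le (integrable_weight_inv.const_mul _)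
    (Filter.Eventually.of_forall fun x => ?_)
  rw [norm_mul, norm_waveE, one_mul]
  exact le_mul_inv_pow (hb x z hz)

theorem integrable_symbol_prod
    (hc : ContinuousOn (fun q : E3 × E3 => T q.1 q.2) {q | q.2 ≠ 0}) (hm : Integrable m)
    (hb : ∀ x z, z ≠ 0 → (1 + ‖x‖) ^ 4 * ‖T x z‖ ≤ m z) (ζ η : E3) :
    Integrable (Function.uncurry fun x z : E3 => waveE x (-ζ) *
      (Complex.exp (-(Complex.I * ((inner ℝ z η : ℝ) : ℂ))) * T x z))
      (volume.prod volume) := by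
  refine (integrable_weight_inv.mul_prod hm).mono' ?_ ?_
  · refine AEStronglyMeasurable.mul (Continuous.aestronglyMeasurable
      (continuous_waveE.comp (f := fun q : E3 × E3 => (q.1, -ζ)) (by fun_prop)))
      ((Continuous.aestronglyMeasurable (by fun_prop)).mul ?_)
    exact aestronglyMeasurable_kernel hc
  · have := ae_prod_ne_zero
    rw [Measure.volume_eq_prod] at this
    filter_upwards [this] with q hq
    simp only [Function.uncurry]
    rw [norm_mul, norm_waveE, one_mul, norm_mul, norm_exp_phase, one_mul, mul_comm]
    exact le_mul_inv_pow (hb q.1 q.2 hq)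

/-- The Fourier transform in `x` of the symbol of a kernel is the Fourier transform in `z` of the
partial Fourier transform of the kernel. -/
theorem fourier_symbol
    (hc : ContinuousOn (fun q : E3 × E3 => T q.1 q.2) {q | q.2 ≠ 0}) (hm : Integrable m)
    (hb : ∀ x z, z ≠ 0 → (1 + ‖x‖) ^ 4 * ‖T x z‖ ≤ m z) (ζ η : E3) :
    𝓕 (fun x => ft (T x) η) ζ = ft (xft T ζ) η := by
  have e1 : 𝓕 (fun x => ft (T x) η) ζ = ∫ x, ∫ z, waveE x (-ζ) *
      (Complex.exp (-(Complex.I * ((inner ℝ z η : ℝ) : ℂ))) * T x z) := by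
    rw [fourier_eq_waveE]
    congr 1
    funext x
    rw [smul_eq_mul, ft, integral_const_mul]
  rw [e1, integral_integral_swap (integrable_symbol_prod hc hm hb ζ η), ft]
  congr 1
  funext z
  rw [xft_eq, ← integral_const_mul]
  congr 1
  funext x
  ring

theorem continuous_ft_xft
    (hc : ContinuousOn (fun q : E3 × E3 => T q.1 q.2) {q | q.2 ≠ 0}) (hm : Integrable m)
    (hb : ∀ x z, z ≠ 0 → (1 + ‖x‖) ^ 4 * ‖T x z‖ ≤ m z) :
    Continuous fun q : E3 × E3 => ft (xft T q.1) q.2 := by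
  refine continuous_of_dominated (bound := fun z => m z * weightConst) (fun q => ?_) (fun q => ?_)
    (hm.mul_const _) ?_
  · refine (Continuous.aestronglyMeasurable (by fun_prop)).mul ?_
    have h := (integrable_symbol_prod hc hm hb q.1 0).integral_prod_right
    refine h.1.congr (Filter.Eventually.of_forall fun z => ?_)
    rw [xft_eq]
    refine integral_congr_ae (Filter.Eventually.of_forall fun x => ?_)
    simp [Function.uncurry]
  · filter_upwards [ae_ne_zero] with z hz
    rw [norm_mul, norm_exp_phase, one_mul]
    exact xft_norm_le hb q.1 hz
  · filter_upwards [ae_ne_zero] with z hz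
    refine Continuous.mul (by fun_prop) ?_
    simp only [xft_eq]
    have h1 := continuous_kernel_fst hc hz
    refine continuous_of_dominated (bound := fun x => m z * ((1 + ‖x‖) ^ 4)⁻¹) (fun q => ?_)
      (fun q => Filter.Eventually.of_forall fun x => ?_) (integrable_weight_inv.const_mul _)
      (Filter.Eventually.of_forall fun x => ?_)
    · exact ((continuous_waveE.comp (f := fun x : E3 => (x, -q.1)) (by fun_prop)).mul
        h1).aestronglyMeasurable
    · rw [norm_mul, norm_waveE, one_mul]
      exact le_mul_inv_pow (hb x z hz)
    · exact (continuous_waveE.comp (f := fun q : E3 × E3 => (x, -q.1)) (by fun_prop)).mul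
        continuous_const

/-- Fourier inversion in `x` recovers the symbol of the kernel. -/
theorem symbol_eq_symOf
    (hc : ContinuousOn (fun q : E3 × E3 => T q.1 q.2) {q | q.2 ≠ 0}) (hm : Integrable m)
    (hb : ∀ x z, z ≠ 0 → (1 + ‖x‖) ^ 4 * ‖T x z‖ ≤ m z)
    (hg : ∀ η, Integrable fun ζ => ft (xft T ζ) η) :
    (fun x η => ft (T x) η) = symOf fun ζ η => ft (xft T ζ) η := by
  funext x η
  have h1 : 𝓕 (fun x => ft (T x) η) = fun ζ => ft (xft T ζ) η :=
    funext fun ζ => fourier_symbol hc hm hb ζ η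
  have h2 := (continuous_symbol hc hm hb η).fourierInv_fourier_eq (integrable_symbol hc hm hb η)
    (by rw [h1]; exact hg η)
  rw [h1] at h2
  exact (congrFun h2 x).symm

end Kernel

/-! ### The terms of the expansion at the coalescence points -/

/-- Functions that are smooth off the origin and decrease rapidly with all derivatives. -/
structure IsShort (h : E3 → ℂ) : Prop where
  smooth : ContDiffOn ℝ ∞ h {z | z ≠ 0}
  decay : ∀ n k : ℕ, ∃ C : ℝ, ∀ z, 1 ≤ ‖z‖ → (1 + ‖z‖) ^ k * ‖iteratedFDeriv ℝ n h z‖ ≤ C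

theorem ne_zero_of_one_le {z : E3} (hz : 1 ≤ ‖z‖) : z ≠ 0 := by
  rintro rfl
  norm_num at hz

theorem isShort_zero : IsShort (fun _ => 0) :=
  ⟨contDiffOn_const, fun n k => ⟨0, fun z _ => by rw [iteratedFDeriv_fun_zero]; simp⟩⟩

theorem IsShort.contDiffAt {h : E3 → ℂ} (hh : IsShort h) {z : E3} (hz : z ≠ 0) (n : ℕ) :
    ContDiffAt ℝ n h z :=
  (hh.smooth.contDiffAt (isOpen_ne.mem_nhds hz)).of_le (natCast_le_infty n)

theorem IsShort.add {g h : E3 → ℂ} (hg : IsShort g) (hh : IsShort h) :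
    IsShort (fun z => g z + h z) := by
  refine ⟨hg.smooth.add hh.smooth, fun n k => ?_⟩
  obtain ⟨C, hC⟩ := hg.decay n k
  obtain ⟨D, hD⟩ := hh.decay n k
  refine ⟨C + D, fun z hz => ?_⟩
  have hz0 := ne_zero_of_one_le hz
  have : iteratedFDeriv ℝ n (fun z => g z + h z) z
      = iteratedFDeriv ℝ n g z + iteratedFDeriv ℝ n h z :=
    iteratedFDeriv_add_apply (hg.contDiffAt hz0 n) (hh.contDiffAt hz0 n)
  rw [this]
  refine (mul_le_mul_of_nonneg_left (norm_add_le _ _) (pow_nonneg (weight_pos z).le k)).trans ?_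
  rw [mul_add]
  exact add_le_add (hC z hz) (hD z hz)

theorem norm_iteratedFDeriv_mul_le_of_isOpen {Ω : Set E3} (hΩ : IsOpen Ω) {f g : E3 → ℂ}
    (hf : ContDiffOn ℝ ∞ f Ω) (hg : ContDiffOn ℝ ∞ g Ω) {z : E3} (hz : z ∈ Ω) (n : ℕ) :
    ‖iteratedFDeriv ℝ n (fun z => f z * g z) z‖ ≤ ∑ i ∈ Finset.range (n + 1),
      (n.choose i : ℝ) * ‖iteratedFDeriv ℝ i f z‖ * ‖iteratedFDeriv ℝ (n - i) g z‖ := by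
  have h := norm_iteratedFDerivWithin_mul_le hf hg hΩ.uniqueDiffOn hz (natCast_le_infty n)
  simp only [iteratedFDerivWithin_of_isOpen _ hΩ hz] at h
  exact h

theorem IsShort.isSym_mul {p : ℤ} {f h : E3 → ℂ} (hf : IsSym p f) (hh : IsShort h) :
    IsShort (fun z => f z * h z) := by
  refine ⟨hf.smooth.contDiffOn.mul hh.smooth, fun n k => ?_⟩
  choose C hC0 hC using hf.bound'
  choose D hD using fun i => hh.decay i (k + p.natAbs)
  refine ⟨∑ i ∈ Finset.range (n + 1), (n.choose i : ℝ) * C i * |D (n - i)|, fun z hz => ?_⟩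
  have hz0 := ne_zero_of_one_le hz
  refine (mul_le_mul_of_nonneg_left (norm_iteratedFDeriv_mul_le_of_isOpen isOpen_ne
    hf.smooth.contDiffOn hh.smooth hz0 n) (pow_nonneg (weight_pos z).le k)).trans ?_
  rw [Finset.mul_sum]
  refine Finset.sum_le_sum fun i _ => ?_
  have h1 : ‖iteratedFDeriv ℝ i f z‖ ≤ C i * (1 + ‖z‖) ^ p.natAbs := by
    refine (hC i z).trans (mul_le_mul_of_nonneg_left ?_ (hC0 i))
    rw [← zpow_natCast]
    exact weight_zpow_mono (by omega) z
  have h2 := (hD (n - i) z hz).trans (le_abs_self _)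
  have hz1 := weight_pos z
  have hCi := hC0 i
  calc (1 + ‖z‖) ^ k * ((n.choose i : ℝ) * ‖iteratedFDeriv ℝ i f z‖ *
        ‖iteratedFDeriv ℝ (n - i) h z‖)
      ≤ (1 + ‖z‖) ^ k * ((n.choose i : ℝ) * (C i * (1 + ‖z‖) ^ p.natAbs) *
        ‖iteratedFDeriv ℝ (n - i) h z‖) := by gcongr
    _ = (n.choose i : ℝ) * C i * ((1 + ‖z‖) ^ (k + p.natAbs) *
        ‖iteratedFDeriv ℝ (n - i) h z‖) := by
      rw [pow_add]
      ring
    _ ≤ _ := mul_le_mul_of_nonneg_left h2 (by positivity)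

theorem isShort_coulombShort : IsShort coulombShort := ⟨coulombShort_spec.1, coulombShort_spec.2⟩

theorem contDiff_normSq_pow (d : ℕ) : ContDiff ℝ ∞ fun z : E3 => ((‖z‖ ^ 2 : ℝ) : ℂ) ^ d :=
  contDiff_radial (f := fun t => (t : ℂ) ^ d) (Complex.ofRealCLM.contDiff.pow d)

theorem isSym_normSq_pow_mul_sphMono (d a b c : ℕ) :
    IsSym ((2 * d + (a + b + c) : ℕ) : ℤ)
      (fun z => ((‖z‖ ^ 2 : ℝ) : ℂ) ^ d * sphMono a b c z) := by
  refine isSym_of_homogeneous ((contDiff_normSq_pow d).mul (contDiff_sphMono a b c))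
    fun r η _ _ => ?_
  rw [sphMono_smul, norm_smul, mul_pow, Real.norm_eq_abs, sq_abs, zpow_natCast]
  push_cast
  ring

theorem HasHomFT.normSq_mul {n : ℕ} {f : E3 → ℂ} (hf : HasHomFT n f) :
    HasHomFT (n + 2) (fun z => ((‖z‖ ^ 2 : ℝ) : ℂ) * f z) := by
  have h := fun i : Fin 3 => (hf.inner_mul (stdE i)).inner_mul (stdE i)
  convert ((h 0).add (h 1)).add (h 2) using 2 with z
  rw [normSq_eq_sum, Fin.sum_univ_three]
  simp only [inner_stdE]
  ring

theorem HasHomFT.normSq_pow_mul {n : ℕ} {f : E3 → ℂ} (hf : HasHomFT n f) (d : ℕ) :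
    HasHomFT (2 * d + n) (fun z => ((‖z‖ ^ 2 : ℝ) : ℂ) ^ d * f z) := by
  induction d with
  | zero => simpa using hf
  | succ d ih =>
    have h := ih.normSq_mul
    rw [show 2 * (d + 1) + n = 2 * d + n + 2 by ring]
    convert h using 2 with z
    ring

theorem hasHomFT_zero (n : ℕ) : HasHomFT n (fun _ => 0) := by
  refine ⟨⟨aestronglyMeasurable_const, fun k => by simp⟩, 0, Submodule.zero_mem _, fun m => ?_⟩
  have : (fun η => ft (fun _ => 0) η - (0 : E3 → ℂ) η) = fun _ => 0 := by
    funext η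
    simp [ft]
  rw [this]
  exact ⟨contDiff_const, fun b => ⟨0, fun η => by rw [iteratedFDeriv_fun_zero]; simp⟩⟩

/-- Off the origin, `K` is the sum of a smooth function and of a rapidly decreasing function whose
Fourier transform has a leading term in `homSym (-4) (j - 1)`; the latter is absent if `j = 0`. -/
structure IsCuspSplit (j : ℕ) (K h q : E3 → ℂ) : Prop where
  eq : ∀ z, z ≠ 0 → K z = h z + q z
  smooth : ContDiff ℝ ∞ q
  short : IsShort h
  hom : HasHomFT (j - 1) h
  zero : j = 0 → h = fun _ => 0

theorem IsCuspSplit.add {j : ℕ} {K h q K' h' q' : E3 → ℂ} (H : IsCuspSplit j K h q)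
    (H' : IsCuspSplit j K' h' q') : IsCuspSplit j (fun z => K z + K' z) (fun z => h z + h' z)
      (fun z => q z + q' z) := by
  refine ⟨fun z hz => ?_, H.smooth.add H'.smooth, H.short.add H'.short, H.hom.add H'.hom,
    fun hj => ?_⟩
  · rw [H.eq z hz, H'.eq z hz]
    ring
  · simp [H.zero hj, H'.zero hj]

theorem IsCuspSplit.const_mul {j : ℕ} {K h q : E3 → ℂ} (H : IsCuspSplit j K h q) (c : ℂ) :
    IsCuspSplit j (fun z => c * K z) (fun z => c * h z) (fun z => c * q z) := by
  have hc : IsSym 0 (fun _ : E3 => c) := by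
    simpa using (isSym_of_mem_homSym one_mem_homSym).const_mul c
  refine ⟨fun z hz => ?_, contDiff_const.mul H.smooth, H.short.isSym_mul hc, H.hom.const_mul c,
    fun hj => ?_⟩
  · rw [H.eq z hz]
    ring
  · simp [H.zero hj]

theorem IsCuspSplit.congr {j : ℕ} {K K' h q : E3 → ℂ} (H : IsCuspSplit j K h q)
    (hK : ∀ z, z ≠ 0 → K' z = K z) : IsCuspSplit j K' h q :=
  ⟨fun z hz => (hK z hz).trans (H.eq z hz), H.smooth, H.short, H.hom, H.zero⟩

theorem exists_isCuspSplit_sum {ι : Type} (s : Finset ι) {j : ℕ} {K : ι → E3 → ℂ}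
    (H : ∀ i ∈ s, ∃ h q, IsCuspSplit j (K i) h q) :
    ∃ h q, IsCuspSplit j (fun z => ∑ i ∈ s, K i z) h q := by
  classical
  induction s using Finset.induction_on with
  | empty =>
    exact ⟨fun _ => 0, fun _ => 0, fun z _ => by simp, contDiff_const, isShort_zero,
      hasHomFT_zero _, fun _ => rfl⟩
  | insert a s ha ih =>
    obtain ⟨h, q, h1⟩ := H a (Finset.mem_insert_self a s)
    obtain ⟨h', q', h2⟩ := ih fun i hi => H i (Finset.mem_insert_of_mem hi)
    refine ⟨_, _, (h1.add h2).congr fun z _ => ?_⟩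
    exact Finset.sum_insert ha

/-- Homogeneous functions `|z|^e P(z)` with a polynomial `P` are smooth if `e` is even. For odd `e`,
`|z|` is replaced by `|z|² u(z)`, up to a smooth function. -/
theorem exists_isCuspSplit_mono {a b c e j : ℕ} (hj : a + b + c + e = j) :
    ∃ h q, IsCuspSplit j (fun z => ((‖z‖ ^ e : ℝ) : ℂ) * sphMono a b c z) h q := by
  obtain ⟨d, rfl | rfl⟩ := e.even_or_odd'
  · refine ⟨fun _ => 0, fun z => ((‖z‖ ^ 2 : ℝ) : ℂ) ^ d * sphMono a b c z, fun z _ => ?_,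
      (contDiff_normSq_pow d).mul (contDiff_sphMono a b c), isShort_zero, hasHomFT_zero _,
      fun _ => rfl⟩
    rw [zero_add, pow_mul, Complex.ofReal_pow]
  · refine ⟨fun z => ((‖z‖ ^ 2 : ℝ) : ℂ) ^ d * (sphMono a b c z * oddKernel z), fun z =>
      ((‖z‖ ^ 2 : ℝ) : ℂ) ^ (d + 1) * sphMono a b c z * coulombLong z, fun z hz => ?_,
      ((contDiff_normSq_pow (d + 1)).mul (contDiff_sphMono a b c)).mul coulombLong_spec.1, ?_, ?_,
      fun hj' => by omega⟩
    · have h1 := coulombShort_add_coulombLong hz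
      have h2 : ((‖z‖ : ℝ) : ℂ) = ((‖z‖ ^ 2 : ℝ) : ℂ) * (coulombShort z + coulombLong z) := by
        rw [h1, ← Complex.ofReal_mul]
        congr 1
        have := norm_ne_zero_iff.2 hz
        field_simp
      have h3 : ((‖z‖ ^ (2 * d + 1) : ℝ) : ℂ) = ((‖z‖ ^ 2 : ℝ) : ℂ) ^ d *
          (((‖z‖ ^ 2 : ℝ) : ℂ) * (coulombShort z + coulombLong z)) := by
        rw [← h2, pow_succ, pow_mul]
        push_cast
        ring
      rw [h3, oddKernel]
      ring
    · convert isShort_coulombShort.isSym_mul (isSym_normSq_pow_mul_sphMono (d + 1) a b c)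
        using 2 with z
      rw [oddKernel]
      ring
    · have := (hasHomFT_sphMono_mul_oddKernel a b c).normSq_pow_mul d
      rwa [show 2 * d + (a + b + c) = j - 1 by omega] at this

/-- A function `|z|^j Y(z/|z|)`, where `Y` is a monomial of degree at most `j` times a polynomial in
the last coordinate. -/
theorem exists_isCuspSplit_polynomial {a b j : ℕ} {D : ℕ} (P : Polynomial ℝ)
    (hP : P.natDegree ≤ D) (hj : a + b + D ≤ j) :
    ∃ h q, IsCuspSplit j (fun z => ((‖z‖ ^ j : ℝ) : ℂ) * (sphMono a b 0 (‖z‖⁻¹ • z) *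
      ((P.eval ((‖z‖⁻¹ • z) 2) : ℝ) : ℂ))) h q := by
  have h := exists_isCuspSplit_sum (Finset.range (D + 1)) (j := j)
    (K := fun k z => ((P.coeff k : ℝ) : ℂ) *
      (((‖z‖ ^ (j - (a + b + k)) : ℝ) : ℂ) * sphMono a b k z)) (fun k hk => by
    have hk' := Finset.mem_range.1 hk
    obtain ⟨h, q, H⟩ := exists_isCuspSplit_mono (a := a) (b := b) (c := k)
      (e := j - (a + b + k)) (j := j) (by omega)
    exact ⟨_, _, H.const_mul _⟩)
  obtain ⟨h, q, H⟩ := h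
  refine ⟨h, q, H.congr fun z hz => ?_⟩
  rw [Polynomial.eval_eq_sum_range' (Nat.lt_succ_of_le hP), Complex.ofReal_sum, Finset.mul_sum,
    Finset.mul_sum]
  refine Finset.sum_congr rfl fun k hk => ?_
  have hk' := Finset.mem_range.1 hk
  have hz0 : ((‖z‖ : ℝ) : ℂ) ≠ 0 := by exact_mod_cast norm_ne_zero_iff.2 hz
  have h1 : ((‖z‖ ^ j : ℝ) : ℂ)
      = ((‖z‖ ^ (j - (a + b + k)) : ℝ) : ℂ) * ((‖z‖ : ℝ) : ℂ) ^ (a + b + k)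
      := by
    rw [← Complex.ofReal_pow, ← Complex.ofReal_mul, ← pow_add, Nat.sub_add_cancel (by omega)]
  have h2 : sphMono a b 0 (‖z‖⁻¹ • z) * ((((‖z‖⁻¹ • z) 2 : ℝ) : ℂ)) ^ k
      = ((‖z‖⁻¹ : ℝ) : ℂ) ^ (a + b + k) * sphMono a b k z := by
    rw [← sphMono_smul]
    simp [sphMono]
  rw [h1, Complex.ofReal_mul, Complex.ofReal_pow ((‖z‖⁻¹ • z) 2)]
  rw [show ∀ A B C D E : ℂ, A * B * (C * (D * E)) = D * A * B * (C * E) by intros; ring, h2,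
    Complex.ofReal_inv, inv_pow]
  field_simp

/-- On the unit sphere, `Y_{lm}` is a monomial in `z₀ ± i z₁` of degree `|m|` times a polynomial of
degree at most `l - |m|` in `z₂`. -/
theorem exists_isCuspSplit_sphericalHarmonic {j l : ℕ} (hl : l ≤ j) {m : ℤ} (hm : |m| ≤ l) :
    ∃ h q, IsCuspSplit j
      (fun z => ((‖z‖ ^ j : ℝ) : ℂ) * sphericalHarmonic l m (‖z‖⁻¹ • z)) h q := by
  set n := m.natAbs with hn
  have hnl : n ≤ l := by
    rw [Int.abs_eq_natAbs] at hm
    omega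
  set P : Polynomial ℝ := Polynomial.derivative^[l + n] ((Polynomial.X ^ 2 - 1) ^ l) with hPdef
  have hP : P.natDegree ≤ l - n := by
    refine (Polynomial.natDegree_iterate_derivative _ _).trans ?_
    have h1 : ((Polynomial.X ^ 2 - 1 : Polynomial ℝ) ^ l).natDegree ≤ l * 2 := by
      refine Polynomial.natDegree_pow_le.trans (Nat.mul_le_mul_left _ ?_)
      refine (Polynomial.natDegree_sub_le _ _).trans ?_
      simp
    omega
  set κ : ℝ := Real.sqrt ((2 * (l : ℝ) + 1) / (4 * Real.pi) *
      ((Nat.factorial (l - n) : ℝ) / (Nat.factorial (l + n) : ℝ))) with hκ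
  set R : ℝ := 2 ^ l * (Nat.factorial l : ℝ) with hR
  have hY : ∀ u : E3, sphericalHarmonicNat l n u
      = ((κ : ℂ) * (-1) ^ n / (R : ℂ)) * (sphMono n 0 0 u * ((P.eval (u 2) : ℝ) : ℂ)) := by
    intro u
    rw [sphericalHarmonicNat, ← hκ, ← hR, ← hPdef, Complex.ofReal_div]
    simp only [sphMono, pow_zero, mul_one]
    ring
  unfold sphericalHarmonic
  split_ifs with h0
  · obtain ⟨h, q, H⟩ := exists_isCuspSplit_polynomial (a := n) (b := 0) (j := j) P hP (by omega)
    refine ⟨_, _, (H.const_mul ((κ : ℂ) * (-1) ^ n / (R : ℂ))).congr fun z _ => ?_⟩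
    rw [hY]
    ring
  · obtain ⟨h, q, H⟩ := exists_isCuspSplit_polynomial (a := 0) (b := n) (j := j) P hP (by omega)
    refine ⟨_, _, (H.const_mul ((-1) ^ n * ((κ : ℂ) * (-1) ^ n / (R : ℂ)))).congr fun z _ => ?_⟩
    have hconj : ∀ u : E3, (starRingEnd ℂ) (sphMono n 0 0 u) = sphMono 0 n 0 u := by
      intro u
      simp [sphMono, sub_eq_add_neg]
    rw [hY]
    simp only [map_mul, map_div₀, map_pow, map_neg, map_one, Complex.conj_ofReal, hconj]
    ring

/-! ### Symbols of kernels with a cusp -/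

theorem exists_schwartz_bound (f : SchwartzMap E3 ℂ) (n k : ℕ) :
    ∃ C : ℝ, ∀ x, (1 + ‖x‖) ^ k * ‖iteratedFDeriv ℝ n f x‖ ≤ C := by
  obtain ⟨C, hC⟩ := f.decay' 0 n
  obtain ⟨D, hD⟩ := f.decay' k n
  refine ⟨2 ^ k * (C + D), fun ζ => ?_⟩
  have h1 := hC ζ
  have h2 := hD ζ
  change ‖ζ‖ ^ 0 * ‖iteratedFDeriv ℝ n f ζ‖ ≤ C at h1
  change ‖ζ‖ ^ k * ‖iteratedFDeriv ℝ n f ζ‖ ≤ D at h2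
  set X := ‖iteratedFDeriv ℝ n f ζ‖
  calc (1 + ‖ζ‖) ^ k * X ≤ 2 ^ k * (‖ζ‖ ^ 0 + ‖ζ‖ ^ k) * X := by
        gcongr
        exact one_add_pow_le (norm_nonneg ζ) k
    _ = 2 ^ k * (‖ζ‖ ^ 0 * X + ‖ζ‖ ^ k * X) := by ring
    _ ≤ _ := mul_le_mul_of_nonneg_left (add_le_add h1 h2) (by positivity)

theorem isRapid_schwartz (f : SchwartzMap E3 ℂ) : IsRapid f := by
  refine ⟨f.continuous, fun k => ?_⟩
  obtain ⟨C, hC⟩ := exists_schwartz_bound f 0 k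
  exact ⟨C, fun ζ => by simpa only [norm_iteratedFDeriv_zero] using hC ζ⟩

theorem isRapid_fourier_schwartz (f : SchwartzMap E3 ℂ) : IsRapid (𝓕 (f : E3 → ℂ)) := by
  rw [← SchwartzMap.fourier_coe]
  exact isRapid_schwartz _

theorem norm_mixedDeriv_zero_left (f : E3 → E3 → ℂ) (b : ℕ) (x z : E3) :
    ‖mixedDeriv f 0 b x z‖ = ‖iteratedFDeriv ℝ b (f x) z‖ := norm_iteratedFDeriv_zero

theorem norm_mixedDeriv_zero (f : E3 → E3 → ℂ) (x z : E3) : ‖mixedDeriv f 0 0 x z‖ = ‖f x z‖ := by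
  rw [norm_mixedDeriv_zero_left, norm_iteratedFDeriv_zero]

/-- The weight `|z|^{-b} (1 + |z|)^{-M}` that bounds the derivatives of order `b` of a kernel with a
cusp. -/
def cuspWeight (M b : ℕ) (z : E3) : ℝ := ‖z‖ ^ (-(b : ℤ)) * ((1 + ‖z‖) ^ M)⁻¹

theorem cuspWeight_nonneg (M b : ℕ) (z : E3) : 0 ≤ cuspWeight M b z := by
  have := weight_pos z
  unfold cuspWeight
  positivity

theorem continuousOn_norm_zpow (n : ℤ) : ContinuousOn (fun z : E3 => ‖z‖ ^ n) {z | z ≠ 0} :=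
  fun _ hz => ContinuousAt.continuousWithinAt
    (continuous_norm.continuousAt.zpow₀ n (Or.inl (norm_ne_zero_iff.2 hz)))

theorem continuousOn_cuspWeight (M b : ℕ) : ContinuousOn (cuspWeight M b) {z | z ≠ 0} := by
  refine (continuousOn_norm_zpow _).mul (Continuous.continuousOn ?_)
  exact Continuous.inv₀ (by fun_prop) fun z => (pow_pos (weight_pos z) M).ne'

theorem integrable_of_weight_bound {V : Type} [NormedAddCommGroup V] {f : E3 → V}
    (hf : Continuous f) {A : ℝ} (h : ∀ x, (1 + ‖x‖) ^ 4 * ‖f x‖ ≤ A) : Integrable f :=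
  (integrable_of_weight_le hf.aestronglyMeasurable (Filter.Eventually.of_forall h)).1

/-- `∑_{j < J} ∑_{i ∈ S j} c j i * K j i z`. -/
def cuspSum {ι : Type} (S : ℕ → Finset ι) (c : ℕ → ι → ℂ) (K : ℕ → ι → E3 → ℂ) (J : ℕ) (z : E3) :
    ℂ := ∑ j ∈ Finset.range J, ∑ i ∈ S j, c j i * K j i z

section CuspSum

variable {ι : Type} {S : ℕ → Finset ι} {K : ℕ → ι → E3 → ℂ}

theorem contDiffAt_cuspSum {n : WithTop ℕ∞} {z : E3} (hK : ∀ j i, ContDiffAt ℝ n (K j i) z)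
    (c : ℕ → ι → ℂ) (J : ℕ) : ContDiffAt ℝ n (cuspSum S c K J) z :=
  ContDiffAt.sum fun j _ => ContDiffAt.sum fun i _ => contDiffAt_const.mul (hK j i)

theorem norm_iteratedFDeriv_cuspSum_le {b : ℕ} {z : E3} (hK : ∀ j i, ContDiffAt ℝ b (K j i) z)
    (c : ℕ → ι → ℂ) (J : ℕ) : ‖iteratedFDeriv ℝ b (cuspSum S c K J) z‖
      ≤ ∑ j ∈ Finset.range J, ∑ i ∈ S j, ‖c j i‖ * ‖iteratedFDeriv ℝ b (K j i) z‖ := by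
  unfold cuspSum
  rw [iteratedFDeriv_fun_sum_apply fun j _ =>
    ContDiffAt.sum fun i _ => contDiffAt_const.mul (hK j i)]
  refine (norm_sum_le _ _).trans (Finset.sum_le_sum fun j _ => ?_)
  rw [iteratedFDeriv_fun_sum_apply fun i _ => contDiffAt_const.mul (hK j i)]
  refine (norm_sum_le _ _).trans (Finset.sum_le_sum fun i _ => ?_)
  have : iteratedFDeriv ℝ b (fun z => c j i * K j i z) z = c j i • iteratedFDeriv ℝ b (K j i) z :=
    iteratedFDeriv_const_smul_apply (a := c j i) (hK j i)
  rw [this, norm_smul]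

theorem exists_bound_cuspSum {c : ℕ → ι → E3 → ℂ} (hc : ∀ j i, IsRapid (c j i)) {A : Set E3}
    {b L : ℕ} (hK : ∀ j i, ∀ z ∈ A, ContDiffAt ℝ b (K j i) z)
    (hb : ∀ j i, ∃ B : ℝ, ∀ z ∈ A, (1 + ‖z‖) ^ L * ‖iteratedFDeriv ℝ b (K j i) z‖ ≤ B) (k J : ℕ) :
    ∃ C : ℝ, ∀ ζ, ∀ z ∈ A, (1 + ‖ζ‖) ^ k * ((1 + ‖z‖) ^ L *
      ‖iteratedFDeriv ℝ b (cuspSum S (fun j i => c j i ζ) K J) z‖) ≤ C := by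
  choose B hB using hb
  choose D hD0 hD using fun j i => (hc j i).bound' k
  refine ⟨∑ j ∈ Finset.range J, ∑ i ∈ S j, D j i * |B j i|, fun ζ z hz => ?_⟩
  have hz1 := weight_pos z
  have hζ1 := weight_pos ζ
  calc _ ≤ (1 + ‖ζ‖) ^ k * ((1 + ‖z‖) ^ L * ∑ j ∈ Finset.range J, ∑ i ∈ S j,
        ‖c j i ζ‖ * ‖iteratedFDeriv ℝ b (K j i) z‖) := by
        gcongr
        exact norm_iteratedFDeriv_cuspSum_le (fun j i => hK j i z hz) _ J
    _ = ∑ j ∈ Finset.range J, ∑ i ∈ S j, ((1 + ‖ζ‖) ^ k * ‖c j i ζ‖) *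
        ((1 + ‖z‖) ^ L * ‖iteratedFDeriv ℝ b (K j i) z‖) := by
      simp only [Finset.mul_sum]
      refine Finset.sum_congr rfl fun j _ => Finset.sum_congr rfl fun i _ => ?_
      ring
    _ ≤ _ := by
      refine Finset.sum_le_sum fun j _ => Finset.sum_le_sum fun i _ => ?_
      exact mul_le_mul (hD j i ζ) ((hB j i z hz).trans (le_abs_self _)) (by positivity) (hD0 j i)

end CuspSum

/-- Kernels `T(x, z)` that are smooth off `z = 0`, decrease rapidly, and have an expansion at
`z = 0` whose terms are split into a smooth and a short-range part. -/
structure IsCuspKernel {ι : Type} (S : ℕ → Finset ι) (v : ℕ → ι → SchwartzMap E3 ℂ)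
    (h q : ℕ → ι → E3 → ℂ) (T : E3 → E3 → ℂ) : Prop where
  smooth : ContDiffOn ℝ ∞ (fun r : E3 × E3 => T r.1 r.2) {r | r.2 ≠ 0}
  decay : ∀ a b k : ℕ, ∃ C : ℝ, ∀ x z : E3, 1 ≤ ‖z‖ →
    (‖x‖ + ‖z‖) ^ k * ‖mixedDeriv T a b x z‖ ≤ C
  expansion : ∀ J a b k : ℕ, ∃ C : ℝ, ∀ x z : E3, z ≠ 0 → ‖z‖ ≤ 1 →
    ‖x‖ ^ k * ‖mixedDeriv (fun x z => T x z
      - cuspSum S (fun j i => v j i x) (fun j i z => h j i z + q j i z) J z) a b x z‖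
      ≤ C * ‖z‖ ^ ((J : ℤ) - (b : ℤ))
  split : ∀ j i, IsCuspSplit j (fun z => h j i z + q j i z) (h j i) (q j i)

namespace IsCuspKernel

variable {ι : Type} {S : ℕ → Finset ι} {v : ℕ → ι → SchwartzMap E3 ℂ} {h q : ℕ → ι → E3 → ℂ}
  {T : E3 → E3 → ℂ}

/-- The bounds of the expansion with the weight `1 + |x|` in place of `|x|`. -/
theorem bound_remainder (H : IsCuspKernel S v h q T) (J a b k : ℕ) : ∃ C : ℝ, 0 ≤ C ∧
    ∀ x z : E3, z ≠ 0 → ‖z‖ ≤ 1 → (1 + ‖x‖) ^ k * ‖mixedDeriv (fun x z => T x z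
      - cuspSum S (fun j i => v j i x) (fun j i z => h j i z + q j i z) J z) a b x z‖
      ≤ C * ‖z‖ ^ ((J : ℤ) - (b : ℤ)) := by
  obtain ⟨C, hC⟩ := H.expansion J a b 0
  obtain ⟨D, hD⟩ := H.expansion J a b k
  refine ⟨2 ^ k * (|C| + |D|), by positivity, fun x z hz hz1 => ?_⟩
  have hp : 0 ≤ ‖z‖ ^ ((J : ℤ) - (b : ℤ)) := zpow_nonneg (norm_nonneg z) _
  have h1 := le_abs_mul_of_le hp (hC x z hz hz1)
  have h2 := le_abs_mul_of_le hp (hD x z hz hz1)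
  set X := ‖mixedDeriv (fun x z => T x z
      - cuspSum S (fun j i => v j i x) (fun j i z => h j i z + q j i z) J z) a b x z‖
  calc (1 + ‖x‖) ^ k * X ≤ 2 ^ k * (‖x‖ ^ 0 + ‖x‖ ^ k) * X := by
        gcongr
        exact one_add_pow_le (norm_nonneg x) k
    _ = 2 ^ k * (‖x‖ ^ 0 * X + ‖x‖ ^ k * X) := by ring
    _ ≤ 2 ^ k * (|C| * ‖z‖ ^ ((J : ℤ) - (b : ℤ)) + |D| * ‖z‖ ^ ((J : ℤ) - (b : ℤ))) :=
      mul_le_mul_of_nonneg_left (add_le_add h1 h2) (by positivity)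
    _ = _ := by ring

/-- The remainder with `J = 0` is the kernel itself, which gives the bound near `z = 0`. -/
theorem bound (H : IsCuspKernel S v h q T) (M a b k : ℕ) : ∃ C : ℝ, 0 ≤ C ∧
    ∀ x z : E3, z ≠ 0 → (1 + ‖x‖) ^ k * ‖mixedDeriv T a b x z‖ ≤ C * cuspWeight M b z := by
  obtain ⟨C, hC0, hC⟩ := H.bound_remainder 0 a b k
  obtain ⟨D, hD⟩ := H.decay a b (k + M + b)
  simp only [cuspSum, Finset.range_zero, Finset.sum_empty, sub_zero, Nat.cast_zero, zero_sub] at hC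
  refine ⟨2 ^ M * (C + |D|), by positivity, fun x z hz => ?_⟩
  have hz0 : 0 < ‖z‖ := norm_pos_iff.2 hz
  have hzw := weight_pos z
  unfold cuspWeight
  rcases le_total ‖z‖ 1 with hz1 | hz1
  · refine (hC x z hz hz1).trans ?_
    have h1 : 1 ≤ 2 ^ M * ((1 + ‖z‖) ^ M)⁻¹ := by
      rw [← div_eq_mul_inv, one_le_div (by positivity)]
      gcongr
      linarith
    calc C * ‖z‖ ^ (-(b : ℤ)) ≤ (C + |D|) * ‖z‖ ^ (-(b : ℤ)) * 1 := by
          rw [mul_one]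
          gcongr
          exact le_add_of_nonneg_right (abs_nonneg D)
      _ ≤ (C + |D|) * ‖z‖ ^ (-(b : ℤ)) * (2 ^ M * ((1 + ‖z‖) ^ M)⁻¹) := by gcongr
      _ = _ := by ring
  · have h1 := (hD x z hz1).trans (le_abs_self D)
    have hx := norm_nonneg x
    rw [zpow_neg, zpow_natCast, ← mul_inv, ← div_eq_mul_inv, le_div_iff₀ (by positivity)]
    calc (1 + ‖x‖) ^ k * ‖mixedDeriv T a b x z‖ * (‖z‖ ^ b * (1 + ‖z‖) ^ M)
        ≤ (‖x‖ + ‖z‖) ^ k * ‖mixedDeriv T a b x z‖ *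
          ((‖x‖ + ‖z‖) ^ b * (2 * (‖x‖ + ‖z‖)) ^ M) := by
          have p1 := pow_le_pow_left₀ (weight_pos x).le
            (show 1 + ‖x‖ ≤ ‖x‖ + ‖z‖ by linarith) k
          have p2 := pow_le_pow_left₀ hz0.le (show ‖z‖ ≤ ‖x‖ + ‖z‖ by linarith) b
          have p3 := pow_le_pow_left₀ hzw.le (show 1 + ‖z‖ ≤ 2 * (‖x‖ + ‖z‖) by linarith) M
          exact mul_le_mul (mul_le_mul_of_nonneg_right p1 (norm_nonneg _))
            (mul_le_mul p2 p3 (by positivity) (by positivity)) (by positivity) (by positivity)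
      _ = 2 ^ M * ((‖x‖ + ‖z‖) ^ (k + M + b) * ‖mixedDeriv T a b x z‖) := by
        rw [mul_pow, pow_add, pow_add]
        ring
      _ ≤ 2 ^ M * |D| := by gcongr
      _ ≤ _ := by
        gcongr
        exact le_add_of_nonneg_left hC0

theorem continuousOn (H : IsCuspKernel S v h q T) :
    ContinuousOn (fun r : E3 × E3 => T r.1 r.2) {r | r.2 ≠ 0} := H.smooth.continuousOn

theorem exists_weight_bound (H : IsCuspKernel S v h q T) (k : ℕ) : ∃ C : ℝ, 0 ≤ C ∧ ∀ x z : E3,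
    z ≠ 0 → (1 + ‖x‖) ^ 4 * ‖T x z‖ ≤ C * ((1 + ‖z‖) ^ k)⁻¹ := by
  obtain ⟨C, hC0, hC⟩ := H.bound k 0 0 4
  refine ⟨C, hC0, fun x z hz => ?_⟩
  have := hC x z hz
  simpa [norm_mixedDeriv_zero, cuspWeight] using this

theorem exists_dominating (H : IsCuspKernel S v h q T) : ∃ m : E3 → ℝ, Integrable m ∧
    ∀ x z, z ≠ 0 → (1 + ‖x‖) ^ 4 * ‖T x z‖ ≤ m z := by
  obtain ⟨C, -, hC⟩ := H.exists_weight_bound 4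
  exact ⟨fun z => C * ((1 + ‖z‖) ^ 4)⁻¹, integrable_weight_inv.const_mul C, hC⟩

theorem contDiffOn_xft (H : IsCuspKernel S v h q T) (ζ : E3) :
    ContDiffOn ℝ ∞ (xft T ζ) {z | z ≠ 0} := by
  refine (xft_spec (w := cuspWeight 0) isOpen_ne H.smooth (continuousOn_cuspWeight 0) (fun b => ?_)
    ζ).1
  obtain ⟨C, -, hC⟩ := H.bound 0 0 b 4
  exact ⟨C, fun x z hz => by simpa only [norm_mixedDeriv_zero_left] using hC x z hz⟩

theorem bound_xft (H : IsCuspKernel S v h q T) (M b k : ℕ) : ∃ C : ℝ, 0 ≤ C ∧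
    ∀ ζ z : E3, z ≠ 0 →
      (1 + ‖ζ‖) ^ k * ‖iteratedFDeriv ℝ b (xft T ζ) z‖ ≤ C * cuspWeight M b z :=
  xft_bound (w := cuspWeight M) isOpen_ne H.smooth (continuousOn_cuspWeight M)
    (fun b z _ => cuspWeight_nonneg M b z) (fun a b => by
      obtain ⟨C, -, hC⟩ := H.bound M a b 4
      exact ⟨C, hC⟩) b k

theorem isMoment_xft (H : IsCuspKernel S v h q T) (ζ : E3) : IsMoment (xft T ζ) := by
  have hm := aestronglyMeasurable_of_continuousOn_ne (H.contDiffOn_xft ζ).continuousOn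
  refine ⟨hm, fun k => ?_⟩
  obtain ⟨C, -, hC⟩ := H.bound_xft (k + 4) 0 0
  refine (integrable_of_weight_le (A := C) ((Continuous.aestronglyMeasurable
    (by fun_prop)).mul hm.norm) ?_).1
  filter_upwards [ae_ne_zero] with z hz
  have h1 := hC ζ z hz
  have hz1 := weight_pos z
  simp only [pow_zero, one_mul, norm_iteratedFDeriv_zero, cuspWeight, Nat.cast_zero, neg_zero,
    zpow_zero] at h1
  change (1 + ‖z‖) ^ 4 * ‖(1 + ‖z‖) ^ k * ‖xft T ζ z‖‖ ≤ C
  rw [Real.norm_of_nonneg (by positivity), ← mul_assoc, ← pow_add, add_comm 4 k]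
  calc (1 + ‖z‖) ^ (k + 4) * ‖xft T ζ z‖
      ≤ (1 + ‖z‖) ^ (k + 4) * (C * ((1 + ‖z‖) ^ (k + 4))⁻¹) := by gcongr
    _ = C := by field_simp

/-- The partial Fourier transform of the remainder of the expansion of the kernel. -/
theorem xft_remainder (H : IsCuspKernel S v h q T) (J : ℕ) (ζ : E3) {z : E3} (hz : z ≠ 0) :
    xft (fun x z => T x z
      - cuspSum S (fun j i => v j i x) (fun j i z => h j i z + q j i z) J z) ζ z
    = xft T ζ z - cuspSum S (fun j i => 𝓕 (v j i : E3 → ℂ) ζ)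
        (fun j i z => h j i z + q j i z) J z := by
  obtain ⟨m, -, hm⟩ := H.exists_dominating
  have hw : Continuous fun x : E3 => waveE x (-ζ) :=
    continuous_waveE.comp (f := fun x : E3 => (x, -ζ)) (by fun_prop)
  have hT : Integrable fun x => waveE x (-ζ) * T x z := by
    refine integrable_of_weight_bound (A := m z)
      (hw.mul (continuous_kernel_fst H.continuousOn hz)) fun x => ?_
    rw [norm_mul, norm_waveE, one_mul]
    exact hm x z hz
  have hv : ∀ j i, Integrable fun x => waveE x (-ζ) * (v j i x * (h j i z + q j i z)) := by
    intro j i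
    obtain ⟨C, hC⟩ := (isRapid_schwartz (v j i)).bound 4
    refine integrable_of_weight_bound (A := C * ‖h j i z + q j i z‖)
      (hw.mul ((v j i).continuous.mul continuous_const)) fun x => ?_
    rw [norm_mul, norm_waveE, one_mul, norm_mul, ← mul_assoc]
    exact mul_le_mul_of_nonneg_right (hC x) (norm_nonneg _)
  simp only [xft_eq, cuspSum, mul_sub, Finset.mul_sum]
  rw [integral_sub hT (integrable_finsetSum _ fun j _ => integrable_finsetSum _ fun i _ => hv j i),
    integral_finsetSum _ fun j _ => integrable_finsetSum _ fun i _ => hv j i]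
  congr 1
  refine Finset.sum_congr rfl fun j _ => ?_
  rw [integral_finsetSum _ fun i _ => hv j i]
  refine Finset.sum_congr rfl fun i _ => ?_
  rw [fourier_eq_waveE, ← integral_mul_const]
  congr 1
  funext x
  rw [smul_eq_mul, mul_assoc]

/-- The partial Fourier transform of the remainder, extended by zero to `z = 0`. -/
def flatPart (S : ℕ → Finset ι) (v : ℕ → ι → SchwartzMap E3 ℂ) (h q : ℕ → ι → E3 → ℂ)
    (T : E3 → E3 → ℂ) (J : ℕ) (ζ z : E3) : ℂ :=
  if z = 0 then 0 else xft T ζ z - cuspSum S (fun j i => 𝓕 (v j i : E3 → ℂ) ζ)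
    (fun j i z => h j i z + q j i z) J z

/-- The part of `xft T ζ` that is left when the short-range parts of the first `J` terms of the
expansion are removed. -/
def regularPart (S : ℕ → Finset ι) (v : ℕ → ι → SchwartzMap E3 ℂ) (h q : ℕ → ι → E3 → ℂ)
    (T : E3 → E3 → ℂ) (J : ℕ) (ζ z : E3) : ℂ :=
  flatPart S v h q T J ζ z + cuspSum S (fun j i => 𝓕 (v j i : E3 → ℂ) ζ) q J z

theorem regularPart_eq {J : ℕ} {ζ z : E3} (hz : z ≠ 0) : regularPart S v h q T J ζ z
    = xft T ζ z - cuspSum S (fun j i => 𝓕 (v j i : E3 → ℂ) ζ) h J z := by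
  rw [regularPart, flatPart, if_neg hz]
  simp only [cuspSum, mul_add, Finset.sum_add_distrib]
  ring

theorem contDiffAt_cusp (H : IsCuspKernel S v h q T) (j : ℕ) (i : ι) {z : E3} (hz : z ≠ 0) :
    ContDiffAt ℝ ∞ (fun z => h j i z + q j i z) z :=
  ((H.split j i).short.smooth.contDiffAt (isOpen_ne.mem_nhds hz)).add
    (H.split j i).smooth.contDiffAt

theorem contDiffOn_flatPart (H : IsCuspKernel S v h q T) (J : ℕ) (ζ : E3) :
    ContDiffOn ℝ ∞ (flatPart S v h q T J ζ) {z | z ≠ 0} := by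
  have h1 : ContDiffOn ℝ ∞ (fun z => xft T ζ z - cuspSum S (fun j i => 𝓕 (v j i : E3 → ℂ) ζ)
      (fun j i z => h j i z + q j i z) J z) {z | z ≠ 0} :=
    (H.contDiffOn_xft ζ).sub fun z hz =>
      (contDiffAt_cuspSum (fun j i => H.contDiffAt_cusp j i hz) _ J).contDiffWithinAt
  exact h1.congr fun z hz => if_neg hz

theorem bound_flatPart (H : IsCuspKernel S v h q T) (J b k : ℕ) : ∃ C : ℝ, 0 ≤ C ∧
    ∀ ζ z : E3, z ≠ 0 → ‖z‖ < 1 → (1 + ‖ζ‖) ^ k *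
      ‖iteratedFDeriv ℝ b (flatPart S v h q T J ζ) z‖ ≤ C * ‖z‖ ^ ((J : ℤ) - (b : ℤ)) := by
  set R : E3 → E3 → ℂ := fun x z => T x z
      - cuspSum S (fun j i => v j i x) (fun j i z => h j i z + q j i z) J z with hR
  set Ω : Set E3 := {z | z ≠ 0} ∩ Metric.ball 0 1 with hΩdef
  have hΩ : IsOpen Ω := isOpen_ne.inter Metric.isOpen_ball
  have hΩ' : IsOpen {r : E3 × E3 | r.2 ≠ 0} := isOpen_ne.preimage continuous_snd
  have hsm : ContDiffOn ℝ ∞ (fun r : E3 × E3 => R r.1 r.2) {r | r.2 ∈ Ω} := by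
    refine ContDiffOn.sub (H.smooth.mono fun r hr => hr.1) fun r hr => ?_
    refine ContDiffAt.contDiffWithinAt (ContDiffAt.sum fun j _ => ContDiffAt.sum fun i _ => ?_)
    exact (((v j i).smooth ⊤).contDiffAt.comp r contDiffAt_fst).mul
      (ContDiffAt.comp r (g := fun z => h j i z + q j i z) (f := Prod.snd)
        (H.contDiffAt_cusp j i hr.1) contDiffAt_snd)
  obtain ⟨C, hC0, hC⟩ := xft_bound (w := fun b z => ‖z‖ ^ ((J : ℤ) - (b : ℤ))) hΩ hsm
    (fun b => (continuousOn_norm_zpow _).mono inter_subset_left)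
    (fun b z _ => zpow_nonneg (norm_nonneg z) _) (fun a b => by
      obtain ⟨C, -, hC⟩ := H.bound_remainder J a b 4
      refine ⟨C, fun x z hz => hC x z hz.1 ?_⟩
      have := hz.2
      rw [mem_ball_zero_iff] at this
      exact this.le) b k
  refine ⟨C, hC0, fun ζ z hz hz1 => ?_⟩
  have heq : flatPart S v h q T J ζ =ᶠ[𝓝 z] xft R ζ := by
    filter_upwards [isOpen_ne.mem_nhds hz] with y hy
    rw [hR, H.xft_remainder J ζ hy, flatPart, if_neg hy]
  rw [(heq.iteratedFDeriv ℝ b).eq_of_nhds]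
  exact hC ζ z ⟨hz, by simpa using hz1⟩

/-- The remainder of order `M + 1` is of class `C^M` across `z = 0`. -/
theorem flatPart_spec (H : IsCuspKernel S v h q T) (M : ℕ) (ζ : E3) :
    ContDiff ℝ M (flatPart S v h q T (M + 1) ζ) ∧
      ∀ b ≤ M, iteratedFDeriv ℝ b (flatPart S v h q T (M + 1) ζ) 0 = 0 := by
  choose C hC0 hC using fun b => H.bound_flatPart (M + 1) b 0
  refine contDiff_of_flat M (if_pos rfl) (H.contDiffOn_flatPart (M + 1) ζ) (A := C)
    fun b hb z hz hz1 => ?_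
  have := hC b ζ z hz hz1
  rw [pow_zero, one_mul, show (((M + 1 : ℕ) : ℤ) - (b : ℤ)) = ((M + 1 - b : ℕ) : ℤ) by omega,
    zpow_natCast] at this
  exact this

theorem contDiff_regularPart (H : IsCuspKernel S v h q T) (M : ℕ) (ζ : E3) :
    ContDiff ℝ M (regularPart S v h q T (M + 1) ζ) := by
  refine (H.flatPart_spec M ζ).1.add ?_
  exact contDiff_iff_contDiffAt.2 fun z => contDiffAt_cuspSum
    (fun j i => ((H.split j i).smooth.of_le (natCast_le_infty M)).contDiffAt) _ _

/-- For `|z| < 1` the regular part is the remainder plus the smooth parts of the terms of the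
expansion; for `|z| ≥ 1` it is the kernel minus their short-range parts, all of which decrease
rapidly. -/
theorem bound_regularPart (H : IsCuspKernel S v h q T) {M b : ℕ} (hb : b ≤ M) (k L : ℕ) :
    ∃ C : ℝ, 0 ≤ C ∧ ∀ ζ z : E3, (1 + ‖ζ‖) ^ k * ((1 + ‖z‖) ^ L *
      ‖iteratedFDeriv ℝ b (regularPart S v h q T (M + 1) ζ) z‖) ≤ C := by
  have hv : ∀ j i, IsRapid (𝓕 (v j i : E3 → ℂ)) := fun j i => isRapid_fourier_schwartz _
  have hq : ∀ j i z, ContDiffAt ℝ b (q j i) z := fun j i z =>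
    ((H.split j i).smooth.of_le (natCast_le_infty b)).contDiffAt
  obtain ⟨C₁, hC₁, h₁⟩ := H.bound_flatPart (M + 1) b k
  obtain ⟨C₂, h₂⟩ := exists_bound_cuspSum (S := S) (K := q) (L := L) hv
    (A := Metric.closedBall 0 1) (b := b) (fun j i z _ => hq j i z) (fun j i => by
      have hc : Continuous fun z => (1 + ‖z‖) ^ L * ‖iteratedFDeriv ℝ b (q j i) z‖ := by
        have := (H.split j i).smooth.continuous_iteratedFDeriv (natCast_le_infty b)
        fun_prop
      obtain ⟨B, hB⟩ := (isCompact_closedBall (0 : E3) 1).exists_bound_of_continuousOn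
        hc.continuousOn
      exact ⟨B, fun z hz => (le_abs_self _).trans (hB z hz)⟩) k (M + 1)
  obtain ⟨C₃, hC₃, h₃⟩ := H.bound_xft L b k
  obtain ⟨C₄, h₄⟩ := exists_bound_cuspSum (S := S) (K := h) (L := L) hv
    (A := {z | 1 ≤ ‖z‖}) (b := b)
    (fun j i z hz => (H.split j i).short.contDiffAt (ne_zero_of_one_le hz) b)
    (fun j i => (H.split j i).short.decay b L) k (M + 1)
  refine ⟨2 ^ L * C₁ + |C₂| + (C₃ + |C₄|), by positivity, fun ζ z => ?_⟩
  have hζw := weight_pos ζ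
  have hzw := weight_pos z
  rcases lt_or_ge ‖z‖ 1 with hz1 | hz1
  · have e : iteratedFDeriv ℝ b (regularPart S v h q T (M + 1) ζ) z
        = iteratedFDeriv ℝ b (flatPart S v h q T (M + 1) ζ) z
        + iteratedFDeriv ℝ b (cuspSum S (fun j i => 𝓕 (v j i : E3 → ℂ) ζ) q (M + 1)) z :=
      iteratedFDeriv_add_apply
        (((H.flatPart_spec M ζ).1.of_le (by exact_mod_cast hb)).contDiffAt)
        (contDiffAt_cuspSum (fun j i => hq j i z) _ _)
    have hf : (1 + ‖ζ‖) ^ k * ‖iteratedFDeriv ℝ b (flatPart S v h q T (M + 1) ζ) z‖ ≤ C₁ := by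
      rcases eq_or_ne z 0 with rfl | hz
      · rw [(H.flatPart_spec M ζ).2 b hb, norm_zero, mul_zero]
        exact hC₁
      · refine (h₁ ζ z hz hz1).trans (mul_le_of_le_one_right hC₁ ?_)
        rw [show (((M + 1 : ℕ) : ℤ) - (b : ℤ)) = ((M + 1 - b : ℕ) : ℤ) by omega, zpow_natCast]
        exact pow_le_one₀ (norm_nonneg z) hz1.le
    have hs := (h₂ ζ z (by simpa using hz1.le)).trans (le_abs_self C₂)
    set X := ‖iteratedFDeriv ℝ b (flatPart S v h q T (M + 1) ζ) z‖
    set Y := ‖iteratedFDeriv ℝ b (cuspSum S (fun j i => 𝓕 (v j i : E3 → ℂ) ζ) q (M + 1)) z‖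
    have h2 : (1 + ‖z‖) ^ L ≤ 2 ^ L := by
      gcongr
      linarith
    calc (1 + ‖ζ‖) ^ k * ((1 + ‖z‖) ^ L * ‖iteratedFDeriv ℝ b
          (regularPart S v h q T (M + 1) ζ) z‖)
        ≤ (1 + ‖ζ‖) ^ k * ((1 + ‖z‖) ^ L * (X + Y)) := by
          rw [e]
          gcongr
          exact norm_add_le _ _
      _ = (1 + ‖z‖) ^ L * ((1 + ‖ζ‖) ^ k * X) + (1 + ‖ζ‖) ^ k * ((1 + ‖z‖) ^ L * Y) := by ring
      _ ≤ 2 ^ L * C₁ + |C₂| := by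
        refine add_le_add (mul_le_mul h2 hf (by positivity) (by positivity)) hs
      _ ≤ _ := le_add_of_nonneg_right (by positivity)
  · have hz := ne_zero_of_one_le hz1
    have heq : regularPart S v h q T (M + 1) ζ =ᶠ[𝓝 z] fun z => xft T ζ z
        + (-1 : ℂ) * cuspSum S (fun j i => 𝓕 (v j i : E3 → ℂ) ζ) h (M + 1) z := by
      filter_upwards [isOpen_ne.mem_nhds hz] with y hy
      rw [regularPart_eq hy]
      ring
    have hcs : ContDiffAt ℝ b (cuspSum S (fun j i => 𝓕 (v j i : E3 → ℂ) ζ) h (M + 1)) z :=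
      contDiffAt_cuspSum (fun j i => (H.split j i).short.contDiffAt hz b) _ _
    have e1 : iteratedFDeriv ℝ b (fun z => (-1 : ℂ) * cuspSum S (fun j i => 𝓕 (v j i : E3 → ℂ) ζ)
        h (M + 1) z) z = (-1 : ℂ) • iteratedFDeriv ℝ b
        (cuspSum S (fun j i => 𝓕 (v j i : E3 → ℂ) ζ) h (M + 1)) z :=
      iteratedFDeriv_const_smul_apply (a := (-1 : ℂ)) hcs
    have e : iteratedFDeriv ℝ b (regularPart S v h q T (M + 1) ζ) z
        = iteratedFDeriv ℝ b (xft T ζ) z + iteratedFDeriv ℝ b (fun z => (-1 : ℂ) *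
          cuspSum S (fun j i => 𝓕 (v j i : E3 → ℂ) ζ) h (M + 1) z) z := by
      rw [(heq.iteratedFDeriv ℝ b).eq_of_nhds]
      exact iteratedFDeriv_add_apply
        (((H.contDiffOn_xft ζ).contDiffAt (isOpen_ne.mem_nhds hz)).of_le (natCast_le_infty b))
        (contDiffAt_const.mul hcs)
    have hX := h₃ ζ z hz
    have hY := (h₄ ζ z hz1).trans (le_abs_self C₄)
    set X := ‖iteratedFDeriv ℝ b (xft T ζ) z‖
    set Y := ‖iteratedFDeriv ℝ b (cuspSum S (fun j i => 𝓕 (v j i : E3 → ℂ) ζ) h (M + 1)) z‖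
    have hX' : (1 + ‖z‖) ^ L * ((1 + ‖ζ‖) ^ k * X) ≤ C₃ := by
      refine (mul_le_mul_of_nonneg_left hX (by positivity)).trans ?_
      have h1 : ‖z‖ ^ (-(b : ℤ)) ≤ 1 := by
        rw [zpow_neg, zpow_natCast]
        exact inv_le_one_of_one_le₀ (one_le_pow₀ hz1)
      calc (1 + ‖z‖) ^ L * (C₃ * cuspWeight L b z) = C₃ * ‖z‖ ^ (-(b : ℤ)) := by
            rw [cuspWeight]
            field_simp
        _ ≤ _ := mul_le_of_le_one_right hC₃ h1
    calc (1 + ‖ζ‖) ^ k * ((1 + ‖z‖) ^ L * ‖iteratedFDeriv ℝ b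
          (regularPart S v h q T (M + 1) ζ) z‖)
        ≤ (1 + ‖ζ‖) ^ k * ((1 + ‖z‖) ^ L * (X + Y)) := by
          rw [e, e1]
          gcongr
          refine (norm_add_le _ _).trans (le_of_eq ?_)
          rw [norm_smul, norm_neg, norm_one, one_mul]
      _ = (1 + ‖z‖) ^ L * ((1 + ‖ζ‖) ^ k * X) + (1 + ‖ζ‖) ^ k * ((1 + ‖z‖) ^ L * Y) := by ring
      _ ≤ C₃ + |C₄| := add_le_add hX' hY
      _ ≤ _ := le_add_of_nonneg_left (by positivity)

/-- The Fourier transform of the regular part is small for large frequencies. -/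
theorem bound_ft_regularPart (H : IsCuspKernel S v h q T) (M b k : ℕ) : ∃ C : ℝ, ∀ ζ : E3,
    ContDiff ℝ b (ft (regularPart S v h q T (M + 1) ζ)) ∧ ∀ η : E3, (1 + ‖ζ‖) ^ k *
      ‖iteratedFDeriv ℝ b (ft (regularPart S v h q T (M + 1) ζ)) η‖
        ≤ C * (1 + ‖η‖) ^ (-(M : ℤ)) := by
  obtain ⟨c, hc0, hc⟩ := exists_ft_decay_const b M
  choose D hD0 hD using fun n : Fin (M + 1) =>
    H.bound_regularPart (M := M) (Nat.lt_succ_iff.1 n.2) k (b + 4)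
  refine ⟨c * ∑ n, D n, fun ζ => ?_⟩
  have hζ := pow_pos (weight_pos ζ) k
  obtain ⟨h1, h2⟩ := hc _ (H.contDiff_regularPart M ζ) (((1 + ‖ζ‖) ^ k)⁻¹ * ∑ n, D n)
    (fun n hn z => by
      have h3 := hD ⟨n, Nat.lt_succ_of_le hn⟩ ζ z
      rw [← div_eq_inv_mul, le_div_iff₀' hζ]
      exact h3.trans (Finset.single_le_sum (f := D) (fun n _ => hD0 n) (Finset.mem_univ _)))
  refine ⟨h1, fun η => ?_⟩
  have h3 := h2 η
  have hη := pow_pos (weight_pos η) M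
  rw [zpow_neg, zpow_natCast, ← div_eq_mul_inv, le_div_iff₀ hη]
  calc _ = (1 + ‖ζ‖) ^ k * ((1 + ‖η‖) ^ M *
        ‖iteratedFDeriv ℝ b (ft (regularPart S v h q T (M + 1) ζ)) η‖) := by ring
    _ ≤ (1 + ‖ζ‖) ^ k * (c * (((1 + ‖ζ‖) ^ k)⁻¹ * ∑ n, D n)) := by gcongr
    _ = _ := by field_simp

theorem ft_regularPart (H : IsCuspKernel S v h q T) (J : ℕ) (ζ η : E3) :
    ft (regularPart S v h q T J ζ) η = ft (xft T ζ) η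
      - cuspSum S (fun j i => 𝓕 (v j i : E3 → ℂ) ζ) (fun j i => ft (h j i)) J η := by
  have h1 : ft (regularPart S v h q T J ζ) η = ∫ z : E3,
      (Complex.exp (-(Complex.I * ((inner ℝ z η : ℝ) : ℂ))) * xft T ζ z
      - ∑ j ∈ Finset.range J, ∑ i ∈ S j, 𝓕 (v j i : E3 → ℂ) ζ *
        (Complex.exp (-(Complex.I * ((inner ℝ z η : ℝ) : ℂ))) * h j i z)) := by
    refine integral_congr_ae ?_
    filter_upwards [ae_ne_zero] with z hz
    rw [regularPart_eq hz, cuspSum, mul_sub, Finset.mul_sum]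
    congr 1
    refine Finset.sum_congr rfl fun j _ => ?_
    rw [Finset.mul_sum]
    exact Finset.sum_congr rfl fun i _ => by ring
  have h2 : ∀ j i, Integrable fun z : E3 => 𝓕 (v j i : E3 → ℂ) ζ *
      (Complex.exp (-(Complex.I * ((inner ℝ z η : ℝ) : ℂ))) * h j i z) :=
    fun j i => ((H.split j i).hom.1.integrable_exp η).const_mul _
  rw [h1, integral_sub ((H.isMoment_xft ζ).integrable_exp η)
    (integrable_finsetSum _ fun j _ => integrable_finsetSum _ fun i _ => h2 j i),
    integral_finsetSum _ fun j _ => integrable_finsetSum _ fun i _ => h2 j i]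
  congr 1
  refine Finset.sum_congr rfl fun j _ => ?_
  rw [integral_finsetSum _ fun i _ => h2 j i]
  exact Finset.sum_congr rfl fun i _ => integral_const_mul _ _

/-- The term of degree `j ≥ 1` of the expansion at `z = 0` contributes the term of order `-3 - j` of
the symbol; the regular part contributes only to arbitrarily low orders. -/
theorem hasExpansion (H : IsCuspKernel S v h q T) :
    HasExpansion (-4) 0 (fun ζ η => ft (xft T ζ) η) := by
  obtain ⟨m, hm, hmT⟩ := H.exists_dominating
  have hv : ∀ j i, IsRapid (𝓕 (v j i : E3 → ℂ)) := fun j i => isRapid_fourier_schwartz _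
  choose hmom s hs hsm using fun j i => (H.split j i).hom
  -- the `n`-th term stems from the term of degree `n + 1` of the expansion of the kernel
  set t : ℕ → E3 → E3 → ℂ := fun n ζ η =>
    ∑ i ∈ S (n + 1), 𝓕 (v (n + 1) i : E3 → ℂ) ζ * s (n + 1) i η with ht
  set e : ℕ → E3 → E3 → ℂ := fun n ζ η =>
    ∑ i ∈ S (n + 1), 𝓕 (v (n + 1) i : E3 → ℂ) ζ * (ft (h (n + 1) i) η - s (n + 1) i η) with he
  have htm : ∀ n, t n ∈ homRap (-4) n := by
    intro n
    have : t n = ∑ i ∈ S (n + 1), fun ζ η => 𝓕 (v (n + 1) i : E3 → ℂ) ζ * s (n + 1) i η := by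
      funext ζ η
      simp [ht, Finset.sum_apply]
    rw [this]
    exact Submodule.sum_mem _ fun i _ => Submodule.subset_span ⟨_, _, hv _ _, hs (n + 1) i, rfl⟩
  have htR : ∀ n : ℕ, IsRS (-4 - n) (t n) := fun n => isRS_of_mem_homRap (htm n)
  have heR : ∀ (n : ℕ) (p : ℤ), IsRS p (e n) := fun n p =>
    IsRS.sum _ fun i _ => (hv _ _).mul_isSym (hsm (n + 1) i p)
  have hdec : ∀ (M : ℕ) (ζ η : E3), ft (xft T ζ) η = ft (regularPart S v h q T (M + 1) ζ) η
      + ∑ n ∈ Finset.range M, (t n ζ η + e n ζ η) := by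
    intro M ζ η
    rw [H.ft_regularPart, cuspSum, Finset.sum_range_succ']
    have h0 : ∑ i ∈ S 0, 𝓕 (v 0 i : E3 → ℂ) ζ * ft (h 0 i) η = 0 := by
      refine Finset.sum_eq_zero fun i _ => ?_
      rw [(H.split 0 i).zero rfl]
      simp [ft]
    have h1 : ∀ n, ∑ i ∈ S (n + 1), 𝓕 (v (n + 1) i : E3 → ℂ) ζ * ft (h (n + 1) i) η
        = t n ζ η + e n ζ η := by
      intro n
      simp only [ht, he, ← Finset.sum_add_distrib]
      exact Finset.sum_congr rfl fun i _ => by ring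
    simp only [h0, h1]
    ring
  have hcont := continuous_ft_xft H.continuousOn hm hmT
  have hts : ∀ N : ℕ, IsRS (-4) (fun ζ η => ∑ n ∈ Finset.range N, t n ζ η) := fun N =>
    IsRS.sum _ fun n _ => (htR n).mono (by omega)
  refine ⟨t, htm, fun n hn => absurd hn (Nat.not_lt_zero n), fun N => ⟨fun ζ => ?_, ?_, ?_⟩⟩
  · exact (H.isMoment_xft ζ).contDiff_ft.sub ((hts N).smooth ζ)
  · exact hcont.sub (hts N).cont
  · intro b k
    -- with sufficiently many terms, the Fourier transform of the regular part decays fast enough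
    set M := N + b + 4 with hM
    obtain ⟨C, hC⟩ := H.bound_ft_regularPart M b k
    set G : E3 → E3 → ℂ := fun ζ η => ∑ n ∈ Finset.range M, e n ζ η
      + ∑ n ∈ Finset.Ico N M, t n ζ η with hG
    have hGR : IsRS (-4 - N) G := by
      refine (IsRS.sum _ fun n _ => heR n _).add (IsRS.sum _ fun n hn => (htR n).mono ?_)
      have := (Finset.mem_Ico.1 hn).1
      omega
    obtain ⟨D, hD⟩ := hGR.bound b k
    refine ⟨C + D, fun ζ η => ?_⟩
    have e1 : (fun η => ft (xft T ζ) η - ∑ n ∈ Finset.range N, t n ζ η)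
        = fun η => ft (regularPart S v h q T (M + 1) ζ) η + G ζ η := by
      funext η
      rw [hdec M ζ η, hG, Finset.sum_add_distrib,
        ← Finset.sum_range_add_sum_Ico (fun n => t n ζ η) (show N ≤ M by omega)]
      ring
    have e2 : iteratedFDeriv ℝ b (fun η => ft (regularPart S v h q T (M + 1) ζ) η + G ζ η) η
        = iteratedFDeriv ℝ b (ft (regularPart S v h q T (M + 1) ζ)) η
          + iteratedFDeriv ℝ b (G ζ) η :=
      iteratedFDeriv_add_apply (hC ζ).1.contDiffAt
        (((hGR.smooth ζ).of_le (natCast_le_infty b)).contDiffAt)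
    have h1 := (hC ζ).2 η
    rw [show -(M : ℤ) = -4 - (N : ℤ) - (b : ℤ) by omega] at h1
    rw [e1, e2, add_mul]
    refine (mul_le_mul_of_nonneg_left (norm_add_le _ _) (pow_nonneg (weight_pos ζ).le k)).trans ?_
    rw [mul_add]
    exact add_le_add h1 (hD ζ η)

end IsCuspKernel

/-! ### Symbols of pair-amplitudes -/

theorem mixedDeriv_congr {f g : E3 → E3 → ℂ} (h : ∀ x z, z ≠ 0 → f x z = g x z) (a b : ℕ) (x : E3)
    {z : E3} (hz : z ≠ 0) : mixedDeriv f a b x z = mixedDeriv g a b x z := by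
  unfold mixedDeriv
  congr 1
  funext x'
  have : f x' =ᶠ[𝓝 z] g x' := by
    filter_upwards [isOpen_ne.mem_nhds hz] with y hy using h x' y hy
  exact (this.iteratedFDeriv ℝ b).eq_of_nhds

/-- A pair-amplitude has an expansion with terms `|z|^j Y_{lm}(z/|z|)`, `l ≤ j`, each of which can
be split into a smooth and a short-range part. -/
theorem IsPairAmplitude.exists_isCuspKernel {τ : E3 → E3 → ℂ} (hτ : IsPairAmplitude τ) :
    ∃ (S : ℕ → Finset (Σ _ : ℕ, ℤ)) (v : ℕ → (Σ _ : ℕ, ℤ) → SchwartzMap E3 ℂ)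
      (h q : ℕ → (Σ _ : ℕ, ℤ) → E3 → ℂ), IsCuspKernel S v h q (inXZ τ) := by
  obtain ⟨v, hv⟩ := hτ.expansion
  set K : ℕ → (Σ _ : ℕ, ℤ) → E3 → ℂ := fun j i z =>
    ((‖z‖ ^ j : ℝ) : ℂ) * sphericalHarmonic i.1 i.2 (‖z‖⁻¹ • z) with hK
  have hsplit : ∀ (j : ℕ) (i : Σ _ : ℕ, ℤ), ∃ h q : E3 → ℂ,
      IsCuspSplit j (fun z => h z + q z) h q ∧
      (i.1 ≤ j → |i.2| ≤ i.1 → ∀ z, z ≠ 0 → K j i z = h z + q z) := by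
    intro j i
    by_cases hi : i.1 ≤ j ∧ |i.2| ≤ i.1
    · obtain ⟨h, q, H⟩ := exists_isCuspSplit_sphericalHarmonic hi.1 hi.2
      exact ⟨h, q, H.congr fun z hz => (H.eq z hz).symm, fun _ _ => H.eq⟩
    · refine ⟨fun _ => 0, fun _ => 0, ⟨fun z _ => rfl, contDiff_const, isShort_zero,
        hasHomFT_zero _, fun _ => rfl⟩, fun h1 h2 => absurd ⟨h1, h2⟩ hi⟩
  choose h q hs hKe using hsplit
  refine ⟨fun j => (Finset.range (j + 1)).sigma fun l => Finset.Icc (-(l : ℤ)) (l : ℤ),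
    fun j i => v j i.1 i.2, h, q, ⟨hτ.smooth, hτ.decay, fun J a b k => ?_, hs⟩⟩
  obtain ⟨C, hC⟩ := hv J a b k
  refine ⟨C, fun x z hz hz1 => ?_⟩
  rw [mixedDeriv_congr (g := fun x z => inXZ τ x z
    - ∑ j ∈ Finset.range J, coalescenceTerm j (v j) x z) (fun x z hz => ?_) a b x hz]
  · exact hC x z hz hz1
  · congr 1
    rw [cuspSum]
    refine Finset.sum_congr rfl fun j _ => ?_
    rw [coalescenceTerm, Finset.sum_sigma]
    refine Finset.sum_congr rfl fun l hl => Finset.sum_congr rfl fun m hm => ?_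
    have h1 := hKe j ⟨l, m⟩ (Nat.lt_succ_iff.1 (Finset.mem_range.1 hl))
      (abs_le.2 (Finset.mem_Icc.1 hm)) z hz
    rw [← h1, hK, mul_assoc]

/-- `s` is the symbol with the Fourier transform `g` in `x`, and `g` has an expansion of
order `p`. -/
structure IsRep (p : ℤ) (s g : E3 → E3 → ℂ) : Prop where
  expansion : HasExpansion p 0 g
  eq : s = symOf g
  integrable : ∀ η, Integrable fun x => s x η

theorem IsRep.fourier {p : ℤ} {s g : E3 → E3 → ℂ} (H : IsRep p s g) (ζ η : E3) :
    𝓕 (fun x => s x η) ζ = g ζ η := by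
  have hg := H.expansion.isRS
  have hc : Continuous fun ζ => g ζ η := hg.cont.comp (f := fun ζ : E3 => (ζ, η)) (by fun_prop)
  have h1 : (fun x => s x η) = 𝓕⁻ (fun ζ => g ζ η) := by
    rw [H.eq]
    rfl
  have h2 : Integrable (𝓕 (fun ζ => g ζ η)) := by
    have h3 := H.integrable η
    rw [h1] at h3
    replace h3 := h3.comp_neg
    refine h3.congr (Filter.Eventually.of_forall fun x => ?_)
    simp only [Real.fourierInv_eq_fourier_neg, neg_neg]
  rw [h1, hc.fourier_fourierInv_eq (hg.integrable η) h2]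

theorem IsRep.sub {p : ℤ} {s g s' g' : E3 → E3 → ℂ} (H : IsRep p s g) (H' : IsRep p s' g') :
    IsRep p (fun x η => s x η - s' x η) (fun ζ η => g ζ η - g' ζ η) := by
  refine ⟨H.expansion.sub H'.expansion, ?_, fun η => (H.integrable η).sub (H'.integrable η)⟩
  rw [H.expansion.isRS.symOf_sub H'.expansion.isRS, H.eq, H'.eq]

/-- Composition with a represented symbol is a twisted convolution on the Fourier side. -/
theorem symbolComp_of_isRep {p q : ℤ} {g s h : E3 → E3 → ℂ} (hg : HasExpansion p 0 g)
    (hp : p ≤ -4) (H : IsRep q s h) :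
    CompConverges (symOf g) s ∧ symbolComp (symOf g) s = symOf (twist g h) :=
  symbolComp_symOf hg.isRS hp H.expansion.isRS H.integrable H.fourier

theorem symbolConverges_of_bound {K : E3 → E3 → ℂ} {m : E3 → ℝ}
    (hc : ContinuousOn (fun q : E3 × E3 => inXZ K q.1 q.2) {q | q.2 ≠ 0}) (hm : Integrable m)
    (hb : ∀ x z, z ≠ 0 → (1 + ‖x‖) ^ 4 * ‖inXZ K x z‖ ≤ m z) : SymbolConverges K :=
  fun x η => integrable_symbolIntegrand hc hm hb x η

/-- Pair-amplitudes have symbols of order `-4`: the singularity of lowest degree is `|z|`, since the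
term with `j = 0` is smooth. -/
theorem IsPairAmplitude.exists_isRep {τ : E3 → E3 → ℂ} (hτ : IsPairAmplitude τ) :
    SymbolConverges τ ∧ ∃ g, IsRep (-4) (kernelSymbol τ) g := by
  obtain ⟨S, v, h, q, H⟩ := hτ.exists_isCuspKernel
  obtain ⟨m, hm, hmT⟩ := H.exists_dominating
  refine ⟨symbolConverges_of_bound H.continuousOn hm hmT, _, H.hasExpansion, ?_,
    fun η => integrable_symbol H.continuousOn hm hmT η⟩
  exact symbol_eq_symOf H.continuousOn hm hmT fun η => H.hasExpansion.isRS.integrable η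

/-! ### Symbols of effective interaction potentials -/

theorem norm_iteratedFDeriv_comp_fst_le {V : Type} [NormedAddCommGroup V] [NormedSpace ℝ V]
    {F : E3 × E3 → V} (hF : ContDiff ℝ ∞ F) (a : ℕ) (x z : E3) :
    ‖iteratedFDeriv ℝ a (fun x => F (x, z)) x‖ ≤ ‖iteratedFDeriv ℝ a F (x, z)‖ := by
  have h1 : ContDiff ℝ ∞ fun r : E3 × E3 => F (r + (0, z)) :=
    hF.comp (contDiff_id.add contDiff_const)
  have h2 := norm_iteratedFDeriv_comp_clm_le h1 (ContinuousLinearMap.inl ℝ E3 E3) a x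
  have e : (fun x => F (x, z)) = fun x =>
      (fun r : E3 × E3 => F (r + (0, z))) (ContinuousLinearMap.inl ℝ E3 E3 x) := by
    funext x
    simp
  rw [e]
  refine h2.trans ?_
  rw [iteratedFDeriv_comp_add_right]
  refine (mul_le_of_le_one_right (norm_nonneg _) (pow_le_one₀ (norm_nonneg _)
    (ContinuousLinearMap.norm_inl_le_one ℝ E3 E3))).trans (le_of_eq ?_)
  simp

theorem norm_iteratedFDeriv_iteratedFDeriv_snd_le (b : ℕ) : ∀ {V : Type} [NormedAddCommGroup V]
    [NormedSpace ℝ V] {F : E3 × E3 → V} (_ : ContDiff ℝ ∞ F) (a : ℕ) (x z : E3),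
    ‖iteratedFDeriv ℝ a (fun x => iteratedFDeriv ℝ b (fun z => F (x, z)) z) x‖
      ≤ ‖iteratedFDeriv ℝ (a + b) F (x, z)‖ := by
  induction b with
  | zero =>
    intro V _ _ F hF a x z
    have e : (fun x => iteratedFDeriv ℝ 0 (fun z => F (x, z)) z)
        = (continuousMultilinearCurryFin0 ℝ E3 V).symm ∘ fun x => F (x, z) := by
      funext x
      rw [iteratedFDeriv_zero_eq_comp]
      rfl
    rw [e, LinearIsometryEquiv.norm_iteratedFDeriv_comp_left]
    exact norm_iteratedFDeriv_comp_fst_le hF a x z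
  | succ b ih =>
    intro V _ _ F hF a x z
    set R : ((E3 × E3) →L[ℝ] V) →L[ℝ] (E3 →L[ℝ] V) :=
      (ContinuousLinearMap.compL ℝ E3 (E3 × E3) V).flip (ContinuousLinearMap.inr ℝ E3 E3) with hR
    have hRn : ‖R‖ ≤ 1 := by
      refine ContinuousLinearMap.opNorm_le_bound _ zero_le_one fun f => ?_
      rw [one_mul]
      exact (ContinuousLinearMap.opNorm_comp_le _ _).trans (mul_le_of_le_one_right (norm_nonneg _)
        (ContinuousLinearMap.norm_inr_le_one ℝ E3 E3))
    have hdF : ContDiff ℝ ∞ (fderiv ℝ F) := hF.fderiv_right (by simp)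
    have hF' : ContDiff ℝ ∞ fun r => R (fderiv ℝ F r) := R.contDiff.comp hdF
    have hfd : ∀ x, (fderiv ℝ fun z => F (x, z)) = fun z => R (fderiv ℝ F (x, z)) := by
      intro x
      funext z
      have h1 : HasFDerivAt (fun z : E3 => (x, z)) (ContinuousLinearMap.inr ℝ E3 E3) z :=
        hasFDerivAt_prodMk_right x z
      exact ((hF.differentiable (by simp) (x, z)).hasFDerivAt.comp z h1).fderiv
    have e : (fun x => iteratedFDeriv ℝ (b + 1) (fun z => F (x, z)) z)
        = (continuousMultilinearCurryRightEquiv' ℝ b E3 V).symm ∘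
          fun x => iteratedFDeriv ℝ b (fun z => R (fderiv ℝ F (x, z))) z := by
      funext x
      rw [iteratedFDeriv_succ_eq_comp_right, hfd x]
      rfl
    have e' := LinearIsometryEquiv.norm_iteratedFDeriv_comp_left (𝕜 := ℝ)
      (F := E3 [×b]→L[ℝ] (E3 →L[ℝ] V)) (G := E3 [×(b + 1)]→L[ℝ] V)
      (continuousMultilinearCurryRightEquiv' ℝ b E3 V).symm
      (fun x => iteratedFDeriv ℝ b (fun z => R (fderiv ℝ F (x, z))) z) x a
    rw [e]
    refine e'.le.trans ((ih hF' a x z).trans ?_)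
    have h2 := R.norm_iteratedFDeriv_comp_left (n := a + b) (f := fderiv ℝ F) (x := (x, z))
      (hdF.contDiffAt (x := (x, z))) (by exact_mod_cast le_top)
    refine h2.trans ?_
    rw [norm_iteratedFDeriv_fderiv, add_assoc]
    exact mul_le_of_le_one_left (norm_nonneg _) hRn

theorem exists_bound_iteratedFDeriv_mul {A B : E3 × E3 → ℂ} (hA : ContDiff ℝ ∞ A)
    (hB : ContDiff ℝ ∞ B) {w₁ w₂ : E3 × E3 → ℝ} (hw₁ : ∀ r, 0 ≤ w₁ r) (hw₂ : ∀ r, 0 ≤ w₂ r)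
    (h₁ : ∀ n : ℕ, ∃ C : ℝ, ∀ r, w₁ r * ‖iteratedFDeriv ℝ n A r‖ ≤ C)
    (h₂ : ∀ n : ℕ, ∃ C : ℝ, ∀ r, w₂ r * ‖iteratedFDeriv ℝ n B r‖ ≤ C) (n : ℕ) :
    ∃ C : ℝ, ∀ r, w₁ r * w₂ r * ‖iteratedFDeriv ℝ n (fun r => A r * B r) r‖ ≤ C := by
  choose C hC using h₁
  choose D hD using h₂
  refine ⟨∑ i ∈ Finset.range (n + 1), (n.choose i : ℝ) * (|C i| * |D (n - i)|), fun r => ?_⟩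
  refine (mul_le_mul_of_nonneg_left (norm_iteratedFDeriv_mul_le hA hB r (natCast_le_infty n))
    (mul_nonneg (hw₁ r) (hw₂ r))).trans ?_
  rw [Finset.mul_sum]
  refine Finset.sum_le_sum fun i _ => ?_
  have h1 := (hC i r).trans (le_abs_self _)
  have h2 := (hD (n - i) r).trans (le_abs_self _)
  have h3 := mul_le_mul h1 h2 (mul_nonneg (hw₂ r) (norm_nonneg _)) (abs_nonneg _)
  calc _ = (n.choose i : ℝ) * ((w₁ r * ‖iteratedFDeriv ℝ i A r‖) *
        (w₂ r * ‖iteratedFDeriv ℝ (n - i) B r‖)) := by ring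
    _ ≤ _ := mul_le_mul_of_nonneg_left h3 (by positivity)

/-- The kernel `φ(x) ψ(x - z) f(z)`. -/
def productKernel (φ ψ : SchwartzMap E3 ℂ) (f : E3 → ℂ) (x z : E3) : ℂ := φ x * ψ (x - z) * f z

section ProductKernel

variable (φ ψ : SchwartzMap E3 ℂ) {f : E3 → ℂ}

/-- Decay in `x` and in `x - z` implies decay in `x` and in `z`. -/
theorem weight_mul_weight_le (x z : E3) (k M : ℕ) :
    (1 + ‖x‖) ^ k * (1 + ‖z‖) ^ M ≤ (1 + ‖x‖) ^ (k + M) * (1 + ‖x - z‖) ^ M := by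
  have h := weight_le_add (-z) x
  rw [norm_neg, neg_add_eq_sub] at h
  calc (1 + ‖x‖) ^ k * (1 + ‖z‖) ^ M
      ≤ (1 + ‖x‖) ^ k * ((1 + ‖x - z‖) * (1 + ‖x‖)) ^ M := by
        have := weight_pos x
        gcongr
    _ = _ := by
      rw [mul_pow, pow_add]
      ring

theorem exists_bound_productKernel_smooth (hf : ContDiff ℝ ∞ f)
    (hfb : ∀ n : ℕ, ∃ C : ℝ, ∀ z, ‖iteratedFDeriv ℝ n f z‖ ≤ C) (M a b : ℕ) :
    ContDiff ℝ ∞ (fun r : E3 × E3 => productKernel φ ψ f r.1 r.2) ∧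
    ∃ C : ℝ, ∀ x z, (1 + ‖x‖) ^ 4 * ‖mixedDeriv (productKernel φ ψ f) a b x z‖
      ≤ C * ((1 + ‖z‖) ^ M)⁻¹ := by
  set L : E3 × E3 →L[ℝ] E3 := ContinuousLinearMap.fst ℝ E3 E3 - ContinuousLinearMap.snd ℝ E3 E3
  have hφ : ContDiff ℝ ∞ fun r : E3 × E3 => φ r.1 := (φ.smooth ⊤).comp contDiff_fst
  have hψ : ContDiff ℝ ∞ fun r : E3 × E3 => ψ (r.1 - r.2) := (ψ.smooth ⊤).comp L.contDiff
  have hff : ContDiff ℝ ∞ fun r : E3 × E3 => f r.2 := hf.comp contDiff_snd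
  have hF : ContDiff ℝ ∞ (fun r : E3 × E3 => productKernel φ ψ f r.1 r.2) := (hφ.mul hψ).mul hff
  refine ⟨hF, ?_⟩
  have b1 : ∀ n : ℕ, ∃ C : ℝ, ∀ r : E3 × E3, (1 + ‖r.1‖) ^ (4 + M) *
      ‖iteratedFDeriv ℝ n (fun r : E3 × E3 => φ r.1) r‖ ≤ C := by
    intro n
    obtain ⟨C, hC⟩ := exists_schwartz_bound φ n (4 + M)
    refine ⟨C, fun r => le_trans ?_ (hC r.1)⟩
    have := weight_pos r.1
    gcongr
    refine (norm_iteratedFDeriv_comp_clm_le (φ.smooth ⊤) (ContinuousLinearMap.fst ℝ E3 E3) n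
      r).trans (mul_le_of_le_one_right (norm_nonneg _) (pow_le_one₀ (norm_nonneg _) ?_))
    exact ContinuousLinearMap.norm_fst_le ..
  have b2 : ∀ n : ℕ, ∃ C : ℝ, ∀ r : E3 × E3, (1 + ‖r.1 - r.2‖) ^ M *
      ‖iteratedFDeriv ℝ n (fun r : E3 × E3 => ψ (r.1 - r.2)) r‖ ≤ C := by
    intro n
    obtain ⟨C, hC⟩ := exists_schwartz_bound ψ n M
    refine ⟨C * ‖L‖ ^ n, fun r => ?_⟩
    have h1 := norm_iteratedFDeriv_comp_clm_le (ψ.smooth ⊤) L n r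
    have h2 := hC (L r)
    have := weight_pos (r.1 - r.2)
    calc _ ≤ (1 + ‖r.1 - r.2‖) ^ M * (‖iteratedFDeriv ℝ n ψ (L r)‖ * ‖L‖ ^ n) := by
          gcongr
          exact h1
      _ = ((1 + ‖L r‖) ^ M * ‖iteratedFDeriv ℝ n ψ (L r)‖) * ‖L‖ ^ n := by
        rw [mul_assoc]
        rfl
      _ ≤ _ := by gcongr
  have b3 : ∀ n : ℕ, ∃ C : ℝ, ∀ r : E3 × E3, (1 : ℝ) *
      ‖iteratedFDeriv ℝ n (fun r : E3 × E3 => f r.2) r‖ ≤ C := by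
    intro n
    obtain ⟨C, hC⟩ := hfb n
    refine ⟨C, fun r => le_trans ?_ (hC r.2)⟩
    rw [one_mul]
    refine (norm_iteratedFDeriv_comp_clm_le hf (ContinuousLinearMap.snd ℝ E3 E3) n
      r).trans (mul_le_of_le_one_right (norm_nonneg _) (pow_le_one₀ (norm_nonneg _) ?_))
    exact ContinuousLinearMap.norm_snd_le ..
  have hw : ∀ (y : E3) (k : ℕ), (0 : ℝ) ≤ (1 + ‖y‖) ^ k := fun y k =>
    pow_nonneg (weight_pos y).le k
  have b4 := exists_bound_iteratedFDeriv_mul hφ hψ (fun r => hw r.1 (4 + M))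
    (fun r => hw (r.1 - r.2) M) b1 b2
  obtain ⟨C, hC⟩ := exists_bound_iteratedFDeriv_mul (hφ.mul hψ) hff
    (fun r => mul_nonneg (hw r.1 (4 + M)) (hw (r.1 - r.2) M)) (fun _ => zero_le_one) b4 b3 (a + b)
  refine ⟨C, fun x z => ?_⟩
  rw [← div_eq_mul_inv, le_div_iff₀ (pow_pos (weight_pos z) M), mul_right_comm]
  refine le_trans ?_ (hC (x, z))
  rw [mul_one]
  refine mul_le_mul (weight_mul_weight_le x z 4 M) ?_ (norm_nonneg _)
    (mul_nonneg (hw x (4 + M)) (hw (x - z) M))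
  exact norm_iteratedFDeriv_iteratedFDeriv_snd_le b hF a x z

theorem continuousOn_productKernel (hf : ContinuousOn f {z | z ≠ 0}) :
    ContinuousOn (fun r : E3 × E3 => productKernel φ ψ f r.1 r.2) {r | r.2 ≠ 0} := by
  refine ContinuousOn.mul (Continuous.continuousOn ?_)
    (hf.comp (f := Prod.snd) continuous_snd.continuousOn fun r hr => hr)
  exact (φ.continuous.comp continuous_fst).mul
    (ψ.continuous.comp (continuous_fst.sub continuous_snd))

theorem exists_bound_productKernel : ∃ C : ℝ, 0 ≤ C ∧ ∀ (f : E3 → ℂ) (x z : E3),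
    (1 + ‖x‖) ^ 4 * ‖productKernel φ ψ f x z‖ ≤ C * (((1 + ‖z‖) ^ 4)⁻¹ * ‖f z‖) := by
  obtain ⟨C, hC0, hC⟩ := (isRapid_schwartz φ).bound' 8
  obtain ⟨D, hD0, hD⟩ := (isRapid_schwartz ψ).bound' 4
  refine ⟨C * D, mul_nonneg hC0 hD0, fun f x z => ?_⟩
  have h1 := weight_mul_weight_le x z 4 4
  rw [productKernel, norm_mul, norm_mul, ← mul_assoc, ← mul_assoc (C * D)]
  refine mul_le_mul_of_nonneg_right ?_ (norm_nonneg _)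
  have hz := pow_pos (weight_pos z) 4
  rw [← div_eq_mul_inv, le_div_iff₀ hz]
  calc (1 + ‖x‖) ^ 4 * (‖φ x‖ * ‖ψ (x - z)‖) * (1 + ‖z‖) ^ 4
      = ((1 + ‖x‖) ^ 4 * (1 + ‖z‖) ^ 4) * (‖φ x‖ * ‖ψ (x - z)‖) := by ring
    _ ≤ ((1 + ‖x‖) ^ (4 + 4) * (1 + ‖x - z‖) ^ 4) * (‖φ x‖ * ‖ψ (x - z)‖) := by gcongr
    _ = ((1 + ‖x‖) ^ 8 * ‖φ x‖) * ((1 + ‖x - z‖) ^ 4 * ‖ψ (x - z)‖) := by ring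
    _ ≤ _ := mul_le_mul (hC x) (hD (x - z))
      (mul_nonneg (pow_nonneg (weight_pos _).le _) (norm_nonneg _)) hC0

/-- A smooth kernel has a symbol of order `-∞`. -/
theorem isRS_ft_xft_productKernel (hf : ContDiff ℝ ∞ f)
    (hfb : ∀ n : ℕ, ∃ C : ℝ, ∀ z, ‖iteratedFDeriv ℝ n f z‖ ≤ C) (p : ℤ) :
    IsRS p (fun ζ η => ft (xft (productKernel φ ψ f) ζ) η) := by
  have hT := (exists_bound_productKernel_smooth φ ψ hf hfb 0 0 0).1
  have hw : ∀ M : ℕ, Continuous fun z : E3 => ((1 + ‖z‖) ^ M)⁻¹ := fun M =>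
    Continuous.inv₀ (by fun_prop) fun z => (pow_pos (weight_pos z) M).ne'
  have hw0 : ∀ (M : ℕ) (z : E3), 0 ≤ ((1 + ‖z‖) ^ M)⁻¹ := fun M z =>
    inv_nonneg.2 (pow_nonneg (weight_pos z).le M)
  have hbd : ∀ M a b : ℕ, ∃ C : ℝ, ∀ x, ∀ z ∈ (univ : Set E3), (1 + ‖x‖) ^ 4 *
      ‖mixedDeriv (productKernel φ ψ f) a b x z‖ ≤ C * ((1 + ‖z‖) ^ M)⁻¹ := fun M a b => by
    obtain ⟨C, hC⟩ := (exists_bound_productKernel_smooth φ ψ hf hfb M a b).2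
    exact ⟨C, fun x z _ => hC x z⟩
  have hsm : ∀ ζ, ContDiff ℝ ∞ (xft (productKernel φ ψ f) ζ) := by
    intro ζ
    have h := (xft_spec (Ω := univ) (w := fun _ z => ((1 + ‖z‖) ^ 0)⁻¹) isOpen_univ hT.contDiffOn
      (fun _ => (hw 0).continuousOn) (fun b => by
        obtain ⟨C, hC⟩ := hbd 0 0 b
        exact ⟨C, fun x z hz => by simpa only [norm_mixedDeriv_zero_left] using hC x z hz⟩) ζ).1
    exact contDiffOn_univ.1 h
  have hxb : ∀ M b k : ℕ, ∃ C : ℝ, 0 ≤ C ∧ ∀ ζ z : E3, (1 + ‖ζ‖) ^ k * ((1 + ‖z‖) ^ M *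
      ‖iteratedFDeriv ℝ b (xft (productKernel φ ψ f) ζ) z‖) ≤ C := by
    intro M b k
    obtain ⟨C, hC0, hC⟩ := xft_bound (Ω := univ) (w := fun _ z => ((1 + ‖z‖) ^ M)⁻¹) isOpen_univ
      hT.contDiffOn (fun _ => (hw M).continuousOn) (fun _ z _ => hw0 M z) (hbd M) b k
    refine ⟨C, hC0, fun ζ z => ?_⟩
    have h1 := hC ζ z trivial
    rw [← div_eq_mul_inv, le_div_iff₀ (pow_pos (weight_pos z) M)] at h1
    linarith
  have hdecay : ∀ b k N : ℕ, ∃ C : ℝ, ∀ ζ : E3,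
      ContDiff ℝ b (ft (xft (productKernel φ ψ f) ζ)) ∧ ∀ η : E3, (1 + ‖ζ‖) ^ k *
        ((1 + ‖η‖) ^ N * ‖iteratedFDeriv ℝ b (ft (xft (productKernel φ ψ f) ζ)) η‖) ≤ C := by
    intro b k N
    obtain ⟨c, hc0, hc⟩ := exists_ft_decay_const b N
    choose D hD0 hD using fun n => hxb (b + 4) n k
    refine ⟨c * ∑ n ∈ Finset.range (N + 1), D n, fun ζ => ?_⟩
    have hζ := pow_pos (weight_pos ζ) k
    obtain ⟨h1, h2⟩ := hc _ ((hsm ζ).of_le (natCast_le_infty N))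
      (((1 + ‖ζ‖) ^ k)⁻¹ * ∑ n ∈ Finset.range (N + 1), D n) (fun n hn z => by
        rw [← div_eq_inv_mul, le_div_iff₀' hζ]
        exact (hD n ζ z).trans (Finset.single_le_sum (f := D) (fun n _ => hD0 n)
          (Finset.mem_range.2 (Nat.lt_succ_of_le hn))))
    refine ⟨h1, fun η => (mul_le_mul_of_nonneg_left (h2 η) hζ.le).trans (le_of_eq ?_)⟩
    field_simp
  obtain ⟨C, hC0, hC⟩ := exists_bound_productKernel φ ψ
  obtain ⟨B, hB⟩ := hfb 0
  simp only [norm_iteratedFDeriv_zero] at hB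
  refine ⟨fun ζ => contDiff_infty.2 fun b => ((hdecay b 0 0).choose_spec ζ).1, ?_, fun b k => ?_⟩
  · refine continuous_ft_xft (m := fun z => C * (((1 + ‖z‖) ^ 4)⁻¹ * B))
      (continuousOn_productKernel φ ψ hf.continuous.continuousOn)
      ((integrable_weight_inv.mul_const B).const_mul C) fun x z _ => (hC f x z).trans ?_
    have := hw0 4 z
    gcongr
    exact hB z
  · obtain ⟨D, hD⟩ := hdecay b k (p - b).natAbs
    refine ⟨|D|, fun ζ η => ?_⟩
    have h1 := (hD ζ).2 η
    rw [mul_left_comm] at h1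
    refine (le_mul_inv_pow (h1.trans (le_abs_self D))).trans ?_
    refine mul_le_mul_of_nonneg_left ?_ (abs_nonneg D)
    rw [← zpow_natCast, ← zpow_neg]
    exact weight_zpow_mono (by omega) η

theorem waveE_mul_exp_phase (ζ x z η : E3) : waveE ζ x *
    Complex.exp (-(Complex.I * ((inner ℝ z (η + (2 * Real.pi) • ζ) : ℝ) : ℂ)))
    = Complex.exp (-(Complex.I * ((inner ℝ z η : ℝ) : ℂ))) * waveE ζ (x - z) := by
  rw [waveE, waveE, ← Complex.exp_add, ← Complex.exp_add, inner_add_right, real_inner_smul_right,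
    inner_sub_right, real_inner_comm z ζ]
  congr 1
  push_cast
  ring

theorem integral_waveE_mul_fourier (x : E3) : ∫ ζ, waveE ζ x * 𝓕 (φ : E3 → ℂ) ζ = φ x := by
  have h1 : 𝓕⁻ (𝓕 (φ : E3 → ℂ)) = φ :=
    φ.continuous.fourierInv_fourier_eq φ.integrable (by
      rw [← SchwartzMap.fourier_coe]
      exact (𝓕 φ).integrable)
  have h2 := congrFun h1 x
  rw [fourierInv_eq_waveE] at h2
  simpa only [smul_eq_mul] using h2

/-- The symbol of `φ(x) u(x - y) ψ(y)` is the composition of multiplication operators and of the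
Fourier multiplier of `u`, hence a twisted convolution on the Fourier side. -/
theorem ft_productKernel_eq_symOf_twist {p : ℤ} (hf : IsMoment f)
    (hfs : IsSym p (ft f)) (x η : E3) :
    ft (productKernel φ ψ f x) η = symOf (twist (fun ζ η => 𝓕 (φ : E3 → ℂ) ζ * ft f η)
      (fun ζ _ => 𝓕 (ψ : E3 → ℂ) ζ)) x η := by
  have hφ := isRapid_fourier_schwartz φ
  have hψ := isRapid_fourier_schwartz ψ
  rw [symOf_twist (hφ.mul_isSym hfs) hψ.isRS]
  have h1 : ∀ η', symOf (fun ζ η => 𝓕 (φ : E3 → ℂ) ζ * ft f η) x η' = φ x * ft f η' := by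
    intro η'
    rw [symOf_eq, ← integral_waveE_mul_fourier φ x, ← integral_mul_const]
    congr 1
    funext ζ
    ring
  have hψi : Integrable (𝓕 (ψ : E3 → ℂ)) := by
    rw [← SchwartzMap.fourier_coe]
    exact (𝓕 ψ).integrable
  have hint : Integrable (Function.uncurry fun ζ z : E3 => φ x *
      (Complex.exp (-(Complex.I * ((inner ℝ z η : ℝ) : ℂ))) *
        (waveE ζ (x - z) * 𝓕 (ψ : E3 → ℂ) ζ) * f z)) (volume.prod volume) := by
    have h2 := ((hψi.mul_prod hf.integrable).const_mul (φ x))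
    refine h2.mono ?_ (Filter.Eventually.of_forall fun r => ?_)
    · have hc : Continuous fun r : E3 × E3 => Complex.exp (-(Complex.I *
          ((inner ℝ r.2 η : ℝ) : ℂ))) * waveE r.1 (x - r.2) :=
        Continuous.mul (by fun_prop)
          (continuous_waveE.comp (f := fun r : E3 × E3 => (r.1, x - r.2)) (by fun_prop))
      refine (hc.aestronglyMeasurable.mul h2.1).congr (Filter.Eventually.of_forall fun r => ?_)
      simp only [Function.uncurry, Pi.mul_apply]
      ring
    · simp only [Function.uncurry, norm_mul, norm_exp_phase, norm_waveE, one_mul]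
      exact le_rfl
  have h3 : ∀ ζ, waveE ζ x * symOf (fun ζ η => 𝓕 (φ : E3 → ℂ) ζ * ft f η) x
      (η + (2 * Real.pi) • ζ) * 𝓕 (ψ : E3 → ℂ) ζ = ∫ z, φ x *
      (Complex.exp (-(Complex.I * ((inner ℝ z η : ℝ) : ℂ))) *
        (waveE ζ (x - z) * 𝓕 (ψ : E3 → ℂ) ζ) * f z) := by
    intro ζ
    rw [h1, ft, integral_const_mul, mul_left_comm, mul_assoc, ← integral_const_mul,
      ← integral_mul_const]
    congr 2
    funext z
    rw [← mul_assoc (waveE ζ x), waveE_mul_exp_phase]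
    ring
  simp only [h3]
  rw [integral_integral_swap hint, ft]
  congr 1
  funext z
  rw [productKernel, ← integral_waveE_mul_fourier ψ (x - z), integral_const_mul,
    integral_mul_const, integral_const_mul]
  ring

end ProductKernel

theorem inXZ_effectivePotential (φ ψ : SchwartzMap E3 ℂ) (x z : E3) :
    inXZ (effectivePotential φ ψ) x z
      = productKernel φ ψ (fun z => ((‖z‖⁻¹ : ℝ) : ℂ)) x z := by
  rw [inXZ, effectivePotential, productKernel, sub_sub_cancel]
  ring

/-- With `1/|z| = u + w`, `u` of short range and `w` smooth, the part with `u` is the composition of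
multiplication by `φ`, the Fourier multiplier of `u` and multiplication by `ψ`, and the part with
`w` has a symbol of order `-∞`. -/
theorem exists_isRep_effectivePotential (φ ψ : SchwartzMap E3 ℂ) :
    SymbolConverges (effectivePotential φ ψ) ∧
      ∃ g, IsRep (-2) (kernelSymbol (effectivePotential φ ψ)) g := by
  obtain ⟨C, hC0, hC⟩ := exists_bound_productKernel φ ψ
  obtain ⟨B, hB⟩ := coulombLong_spec.2 0
  simp only [norm_iteratedFDeriv_zero] at hB
  have hwb : ∀ z : E3, ((1 + ‖z‖) ^ 4)⁻¹ ≤ 1 := fun z =>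
    inv_le_one_of_one_le₀ (one_le_pow₀ (one_le_weight z))
  have hw0 : ∀ z : E3, 0 ≤ ((1 + ‖z‖) ^ 4)⁻¹ := fun z =>
    inv_nonneg.2 (pow_nonneg (weight_pos z).le 4)
  -- the dominating functions of the two parts of the kernel
  set m₁ : E3 → ℝ := fun z => C * ‖coulombShort z‖
  set m₂ : E3 → ℝ := fun z => C * (((1 + ‖z‖) ^ 4)⁻¹ * B)
  have hm₁ : Integrable m₁ := isMoment_coulombShort.integrable.norm.const_mul C
  have hm₂ : Integrable m₂ := (integrable_weight_inv.mul_const B).const_mul C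
  have hb₁ : ∀ x z, z ≠ 0 → (1 + ‖x‖) ^ 4 * ‖productKernel φ ψ coulombShort x z‖ ≤ m₁ z :=
    fun x z _ => (hC _ x z).trans (mul_le_mul_of_nonneg_left
      (mul_le_of_le_one_left (norm_nonneg _) (hwb z)) hC0)
  have hb₂ : ∀ x z, z ≠ 0 → (1 + ‖x‖) ^ 4 * ‖productKernel φ ψ coulombLong x z‖ ≤ m₂ z :=
    fun x z _ => (hC _ x z).trans (mul_le_mul_of_nonneg_left
      (mul_le_mul_of_nonneg_left (hB z) (hw0 z)) hC0)
  have hc₁ := continuousOn_productKernel φ ψ coulombShort_spec.1.continuousOn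
  have hc₂ := continuousOn_productKernel φ ψ coulombLong_spec.1.continuous.continuousOn
  have hsum : ∀ x z, z ≠ 0 → inXZ (effectivePotential φ ψ) x z
      = productKernel φ ψ coulombShort x z + productKernel φ ψ coulombLong x z := by
    intro x z hz
    rw [inXZ_effectivePotential, productKernel, ← coulombShort_add_coulombLong hz]
    simp only [productKernel]
    ring
  have hc : ContinuousOn (fun q : E3 × E3 => inXZ (effectivePotential φ ψ) q.1 q.2)
      {q | q.2 ≠ 0} := (hc₁.add hc₂).congr fun q hq => hsum q.1 q.2 hq
  have hb : ∀ x z, z ≠ 0 →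
      (1 + ‖x‖) ^ 4 * ‖inXZ (effectivePotential φ ψ) x z‖ ≤ (m₁ + m₂) z := by
    intro x z hz
    rw [hsum x z hz]
    refine (mul_le_mul_of_nonneg_left (norm_add_le _ _) (pow_nonneg (weight_pos x).le 4)).trans ?_
    rw [mul_add]
    exact add_le_add (hb₁ x z hz) (hb₂ x z hz)
  have hm := hm₁.add hm₂
  refine ⟨symbolConverges_of_bound hc hm hb, ?_⟩
  have hφ := isRapid_fourier_schwartz φ
  have hψ := isRapid_fourier_schwartz ψ
  have hΘ : IsSym (-2) coulombHat := by
    simpa using isSym_of_mem_homSym coulombHat_mem_homSym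
  have hU : IsSym (-2) (ft coulombShort) := by
    convert hΘ.add (isSym_ft_coulombShort_sub (-2)) using 2 with η
    ring
  have hA : HasExpansion (-2) 0 (fun ζ η => 𝓕 (φ : E3 → ℂ) ζ * ft coulombShort η) := by
    have h1 : HasExpansion (-2) 0 (fun ζ η => 𝓕 (φ : E3 → ℂ) ζ * coulombHat η) :=
      hasExpansion_of_mem_homRap (Submodule.subset_span ⟨_, _, hφ, coulombHat_mem_homSym, rfl⟩)
    convert h1.add_smoothing fun m => hφ.mul_isSym (isSym_ft_coulombShort_sub m) using 3 with ζ η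
    ring
  have hBe : HasExpansion 0 0 (fun ζ (_ : E3) => 𝓕 (ψ : E3 → ℂ) ζ) :=
    hasExpansion_of_mem_homRap (Submodule.subset_span ⟨_, _, hψ, one_mem_homSym, by
      funext ζ η
      simp⟩)
  have hE := hA.twist hBe
  rw [add_zero] at hE
  have hL := isRS_ft_xft_productKernel φ ψ coulombLong_spec.1 coulombLong_spec.2
  refine ⟨_, hE.add_smoothing hL, ?_, fun η => integrable_symbol hc hm hb η⟩
  rw [hE.isRS.symOf_add (hL 0), ← symbol_eq_symOf hc₂ hm₂ hb₂ fun η => (hL 0).integrable η]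
  funext x η
  rw [← ft_productKernel_eq_symOf_twist φ ψ isMoment_coulombShort hU]
  refine Eq.trans ?_ (integral_add (integrable_symbolIntegrand hc₁ hm₁ hb₁ x η)
    (integrable_symbolIntegrand hc₂ hm₂ hb₂ x η))
  refine integral_congr_ae ?_
  filter_upwards [ae_ne_zero] with z hz
  rw [symbolIntegrand, hsum x z hz, mul_add]

end RPA

end

theorem lemma3 {N : ℕ} (φ : Fin N → SchwartzMap RPA.E3 ℂ)
    (τ : Fin N → Fin N → RPA.E3 → RPA.E3 → ℂ)
    (hτ : ∀ i k : Fin N, RPA.IsPairAmplitude (τ i k)) (i j : Fin N) :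
    ((∀ k l : Fin N, RPA.SymbolConverges (τ k l)) ∧
      (∀ k l : Fin N, RPA.SymbolConverges (RPA.effectivePotential (φ k) (φ l))) ∧
      (∀ k : Fin N, RPA.CompConverges (RPA.sigma τ i k) (RPA.rho φ k j)) ∧
      (∀ k l : Fin N, RPA.CompConverges (RPA.sigma τ i k) (RPA.rhoAnti φ k l)) ∧
      (∀ k l : Fin N, RPA.CompConverges
        (RPA.symbolComp (RPA.sigma τ i k) (RPA.rhoAnti φ k l)) (RPA.sigma τ l j))) ∧
    (RPA.IsClassicalSymbol (-6) (RPA.sigmaRPA6 φ τ i j) ∧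
      ∃ t : ℕ → RPA.E3 → RPA.E3 → ℂ,
        RPA.IsHomogeneousExpansion (-6) (RPA.sigmaRPA6 φ τ i j) t ∧
        RPA.OrthogonalityConstraints t) ∧
    (RPA.IsClassicalSymbol (-10) (RPA.sigmaRPA10 φ τ i j) ∧
      ∃ t : ℕ → RPA.E3 → RPA.E3 → ℂ,
        RPA.IsHomogeneousExpansion (-10) (RPA.sigmaRPA10 φ τ i j) t ∧
        RPA.OrthogonalityConstraints t) := by
  have hσ := fun i k => (hτ i k).exists_isRep
  choose gσ hgσ using fun i k => (hσ i k).2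
  have hρ := fun k l => RPA.exists_isRep_effectivePotential (φ k) (φ l)
  choose gρ hgρ using fun k l => (hρ k l).2
  have hσeq : ∀ i k, RPA.sigma τ i k = RPA.symOf (gσ i k) := fun i k => (hgσ i k).eq
  have hanti : ∀ k l, RPA.IsRep (-2) (RPA.rhoAnti φ k l)
      (fun ζ η => gρ k l ζ η - gρ l k ζ η) := fun k l => (hgρ k l).sub (hgρ l k)
  have h6 : ∀ k, RPA.CompConverges (RPA.sigma τ i k) (RPA.rho φ k j) ∧
      RPA.symbolComp (RPA.sigma τ i k) (RPA.rho φ k j)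
        = RPA.symOf (RPA.twist (gσ i k) (gρ k j)) := fun k => by
    rw [hσeq]
    exact RPA.symbolComp_of_isRep (hgσ i k).expansion le_rfl (hgρ k j)
  have h8 : ∀ k l, RPA.CompConverges (RPA.sigma τ i k) (RPA.rhoAnti φ k l) ∧
      RPA.symbolComp (RPA.sigma τ i k) (RPA.rhoAnti φ k l)
        = RPA.symOf (RPA.twist (gσ i k) (fun ζ η => gρ k l ζ η - gρ l k ζ η)) := fun k l => by
    rw [hσeq]
    exact RPA.symbolComp_of_isRep (hgσ i k).expansion le_rfl (hanti k l)
  -- the orders of the factors add up: `-4 - 2 = -6`, and `-6 - 4 = -10` below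
  have e6 : ∀ k, RPA.HasExpansion (-6) 0 (RPA.twist (gσ i k) (gρ k j)) := fun k => by
    have h := (hgσ i k).expansion.twist (hgρ k j).expansion
    norm_num at h
    exact h
  have e8 : ∀ k l, RPA.HasExpansion (-6) 0
      (RPA.twist (gσ i k) (fun ζ η => gρ k l ζ η - gρ l k ζ η)) := fun k l => by
    have h := (hgσ i k).expansion.twist (hanti k l).expansion
    norm_num at h
    exact h
  have h10 : ∀ k l, RPA.CompConverges
      (RPA.symbolComp (RPA.sigma τ i k) (RPA.rhoAnti φ k l)) (RPA.sigma τ l j) ∧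
      RPA.symbolComp (RPA.symbolComp (RPA.sigma τ i k) (RPA.rhoAnti φ k l)) (RPA.sigma τ l j)
        = RPA.symOf (RPA.twist (RPA.twist (gσ i k) (fun ζ η => gρ k l ζ η - gρ l k ζ η))
          (gσ l j)) := fun k l => by
    rw [(h8 k l).2]
    exact RPA.symbolComp_of_isRep (e8 k l) (by norm_num) (hgσ l j)
  have e10 : ∀ k l, RPA.HasExpansion (-10) 0 (RPA.twist (RPA.twist (gσ i k)
      (fun ζ η => gρ k l ζ η - gρ l k ζ η)) (gσ l j)) := fun k l => by
    have h := (e8 k l).twist (hgσ l j).expansion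
    norm_num at h
    exact h
  have s6 : RPA.sigmaRPA6 φ τ i j
      = RPA.symOf fun ζ η => ∑ k, RPA.twist (gσ i k) (gρ k j) ζ η := by
    rw [RPA.IsRS.symOf_sum _ fun k _ => (e6 k).isRS]
    funext x η
    exact Finset.sum_congr rfl fun k _ => by rw [(h6 k).2]
  have s10 : RPA.sigmaRPA10 φ τ i j = RPA.symOf fun ζ η => ∑ k, ∑ l,
      RPA.twist (RPA.twist (gσ i k) (fun ζ η => gρ k l ζ η - gρ l k ζ η)) (gσ l j) ζ η := by
    rw [RPA.IsRS.symOf_sum _ fun k _ => RPA.IsRS.sum _ fun l _ => (e10 k l).isRS]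
    funext x η
    refine Finset.sum_congr rfl fun k _ => ?_
    rw [RPA.IsRS.symOf_sum _ fun l _ => (e10 k l).isRS]
    exact Finset.sum_congr rfl fun l _ => by rw [(h10 k l).2]
  obtain ⟨t6, ht6, ho6⟩ := (RPA.HasExpansion.sum Finset.univ
    fun k _ => e6 k).exists_isHomogeneousExpansion
  obtain ⟨t10, ht10, ho10⟩ := (RPA.HasExpansion.sum Finset.univ fun k _ =>
    RPA.HasExpansion.sum Finset.univ fun l _ => e10 k l).exists_isHomogeneousExpansion
  rw [← s6] at ht6
  rw [← s10] at ht10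
  exact ⟨⟨fun k l => (hσ k l).1, fun k l => (hρ k l).1, fun k => (h6 k).1, fun k l => (h8 k l).1,
    fun k l => (h10 k l).1⟩, ⟨⟨t6, ht6⟩, t6, ht6, ho6⟩, ⟨t10, ht10⟩, t10, ht10, ho10⟩
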